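/- **Theorem (Energy balance identities).** Let $d\ge 2$, $T>0$, $\nu\ge 0$, $\mathbb T^d=\mathbb R^d/\mathbb Z^d$. Repeated indices are summed. Let $u:[0,T]\times\mathbb T^d\to\mathbb R^d$ satisfy $u\in L^3([0,T]\times\mathbb T^d)\cap C^0([0,T];L^2(\mathbb T^d))$ and, if $\nu\neq 0$, also $u\in L^2([0,T];\dot H^1(\mathbb T^d))$. Let $f\in L^{3/2}([0,T]\times\mathbb T^d)\cup L^1([0,T];L^2(\mathbb T^d))$ be a vector field, let $u_0\in L^2(\mathbb T^d)$, and let $p\in L^1([0,T]\times\mathbb T^d)$ be a scalar pressure. Suppose that $u$ is a weak solution of the Euler ($\nu=0$) or Navier–Stokes ($\nu>0$) equations with pressure $p$, force $f$ and initial datum $u_0$, that is, $\operatorname{div}u=0$ in the weak sense and $$\int_{\mathbb T^d}\big[\phi^i(0,x)u_0^i(x)-\phi^i(T,x)u^i(T,x)\big]dx+\int_{[0,T]\times\mathbb T^d}\phi^i f^i\,dt\,dx=-\int_{[0,T]\times\mathbb T^d}\big[\partial_t\phi^i\,u^i+\partial_j\phi^i\,u^iu^j+\partial_i\phi^i\,p-\nu\,\partial_j\phi^i\,\partial_ju^i\big]dt\,dx$$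 for all $\phi\in C^\infty([0,T]\times\mathbb T^d;\mathbb R^d)$. For $y\ne0$ put $T_I^{ij}(y)=\delta^{ij}$, $T_L^{ij}(y)=y^iy^j/|y|^2$, $T_T^{ij}(y)=\delta^{ij}-y^iy^j/|y|^2$, and put $$c_I=\frac4d,\qquad c_L=\frac{12}{d(d+2)},\qquad c_T=\frac{4(d-1)}{d(d+2)}.$$ Then the functions $u^j|u|^2+2pu^j$ and $u^if^i$ are integrable on $[0,T]\times\mathbb T^d$. For $\bullet\in\{I,L,T\}$ and every $\ell>0$, with $\delta u=u(t,x+\ell y)-u(t,x)$, the spherical average (with $\sigma$ the surface measure) $$\frac1{\ell\,|\mathbb S^{d-1}|}\int_{\mathbb S^{d-1}}(y\cdot\delta u)\,\big|T_\bullet(y)\,\delta u\big|^2\,d\sigma(y)$$ is well defined for a.e. $(t,x)$ and integrable on $[0,T]\times\mathbb T^d$. For each $\bullet\in\{I,L,T\}$ the limit $$-c_\bullet\,D_\bullet[u]=\lim_{\ell\to0^+}\frac1{\ell\,|\mathbb S^{d-1}|}\int_{\mathbb S^{d-1}}(y\cdot\delta u)\,\big|T_\bullet(y)\,\delta u\big|^2\,d\sigma(y)$$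 exists in the sense of distributions on $(0,T)\times\mathbb T^d$, it defines a distribution $D_\bullet[u]$, and in the sense of distributions on $(0,T)\times\mathbb T^d$ $$\partial_t|u|^2+\partial_j\big(u^j|u|^2+2pu^j\big)-2u^if^i-\nu\big(\Delta|u|^2-2\,\partial_ku^i\,\partial_ku^i\big)=-2D_\bullet[u].$$ -/

import Mathlib

open MeasureTheory Metric Set Filter Topology
open scoped ContDiff ENNReal

namespace EnergyBalance

/-- `ℝ^d` with its Euclidean norm. -/
abbrev E (d : ℕ) : Type := EuclideanSpace ℝ (Fin d)

/-- The torus `𝕋^d = ℝ^d / ℤ^d`. -/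
abbrev Torus (d : ℕ) : Type := UnitAddTorus (Fin d)

/-- The quotient map `ℝ^d → 𝕋^d`. -/
def proj {d : ℕ} (v : E d) : Torus d := fun i => (v i : UnitAddCircle)

/-- The measure `dt dx` on `[0,T] × 𝕋^d`, as a measure on `ℝ × 𝕋^d`. -/
noncomputable def spaceTime (d : ℕ) (T : ℝ) : Measure (ℝ × Torus d) :=
  ((volume : Measure ℝ).restrict (Icc 0 T)).prod (volume : Measure (Torus d))

/-! ### Smooth functions and classical derivatives -/

/-- `φ` as a function on `ℝ × ℝ^d`, periodic in the second variable. -/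
def lift {d : ℕ} (φ : ℝ → Torus d → ℝ) : ℝ × E d → ℝ := fun z => φ z.1 (proj z.2)

/-- `φ : ℝ × 𝕋^d → ℝ` is smooth. -/
def IsSmooth {d : ℕ} (φ : ℝ → Torus d → ℝ) : Prop := ContDiff ℝ ∞ (lift φ)

/-- The partial derivative `∂_k ψ (x)` of a function on the torus. -/
noncomputable def pd {d : ℕ} (k : Fin d) (ψ : Torus d → ℝ) (x : Torus d) : ℝ :=
  deriv (fun s : ℝ => ψ (x + proj (EuclideanSpace.single k s))) 0

/-- The time derivative `∂_t φ (t, x)`. -/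
noncomputable def dt {d : ℕ} (φ : ℝ → Torus d → ℝ) (t : ℝ) (x : Torus d) : ℝ :=
  deriv (fun s : ℝ => φ s x) t

/-- The spatial Laplacian. -/
noncomputable def lap {d : ℕ} (ψ : Torus d → ℝ) (x : Torus d) : ℝ :=
  ∑ k, pd k (pd k ψ) x

/-! ### Test functions and distributions on `(0,T) × 𝕋^d` -/

/-- `φ` vanishes for times outside `[a, b]`. -/
def TimeSupportedIn {d : ℕ} (φ : ℝ → Torus d → ℝ) (a b : ℝ) : Prop :=
  ∀ t, t ∉ Icc a b → ∀ x, φ t x = 0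

/-- The space `C_c^∞((0,T) × 𝕋^d)`. -/
def TestFunctions (d : ℕ) (T : ℝ) : Submodule ℝ (ℝ → Torus d → ℝ) where
  carrier := {φ | IsSmooth φ ∧ ∃ a b, 0 < a ∧ b < T ∧ TimeSupportedIn φ a b}
  zero_mem' := by
    refine ⟨?_, 1, T - 1, one_pos, by linarith, fun t _ x => rfl⟩
    exact (contDiff_const : ContDiff ℝ ∞ (fun _ : ℝ × E d => (0 : ℝ)))
  add_mem' := by
    rintro φ ψ ⟨hφ, a, b, ha, hb, h⟩ ⟨hψ, a', b', ha', hb', h'⟩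
    refine ⟨ContDiff.add hφ hψ, min a a', max b b', lt_min ha ha', max_lt hb hb', ?_⟩
    intro t ht x
    have h1 : t ∉ Icc a b := fun hh =>
      ht ⟨(min_le_left _ _).trans hh.1, hh.2.trans (le_max_left _ _)⟩
    have h2 : t ∉ Icc a' b' := fun hh =>
      ht ⟨(min_le_right _ _).trans hh.1, hh.2.trans (le_max_right _ _)⟩
    simp [h t h1 x, h' t h2 x]
  smul_mem' := by
    rintro c φ ⟨hφ, a, b, ha, hb, h⟩
    refine ⟨ContDiff.const_smul c hφ, a, b, ha, hb, ?_⟩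
    intro t ht x
    simp [h t ht x]

/-- A linear functional on `C_c^∞((0,T) × 𝕋^d)` is a distribution if on each set of test
functions supported in a fixed compact `[a,b] × 𝕋^d` it is bounded by finitely many of the
seminorms `sup |D^n φ|`. -/
def IsDistribution {d : ℕ} {T : ℝ} (D : TestFunctions d T →ₗ[ℝ] ℝ) : Prop :=
  ∀ a b : ℝ, 0 < a → b < T → ∃ (N : ℕ) (C : ℝ), ∀ (φ : TestFunctions d T) (M : ℝ),
    TimeSupportedIn φ.1 a b →
    (∀ n ≤ N, ∀ z, ‖iteratedFDeriv ℝ n (lift φ.1) z‖ ≤ M) → |D φ| ≤ C * M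

/-! ### Function spaces -/

/-- `g ∈ L^p([0,T] × 𝕋^d)`. -/
def MemLpTX {d : ℕ} (T : ℝ) (p : ℝ≥0∞) (g : ℝ → Torus d → E d) : Prop :=
  MemLp (fun z : ℝ × Torus d => g z.1 z.2) p (spaceTime d T)

/-- `g ∈ L^1([0,T]; L^2(𝕋^d))`. -/
def MemL1L2 {d : ℕ} (T : ℝ) (g : ℝ → Torus d → E d) : Prop :=
  AEStronglyMeasurable (fun z : ℝ × Torus d => g z.1 z.2) (spaceTime d T) ∧
    ∫⁻ t in Icc 0 T, eLpNorm (g t) 2 volume < ⊤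

/-- `g ∈ C^0([0,T]; L^2(𝕋^d))`. -/
def MemC0L2 {d : ℕ} (T : ℝ) (g : ℝ → Torus d → E d) : Prop :=
  (∀ t ∈ Icc 0 T, MemLp (g t) 2 volume) ∧
    ∀ t₀ ∈ Icc 0 T, Tendsto (fun t => eLpNorm (g t - g t₀) 2 volume) (𝓝[Icc 0 T] t₀) (𝓝 0)

/-- `u ∈ L^2([0,T]; Ḣ^1(𝕋^d))`, where `G k` is the weak derivative `∂_k u`. -/
def MemL2H1 {d : ℕ} (T : ℝ) (u : ℝ → Torus d → E d) (G : Fin d → ℝ → Torus d → E d) : Prop :=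
  ∀ k, MemLpTX T 2 (G k) ∧ ∀ φ : ℝ → Torus d → ℝ, IsSmooth φ → ∀ i,
    ∫ z, u z.1 z.2 i * pd k (φ z.1) z.2 ∂(spaceTime d T)
      = - ∫ z, G k z.1 z.2 i * φ z.1 z.2 ∂(spaceTime d T)

/-! ### Weak solutions -/

/-- `(u, p)` solves `∂_t u + div (u ⊗ u) + ∇p = νΔu + f`, `div u = 0`, `u(0) = u₀` weakly on
`[0,T] × 𝕋^d`. Here `G k` stands for `∂_k u`; it only enters if `ν ≠ 0`. -/
structure IsWeakSolution {d : ℕ} (T ν : ℝ) (u : ℝ → Torus d → E d) (p : ℝ → Torus d → ℝ)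
    (f : ℝ → Torus d → E d) (u₀ : Torus d → E d) (G : Fin d → ℝ → Torus d → E d) : Prop where
  pressure_integrable : Integrable (fun z : ℝ × Torus d => p z.1 z.2) (spaceTime d T)
  div_free : ∀ φ : ℝ → Torus d → ℝ, IsSmooth φ →
    ∫ z, ∑ i, u z.1 z.2 i * pd i (φ z.1) z.2 ∂(spaceTime d T) = 0
  momentum : ∀ φ : Fin d → ℝ → Torus d → ℝ, (∀ i, IsSmooth (φ i)) →
    (∫ x, ∑ i, (φ i 0 x * u₀ x i - φ i T x * u T x i))
      + ∫ z, ∑ i, φ i z.1 z.2 * f z.1 z.2 i ∂(spaceTime d T)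
    = - ∫ z, ((∑ i, dt (φ i) z.1 z.2 * u z.1 z.2 i)
        + (∑ i, ∑ j, pd j (φ i z.1) z.2 * u z.1 z.2 i * u z.1 z.2 j)
        + (∑ i, pd i (φ i z.1) z.2 * p z.1 z.2)
        - ν * ∑ i, ∑ j, pd j (φ i z.1) z.2 * G j z.1 z.2 i) ∂(spaceTime d T)

/-! ### Structure functions -/

/-- The three labels `I`, `L`, `T`. -/
inductive Label
  | I
  | L
  | T

/-- The symmetric tensors `T_I = Id`, `T_L(y) = y ⊗ y / |y|²`, `T_T = Id - T_L`. -/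
noncomputable def tensor {d : ℕ} : Label → E d → Matrix (Fin d) (Fin d) ℝ
  | .I, _ => 1
  | .L, y => Matrix.of fun i j => y i * y j / ‖y‖ ^ 2
  | .T, y => 1 - Matrix.of fun i j => y i * y j / ‖y‖ ^ 2

/-- The constants `4/d`, `12/(d(d+2))`, `4(d-1)/(d(d+2))`. -/
noncomputable def coeff (d : ℕ) : Label → ℝ
  | .I => 4 / (d : ℝ)
  | .L => 12 / ((d : ℝ) * ((d : ℝ) + 2))
  | .T => 4 * ((d : ℝ) - 1) / ((d : ℝ) * ((d : ℝ) + 2))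

/-- The surface measure on `S^{d-1}`. -/
noncomputable def sphereMeasure (d : ℕ) : Measure (sphere (0 : E d) 1) :=
  (volume : Measure (E d)).toSphere

/-- The increment `δu = v(x + ℓ y) - v(x)`. -/
def increment {d : ℕ} (v : Torus d → E d) (ℓ : ℝ) (x : Torus d) (y : E d) : E d :=
  v (x + proj (ℓ • y)) - v x

/-- `(y · δu) |T_•(y) δu|²`. -/
noncomputable def fluxIntegrand {d : ℕ} (k : Label) (v : Torus d → E d) (ℓ : ℝ) (x : Torus d)
    (y : E d) : ℝ :=
  (∑ j, y j * increment v ℓ x y j)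
    * ∑ i, (∑ j, tensor k y i j * increment v ℓ x y j) ^ 2

/-- `(1/ℓ) ⨍_{S^{d-1}} (y · δu) |T_•(y) δu|² dy`. -/
noncomputable def sphereFlux {d : ℕ} (k : Label) (u : ℝ → Torus d → E d) (ℓ t : ℝ)
    (x : Torus d) : ℝ :=
  1 / ℓ * ⨍ y : sphere (0 : E d) 1, fluxIntegrand k (u t) ℓ x (y : E d) ∂(sphereMeasure d)

/-! ### The energy balance -/

/-- The pairing with `φ` of the distribution
`∂_t |u|² + ∂_j (u^j |u|² + 2 p u^j) - 2 u·f - ν (Δ|u|² - 2 |∇u|²)`. -/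
noncomputable def balancePairing {d : ℕ} (T ν : ℝ) (u : ℝ → Torus d → E d)
    (p : ℝ → Torus d → ℝ) (f : ℝ → Torus d → E d) (G : Fin d → ℝ → Torus d → E d)
    (φ : ℝ → Torus d → ℝ) : ℝ :=
  ∫ z, (- (‖u z.1 z.2‖ ^ 2 * dt φ z.1 z.2)
      - (∑ j, (u z.1 z.2 j * ‖u z.1 z.2‖ ^ 2 + 2 * p z.1 z.2 * u z.1 z.2 j) * pd j (φ z.1) z.2)
      - 2 * (∑ i, u z.1 z.2 i * f z.1 z.2 i) * φ z.1 z.2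
      - ν * (‖u z.1 z.2‖ ^ 2 * lap (φ z.1) z.2
          - 2 * (∑ k, ‖G k z.1 z.2‖ ^ 2) * φ z.1 z.2)) ∂(spaceTime d T)

end EnergyBalance

open EnergyBalance

/-!
# Energy balance identities for weak solutions

The proof compares the evolution of `u^i(t, x) u^j(t, z)` at two distinct points with its limit as
`z → x` (the Kármán–Howarth–Monin method). Testing the evolution with `φ(t, x) Q^{ij}(z - x)`, for
a symmetric matrix of smooth kernels `Q` of small support, only involves products of distributions
in different variables and is legitimate for weak solutions (`EvolutionLaw.two_point`,
`Flow.two_point`). The terms in which a derivative falls on `Q` are third order in `u`;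
incompressibility allows one to complete them to the correlation `incr` of three increments, and it
removes the pressure from them as soon as the divergence of `Q` is a gradient. What is left is
`Flow.two_point_balance`: the third order increments paired with `∇Q` equal second order quantities
(`kernelTerm`, `potentialTerm`), in which no derivative falls on the kernels, paired with `Q`.

All these correlations are continuous functions of the separation. For the isotropic kernels
`a(|y|²) δ^{ij} + b(|y|²) y^i y^j` the balance therefore becomes, in polar coordinates, a relation
between continuous functions of the radius (`TwoPointBalance.radial`), tested with an arbitrary
radial function. The choices `M(|y|²) δ^{ij}` and `M(|y|²) (|y|² δ^{ij} - y^i y^j)` turn it into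
first order differential equations for the spherical means of `(y · δu) |δu|²` and of
`(y · δu) |T_T δu|²`, which are solved explicitly (`eq_primitive_of_radialTest`). The behaviour of the
solutions at zero separation follows from L'Hôpital's rule and the second moments of the sphere
(`TwoPointBalance.tendsto_full`, `TwoPointBalance.tendsto_transverse`); the longitudinal case is the
difference of the two. At separation zero the second order quantities add up to minus the pairing of the
test function with the left side of the energy balance (`Flow.trace_eq`), so all three limits are
given by the same distribution `Flow.dissipation`, a sum of derivatives of integrable functions.

The continuity of the correlations at all separations, zero included, needs the products to be
integrable. This is immediate by Hölder's inequality except for the pressure, of which only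
integrability is assumed. At almost every time the pressure solves
`-Δp = ∂_i ∂_j (u^i u^j) - ∂_i f^i` (`ae_pressure_equation`), and duality reduces the estimate of
`∫ |p h|`, `h ∈ L³`, to the bound `‖∂_i ∂_j w‖_{L³} ≲ ‖Δw‖_{L³}` for trigonometric polynomials
(`integral_hessian_cube_le`) and to a one-dimensional Poincaré inequality (`integral_pd_pow_le`). The former
is proved with a Bellman function: `∫ (G² + |H|)^{3/2}` decreases along the heat flow at a rate that
controls `∫ |∇G| |∇H|` (`bell_hessian`, `bell_dissipation`). The resulting property `Tame` covers
forces in `L^{3/2}_{t,x}`, forces in `L¹_t L²_x` and the pressure alike (`force_tame`,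
`pressure_tame`); for a tame function the correlation with `u ∈ L³_{t,x} ∩ L^∞_t L²_x` is
continuous (`Tame.shiftPair`, `ShiftPair.contCorr`).
-/

namespace EnergyBalance

variable {d : ℕ}

/-! ### The torus and its smooth functions -/

theorem proj_add (v w : E d) : proj (v + w) = proj v + proj w := by
  ext i; simp [proj]

theorem proj_zero : proj (0 : E d) = 0 := by
  ext i; simp [proj]

theorem proj_neg (v : E d) : proj (-v) = -proj v := by
  ext i; simp [proj]

theorem proj_sub (v w : E d) : proj (v - w) = proj v - proj w := by
  ext i; simp [proj]

theorem isOpenQuotientMap_proj : IsOpenQuotientMap (proj : E d → Torus d) := by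
  have h1 : IsOpenQuotientMap (Pi.map (fun (_ : Fin d) (s : ℝ) => (s : UnitAddCircle))) :=
    IsOpenQuotientMap.piMap fun _ => QuotientAddGroup.isOpenQuotientMap_mk
  have h2 : IsOpenQuotientMap (fun v : E d => (v : Fin d → ℝ)) :=
    (PiLp.homeomorph 2 (fun _ : Fin d => ℝ)).isOpenQuotientMap
  exact h1.comp h2

@[fun_prop]
theorem continuous_proj : Continuous (proj : E d → Torus d) := isOpenQuotientMap_proj.continuous

theorem proj_surjective : Function.Surjective (proj : E d → Torus d) :=
  isOpenQuotientMap_proj.surjective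

instance : IsProbabilityMeasure (volume : Measure UnitAddCircle) :=
  ⟨by simp⟩

instance : IsProbabilityMeasure (volume : Measure (Torus d)) := by
  rw [volume_pi]; infer_instance

instance (T : ℝ) : IsFiniteMeasure (spaceTime d T) := by
  unfold spaceTime; infer_instance

/-- A smooth function on the torus, seen through its periodic lift to `ℝ^d`. -/
def SmoothT (q : Torus d → ℝ) : Prop := ContDiff ℝ ∞ (fun v : E d => q (proj v))

theorem SmoothT.continuous {q : Torus d → ℝ} (hq : SmoothT q) : Continuous q :=
  isOpenQuotientMap_proj.continuous_comp_iff.1 (ContDiff.continuous hq)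

theorem IsSmooth.continuous {φ : ℝ → Torus d → ℝ} (hφ : IsSmooth φ) :
    Continuous (fun z : ℝ × Torus d => φ z.1 z.2) :=
  (IsOpenQuotientMap.id.prodMap isOpenQuotientMap_proj).continuous_comp_iff.1
    (ContDiff.continuous hφ)

theorem IsSmooth.slice {φ : ℝ → Torus d → ℝ} (hφ : IsSmooth φ) (t : ℝ) : SmoothT (φ t) :=
  ContDiff.comp (g := lift φ) hφ (contDiff_const.prodMk contDiff_id)

theorem SmoothT.isSmooth {q : Torus d → ℝ} (hq : SmoothT q) : IsSmooth (fun _ : ℝ => q) :=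
  ContDiff.comp (g := fun v : E d => q (proj v)) hq contDiff_snd

theorem isSmooth_time {χ : ℝ → ℝ} (hχ : ContDiff ℝ ∞ χ) :
    IsSmooth (fun (t : ℝ) (_ : Torus d) => χ t) :=
  hχ.comp contDiff_fst

theorem IsSmooth.mul {φ ψ : ℝ → Torus d → ℝ} (hφ : IsSmooth φ) (hψ : IsSmooth ψ) :
    IsSmooth (fun t x => φ t x * ψ t x) := ContDiff.mul hφ hψ

theorem SmoothT.mul {φ ψ : Torus d → ℝ} (hφ : SmoothT φ) (hψ : SmoothT ψ) :
    SmoothT (fun x => φ x * ψ x) := ContDiff.mul hφ hψ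

theorem isSmooth_zero : IsSmooth (fun (_ : ℝ) (_ : Torus d) => (0 : ℝ)) := contDiff_const

theorem SmoothT.sub_left {q : Torus d → ℝ} (hq : SmoothT q) (b : Torus d) :
    SmoothT (fun x => q (b - x)) := by
  obtain ⟨v, rfl⟩ := proj_surjective b
  have : (fun w : E d => q (proj v - proj w)) = (fun w : E d => q (proj w)) ∘ fun w => v - w := by
    ext w; simp [proj_sub]
  unfold SmoothT; rw [this]
  exact ContDiff.comp hq (contDiff_const.sub contDiff_id)

theorem SmoothT.add_right {q : Torus d → ℝ} (hq : SmoothT q) (b : Torus d) :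
    SmoothT (fun x => q (x + b)) := by
  obtain ⟨v, rfl⟩ := proj_surjective b
  have : (fun w : E d => q (proj w + proj v)) = (fun w : E d => q (proj w)) ∘ fun w => w + v := by
    ext w; simp [proj_add]
  unfold SmoothT; rw [this]
  exact ContDiff.comp hq (contDiff_id.add contDiff_const)

theorem SmoothT.sub_right {q : Torus d → ℝ} (hq : SmoothT q) (b : Torus d) :
    SmoothT (fun x => q (x - b)) := by
  simpa [sub_eq_add_neg] using hq.add_right (-b)

theorem single_eq_smul (k : Fin d) (s : ℝ) :
    (EuclideanSpace.single k s : E d) = s • EuclideanSpace.single k 1 := by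
  ext i; simp

theorem pd_proj {q : Torus d → ℝ} (hq : SmoothT q) (k : Fin d) (v : E d) :
    pd k q (proj v) = fderiv ℝ (fun w : E d => q (proj w)) v (EuclideanSpace.single k 1) := by
  have h1 : HasFDerivAt (fun w : E d => q (proj w)) (fderiv ℝ (fun w : E d => q (proj w)) v)
      (v + (0 : ℝ) • EuclideanSpace.single k 1) := by
    simpa using (ContDiff.differentiable hq (by simp)).differentiableAt.hasFDerivAt
  have h2 : HasDerivAt (fun s : ℝ => v + s • (EuclideanSpace.single k 1 : E d))
      (EuclideanSpace.single k 1) 0 := by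
    simpa using ((hasDerivAt_id (0 : ℝ)).smul_const (EuclideanSpace.single k 1 : E d)).const_add v
  have h3 := h1.comp_hasDerivAt (0 : ℝ) h2
  unfold pd
  rw [← h3.deriv]
  congr 1
  ext s
  simp [proj_add, ← single_eq_smul]

/-- Along the `k`-th coordinate direction, `pd k q` is a genuine derivative of `q`. -/
theorem SmoothT.hasDerivAt {q : Torus d → ℝ} (hq : SmoothT q) (k : Fin d) (x : Torus d) (s : ℝ) :
    HasDerivAt (fun s : ℝ => q (x + proj (EuclideanSpace.single k s)))
      (pd k q (x + proj (EuclideanSpace.single k s))) s := by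
  obtain ⟨v, rfl⟩ := proj_surjective x
  rw [← proj_add, pd_proj hq]
  have h1 := (ContDiff.differentiable hq (by simp)).differentiableAt
    (x := v + (EuclideanSpace.single k s : E d)) |>.hasFDerivAt
  have h2 : HasDerivAt (fun s : ℝ => v + (EuclideanSpace.single k s : E d))
      (EuclideanSpace.single k 1) s := by
    have := ((hasDerivAt_id s).smul_const (EuclideanSpace.single k 1 : E d)).const_add v
    simp only [id, one_smul] at this
    have e : (fun s : ℝ => v + (EuclideanSpace.single k s : E d))
        = fun s : ℝ => v + s • (EuclideanSpace.single k 1 : E d) := by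
      ext1 r; rw [single_eq_smul k r]
    rw [e]; exact this
  have h3 := h1.comp_hasDerivAt s h2
  have e : (fun s : ℝ => q (proj v + proj (EuclideanSpace.single k s)))
      = (fun w : E d => q (proj w)) ∘ fun s => v + (EuclideanSpace.single k s : E d) := by
    ext r; simp [proj_add]
  rw [e]; exact h3

theorem SmoothT.hasDerivAt_zero {q : Torus d → ℝ} (hq : SmoothT q) (k : Fin d) (x : Torus d) :
    HasDerivAt (fun s : ℝ => q (x + proj (EuclideanSpace.single k s))) (pd k q x) 0 := by
  have h0 : proj (EuclideanSpace.single k (0 : ℝ) : E d) = 0 := by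
    rw [single_eq_smul]; simp [proj_zero]
  simpa [h0] using hq.hasDerivAt k x 0

theorem single_zero_add (k : Fin d) (x : Torus d) :
    x + proj (EuclideanSpace.single k (0 : ℝ)) = x := by
  rw [single_eq_smul]; simp [proj_zero]

theorem SmoothT.pd {q : Torus d → ℝ} (hq : SmoothT q) (k : Fin d) : SmoothT (pd k q) := by
  unfold SmoothT
  simp_rw [pd_proj hq k]
  exact (ContDiff.fderiv_right hq (by simp)).clm_apply contDiff_const

theorem pd_lift {φ : ℝ → Torus d → ℝ} (hφ : IsSmooth φ) (k : Fin d) (t : ℝ) (v : E d) :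
    pd k (φ t) (proj v) = fderiv ℝ (lift φ) (t, v) (0, EuclideanSpace.single k 1) := by
  rw [pd_proj (hφ.slice t)]
  have h1 : HasFDerivAt (lift φ) (fderiv ℝ (lift φ) (t, v)) (t, v) :=
    (ContDiff.differentiable hφ (by simp)).differentiableAt.hasFDerivAt
  have h2 := h1.comp v (hasFDerivAt_prodMk_right t v)
  have h3 : (fun w : E d => φ t (proj w)) = lift φ ∘ fun w => (t, w) := rfl
  rw [h3, h2.fderiv]
  simp

theorem dt_lift {φ : ℝ → Torus d → ℝ} (hφ : IsSmooth φ) (t : ℝ) (v : E d) :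
    dt φ t (proj v) = fderiv ℝ (lift φ) (t, v) (1, 0) := by
  have h1 : HasFDerivAt (lift φ) (fderiv ℝ (lift φ) (t, v)) (t, v) :=
    (ContDiff.differentiable hφ (by simp)).differentiableAt.hasFDerivAt
  have h2 := (h1.comp t (hasFDerivAt_prodMk_left t v)).hasDerivAt
  have h3 : (fun s : ℝ => φ s (proj v)) = lift φ ∘ fun s => (s, v) := rfl
  unfold dt
  rw [h3, h2.deriv]
  simp

theorem IsSmooth.hasDerivAt_time {φ : ℝ → Torus d → ℝ} (hφ : IsSmooth φ) (t : ℝ) (x : Torus d) :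
    HasDerivAt (fun s => φ s x) (dt φ t x) t := by
  obtain ⟨v, rfl⟩ := proj_surjective x
  have h1 : Differentiable ℝ (lift φ ∘ fun s : ℝ => (s, v)) :=
    (ContDiff.differentiable hφ (by simp)).comp (by fun_prop)
  exact (h1 t).hasDerivAt

theorem IsSmooth.pd {φ : ℝ → Torus d → ℝ} (hφ : IsSmooth φ) (k : Fin d) :
    IsSmooth (fun t => pd k (φ t)) := by
  have : lift (fun t => EnergyBalance.pd k (φ t))
      = fun z : ℝ × E d => fderiv ℝ (lift φ) z (0, EuclideanSpace.single k 1) := by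
    ext z; exact pd_lift hφ k z.1 z.2
  unfold IsSmooth; rw [this]
  exact (ContDiff.fderiv_right hφ (by simp)).clm_apply contDiff_const

theorem IsSmooth.dt {φ : ℝ → Torus d → ℝ} (hφ : IsSmooth φ) : IsSmooth (dt φ) := by
  have : lift (EnergyBalance.dt φ) = fun z : ℝ × E d => fderiv ℝ (lift φ) z (1, 0) := by
    ext z; exact dt_lift hφ z.1 z.2
  unfold IsSmooth; rw [this]
  exact (ContDiff.fderiv_right hφ (by simp)).clm_apply contDiff_const

theorem pd_mul {q r : Torus d → ℝ} (hq : SmoothT q) (hr : SmoothT r) (k : Fin d) (x : Torus d) :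
    pd k (fun x => q x * r x) x = pd k q x * r x + q x * pd k r x := by
  have h := (hq.hasDerivAt_zero k x).mul (hr.hasDerivAt_zero k x)
  rw [single_zero_add] at h
  exact h.deriv

theorem pd_const_mul {q : Torus d → ℝ} (hq : SmoothT q) (c : ℝ) (k : Fin d) (x : Torus d) :
    pd k (fun x => c * q x) x = c * pd k q x :=
  ((hq.hasDerivAt_zero k x).const_mul c).deriv

theorem pd_add {q r : Torus d → ℝ} (hq : SmoothT q) (hr : SmoothT r) (k : Fin d) (x : Torus d) :
    pd k (fun x => q x + r x) x = pd k q x + pd k r x :=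
  ((hq.hasDerivAt_zero k x).add (hr.hasDerivAt_zero k x)).deriv

theorem pd_sub_right {q : Torus d → ℝ} (k : Fin d) (b x : Torus d) :
    pd k (fun x => q (x - b)) x = pd k q (x - b) := by
  unfold pd; simp only [sub_add_eq_add_sub]

theorem pd_sub_left {q : Torus d → ℝ} (hq : SmoothT q) (k : Fin d) (b x : Torus d) :
    pd k (fun x => q (b - x)) x = - pd k q (b - x) := by
  have h := hq.hasDerivAt k (b - x) (-0)
  have h2 := HasDerivAt.comp (0 : ℝ) h (hasDerivAt_neg (0 : ℝ))
  rw [neg_zero, single_zero_add] at h2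
  have h3 : pd k (fun x => q (b - x)) x = deriv ((fun s : ℝ =>
      q (b - x + proj (EuclideanSpace.single k s))) ∘ fun s => -s) 0 := by
    unfold pd; congr 1; ext s
    have e : proj (EuclideanSpace.single k (-s) : E d) = - proj (EuclideanSpace.single k s) := by
      rw [← proj_neg]; congr 1; ext i; simp; split_ifs <;> simp
    simp only [Function.comp, e]
    congr 1; abel
  rw [h3, h2.deriv]; ring

theorem dt_mul_time {χ : ℝ → ℝ} (hχ : ContDiff ℝ ∞ χ) {φ : ℝ → Torus d → ℝ} (hφ : IsSmooth φ)
    (t : ℝ) (x : Torus d) :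
    dt (fun t x => χ t * φ t x) t x = deriv χ t * φ t x + χ t * dt φ t x :=
  (((hχ.differentiable (by simp)) t).hasDerivAt.mul (hφ.hasDerivAt_time t x)).deriv

theorem dt_mul_const {φ : ℝ → Torus d → ℝ} (hφ : IsSmooth φ) (q : Torus d → ℝ)
    (t : ℝ) (x : Torus d) :
    dt (fun t x => φ t x * q x) t x = dt φ t x * q x :=
  ((hφ.hasDerivAt_time t x).mul_const (q x)).deriv

/-- A smooth function is bounded on `[0, T] × 𝕋^d`. -/
theorem IsSmooth.bounded {φ : ℝ → Torus d → ℝ} (hφ : IsSmooth φ) (T : ℝ) :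
    ∃ C, ∀ t ∈ Icc 0 T, ∀ x, |φ t x| ≤ C := by
  obtain ⟨C, hC⟩ := (isCompact_Icc.prod isCompact_univ : IsCompact
    (Icc (0 : ℝ) T ×ˢ (univ : Set (Torus d)))).exists_bound_of_continuousOn
    hφ.continuous.continuousOn
  exact ⟨C, fun t ht x => hC (t, x) ⟨ht, mem_univ _⟩⟩

theorem SmoothT.bounded {q : Torus d → ℝ} (hq : SmoothT q) : ∃ C, ∀ x, |q x| ≤ C := by
  obtain ⟨C, hC⟩ := (isCompact_univ (X := Torus d)).exists_bound_of_continuousOn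
    hq.continuous.continuousOn
  exact ⟨C, fun x => hC x (mem_univ _)⟩

theorem _root_.Continuous.integrable_torus {F : Type*} [NormedAddCommGroup F] {q : Torus d → F}
    (hq : Continuous q) : Integrable q volume := by
  rw [← integrableOn_univ]
  exact hq.continuousOn.integrableOn_compact isCompact_univ

theorem integral_pd {q : Torus d → ℝ} (hq : SmoothT q) (k : Fin d) : ∫ x, pd k q x = 0 := by
  obtain ⟨C, hC⟩ := (hq.pd k).bounded
  have h := hasDerivAt_integral_of_dominated_loc_of_deriv_le (μ := (volume : Measure (Torus d)))
    (F := fun s x => q (x + proj (EuclideanSpace.single k s)))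
    (F' := fun s x => pd k q (x + proj (EuclideanSpace.single k s)))
    (x₀ := (0 : ℝ)) (s := univ) (bound := fun _ => C) univ_mem
    (Eventually.of_forall fun s =>
      (hq.continuous.comp (continuous_add_const _)).aestronglyMeasurable)
    ((hq.continuous.comp (continuous_add_const _)).integrable_torus)
    (((hq.pd k).continuous.comp (continuous_add_const _)).aestronglyMeasurable)
    (Eventually.of_forall fun x s _ => hC _) (integrable_const _)
    (Eventually.of_forall fun x s _ => hq.hasDerivAt k x s)
  have h2 := h.2
  simp only [integral_add_right_eq_self (μ := (volume : Measure (Torus d)))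
    (f := fun x => q x), single_zero_add] at h2
  exact h2.unique (hasDerivAt_const _ _)

theorem integral_mul_pd {q r : Torus d → ℝ} (hq : SmoothT q) (hr : SmoothT r) (k : Fin d) :
    ∫ x, q x * pd k r x = - ∫ x, pd k q x * r x := by
  have h := integral_pd (hq.mul hr) k
  simp_rw [pd_mul hq hr] at h
  rw [integral_add ((hq.pd k).mul hr).continuous.integrable_torus
    (hq.mul (hr.pd k)).continuous.integrable_torus] at h
  linarith

instance : Measure.IsNegInvariant (volume : Measure (Torus d)) :=
  Measure.IsAddHaarMeasure.isNegInvariant_of_regular _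

/-! ### Periodization of kernels with small support -/

/-- The representative of a point of the torus in the cube `(-1/2, 1/2]^d`. -/
noncomputable def rep (x : Torus d) : E d :=
  WithLp.toLp 2 fun i => (AddCircle.equivIoc (1 : ℝ) (-(1 / 2)) (x i) : ℝ)

/-- The cube `(-1/2, 1/2]^d`. -/
def cube (d : ℕ) : Set (E d) := {v | ∀ i, v i ∈ Ioc (-(1 / 2) : ℝ) (-(1 / 2) + 1)}

theorem proj_rep (x : Torus d) : proj (rep x) = x := by
  ext i
  exact AddCircle.coe_equivIoc (p := (1 : ℝ)) (a := -(1 / 2)) (y := x i)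

theorem rep_proj {v : E d} (hv : v ∈ cube d) : rep (proj v) = v := by
  ext i
  exact AddCircle.equivIoc_coe_of_mem (p := (1 : ℝ)) (a := -(1 / 2)) (hv i)

theorem mem_cube_of_norm_lt {v : E d} (hv : ‖v‖ < 1 / 2) : v ∈ cube d := by
  intro i
  have h := (PiLp.norm_apply_le v i).trans_lt hv
  rw [Real.norm_eq_abs, abs_lt] at h
  exact ⟨h.1, by linarith [h.2]⟩

theorem measurePreserving_proj :
    MeasurePreserving (proj : E d → Torus d) (volume.restrict (cube d)) volume := by
  have h1 : MeasurePreserving (fun (a : Fin d → ℝ) (i : Fin d) => ((a i : ℝ) : UnitAddCircle))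
      (Measure.pi fun _ => volume.restrict (Ioc (-(1 / 2) : ℝ) (-(1 / 2) + 1)))
      (Measure.pi fun _ => volume) :=
    measurePreserving_pi _ _ fun _ => UnitAddCircle.measurePreserving_mk _
  rw [← Measure.restrict_pi_pi] at h1
  have h2 := (EuclideanSpace.volume_preserving_symm_measurableEquiv_toLp (Fin d)).restrict_preimage
    (s := Set.pi univ fun _ => Ioc (-(1 / 2) : ℝ) (-(1 / 2) + 1))
    (MeasurableSet.univ_pi fun _ => measurableSet_Ioc)
  have h3 : ((MeasurableEquiv.toLp 2 (Fin d → ℝ)).symm) ⁻¹'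
      (Set.pi univ fun _ => Ioc (-(1 / 2) : ℝ) (-(1 / 2) + 1)) = cube d := by
    ext v; simp [cube]
  rw [h3] at h2
  exact h1.comp h2

/-- The periodization of a kernel on `ℝ^d`; meaningful for kernels supported near the origin. -/
noncomputable def per (K : E d → ℝ) (x : Torus d) : ℝ := K (rep x)

theorem per_proj (K : E d → ℝ) {v : E d} (hv : ‖v‖ < 1 / 2) : per K (proj v) = K v := by
  rw [per, rep_proj (mem_cube_of_norm_lt hv)]

/-- Near `v₀` the lift of `per K` is a translate of `K` by a lattice vector, or it vanishes. -/
theorem per_locally {K : E d → ℝ} (hK : ∀ v, 1 / 4 ≤ ‖v‖ → K v = 0) (v₀ : E d) :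
    (∃ c : E d, proj c = 0 ∧ ‖v₀ - c‖ < 1 / 2 ∧ ∀ᶠ v in 𝓝 v₀, per K (proj v) = K (v - c)) ∨
      ∀ᶠ v in 𝓝 v₀, per K (proj v) = 0 := by
  by_cases h : ‖rep (proj v₀)‖ < 1 / 2
  · left
    refine ⟨v₀ - rep (proj v₀), by rw [proj_sub, proj_rep, sub_self], by simpa using h, ?_⟩
    have hc : Tendsto (fun v : E d => ‖v - (v₀ - rep (proj v₀))‖) (𝓝 v₀)
        (𝓝 ‖v₀ - (v₀ - rep (proj v₀))‖) :=
      (Continuous.norm (by fun_prop)).tendsto _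
    rw [sub_sub_cancel] at hc
    filter_upwards [hc.eventually (gt_mem_nhds h)] with v hv
    rw [← per_proj K hv, proj_sub v, proj_sub v₀, proj_rep]
    simp
  · right
    filter_upwards [ball_mem_nhds v₀ (show (0 : ℝ) < 1 / 4 by norm_num)] with v hv
    by_contra hne
    have h1 : ‖rep (proj v)‖ < 1 / 4 := by
      by_contra h2
      exact hne (hK _ (not_lt.1 h2))
    have h2 : ‖v₀ - v + rep (proj v)‖ < 1 / 2 := by
      rw [mem_ball, dist_comm, dist_eq_norm] at hv
      calc _ ≤ ‖v₀ - v‖ + ‖rep (proj v)‖ := norm_add_le _ _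
        _ < 1 / 2 := by linarith
    have h3 : proj (v₀ - v + rep (proj v)) = proj v₀ := by
      rw [proj_add, proj_sub, proj_rep]; abel
    exact h (by rw [← h3, rep_proj (mem_cube_of_norm_lt h2)]; exact h2)

/-- The lift of `per K` is locally a translate of `K` or zero, hence smooth. -/
theorem smoothT_per {K : E d → ℝ} (hK : ContDiff ℝ ∞ K) (h0 : ∀ v, 1 / 4 ≤ ‖v‖ → K v = 0) :
    SmoothT (per K) := by
  refine contDiff_iff_contDiffAt.2 fun v₀ => ?_
  rcases per_locally h0 v₀ with ⟨c, -, -, hc⟩ | hc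
  · exact (hK.comp (contDiff_id.sub contDiff_const)).contDiffAt.congr_of_eventuallyEq hc
  · exact contDiffAt_const.congr_of_eventuallyEq hc

theorem pd_per {K : E d → ℝ} (hK : ContDiff ℝ ∞ K) (h0 : ∀ v, 1 / 4 ≤ ‖v‖ → K v = 0)
    (k : Fin d) :
    pd k (per K) = per (fun v => fderiv ℝ K v (EuclideanSpace.single k 1)) := by
  have h0' : ∀ v : E d, 1 / 4 ≤ ‖v‖ → fderiv ℝ K v = 0 := by
    have h1 : ∀ v : E d, 1 / 4 < ‖v‖ → fderiv ℝ K v = 0 := by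
      intro v hv
      have : K =ᶠ[𝓝 v] fun _ => (0 : ℝ) := by
        filter_upwards [continuous_norm.continuousAt.eventually (lt_mem_nhds hv)] with w hw
        exact h0 w hw.le
      rw [this.fderiv_eq]; simp
    intro v hv
    have hcont : Continuous fun s : ℝ => fderiv ℝ K (s • v) :=
      (hK.continuous_fderiv (by simp)).comp (by fun_prop)
    have h2 : Tendsto (fun s : ℝ => fderiv ℝ K (s • v)) (𝓝[>] 1) (𝓝 (fderiv ℝ K v)) := by
      have := (hcont.tendsto 1).mono_left (nhdsWithin_le_nhds (s := Ioi (1 : ℝ)))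
      simpa using this
    refine tendsto_nhds_unique h2 (tendsto_const_nhds.congr' ?_)
    filter_upwards [self_mem_nhdsWithin] with s hs
    have hs' : (1 : ℝ) < s := hs
    refine (h1 _ ?_).symm
    rw [norm_smul, Real.norm_of_nonneg (by linarith)]
    nlinarith [norm_nonneg v]
  ext x
  obtain ⟨v₀, rfl⟩ := proj_surjective x
  rw [pd_proj (smoothT_per hK h0)]
  rcases per_locally h0 v₀ with ⟨c, hc0, hn, hc⟩ | hc
  · have e1 : (fun w : E d => per K (proj w)) =ᶠ[𝓝 v₀] fun w => K (w - c) := hc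
    rw [e1.fderiv_eq, fderiv_comp_sub]
    have e2 : proj v₀ = proj (v₀ - c) := by rw [proj_sub, hc0, sub_zero]
    rw [e2, per_proj _ hn]
  · have e1 : (fun w : E d => per K (proj w)) =ᶠ[𝓝 v₀] fun _ => 0 := hc
    rw [e1.fderiv_eq]
    simp only [fderiv_fun_const, Pi.zero_apply, zero_apply]
    unfold per
    by_cases hr : 1 / 4 ≤ ‖rep (proj v₀)‖
    · simp only [h0' _ hr, zero_apply]
    · push Not at hr
      -- the lift vanishes near `v₀`, hence `K` vanishes near the representative of `v₀`
      have e3 : K =ᶠ[𝓝 (rep (proj v₀))] fun _ => 0 := by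
        have hc' : Tendsto (fun w : E d => w + (v₀ - rep (proj v₀))) (𝓝 (rep (proj v₀)))
            (𝓝 v₀) := by
          have : Continuous fun w : E d => w + (v₀ - rep (proj v₀)) := by fun_prop
          simpa using this.tendsto (rep (proj v₀))
        filter_upwards [hc'.eventually hc, continuous_norm.continuousAt.eventually
          (gt_mem_nhds (hr.trans (show (1 : ℝ) / 4 < 1 / 2 by norm_num)))] with w hw hw2
        rw [← per_proj K hw2, ← hw]
        congr 1
        rw [proj_add, proj_sub, proj_rep, sub_self, add_zero]
      simp only [e3.fderiv_eq, fderiv_fun_const, Pi.zero_apply, zero_apply]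

/-- Integrals against a periodized kernel are integrals over `ℝ^d`. -/
theorem integral_per_mul {K : E d → ℝ} (h0 : ∀ v, 1 / 4 ≤ ‖v‖ → K v = 0) {h : Torus d → ℝ}
    (hm : AEStronglyMeasurable (fun x => per K x * h x) volume) :
    ∫ x, per K x * h x = ∫ v, K v * h (proj v) := by
  have hmeas : MeasurableSet (cube d) := by
    have : cube d = ⋂ i, (fun v : E d => v i) ⁻¹' Ioc (-(1 / 2) : ℝ) (-(1 / 2) + 1) := by
      ext v; simp [cube]
    rw [this]
    exact MeasurableSet.iInter fun i => measurableSet_Ioc.preimage (by fun_prop)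
  have hmp := measurePreserving_proj (d := d)
  rw [← hmp.map_eq] at hm ⊢
  rw [integral_map hmp.aemeasurable hm]
  have h1 : ∫ v in cube d, per K (proj v) * h (proj v) = ∫ v in cube d, K v * h (proj v) := by
    refine setIntegral_congr_fun hmeas fun v hv => ?_
    simp only [per, rep_proj hv]
  rw [h1]
  refine setIntegral_eq_integral_of_forall_compl_eq_zero fun v hv => ?_
  rw [h0 v, zero_mul]
  by_contra h2
  exact hv (mem_cube_of_norm_lt (by linarith [not_le.1 h2]))

/-- Convolution on the torus. -/
noncomputable def conv (Q P : Torus d → ℝ) (w : Torus d) : ℝ := ∫ c, Q c * P (w - c)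

/-- A smooth approximation of the identity on the torus. -/
theorem exists_approxIdentity (d : ℕ) : ∃ P : ℕ → Torus d → ℝ, (∀ n, SmoothT (P n)) ∧
    ∀ Q : Torus d → ℝ, Continuous Q → (∀ w, Tendsto (fun n => conv Q (P n) w) atTop (𝓝 (Q w))) ∧
      ∀ C, (∀ x, |Q x| ≤ C) → ∀ n w, |conv Q (P n) w| ≤ C := by
  -- normalized bumps, of radius at most `1/4` so that they can be periodized
  let b : ℕ → ContDiffBump (0 : E d) := fun n =>
    ⟨1 / (n + 10), 2 / (n + 10), by positivity, by gcongr; norm_num⟩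
  have hr : ∀ n, (b n).rOut ≤ 1 / 4 := by
    intro n
    change 2 / ((n : ℝ) + 10) ≤ 1 / 4
    rw [div_le_div_iff₀ (by positivity) (by norm_num)]
    have : (0 : ℝ) ≤ n := Nat.cast_nonneg n
    linarith
  let K : ℕ → E d → ℝ := fun n v => (b n).normed volume v
  have hK : ∀ n, ContDiff ℝ ∞ (K n) := fun n => (b n).contDiff_normed
  have h0 : ∀ n v, 1 / 4 ≤ ‖v‖ → K n v = 0 := by
    intro n v hv
    have : v ∉ Function.support ((b n).normed volume) := by
      rw [(b n).support_normed_eq]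
      simp only [mem_ball, dist_zero_right, not_lt]
      exact (hr n).trans hv
    simpa using this
  have hP : ∀ n, SmoothT (per (K n)) := fun n => smoothT_per (hK n) (h0 n)
  have hconv : ∀ Q : Torus d → ℝ, Continuous Q → ∀ n w,
      conv Q (per (K n)) w = ∫ v, K n v * Q (w - proj v) := by
    intro Q hQ n w
    rw [← integral_per_mul (h0 n) (h := fun x => Q (w - x))
      ((hP n).continuous.mul (hQ.comp (continuous_const.sub continuous_id))).aestronglyMeasurable]
    unfold conv
    have := integral_sub_left_eq_self (μ := (volume : Measure (Torus d)))
      (fun c => Q c * per (K n) (w - c)) w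
    rw [← this]
    refine integral_congr_ae (Eventually.of_forall fun x => ?_)
    simp [mul_comm]
  refine ⟨fun n => per (K n), hP, fun Q hQ => ⟨fun w => ?_, fun C hC n w => ?_⟩⟩
  · simp_rw [hconv Q hQ]
    have h1 := ContDiffBump.convolution_tendsto_right_of_continuous (μ := (volume : Measure (E d)))
      (φ := b) (l := atTop) (g := fun v => Q (w + proj v)) ?_ (by fun_prop) 0
    · simp only [convolution_def, ContinuousLinearMap.lsmul_apply, smul_eq_mul, zero_sub,
        proj_zero, add_zero] at h1
      refine h1.congr fun n => ?_
      refine integral_congr_ae (Eventually.of_forall fun v => ?_)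
      simp [K, proj_neg, sub_eq_add_neg]
    · change Tendsto (fun n : ℕ => 2 / ((n : ℝ) + 10)) atTop (𝓝 0)
      exact tendsto_const_nhds.div_atTop
        (tendsto_atTop_add_const_right _ _ tendsto_natCast_atTop_atTop)
  · rw [hconv Q hQ]
    have h1 : ∫ v, K n v = 1 := (b n).integral_normed
    have h2 : ∀ v, 0 ≤ K n v := fun v => (b n).nonneg_normed v
    have h3 : Integrable (K n) := (b n).integrable_normed
    calc |∫ v, K n v * Q (w - proj v)| ≤ ∫ v, K n v * C := by
          rw [← Real.norm_eq_abs]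
          refine norm_integral_le_of_norm_le (h3.mul_const C) (Eventually.of_forall fun v => ?_)
          rw [norm_mul, Real.norm_of_nonneg (h2 v)]
          exact mul_le_mul_of_nonneg_left (hC _) (h2 v)
      _ = C := by rw [integral_mul_const, h1, one_mul]

/-! ### Weak time derivatives of scalar functions -/

/-- The fundamental lemma of the calculus of variations on `[0, T]`. -/
theorem ae_eq_zero_of_tests {T : ℝ} {h : ℝ → ℝ}
    (hi : Integrable h (volume.restrict (Icc 0 T)))
    (H : ∀ χ : ℝ → ℝ, ContDiff ℝ ∞ χ → HasCompactSupport χ → tsupport χ ⊆ Ioo 0 T →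
      ∫ t in Icc 0 T, χ t * h t = 0) :
    ∀ᵐ t ∂(volume.restrict (Icc 0 T)), h t = 0 := by
  have h1 : IntegrableOn h (Ioo 0 T) := hi.mono_measure (Measure.restrict_mono Ioo_subset_Icc_self
    le_rfl)
  have h2 := IsOpen.ae_eq_zero_of_integral_contDiff_smul_eq_zero (μ := volume) isOpen_Ioo
    h1.locallyIntegrableOn (fun g hg hg1 hg2 => by
      rw [← H g hg hg1 hg2]
      refine (setIntegral_eq_integral_of_forall_compl_eq_zero fun t ht => ?_).symm
      have : t ∉ tsupport g := fun h => ht (Ioo_subset_Icc_self (hg2 h))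
      simp [image_eq_zero_of_notMem_tsupport this])
  rw [← restrict_Ioo_eq_restrict_Icc]
  exact (ae_restrict_iff' measurableSet_Ioo).2 h2

theorem intervalIntegrable_of_Icc {T : ℝ} (hT : 0 ≤ T) {h : ℝ → ℝ}
    (hi : Integrable h (volume.restrict (Icc 0 T))) : IntervalIntegrable h volume 0 T := by
  rw [intervalIntegrable_iff_integrableOn_Icc_of_le hT]; exact hi

/-- Integration by parts for two primitives. -/
theorem integral_primitive_mul {T : ℝ} (hT : 0 ≤ T) {α β : ℝ → ℝ}
    (hα : Integrable α (volume.restrict (Icc 0 T)))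
    (hβ : Integrable β (volume.restrict (Icc 0 T))) :
    ∫ t in Icc 0 T, (∫ s in 0..t, α s) * β t
      = (∫ s in 0..T, α s) * (∫ s in 0..T, β s) - ∫ t in Icc 0 T, α t * ∫ s in 0..t, β s := by
  have hα' := intervalIntegrable_of_Icc hT hα
  have hβ' := intervalIntegrable_of_Icc hT hβ
  have key := AbsolutelyContinuousOnInterval.integral_mul_deriv_eq_deriv_mul
    (hα'.absolutelyContinuousOnInterval_intervalIntegral (c := 0) left_mem_uIcc)
    (hβ'.absolutelyContinuousOnInterval_intervalIntegral (c := 0) left_mem_uIcc)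
  have e : ∀ {h : ℝ → ℝ}, IntervalIntegrable h volume 0 T →
      ∀ᵐ t ∂(volume.restrict (Icc 0 T)), deriv (fun t => ∫ s in 0..t, h s) t = h t := by
    intro h hh
    rw [ae_restrict_iff' measurableSet_Icc]
    filter_upwards [hh.ae_hasDerivAt_integral] with t ht1 ht2
    exact (ht1 (by rwa [uIcc_of_le hT]) 0 left_mem_uIcc).deriv
  rw [intervalIntegral.integral_of_le (f := fun t => _ * deriv _ t) hT,
    intervalIntegral.integral_of_le (f := fun t => deriv _ t * _) hT,
    ← integral_Icc_eq_integral_Ioc, ← integral_Icc_eq_integral_Ioc] at key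
  rw [intervalIntegral.integral_same, intervalIntegral.integral_same] at key
  rw [integral_congr_ae (g := fun t => (∫ s in 0..t, α s) * β t)
    ((e hβ').mono fun t ht => by simp only [ht]),
    integral_congr_ae (f := fun t => deriv (fun t => ∫ s in 0..t, α s) t * ∫ s in 0..t, β s)
    (g := fun t => α t * ∫ s in 0..t, β s)
    ((e hα').mono fun t ht => by simp only [ht])] at key
  rw [key]; ring

theorem continuousOn_primitive {T : ℝ} (hT : 0 ≤ T) {α : ℝ → ℝ}
    (hα : Integrable α (volume.restrict (Icc 0 T))) :
    ContinuousOn (fun t => ∫ s in 0..t, α s) (Icc 0 T) := by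
  have h := intervalIntegral.continuousOn_primitive_interval (f := α) (μ := volume) (a := 0)
    (b := T) (by rw [uIcc_of_le hT]; exact hα)
  rwa [uIcc_of_le hT] at h

theorem integrable_mul_primitive {T : ℝ} (hT : 0 ≤ T) {α β : ℝ → ℝ}
    (hα : Integrable α (volume.restrict (Icc 0 T)))
    (hβ : Integrable β (volume.restrict (Icc 0 T))) :
    Integrable (fun t => (∫ s in 0..t, α s) * β t) (volume.restrict (Icc 0 T)) := by
  have hc := continuousOn_primitive hT hα
  obtain ⟨C, hC⟩ := isCompact_Icc.exists_bound_of_continuousOn hc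
  refine hβ.bdd_mul (c := C) (hc.aestronglyMeasurable measurableSet_Icc) ?_
  rw [ae_restrict_iff' measurableSet_Icc]
  exact Eventually.of_forall hC

/-- A function with integrable weak derivative `α`, in a formulation that sees the initial
value `c₀`, is a primitive of `α`. -/
theorem eq_primitive_of_weak {T : ℝ} (hT : 0 < T) {A α : ℝ → ℝ} {c₀ : ℝ}
    (hA : Integrable A (volume.restrict (Icc 0 T)))
    (hα : Integrable α (volume.restrict (Icc 0 T)))
    (H : ∀ χ : ℝ → ℝ, ContDiff ℝ ∞ χ → χ T = 0 →
      ∫ t in Icc 0 T, (deriv χ t * A t + χ t * α t) = - (χ 0 * c₀)) :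
    ∀ᵐ t ∂(volume.restrict (Icc 0 T)), A t = c₀ + ∫ s in 0..t, α s := by
  have h1 : Integrable (fun t => A t - (c₀ + ∫ s in 0..t, α s)) (volume.restrict (Icc 0 T)) :=
    hA.sub ((integrable_const c₀).add
      ((continuousOn_primitive hT.le hα).integrableOn_compact isCompact_Icc))
  refine (ae_eq_zero_of_tests h1 fun η hη hηc hηs => ?_).mono fun t ht => by linarith
  have hηi : Integrable η (volume.restrict (Icc 0 T)) :=
    (hη.continuous.integrable_of_hasCompactSupport hηc).restrict
  -- the antiderivative of `η` that vanishes at time `T`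
  let χ : ℝ → ℝ := fun t => (∫ s in 0..t, η s) - ∫ s in 0..T, η s
  have hd : ∀ t, HasDerivAt χ (η t) t := fun t =>
    (intervalIntegral.integral_hasDerivAt_right (hη.continuous.intervalIntegrable _ _)
      (hη.continuous.stronglyMeasurableAtFilter _ _) hη.continuous.continuousAt).sub_const _
  have hdd : deriv χ = η := funext fun t => (hd t).deriv
  have hχ : ContDiff ℝ ∞ χ := by
    rw [contDiff_infty_iff_deriv]
    exact ⟨fun t => (hd t).differentiableAt, by rw [hdd]; exact hη⟩
  have h2 := H χ hχ (sub_self _)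
  have h3 := integral_primitive_mul hT.le hηi hα
  have i1 : Integrable (fun t => η t * A t) (volume.restrict (Icc 0 T)) := by
    obtain ⟨C, hC⟩ := hηc.exists_bound_of_continuous hη.continuous
    exact hA.bdd_mul (c := C) hη.continuous.aestronglyMeasurable (Eventually.of_forall hC)
  have i2 := integrable_mul_primitive hT.le hηi hα
  have i3 : Integrable (fun t => η t * ∫ s in 0..t, α s) (volume.restrict (Icc 0 T)) := by
    simpa only [mul_comm] using integrable_mul_primitive hT.le hα hηi
  simp only [hdd, χ, zero_mul, intervalIntegral.integral_same, sub_mul] at h2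
  have i4 : Integrable (fun t => (∫ s in 0..t, η s) * α t - (∫ s in 0..T, η s) * α t)
      (volume.restrict (Icc 0 T)) := i2.sub (hα.const_mul _)
  rw [integral_add i1 i4, integral_sub i2 (hα.const_mul _),
    integral_const_mul, h3] at h2
  have e1 : ∫ t in Icc 0 T, α t = ∫ s in 0..T, α s := by
    rw [intervalIntegral.integral_of_le hT.le, integral_Icc_eq_integral_Ioc]
  have e2 : ∫ t in Icc 0 T, η t = ∫ s in 0..T, η s := by
    rw [intervalIntegral.integral_of_le hT.le, integral_Icc_eq_integral_Ioc]
  have e3 : ∫ t in Icc 0 T, η t * (A t - (c₀ + ∫ s in 0..t, α s))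
      = (∫ t in Icc 0 T, η t * A t) - ((∫ t in Icc 0 T, η t) * c₀
        + ∫ t in Icc 0 T, η t * ∫ s in 0..t, α s) := by
    rw [← integral_mul_const, ← integral_add (hηi.mul_const _) i3,
      ← integral_sub i1 ((hηi.mul_const _).fun_add i3)]
    congr 1; ext t; ring
  rw [e3, e2]
  rw [e1] at h2
  linarith

/-- The product rule for two functions with integrable weak derivatives, the first of which
vanishes at both ends. -/
theorem integral_product_rule {T : ℝ} (hT : 0 < T) {A α B β : ℝ → ℝ} {c₀ : ℝ}
    (hA : Integrable A (volume.restrict (Icc 0 T)))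
    (hα : Integrable α (volume.restrict (Icc 0 T)))
    (hB : Integrable B (volume.restrict (Icc 0 T)))
    (hβ : Integrable β (volume.restrict (Icc 0 T)))
    (H1 : ∀ χ : ℝ → ℝ, ContDiff ℝ ∞ χ →
      ∫ t in Icc 0 T, (deriv χ t * A t + χ t * α t) = 0)
    (H2 : ∀ χ : ℝ → ℝ, ContDiff ℝ ∞ χ → χ T = 0 →
      ∫ t in Icc 0 T, (deriv χ t * B t + χ t * β t) = - (χ 0 * c₀)) :
    ∫ t in Icc 0 T, (α t * B t + A t * β t) = 0 := by
  have h1 := eq_primitive_of_weak (c₀ := 0) hT hA hα (fun χ hχ _ => by simpa using H1 χ hχ)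
  have h1' := H1 (fun _ => 1) contDiff_const
  simp only [deriv_const, zero_mul, one_mul, zero_add] at h1'
  have h2 := eq_primitive_of_weak hT hB hβ H2
  have e : ∫ t in Icc 0 T, (α t * B t + A t * β t)
      = ∫ t in Icc 0 T, (c₀ * α t + (∫ s in 0..t, β s) * α t + (∫ s in 0..t, α s) * β t) := by
    refine integral_congr_ae ?_
    filter_upwards [h1, h2] with t ht1 ht2
    rw [ht1, ht2]; ring
  have i1 := integrable_mul_primitive hT.le hα hβ
  have i2 := integrable_mul_primitive hT.le hβ hα
  rw [e, integral_add ((hα.const_mul _).fun_add i2) i1, integral_add (hα.const_mul _) i2,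
    integral_const_mul, integral_primitive_mul hT.le hα hβ]
  have e1 : ∫ t in Icc 0 T, α t = ∫ s in 0..T, α s := by
    rw [intervalIntegral.integral_of_le hT.le, integral_Icc_eq_integral_Ioc]
  have e2 : ∀ t, α t * ∫ s in 0..t, β s = (∫ s in 0..t, β s) * α t := fun t => mul_comm _ _
  simp only [e2]
  rw [e1] at h1' ⊢
  rw [h1']; ring

/-! ### Two-point correlations -/

/-- `g(t,x) h(t,z)` is integrable in `(t,x,z)`. -/
def Pair (T : ℝ) (g h : ℝ × Torus d → ℝ) : Prop :=
  Integrable (fun w : (ℝ × Torus d) × Torus d => g w.1 * h (w.1.1, w.2))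
    ((spaceTime d T).prod volume)

/-- The correlation `∫∫∫ Q(z - x) g(t,x) h(t,z) dt dx dz`. -/
noncomputable def corr (T : ℝ) (Q : Torus d → ℝ) (g h : ℝ × Torus d → ℝ) : ℝ :=
  ∫ w, Q (w.2 - w.1.2) * (g w.1 * h (w.1.1, w.2)) ∂((spaceTime d T).prod volume)

theorem Pair.mul_kernel {T : ℝ} {g h : ℝ × Torus d → ℝ} (hp : Pair T g h)
    {k : (ℝ × Torus d) × Torus d → ℝ} (hk : Continuous k) {C : ℝ}
    (hC : ∀ w, w.1.1 ∈ Icc 0 T → |k w| ≤ C) :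
    Integrable (fun w : (ℝ × Torus d) × Torus d => k w * (g w.1 * h (w.1.1, w.2)))
      ((spaceTime d T).prod volume) := by
  refine hp.bdd_mul (c := C) hk.aestronglyMeasurable ?_
  have h1 : ∀ᵐ z ∂(spaceTime d T), z.1 ∈ Icc 0 T := by
    have : Measure.QuasiMeasurePreserving Prod.fst (spaceTime d T) (volume.restrict (Icc 0 T)) :=
      Measure.quasiMeasurePreserving_fst
    exact this.ae (ae_restrict_mem measurableSet_Icc)
  have h2 : ∀ᵐ w ∂((spaceTime d T).prod (volume : Measure (Torus d))), w.1.1 ∈ Icc 0 T :=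
    (Measure.quasiMeasurePreserving_fst).ae h1
  exact h2.mono fun w hw => hC w hw

theorem Pair.integrable_corr {T : ℝ} {g h : ℝ × Torus d → ℝ} (hp : Pair T g h)
    {Q : Torus d → ℝ} (hQ : Continuous Q) :
    Integrable (fun w : (ℝ × Torus d) × Torus d => Q (w.2 - w.1.2) * (g w.1 * h (w.1.1, w.2)))
      ((spaceTime d T).prod volume) := by
  obtain ⟨C, hC⟩ := (isCompact_univ (X := Torus d)).exists_bound_of_continuousOn hQ.continuousOn
  exact hp.mul_kernel (k := fun w => Q (w.2 - w.1.2)) (hQ.comp (by fun_prop))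
    (fun w _ => hC _ (mem_univ _))

theorem Pair.add_left {T : ℝ} {g g' h : ℝ × Torus d → ℝ} (hp : Pair T g h) (hp' : Pair T g' h) :
    Pair T (fun z => g z + g' z) h := by
  unfold Pair; simpa only [add_mul] using Integrable.fun_add hp hp'

theorem Pair.smooth_mul {T : ℝ} {g h : ℝ × Torus d → ℝ} (hp : Pair T g h) {φ : ℝ → Torus d → ℝ}
    (hφ : IsSmooth φ) : Pair T (fun z => φ z.1 z.2 * g z) h := by
  obtain ⟨C, hC⟩ := hφ.bounded T
  have := hp.mul_kernel (k := fun w => φ w.1.1 w.1.2) (hφ.continuous.comp continuous_fst)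
    (fun w hw => hC _ hw _)
  unfold Pair; simpa only [mul_assoc] using this

theorem corr_add_left {T : ℝ} {Q : Torus d → ℝ} (hQ : Continuous Q) {g g' h : ℝ × Torus d → ℝ}
    (hp : Pair T g h) (hp' : Pair T g' h) :
    corr T Q (fun z => g z + g' z) h = corr T Q g h + corr T Q g' h := by
  unfold corr
  rw [← integral_add (hp.integrable_corr hQ) (hp'.integrable_corr hQ)]
  congr 1; ext w; ring

theorem measurePreserving_forget (T : ℝ) :
    MeasurePreserving (fun w : (ℝ × Torus d) × Torus d => (w.1.1, w.2))
      ((spaceTime d T).prod volume) (spaceTime d T) := by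
  have h1 : MeasurePreserving (Prod.fst : ℝ × Torus d → ℝ) (spaceTime d T)
      (volume.restrict (Icc 0 T)) := measurePreserving_fst
  exact h1.prod (MeasurePreserving.id _)

/-- The exchange `(t, x, z) ↦ (t, z, x)`. -/
theorem measurePreserving_exchange (T : ℝ) :
    MeasurePreserving (fun w : (ℝ × Torus d) × Torus d => ((w.1.1, w.2), w.1.2))
      ((spaceTime d T).prod volume) ((spaceTime d T).prod volume) := by
  have h1 : MeasurePreserving (MeasurableEquiv.prodAssoc : (ℝ × Torus d) × Torus d ≃ᵐ _)
      ((spaceTime d T).prod volume)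
      ((volume.restrict (Icc 0 T)).prod ((volume : Measure (Torus d)).prod volume)) :=
    measurePreserving_prodAssoc _ _ _
  have h2 : MeasurePreserving (Prod.map id Prod.swap : ℝ × Torus d × Torus d → _)
      ((volume.restrict (Icc 0 T)).prod ((volume : Measure (Torus d)).prod volume))
      ((volume.restrict (Icc 0 T)).prod ((volume : Measure (Torus d)).prod volume)) :=
    (MeasurePreserving.id _).prod Measure.measurePreserving_swap
  exact (h1.symm _).comp (h2.comp h1)

theorem exchange_involutive :
    Function.Involutive (fun w : (ℝ × Torus d) × Torus d => ((w.1.1, w.2), w.1.2)) := fun _ => rfl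

theorem measurableEmbedding_exchange :
    MeasurableEmbedding (fun w : (ℝ × Torus d) × Torus d => ((w.1.1, w.2), w.1.2)) := by
  have hm : Measurable (fun w : (ℝ × Torus d) × Torus d => ((w.1.1, w.2), w.1.2)) := by fun_prop
  exact MeasurableEquiv.measurableEmbedding
    ⟨⟨_, _, exchange_involutive.leftInverse, exchange_involutive.rightInverse⟩, hm, hm⟩

theorem Pair.symm {T : ℝ} {g h : ℝ × Torus d → ℝ} (hp : Pair T g h) : Pair T h g := by
  have := (measurePreserving_exchange (d := d) T).integrable_comp_emb measurableEmbedding_exchange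
    |>.2 hp
  unfold Pair
  refine this.congr (Eventually.of_forall fun w => ?_)
  simp [Function.comp, mul_comm]

/-- Exchanging the two points reflects the kernel. -/
theorem corr_symm (T : ℝ) (Q : Torus d → ℝ) (g h : ℝ × Torus d → ℝ) :
    corr T Q g h = corr T (fun x => Q (-x)) h g := by
  unfold corr
  rw [← (measurePreserving_exchange (d := d) T).integral_comp measurableEmbedding_exchange]
  congr 1; ext w; simp only [neg_sub]; ring

/-- A function of two variables vanishes almost everywhere if almost all its sections in one
direction do. -/
theorem ae_eq_zero_of_sections {X Y : Type*} [MeasurableSpace X] [MeasurableSpace Y]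
    {μ : Measure X} {ν : Measure Y} [SFinite μ] [SFinite ν] {h : X × Y → ℝ}
    (hm : AEStronglyMeasurable h (μ.prod ν)) (h0 : ∀ᵐ y ∂ν, ∀ᵐ x ∂μ, h (x, y) = 0) :
    ∀ᵐ z ∂(μ.prod ν), h z = 0 := by
  have h1 : ∫⁻ z, ‖h z‖ₑ ∂(μ.prod ν) = 0 := by
    rw [lintegral_prod_symm _ hm.enorm]
    refine (lintegral_congr_ae (g := fun _ => 0) (h0.mono fun y hy => ?_)).trans (by simp)
    refine (lintegral_congr_ae (g := fun _ => 0) (hy.mono fun x hx => ?_)).trans (by simp)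
    simp [hx]
  rw [lintegral_eq_zero_iff' hm.enorm] at h1
  exact h1.mono fun z hz => by simpa using hz

/-! ### Stationary laws -/

theorem integral_eq_zero_of_inner_right {T : ℝ} {W : (ℝ × Torus d) × Torus d → ℝ}
    (hW : Integrable W ((spaceTime d T).prod volume))
    (h0 : ∀ x, ∀ᵐ t ∂(volume.restrict (Icc 0 T)), ∫ y, W ((t, x), y) = 0) :
    ∫ w, W w ∂((spaceTime d T).prod volume) = 0 := by
  rw [integral_prod _ hW]
  have hm := hW.integral_prod_left.aestronglyMeasurable
  have := ae_eq_zero_of_sections (μ := volume.restrict (Icc 0 T))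
    (ν := (volume : Measure (Torus d))) (h := fun z => ∫ y, W (z, y)) hm
    (Eventually.of_forall h0)
  exact (integral_congr_ae (g := fun _ => (0 : ℝ)) this).trans (by simp)

theorem integral_eq_zero_of_inner_left {T : ℝ} {W : (ℝ × Torus d) × Torus d → ℝ}
    (hW : Integrable W ((spaceTime d T).prod volume))
    (h0 : ∀ y, ∀ᵐ t ∂(volume.restrict (Icc 0 T)), ∫ x, W ((t, x), y) = 0) :
    ∫ w, W w ∂((spaceTime d T).prod volume) = 0 := by
  rw [← (measurePreserving_exchange (d := d) T).integral_comp measurableEmbedding_exchange]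
  exact integral_eq_zero_of_inner_right
    ((measurePreserving_exchange (d := d) T).integrable_comp_emb measurableEmbedding_exchange
      |>.2 hW) h0

theorem integrable_smooth_mul {T : ℝ} {g : ℝ × Torus d → ℝ} (hg : Integrable g (spaceTime d T))
    {φ : ℝ → Torus d → ℝ} (hφ : IsSmooth φ) :
    Integrable (fun z => φ z.1 z.2 * g z) (spaceTime d T) := by
  obtain ⟨C, hC⟩ := hφ.bounded T
  refine hg.bdd_mul (c := C) hφ.continuous.aestronglyMeasurable ?_
  have h1 : ∀ᵐ z ∂(spaceTime d T), z.1 ∈ Icc 0 T := by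
    have : Measure.QuasiMeasurePreserving Prod.fst (spaceTime d T) (volume.restrict (Icc 0 T)) :=
      Measure.quasiMeasurePreserving_fst
    exact this.ae (ae_restrict_mem measurableSet_Icc)
  exact h1.mono fun z hz => hC _ hz _

/-- The weak form of `∂_k v^k = c` on `[0,T] × 𝕋^d`. -/
structure StationaryLaw (T : ℝ) (v : Fin d → ℝ × Torus d → ℝ) (c : ℝ × Torus d → ℝ) : Prop where
  integrable_field : ∀ k, Integrable (v k) (spaceTime d T)
  integrable_source : Integrable c (spaceTime d T)
  law : ∀ φ : ℝ → Torus d → ℝ, IsSmooth φ →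
    ∫ z, (∑ k, pd k (φ z.1) z.2 * v k z + φ z.1 z.2 * c z) ∂(spaceTime d T) = 0

/-- A stationary law holds at almost every time: multiply the test function by a function of
time. -/
theorem StationaryLaw.slice {T : ℝ} {v : Fin d → ℝ × Torus d → ℝ} {c : ℝ × Torus d → ℝ}
    (hv : StationaryLaw T v c) {φ : ℝ → Torus d → ℝ} (hφ : IsSmooth φ) :
    ∀ᵐ t ∂(volume.restrict (Icc 0 T)),
      ∫ x, (∑ k, pd k (φ t) x * v k (t, x) + φ t x * c (t, x)) = 0 := by
  have hi : Integrable (fun z : ℝ × Torus d => ∑ k, pd k (φ z.1) z.2 * v k z + φ z.1 z.2 * c z)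
      (spaceTime d T) :=
    (integrable_finsetSum _ fun k _ =>
      integrable_smooth_mul (hv.integrable_field k) (hφ.pd k)).fun_add
      (integrable_smooth_mul hv.integrable_source hφ)
  refine ae_eq_zero_of_tests hi.integral_prod_left fun χ hχ hχc _ => ?_
  have h := hv.law _ ((isSmooth_time hχ).mul hφ)
  have e : ∀ z : ℝ × Torus d,
      (∑ k, pd k (fun x => χ z.1 * φ z.1 x) z.2 * v k z + χ z.1 * φ z.1 z.2 * c z)
        = χ z.1 * (∑ k, pd k (φ z.1) z.2 * v k z + φ z.1 z.2 * c z) := by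
    intro z
    rw [mul_add, Finset.mul_sum]
    congr 1
    · refine Finset.sum_congr rfl fun k _ => ?_
      rw [pd_const_mul (hφ.slice z.1)]; ring
    · ring
  simp_rw [e] at h
  have hi2 := integrable_smooth_mul hi (isSmooth_time (d := d) hχ)
  unfold spaceTime at h hi2
  rw [integral_prod _ hi2] at h
  refine Eq.trans (integral_congr_ae (Eventually.of_forall fun t => ?_)) h
  exact (integral_const_mul (χ t) _).symm

/-- Moving the derivative of the kernel onto the field at the second point. -/
theorem StationaryLaw.corr_right {T : ℝ} {v : Fin d → ℝ × Torus d → ℝ} {c g : ℝ × Torus d → ℝ}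
    (hv : StationaryLaw T v c) (hgv : ∀ k, Pair T g (v k)) (hgc : Pair T g c)
    {Q : Torus d → ℝ} (hQ : SmoothT Q) :
    ∑ k, corr T (pd k Q) g (v k) = - corr T Q g c := by
  have hi : ∀ k, _ := fun k => (hgv k).integrable_corr (hQ.pd k).continuous
  have hi' := hgc.integrable_corr hQ.continuous
  have key := integral_eq_zero_of_inner_right
    ((integrable_finsetSum Finset.univ fun k _ => hi k).fun_add hi') (fun x => by
      filter_upwards [hv.slice (hQ.sub_right x).isSmooth] with t ht
      have e : ∀ y, (∑ k, pd k Q (y - x) * (g (t, x) * v k (t, y)) + Q (y - x) * (g (t, x) * c (t, y)))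
          = g (t, x) * (∑ k, pd k (fun y => Q (y - x)) y * v k (t, y) + Q (y - x) * c (t, y)) := by
        intro y
        rw [mul_add, Finset.mul_sum]
        congr 1
        · refine Finset.sum_congr rfl fun k _ => ?_
          rw [pd_sub_right]; ring
        · ring
      simp only [e]
      rw [integral_const_mul, ht, mul_zero])
  rw [integral_add (integrable_finsetSum Finset.univ fun k _ => hi k) hi',
    integral_finsetSum _ fun k _ => hi k] at key
  unfold corr
  linarith

/-- Moving the derivative of the kernel onto the localized field at the first point. -/
theorem StationaryLaw.corr_left {T : ℝ} {v : Fin d → ℝ × Torus d → ℝ} {c h : ℝ × Torus d → ℝ}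
    (hv : StationaryLaw T v c) (hvh : ∀ k, Pair T (v k) h) (hch : Pair T c h)
    {Q : Torus d → ℝ} (hQ : SmoothT Q) {φ : ℝ → Torus d → ℝ} (hφ : IsSmooth φ) :
    ∑ k, corr T (pd k Q) (fun z => φ z.1 z.2 * v k z) h
      = ∑ k, corr T Q (fun z => pd k (φ z.1) z.2 * v k z) h
        + corr T Q (fun z => φ z.1 z.2 * c z) h := by
  have hi1 : ∀ k, _ := fun k => ((hvh k).smooth_mul hφ).integrable_corr (hQ.pd k).continuous
  have hi2 : ∀ k, _ := fun k => ((hvh k).smooth_mul (hφ.pd k)).integrable_corr hQ.continuous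
  have hi3 := (hch.smooth_mul hφ).integrable_corr hQ.continuous
  have j1 := integrable_finsetSum Finset.univ fun k _ => hi1 k
  have j2 := integrable_finsetSum Finset.univ fun k _ => hi2 k
  have key := integral_eq_zero_of_inner_left ((j2.fun_add hi3).sub j1) (fun y => by
      filter_upwards [hv.slice (hφ.mul (hQ.sub_left y).isSmooth)] with t ht
      rw [← mul_zero (h (t, y)), ← ht, ← integral_const_mul]
      congr 1; ext x
      simp only [Pi.sub_apply]
      rw [mul_add, Finset.mul_sum, add_sub_right_comm, ← Finset.sum_sub_distrib]
      congr 1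
      · refine Finset.sum_congr rfl fun k _ => ?_
        rw [pd_mul (hφ.slice t) (hQ.sub_left y), pd_sub_left hQ]; ring
      · ring)
  simp only [Pi.sub_apply] at key
  rw [integral_sub (j2.fun_add hi3) j1, integral_add j2 hi3, integral_finsetSum _ fun k _ => hi1 k,
    integral_finsetSum _ fun k _ => hi2 k] at key
  unfold corr
  linarith

/-- Constant fields are divergence free. -/
theorem stationaryLaw_const (T : ℝ) (k : Fin d) :
    StationaryLaw T (fun j (_ : ℝ × Torus d) => if j = k then (1 : ℝ) else 0) (fun _ => 0) where
  integrable_field j := integrable_const _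
  integrable_source := integrable_const _
  law φ hφ := by
    simp only [mul_zero, add_zero, mul_ite, mul_one, Finset.sum_ite_eq', Finset.mem_univ, if_true]
    have h1 : Integrable (fun z : ℝ × Torus d => pd k (φ z.1) z.2) (spaceTime d T) := by
      simpa using integrable_smooth_mul (T := T) (integrable_const (1 : ℝ)) (hφ.pd k)
    unfold spaceTime at h1 ⊢
    rw [integral_prod _ h1]
    simp [integral_pd (hφ.slice _)]

/-! ### Evolution laws and the two-point identity -/

/-- The weak form of `∂_t a + ∂_k A^k = α` on `[0,T] × 𝕋^d`, with boundary values `a₀` and `a₁`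
of `a`. -/
structure EvolutionLaw (T : ℝ) (a : ℝ × Torus d → ℝ) (A : Fin d → ℝ × Torus d → ℝ)
    (α : ℝ × Torus d → ℝ) : Prop where
  integrable : Integrable a (spaceTime d T)
  integrable_flux : ∀ k, Integrable (A k) (spaceTime d T)
  integrable_source : Integrable α (spaceTime d T)
  law : ∃ a₁ a₀ : Torus d → ℝ, ∀ φ : ℝ → Torus d → ℝ, IsSmooth φ →
    ∫ z, (dt φ z.1 z.2 * a z + ∑ k, pd k (φ z.1) z.2 * A k z + φ z.1 z.2 * α z) ∂(spaceTime d T)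
      = ∫ x, (φ T x * a₁ x - φ 0 x * a₀ x)

theorem integrable_moment {T : ℝ} {g : ℝ × Torus d → ℝ} (hg : Integrable g (spaceTime d T))
    {Q : Torus d → ℝ} (hQ : SmoothT Q) :
    Integrable (fun z => Q z.2 * g z) (spaceTime d T) := integrable_smooth_mul hg hQ.isSmooth

/-- The product of a moment in `x` and a moment in `z`, integrated in time. -/
theorem Pair.integral_moments {T : ℝ} {g h : ℝ × Torus d → ℝ} (hp : Pair T g h)
    {q r : Torus d → ℝ} (hq : Continuous q) (hr : Continuous r) :
    Integrable (fun t => (∫ x, q x * g (t, x)) * ∫ y, r y * h (t, y))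
      (volume.restrict (Icc 0 T)) ∧
    ∫ t in Icc 0 T, (∫ x, q x * g (t, x)) * ∫ y, r y * h (t, y)
      = ∫ w, q w.1.2 * r w.2 * (g w.1 * h (w.1.1, w.2)) ∂((spaceTime d T).prod volume) := by
  obtain ⟨C, hC⟩ := (isCompact_univ (X := Torus d × Torus d)).exists_bound_of_continuousOn
    (f := fun p => q p.1 * r p.2) (by fun_prop)
  have hi := hp.mul_kernel (k := fun w => q w.1.2 * r w.2) (C := C) (by fun_prop)
    (fun w _ => hC (w.1.2, w.2) (mem_univ _))
  have e : ∀ t x, ∫ y, q x * r y * (g (t, x) * h (t, y))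
      = (q x * g (t, x)) * ∫ y, r y * h (t, y) := by
    intro t x
    rw [← integral_const_mul]; congr 1; ext y; ring
  have h1 := hi.integral_prod_left
  have h2 : Integrable (fun t => ∫ x, ∫ y, q x * r y * (g (t, x) * h (t, y)))
      (volume.restrict (Icc 0 T)) := Integrable.integral_prod_left h1
  have h3 := integral_prod _ hi
  unfold spaceTime at h3 h1
  rw [integral_prod _ h1] at h3
  simp only [e, integral_mul_const] at h2 h3
  exact ⟨h2, h3.symm⟩

theorem continuous_conv {Q P : Torus d → ℝ} (hQ : Continuous Q) (hP : Continuous P) :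
    Continuous (conv Q P) := by
  have : Continuous (fun p : Torus d × Torus d => Q p.2 * P (p.1 - p.2)) := by fun_prop
  have h2 := continuous_parametric_integral_of_continuous (μ := (volume : Measure (Torus d)))
    (f := fun w c => Q c * P (w - c)) this isCompact_univ
  simp only [Measure.restrict_univ] at h2
  exact h2

/-- Averaging products of moments over the position of the test functions produces a
correlation. -/
theorem Pair.integral_conv {T : ℝ} {g h : ℝ × Torus d → ℝ} (hp : Pair T g h)
    {Q P : Torus d → ℝ} (hQ : Continuous Q) (hP : Continuous P) :
    Integrable (fun c : Torus d => ∫ w, Q (c - w.1.2) * P (w.2 - c) * (g w.1 * h (w.1.1, w.2))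
      ∂((spaceTime d T).prod volume)) ∧
    ∫ c, ∫ w, Q (c - w.1.2) * P (w.2 - c) * (g w.1 * h (w.1.1, w.2))
      ∂((spaceTime d T).prod volume) = corr T (conv Q P) g h := by
  obtain ⟨C, hC⟩ := (isCompact_univ (X := Torus d × Torus d)).exists_bound_of_continuousOn
    (f := fun p => Q p.1 * P p.2) (by fun_prop)
  have hi : Integrable (fun p : Torus d × ((ℝ × Torus d) × Torus d) =>
      Q (p.1 - p.2.1.2) * P (p.2.2 - p.1) * (g p.2.1 * h (p.2.1.1, p.2.2)))
      ((volume : Measure (Torus d)).prod ((spaceTime d T).prod volume)) := by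
    have h1 : Integrable (fun p : Torus d × ((ℝ × Torus d) × Torus d) =>
      (g p.2.1 * h (p.2.1.1, p.2.2)))
      ((volume : Measure (Torus d)).prod ((spaceTime d T).prod volume)) := hp.comp_snd _
    exact h1.bdd_mul (c := C)
      ((hQ.measurable.comp (by fun_prop)).mul
        (hP.measurable.comp (by fun_prop))).aestronglyMeasurable
      (Eventually.of_forall fun p => hC (p.1 - p.2.1.2, p.2.2 - p.1) (mem_univ _))
  refine ⟨hi.integral_prod_left, ?_⟩
  rw [integral_integral_swap hi]
  unfold corr
  congr 1; ext w
  rw [integral_mul_const]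
  congr 1
  rw [← integral_add_right_eq_self _ w.1.2]
  unfold conv
  congr 1; ext c
  rw [add_sub_cancel_right]
  congr 2; abel

/-- Derivatives can be moved between the factors of a convolution. -/
theorem conv_pd {Q P : Torus d → ℝ} (hQ : SmoothT Q) (hP : SmoothT P) (k : Fin d) :
    conv Q (pd k P) = conv (pd k Q) P := by
  ext w
  unfold conv
  have h := integral_mul_pd hQ (hP.sub_left w) k
  simp only [pd_sub_left hP, mul_neg, integral_neg] at h
  linarith

theorem Pair.sum_left {T : ℝ} {ι : Type*} {s : Finset ι} {g : ι → ℝ × Torus d → ℝ}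
    {h : ℝ × Torus d → ℝ} (hp : ∀ k ∈ s, Pair T (g k) h) : Pair T (fun z => ∑ k ∈ s, g k z) h := by
  unfold Pair
  simpa only [Finset.sum_mul] using integrable_finsetSum s hp

/-- Correlations pass to bounded pointwise limits of kernels. -/
theorem tendsto_corr {T : ℝ} {g h : ℝ × Torus d → ℝ} (hp : Pair T g h) {Q : ℕ → Torus d → ℝ}
    (hQ : ∀ n, Continuous (Q n)) {Q₀ : Torus d → ℝ} {C : ℝ} (hC : ∀ n x, |Q n x| ≤ C)
    (hlim : ∀ x, Tendsto (fun n => Q n x) atTop (𝓝 (Q₀ x))) :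
    Tendsto (fun n => corr T (Q n) g h) atTop (𝓝 (corr T Q₀ g h)) := by
  refine tendsto_integral_of_dominated_convergence
    (fun w => C * ‖g w.1 * h (w.1.1, w.2)‖)
    (fun n => (hp.integrable_corr (hQ n)).aestronglyMeasurable) (hp.norm.const_mul C)
    (fun n => Eventually.of_forall fun w => ?_) (Eventually.of_forall fun w => ?_)
  · rw [norm_mul]
    exact mul_le_mul_of_nonneg_right (hC _ _) (norm_nonneg _)
  · exact (hlim _).mul_const _

theorem integral_sub_sum_add_sum_add {X ι : Type*} [Fintype ι] [MeasurableSpace X] {μ : Measure X}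
    {f₀ f₃ : X → ℝ} {f₁ f₂ : ι → X → ℝ} (h₀ : Integrable f₀ μ) (h₁ : ∀ k, Integrable (f₁ k) μ)
    (h₂ : ∀ k, Integrable (f₂ k) μ) (h₃ : Integrable f₃ μ) :
    ∫ x, (f₀ x - ∑ k, f₁ k x + ∑ k, f₂ k x + f₃ x) ∂μ
      = ∫ x, f₀ x ∂μ - ∑ k, ∫ x, f₁ k x ∂μ + ∑ k, ∫ x, f₂ k x ∂μ + ∫ x, f₃ x ∂μ := by
  have j₁ := integrable_finsetSum Finset.univ fun k _ => h₁ k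
  have j₂ := integrable_finsetSum Finset.univ fun k _ => h₂ k
  have j₀₁ : Integrable (fun x => f₀ x - ∑ k, f₁ k x) μ := h₀.sub j₁
  rw [integral_add (j₀₁.fun_add j₂) h₃, integral_add j₀₁ j₂, integral_sub h₀ j₁,
    integral_finsetSum _ fun k _ => h₁ k, integral_finsetSum _ fun k _ => h₂ k]

/-- Fubini for the two terms that a test function `χ(t) q(x)` produces in an evolution law. -/
theorem integral_time_moments {T : ℝ} {u v : ℝ × Torus d → ℝ} (hu : Integrable u (spaceTime d T))
    (hv : Integrable v (spaceTime d T)) {χ η : ℝ → ℝ} (hχ : ContDiff ℝ ∞ χ)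
    (hη : ContDiff ℝ ∞ η) :
    ∫ t in Icc 0 T, (η t * (∫ x, u (t, x)) + χ t * ∫ x, v (t, x))
      = ∫ z, (η z.1 * u z + χ z.1 * v z) ∂(spaceTime d T) := by
  have j1 := integrable_smooth_mul hu (isSmooth_time (d := d) hη)
  have j2 := integrable_smooth_mul hv (isSmooth_time (d := d) hχ)
  have k1 := j1.integral_prod_left
  have k2 := j2.integral_prod_left
  have e1 := integral_prod _ j1
  have e2 := integral_prod _ j2
  simp only [integral_const_mul] at k1 k2 e1 e2
  rw [integral_add j1 j2, integral_add k1 k2]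
  exact (congrArg₂ (· + ·) e1 e2).symm

/-- The two-point identity: the weak form of
`∂_t (a(t,x) b(t,z)) = - ∂_{x_k} A^k(t,x) b(t,z) - a(t,x) ∂_{z_k} B^k(t,z) + α(t,x) b(t,z) + a(t,x) β(t,z)`
tested against `φ(t,x) Q(z - x)`. -/
theorem EvolutionLaw.two_point {T : ℝ} (hT : 0 < T) {a b α β : ℝ × Torus d → ℝ}
    {A B : Fin d → ℝ × Torus d → ℝ} (ha : EvolutionLaw T a A α) (hb : EvolutionLaw T b B β)
    (hab : Pair T a b) (hAb : ∀ k, Pair T (A k) b) (haB : ∀ k, Pair T a (B k))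
    (hαb : Pair T α b) (haβ : Pair T a β)
    {φ : ℝ → Torus d → ℝ} (hφ : IsSmooth φ) (h0 : ∀ x, φ 0 x = 0) (h1 : ∀ x, φ T x = 0)
    {Q : Torus d → ℝ} (hQ : SmoothT Q) :
    corr T Q (fun z => dt φ z.1 z.2 * a z + ∑ k, pd k (φ z.1) z.2 * A k z + φ z.1 z.2 * α z) b
      - ∑ k, corr T (pd k Q) (fun z => φ z.1 z.2 * A k z) b
      + ∑ k, corr T (pd k Q) (fun z => φ z.1 z.2 * a z) (B k)
      + corr T Q (fun z => φ z.1 z.2 * a z) β = 0 := by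
  set g₀ : ℝ × Torus d → ℝ :=
    fun z => dt φ z.1 z.2 * a z + ∑ k, pd k (φ z.1) z.2 * A k z + φ z.1 z.2 * α z with hg₀
  have hg₀i : Integrable g₀ (spaceTime d T) :=
    ((integrable_smooth_mul ha.integrable hφ.dt).fun_add (integrable_finsetSum _ fun k _ =>
      integrable_smooth_mul (ha.integrable_flux k) (hφ.pd k))).fun_add
      (integrable_smooth_mul ha.integrable_source hφ)
  have p0 : Pair T g₀ b := ((hab.smooth_mul hφ.dt).add_left
    (Pair.sum_left fun k _ => (hAb k).smooth_mul (hφ.pd k))).add_left (hαb.smooth_mul hφ)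
  have p1 : ∀ k, Pair T (fun z => φ z.1 z.2 * A k z) b := fun k => (hAb k).smooth_mul hφ
  have p2 : ∀ k, Pair T (fun z => φ z.1 z.2 * a z) (B k) := fun k => (haB k).smooth_mul hφ
  have p3 : Pair T (fun z => φ z.1 z.2 * a z) β := haβ.smooth_mul hφ
  have iφa := integrable_smooth_mul ha.integrable hφ
  have iφA := fun k => integrable_smooth_mul (ha.integrable_flux k) hφ
  -- the identity for kernels of convolution type, before averaging in `c`
  have fixed : ∀ P : Torus d → ℝ, SmoothT P → ∀ c : Torus d,
      (∫ w, Q (c - w.1.2) * P (w.2 - c) * (g₀ w.1 * b (w.1.1, w.2))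
          ∂((spaceTime d T).prod volume))
        - ∑ k, ∫ w, pd k Q (c - w.1.2) * P (w.2 - c) * ((φ w.1.1 w.1.2 * A k w.1) * b (w.1.1, w.2))
          ∂((spaceTime d T).prod volume)
        + ∑ k, ∫ w, Q (c - w.1.2) * pd k P (w.2 - c) * ((φ w.1.1 w.1.2 * a w.1) * B k (w.1.1, w.2))
          ∂((spaceTime d T).prod volume)
        + ∫ w, Q (c - w.1.2) * P (w.2 - c) * ((φ w.1.1 w.1.2 * a w.1) * β (w.1.1, w.2))
          ∂((spaceTime d T).prod volume) = 0 := by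
    intro P hP c
    have sQ := hQ.sub_left c
    have sQ' := fun k => (hQ.pd k).sub_left c
    have sP := hP.sub_right c
    have sP' := fun k => (hP.pd k).sub_right c
    obtain ⟨b₁, b₀, hblaw⟩ := hb.law
    obtain ⟨a₁, a₀, halaw⟩ := ha.law
    have i0 := integrable_moment hg₀i sQ
    have i1 := fun k => integrable_moment (iφA k) (sQ' k)
    have i2 := integrable_moment iφa sQ
    have i3 := integrable_moment hb.integrable sP
    have i4 := fun k => integrable_moment (hb.integrable_flux k) (sP' k)
    have i5 := integrable_moment hb.integrable_source sP
    have i1' : ∀ k, Integrable (fun z : ℝ × Torus d =>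
        -(pd k Q (c - z.2) * (φ z.1 z.2 * A k z))) (spaceTime d T) := fun k => (i1 k).neg
    have iA := i0.fun_add (integrable_finsetSum Finset.univ fun k _ => i1' k)
    have iB := (integrable_finsetSum Finset.univ fun k _ => i4 k).fun_add i5
    -- the product rule in time for the moments of `φ a` against `Q(c - ·)` and of `b` against `P(· - c)`
    have prod := integral_product_rule (c₀ := ∫ x, P (x - c) * b₀ x) hT i2.integral_prod_left iA.integral_prod_left
      i3.integral_prod_left iB.integral_prod_left (fun χ hχ => ?_) (fun χ hχ hχT => ?_)
    · have sl : ∀ {g : ℝ × Torus d → ℝ}, Integrable g (spaceTime d T) →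
          ∀ᵐ t ∂(volume.restrict (Icc 0 T)), Integrable (fun x => g (t, x)) volume :=
        fun hg => hg.prod_right_ae
      have m0 := p0.integral_moments sQ.continuous sP.continuous
      have m1 := fun k => (p1 k).integral_moments (sQ' k).continuous sP.continuous
      have m2 := fun k => (p2 k).integral_moments sQ.continuous (sP' k).continuous
      have m3 := p3.integral_moments sQ.continuous sP.continuous
      rw [← m0.2, ← m3.2, Finset.sum_congr rfl fun k _ => (m1 k).2.symm,
        Finset.sum_congr rfl fun k _ => (m2 k).2.symm,
        ← integral_sub_sum_add_sum_add m0.1 (fun k => (m1 k).1) (fun k => (m2 k).1) m3.1]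
      refine Eq.trans (integral_congr_ae ?_) prod
      filter_upwards [sl i0, sl i5, ae_all_iff.2 fun k => sl (i1' k), ae_all_iff.2 fun k => sl (i4 k)]
        with t t0 t5 t1 t4
      rw [integral_add t0 (integrable_finsetSum Finset.univ fun k _ => t1 k),
        integral_add (integrable_finsetSum Finset.univ fun k _ => t4 k) t5,
        integral_finsetSum _ fun k _ => t1 k, integral_finsetSum _ fun k _ => t4 k]
      simp only [integral_neg, Finset.sum_neg_distrib]
      rw [mul_add, Finset.mul_sum, add_mul, neg_mul, Finset.sum_mul]
      ring
    · have h := halaw _ ((isSmooth_time hχ).mul (hφ.mul sQ.isSmooth))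
      simp only [h0, h1, zero_mul, mul_zero, sub_zero, integral_zero] at h
      refine ((integral_time_moments i2 iA hχ (contDiff_infty_iff_deriv.1 hχ).2).trans ?_).trans h
      refine integral_congr_ae (Eventually.of_forall fun z => ?_)
      simp only [hg₀]
      rw [dt_mul_time hχ (hφ.mul sQ.isSmooth), dt_mul_const hφ]
      have e : ∀ k, pd k (fun x => χ z.1 * (φ z.1 x * Q (c - x))) z.2 * A k z
          = χ z.1 * (Q (c - z.2) * (pd k (φ z.1) z.2 * A k z))
            + χ z.1 * -(pd k Q (c - z.2) * (φ z.1 z.2 * A k z)) := by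
        intro k
        rw [pd_const_mul ((hφ.slice z.1).mul sQ), pd_mul (hφ.slice z.1) sQ, pd_sub_left hQ]; ring
      simp only [e]
      rw [Finset.sum_add_distrib, ← Finset.mul_sum, ← Finset.mul_sum, ← Finset.mul_sum]
      ring
    · have h := hblaw _ ((isSmooth_time hχ).mul sP.isSmooth)
      refine (integral_time_moments i3 iB hχ (contDiff_infty_iff_deriv.1 hχ).2).trans ?_
      refine (integral_congr_ae (Eventually.of_forall fun z => ?_)).trans (h.trans ?_)
      · rw [dt_mul_time hχ sP.isSmooth]
        have e : ∀ k, pd k (fun x => χ z.1 * P (x - c)) z.2 * B k z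
            = χ z.1 * (pd k P (z.2 - c) * B k z) := by
          intro k
          rw [pd_const_mul sP, pd_sub_right]; ring
        have e0 : dt (fun _ : ℝ => fun x => P (x - c)) z.1 z.2 = 0 := by simp [dt]
        simp only [e, e0]
        rw [← Finset.mul_sum]
        ring
      · simp only [hχT, zero_mul, zero_sub, integral_neg, mul_assoc, integral_const_mul]
  -- averaging in `c`, and then letting the auxiliary kernel concentrate
  have averaged : ∀ P : Torus d → ℝ, SmoothT P →
      corr T (conv Q P) g₀ b - ∑ k, corr T (conv (pd k Q) P) (fun z => φ z.1 z.2 * A k z) b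
        + ∑ k, corr T (conv (pd k Q) P) (fun z => φ z.1 z.2 * a z) (B k)
        + corr T (conv Q P) (fun z => φ z.1 z.2 * a z) β = 0 := by
    intro P hP
    have m0 := p0.integral_conv hQ.continuous hP.continuous
    have m1 := fun k => (p1 k).integral_conv (hQ.pd k).continuous hP.continuous
    have m2 := fun k => (p2 k).integral_conv hQ.continuous (hP.pd k).continuous
    have m3 := p3.integral_conv hQ.continuous hP.continuous
    have h := integral_sub_sum_add_sum_add m0.1 (fun k => (m1 k).1) (fun k => (m2 k).1) m3.1
    rw [m0.2, m3.2, Finset.sum_congr rfl fun k _ => (m1 k).2,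
      Finset.sum_congr rfl fun k _ => (m2 k).2] at h
    simp only [conv_pd hQ hP] at h
    rw [← h]
    exact (integral_congr_ae (Eventually.of_forall fun c => fixed P hP c)).trans (by simp)
  obtain ⟨P, hP, hlim⟩ := exists_approxIdentity d
  have lim : ∀ {q : Torus d → ℝ} {g h : ℝ × Torus d → ℝ}, SmoothT q → Pair T g h →
      Tendsto (fun n => corr T (conv q (P n)) g h) atTop (𝓝 (corr T q g h)) := by
    intro q g h hq hp
    obtain ⟨C, hC⟩ := hq.bounded
    exact tendsto_corr hp (fun n => continuous_conv hq.continuous (hP n).continuous)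
      ((hlim q hq.continuous).2 C hC) (hlim q hq.continuous).1
  refine tendsto_nhds_unique ((((lim hQ p0).sub (tendsto_finsetSum Finset.univ fun k _ =>
    lim (hQ.pd k) (p1 k))).add (tendsto_finsetSum Finset.univ fun k _ =>
    lim (hQ.pd k) (p2 k))).add (lim hQ p3)) ?_
  simp only [averaged _ (hP _)]
  exact tendsto_const_nhds

/-! ### Real trigonometric polynomials and their heat flow -/

/-- The real trigonometric polynomial `Re ∑_{k ∈ s} c_k e^{2πi k·x}`. -/
noncomputable def trig (s : Finset (Fin d → ℤ)) (c : (Fin d → ℤ) → ℂ) (x : Torus d) : ℝ :=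
  (∑ k ∈ s, c k * UnitAddTorus.mFourier k x).re

/-- The symbol of `∂_j`. -/
noncomputable def sym (j : Fin d) (k : Fin d → ℤ) : ℂ := 2 * Real.pi * Complex.I * (k j : ℂ)

/-- The eigenvalue of `-Δ` at the frequency `k`. -/
noncomputable def eig (k : Fin d → ℤ) : ℝ := ∑ j, (2 * Real.pi * (k j : ℝ)) ^ 2

theorem mFourier_proj (k : Fin d → ℤ) (v : E d) :
    UnitAddTorus.mFourier k (proj v)
      = Complex.exp (∑ j, 2 * Real.pi * Complex.I * (k j : ℂ) * ((v j : ℝ) : ℂ)) := by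
  rw [Complex.exp_sum]
  change ∏ i, fourier (k i) ((v i : ℝ) : UnitAddCircle) = _
  refine Finset.prod_congr rfl fun i _ => ?_
  rw [fourier_coe_apply]
  congr 1; simp

theorem sum_sym_sq (k : Fin d → ℤ) : ∑ j, sym j k * sym j k = -(eig k : ℂ) := by
  unfold sym eig
  push_cast
  rw [← Finset.sum_neg_distrib]
  refine Finset.sum_congr rfl fun j _ => ?_
  have := Complex.I_mul_I
  linear_combination (4 * (Real.pi : ℂ) ^ 2 * (k j : ℂ) ^ 2) * this

theorem eig_zero : eig (0 : Fin d → ℤ) = 0 := by simp [eig]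

theorem eig_pos {k : Fin d → ℤ} (hk : k ≠ 0) : 0 < eig k := by
  obtain ⟨j, hj⟩ := Function.ne_iff.1 hk
  refine Finset.sum_pos' (fun i _ => sq_nonneg _) ⟨j, Finset.mem_univ _, ?_⟩
  have : (k j : ℝ) ≠ 0 := by simpa using hj
  have := Real.pi_pos
  positivity

theorem contDiff_mFourier_proj (k : Fin d → ℤ) :
    ContDiff ℝ ∞ (fun v : E d => UnitAddTorus.mFourier k (proj v)) := by
  simp_rw [mFourier_proj]
  refine ContDiff.cexp (ContDiff.sum fun j _ => contDiff_const.mul ?_)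
  have h : ContDiff ℝ ∞ (fun v : E d => v j) := by fun_prop
  exact Complex.ofRealCLM.contDiff.comp h

/-- The heat flow of a trigonometric polynomial. -/
noncomputable def heat (s : Finset (Fin d → ℤ)) (c : (Fin d → ℤ) → ℂ) (t : ℝ) : Torus d → ℝ :=
  trig s fun k => (Real.exp (-(eig k) * t) : ℂ) * c k

theorem isSmooth_heat (s : Finset (Fin d → ℤ)) (c : (Fin d → ℤ) → ℂ) : IsSmooth (heat s c) := by
  refine Complex.reCLM.contDiff.comp (ContDiff.sum fun k _ => ContDiff.mul (ContDiff.mul ?_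
    contDiff_const) ((contDiff_mFourier_proj k).comp contDiff_snd))
  refine Complex.ofRealCLM.contDiff.comp (Real.contDiff_exp.comp ?_)
  exact contDiff_const.mul contDiff_fst

theorem smoothT_trig (s : Finset (Fin d → ℤ)) (c : (Fin d → ℤ) → ℂ) : SmoothT (trig s c) :=
  Complex.reCLM.contDiff.comp (ContDiff.sum fun k _ => contDiff_const.mul
    (contDiff_mFourier_proj k))

theorem heat_zero (s : Finset (Fin d → ℤ)) (c : (Fin d → ℤ) → ℂ) : heat s c 0 = trig s c := by
  simp [heat]

theorem pd_trig (s : Finset (Fin d → ℤ)) (c : (Fin d → ℤ) → ℂ) (j : Fin d) :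
    pd j (trig s c) = trig s fun k => sym j k * c k := by
  ext x
  obtain ⟨v, rfl⟩ := proj_surjective x
  have h1 : ∀ k : Fin d → ℤ, HasDerivAt (fun r : ℝ => UnitAddTorus.mFourier k
      (proj v + proj (EuclideanSpace.single j r))) (sym j k * UnitAddTorus.mFourier k (proj v)) 0 := by
    intro k
    have e : ∀ r : ℝ, UnitAddTorus.mFourier k (proj v + proj (EuclideanSpace.single j r))
        = Complex.exp (sym j k * r) * UnitAddTorus.mFourier k (proj v) := by
      intro r
      rw [← proj_add, mFourier_proj, mFourier_proj, ← Complex.exp_add]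
      congr 1
      simp only [PiLp.add_apply, Complex.ofReal_add, mul_add, Finset.sum_add_distrib]
      rw [add_comm]
      congr 1
      rw [Finset.sum_eq_single j]
      · simp [sym]
      · intro i _ hi; simp [hi]
      · simp
    simp_rw [e]
    have h2 : HasDerivAt (fun r : ℝ => sym j k * (r : ℂ)) (sym j k) 0 := by
      simpa using (Complex.ofRealCLM.hasDerivAt (x := (0 : ℝ))).const_mul (sym j k)
    have h3 := h2.cexp.mul_const (UnitAddTorus.mFourier k (proj v))
    simpa using h3
  have h2 : HasDerivAt (fun r : ℝ => ∑ k ∈ s, c k * UnitAddTorus.mFourier k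
      (proj v + proj (EuclideanSpace.single j r)))
      (∑ k ∈ s, c k * (sym j k * UnitAddTorus.mFourier k (proj v))) 0 :=
    HasDerivAt.fun_sum fun k _ => (h1 k).const_mul (c k)
  have h3 := Complex.reCLM.hasFDerivAt.comp_hasDerivAt (0 : ℝ) h2
  refine h3.deriv.trans ?_
  simp only [trig, Complex.reCLM_apply]
  congr 1
  exact Finset.sum_congr rfl fun k _ => by ring

theorem lap_trig (s : Finset (Fin d → ℤ)) (c : (Fin d → ℤ) → ℂ) :
    lap (trig s c) = trig s fun k => -(eig k : ℂ) * c k := by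
  ext x
  simp only [lap, pd_trig, trig]
  rw [← Complex.re_sum, Finset.sum_comm]
  congr 1
  refine Finset.sum_congr rfl fun k _ => ?_
  rw [← Finset.sum_mul, ← sum_sym_sq]
  congr 1
  rw [Finset.sum_mul]
  exact Finset.sum_congr rfl fun j _ => by ring

theorem dt_heat (s : Finset (Fin d → ℤ)) (c : (Fin d → ℤ) → ℂ) (t : ℝ) :
    dt (heat s c) t = lap (heat s c t) := by
  ext x
  unfold heat
  rw [lap_trig]
  have h1 : ∀ k : Fin d → ℤ, HasDerivAt (fun r : ℝ => ((Real.exp (-(eig k) * r) : ℝ) : ℂ) * c k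
      * UnitAddTorus.mFourier k x) ((-(eig k : ℂ)) * (((Real.exp (-(eig k) * t) : ℝ) : ℂ) * c k)
      * UnitAddTorus.mFourier k x) t := by
    intro k
    have h2 : HasDerivAt (fun r : ℝ => Real.exp (-(eig k) * r))
        (Real.exp (-(eig k) * t) * -(eig k)) t := by
      simpa using ((hasDerivAt_id t).const_mul (-(eig k))).exp
    refine ((h2.ofReal_comp.mul_const (c k)).mul_const
      (UnitAddTorus.mFourier k x)).congr_deriv ?_
    push_cast; ring
  have h2 := HasDerivAt.fun_sum fun k (_ : k ∈ s) => h1 k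
  have h3 := Complex.reCLM.hasFDerivAt.comp_hasDerivAt t h2
  exact h3.deriv

theorem abs_trig_le (s : Finset (Fin d → ℤ)) (c : (Fin d → ℤ) → ℂ) (x : Torus d) :
    |trig s c x| ≤ ∑ k ∈ s, ‖c k‖ := by
  refine (Complex.abs_re_le_norm _).trans ((norm_sum_le _ _).trans
    (Finset.sum_le_sum fun k _ => ?_))
  rw [norm_mul]
  refine mul_le_of_le_one_right (norm_nonneg _) ?_
  exact (ContinuousMap.norm_coe_le_norm _ _).trans UnitAddTorus.mFourier_norm.le

/-- Real trigonometric polynomials are uniformly dense in the continuous functions. -/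
theorem exists_trig_near {f : Torus d → ℝ} (hf : Continuous f) {δ : ℝ} (hδ : 0 < δ) :
    ∃ s c, ∀ x, |f x - trig s c x| ≤ δ := by
  let F : C(UnitAddTorus (Fin d), ℂ) := ⟨fun x => (f x : ℂ), Complex.continuous_ofReal.comp hf⟩
  have h1 : F ∈ (Submodule.span ℂ (range (UnitAddTorus.mFourier (d := Fin d)))).topologicalClosure :=
    by rw [UnitAddTorus.span_mFourier_closure_eq_top]; trivial
  obtain ⟨q, hq, hd⟩ := Metric.mem_closure_iff.1 h1 δ hδ
  obtain ⟨c, rfl⟩ := Finsupp.mem_span_range_iff_exists_finsupp.1 hq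
  refine ⟨c.support, c, fun x => ?_⟩
  have h2 : ‖(F - c.sum fun i a => a • UnitAddTorus.mFourier i) x‖ ≤ δ :=
    (ContinuousMap.norm_coe_le_norm _ x).trans (by rw [← dist_eq_norm]; exact hd.le)
  refine le_trans ?_ h2
  have e : f x - trig c.support c x
      = ((F - c.sum fun i a => a • UnitAddTorus.mFourier i) x).re := by
    simp only [ContinuousMap.coe_sub, Pi.sub_apply, Complex.sub_re]
    congr 1
    simp [trig, Finsupp.sum, ContinuousMap.sum_apply]
  rw [e]
  exact Complex.abs_re_le_norm _

/-- Differentiation under the integral over the torus. -/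
theorem IsSmooth.hasDerivAt_integral {φ : ℝ → Torus d → ℝ} (hφ : IsSmooth φ) (t : ℝ) :
    HasDerivAt (fun t => ∫ x, φ t x) (∫ x, EnergyBalance.dt φ t x) t := by
  obtain ⟨C, hC⟩ := ((isCompact_Icc (a := t - 1) (b := t + 1)).prod isCompact_univ : IsCompact
    (_ ×ˢ (univ : Set (Torus d)))).exists_bound_of_continuousOn hφ.dt.continuous.continuousOn
  exact (hasDerivAt_integral_of_dominated_loc_of_deriv_le (s := Icc (t - 1) (t + 1))
    (F := φ) (F' := EnergyBalance.dt φ) (bound := fun _ => C) (Icc_mem_nhds (by linarith) (by linarith))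
    (Eventually.of_forall fun s => (hφ.slice s).continuous.aestronglyMeasurable)
    (hφ.slice t).continuous.integrable_torus (hφ.dt.slice t).continuous.aestronglyMeasurable
    (Eventually.of_forall fun x s hs => hC (s, x) ⟨hs, mem_univ _⟩) (integrable_const _)
    (Eventually.of_forall fun x s _ => hφ.hasDerivAt_time s x)).2

/-! ### A Bellman function for the exponents `3` and `3/2` -/

/-- `√(η² + ε²)`, a smooth substitute of `|η|`. -/
noncomputable def softAbs (ε η : ℝ) : ℝ := √(η ^ 2 + ε ^ 2)

/-- `ξ² + √(η² + ε²)`. -/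
noncomputable def bellBase (ε ξ η : ℝ) : ℝ := ξ ^ 2 + softAbs ε η

/-- The Bellman function `(ξ² + √(η² + ε²))^{3/2}`. -/
noncomputable def bell (ε ξ η : ℝ) : ℝ := bellBase ε ξ η * √(bellBase ε ξ η)

/-- `∂_ξ` of the Bellman function. -/
noncomputable def bellX (ε ξ η : ℝ) : ℝ := 3 * ξ * √(bellBase ε ξ η)

/-- `∂_η` of the Bellman function. -/
noncomputable def bellY (ε ξ η : ℝ) : ℝ := 3 / 2 * √(bellBase ε ξ η) * (η / softAbs ε η)

/-- `∂_ξ²` of the Bellman function. -/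
noncomputable def bellXX (ε ξ η : ℝ) : ℝ := 3 * √(bellBase ε ξ η) + 3 * ξ ^ 2 / √(bellBase ε ξ η)

/-- `∂_ξ ∂_η` of the Bellman function. -/
noncomputable def bellXY (ε ξ η : ℝ) : ℝ := 3 / 2 * ξ * (η / softAbs ε η) / √(bellBase ε ξ η)

/-- `∂_η²` of the Bellman function. -/
noncomputable def bellYY (ε ξ η : ℝ) : ℝ :=
  3 / 4 * (η / softAbs ε η) ^ 2 / √(bellBase ε ξ η)
    + 3 / 2 * √(bellBase ε ξ η) * (ε ^ 2 / softAbs ε η ^ 3)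

section Bellman

variable {ε : ℝ}

theorem softAbs_pos (hε : 0 < ε) (η : ℝ) : 0 < softAbs ε η := Real.sqrt_pos.2 (by positivity)

theorem softAbs_sq (η : ℝ) : softAbs ε η ^ 2 = η ^ 2 + ε ^ 2 := Real.sq_sqrt (by positivity)

theorem bellBase_pos (hε : 0 < ε) (ξ η : ℝ) : 0 < bellBase ε ξ η :=
  add_pos_of_nonneg_of_pos (sq_nonneg _) (softAbs_pos hε η)

theorem hasDerivAt_softAbs (hε : 0 < ε) {b : ℝ → ℝ} {b' t : ℝ} (hb : HasDerivAt b b' t) :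
    HasDerivAt (fun t => softAbs ε (b t)) (b t / softAbs ε (b t) * b') t := by
  have h := ((hb.fun_pow 2).add_const (ε ^ 2)).sqrt (by positivity)
  refine h.congr_deriv ?_
  have : √(b t ^ 2 + ε ^ 2) ≠ 0 := (softAbs_pos hε (b t)).ne'
  unfold softAbs
  field_simp
  norm_num
  ring

theorem hasDerivAt_sqrt_bellBase (hε : 0 < ε) {a b : ℝ → ℝ} {a' b' t : ℝ}
    (ha : HasDerivAt a a' t) (hb : HasDerivAt b b' t) :
    HasDerivAt (fun t => √(bellBase ε (a t) (b t)))
      ((2 * a t * a' + b t / softAbs ε (b t) * b') / (2 * √(bellBase ε (a t) (b t)))) t := by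
  have h := ((ha.fun_pow 2).fun_add (hasDerivAt_softAbs hε hb)).sqrt (bellBase_pos hε (a t) (b t)).ne'
  refine h.congr_deriv ?_
  simp [bellBase]

theorem hasDerivAt_bellX (hε : 0 < ε) {a b : ℝ → ℝ} {a' b' t : ℝ}
    (ha : HasDerivAt a a' t) (hb : HasDerivAt b b' t) :
    HasDerivAt (fun t => bellX ε (a t) (b t))
      (bellXX ε (a t) (b t) * a' + bellXY ε (a t) (b t) * b') t := by
  refine ((ha.const_mul 3).mul (hasDerivAt_sqrt_bellBase hε ha hb)).congr_deriv ?_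
  have h1 := (Real.sqrt_pos.2 (bellBase_pos hε (a t) (b t))).ne'
  unfold bellXX bellXY
  field_simp
  ring

theorem hasDerivAt_bellY (hε : 0 < ε) {a b : ℝ → ℝ} {a' b' t : ℝ}
    (ha : HasDerivAt a a' t) (hb : HasDerivAt b b' t) :
    HasDerivAt (fun t => bellY ε (a t) (b t))
      (bellXY ε (a t) (b t) * a' + bellYY ε (a t) (b t) * b') t := by
  have h1 := (Real.sqrt_pos.2 (bellBase_pos hε (a t) (b t))).ne'
  have h2 := (softAbs_pos hε (b t)).ne'
  refine (((hasDerivAt_sqrt_bellBase hε ha hb).const_mul (3 / 2)).mul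
    (hb.fun_div (hasDerivAt_softAbs hε hb) h2)).congr_deriv ?_
  have h3 := softAbs_sq (ε := ε) (b t)
  have h4 : ε ^ 2 = softAbs ε (b t) ^ 2 - b t ^ 2 := by rw [h3]; ring
  unfold bellXY bellYY
  rw [h4]
  field_simp
  ring

theorem hasDerivAt_bell (hε : 0 < ε) {a b : ℝ → ℝ} {a' b' t : ℝ}
    (ha : HasDerivAt a a' t) (hb : HasDerivAt b b' t) :
    HasDerivAt (fun t => bell ε (a t) (b t))
      (bellX ε (a t) (b t) * a' + bellY ε (a t) (b t) * b') t := by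
  have h1 := Real.sqrt_pos.2 (bellBase_pos hε (a t) (b t))
  have h5 := Real.sq_sqrt (bellBase_pos hε (a t) (b t)).le
  have h0 : HasDerivAt (fun t => bellBase ε (a t) (b t))
      (2 * a t * a' + b t / softAbs ε (b t) * b') t := by
    simpa [bellBase] using (ha.fun_pow 2).fun_add (hasDerivAt_softAbs hε hb)
  refine (h0.mul (hasDerivAt_sqrt_bellBase hε ha hb)).congr_deriv ?_
  unfold bellX bellY
  set r := √(bellBase ε (a t) (b t)) with hr
  rw [← h5]
  have := h1.ne'
  field_simp
  ring

/-- The quantitative convexity of the Bellman function. -/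
theorem bell_hessian (hε : 0 < ε) (ξ η a b : ℝ) :
    (3 * √(bellBase ε ξ η) * a ^ 2 + 3 / 4 / √(bellBase ε ξ η) * b ^ 2) / 4
      ≤ bellXX ε ξ η * a ^ 2 + 2 * bellXY ε ξ η * (a * b) + bellYY ε ξ η * b ^ 2 := by
  have hψ := softAbs_pos hε η
  have hψ2 := softAbs_sq (ε := ε) η
  have hS := bellBase_pos hε ξ η
  have hr := Real.sqrt_pos.2 hS
  have hr2 := Real.sq_sqrt hS.le
  have hle : softAbs ε η ≤ bellBase ε ξ η := by unfold bellBase; nlinarith [sq_nonneg ξ]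
  have hξ : ξ ^ 2 ≤ bellBase ε ξ η := by unfold bellBase; linarith
  unfold bellXX bellXY bellYY
  set S := bellBase ε ξ η
  set r := √S
  set ψ := softAbs ε η
  set m := η / ψ with hm
  have hm1 : m ^ 2 ≤ 1 := by
    rw [hm, div_pow, div_le_one (by positivity), hψ2]; nlinarith
  -- the second derivative in `η` is at least `3/4 / r`
  have hC : 3 / 4 / r ≤ 3 / 4 * m ^ 2 / r + 3 / 2 * r * (ε ^ 2 / ψ ^ 3) := by
    have e1 : ε ^ 2 = ψ ^ 2 - η ^ 2 := by rw [hψ2]; ring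
    have e2 : ε ^ 2 / ψ ^ 3 = (1 - m ^ 2) / ψ := by
      rw [e1, hm]; field_simp
    rw [e2]
    have e3 : 3 / 2 * r * ((1 - m ^ 2) / ψ) ≥ 3 / 2 * ((1 - m ^ 2) / r) := by
      have : (1 - m ^ 2) / r ≤ r * ((1 - m ^ 2) / ψ) := by
        rw [div_le_iff₀ hr]
        have : r * ((1 - m ^ 2) / ψ) * r = (1 - m ^ 2) * (S / ψ) := by
          rw [← hr2]; ring
        rw [this]
        have h1 : 1 ≤ S / ψ := (one_le_div hψ).2 hle
        nlinarith
      nlinarith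
    have e4 : 3 / 4 / r = 3 / 4 * m ^ 2 / r + 3 / 4 * ((1 - m ^ 2) / r) := by ring
    have e5 : 0 ≤ (1 - m ^ 2) / r := div_nonneg (by linarith) hr.le
    rw [e4]; linarith
  have hb2 := mul_le_mul_of_nonneg_right hC (sq_nonneg b)
  -- what is left is a positive definite form in `r a` and `b`
  have key : 0 ≤ r * (3 / 4 * (3 * r * a ^ 2 + 3 / 4 / r * b ^ 2) + 3 * ξ ^ 2 / r * a ^ 2
      + 2 * (3 / 2 * ξ * m / r) * (a * b)) := by
    have e : r * (3 / 4 * (3 * r * a ^ 2 + 3 / 4 / r * b ^ 2) + 3 * ξ ^ 2 / r * a ^ 2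
      + 2 * (3 / 2 * ξ * m / r) * (a * b))
        = 9 / 4 * S * a ^ 2 + 9 / 16 * b ^ 2 + 3 * ξ ^ 2 * a ^ 2 + 3 * (ξ * a) * (m * b) := by
      rw [← hr2]; field_simp; ring
    rw [e]
    have h1 : ξ ^ 2 * a ^ 2 ≤ S * a ^ 2 := mul_le_mul_of_nonneg_right hξ (sq_nonneg a)
    have h2 : (m * b) ^ 2 ≤ b ^ 2 := by nlinarith [sq_nonneg b]
    nlinarith [sq_nonneg (3 * (ξ * a) + 4 / 3 * (m * b)), sq_nonneg (2 * (ξ * a) + 3 / 4 * (m * b))]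
  have key2 := nonneg_of_mul_nonneg_right key hr
  nlinarith

theorem contDiff_softAbs (hε : 0 < ε) : ContDiff ℝ ∞ (softAbs ε) :=
  ContDiff.sqrt (by fun_prop) fun η => by positivity

theorem contDiff_sqrt_bellBase (hε : 0 < ε) :
    ContDiff ℝ ∞ (fun p : ℝ × ℝ => √(bellBase ε p.1 p.2)) :=
  ContDiff.sqrt ((contDiff_fst.pow 2).add ((contDiff_softAbs hε).comp contDiff_snd))
    fun p => (bellBase_pos hε p.1 p.2).ne'

theorem contDiff_bell (hε : 0 < ε) : ContDiff ℝ ∞ (fun p : ℝ × ℝ => bell ε p.1 p.2) :=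
  ((contDiff_fst.pow 2).add ((contDiff_softAbs hε).comp contDiff_snd)).mul
    (contDiff_sqrt_bellBase hε)

theorem contDiff_bellX (hε : 0 < ε) : ContDiff ℝ ∞ (fun p : ℝ × ℝ => bellX ε p.1 p.2) :=
  (contDiff_const.mul contDiff_fst).mul (contDiff_sqrt_bellBase hε)

theorem contDiff_bellY (hε : 0 < ε) : ContDiff ℝ ∞ (fun p : ℝ × ℝ => bellY ε p.1 p.2) :=
  (contDiff_const.mul (contDiff_sqrt_bellBase hε)).mul
    (contDiff_snd.div ((contDiff_softAbs hε).comp contDiff_snd)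
      fun p => (softAbs_pos hε p.2).ne')

/-- Along the heat flow the integral of the Bellman function controls products of gradients. -/
theorem bell_dissipation (hε : 0 < ε) {g h : ℝ → Torus d → ℝ} (hg : IsSmooth g) (hh : IsSmooth h)
    (hgt : ∀ t, dt g t = lap (g t)) (hht : ∀ t, dt h t = lap (h t)) (i j : Fin d) (t : ℝ) :
    ∃ D, HasDerivAt (fun t => ∫ x, bell ε (g t x) (h t x)) D t ∧
      D ≤ - (3 / 4 * ∫ x, |pd j (g t) x * pd i (h t) x|) := by
  have sΦ : IsSmooth (fun t x => bell ε (g t x) (h t x)) :=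
    (contDiff_bell hε).comp (ContDiff.prodMk hg hh)
  have sX : SmoothT (fun x => bellX ε (g t x) (h t x)) :=
    (contDiff_bellX hε).comp (ContDiff.prodMk (hg.slice t) (hh.slice t))
  have sY : SmoothT (fun x => bellY ε (g t x) (h t x)) :=
    (contDiff_bellY hε).comp (ContDiff.prodMk (hg.slice t) (hh.slice t))
  refine ⟨_, sΦ.hasDerivAt_integral t, ?_⟩
  have e1 : ∀ x, dt (fun t x => bell ε (g t x) (h t x)) t x
      = ∑ k, bellX ε (g t x) (h t x) * pd k (pd k (g t)) x
        + ∑ k, bellY ε (g t x) (h t x) * pd k (pd k (h t)) x := by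
    intro x
    have := hasDerivAt_bell hε (hg.hasDerivAt_time t x) (hh.hasDerivAt_time t x)
    rw [show dt (fun t x => bell ε (g t x) (h t x)) t x = _ from this.deriv, hgt, hht]
    simp only [lap, Finset.mul_sum]
  have eX : ∀ k x, pd k (fun x => bellX ε (g t x) (h t x)) x
      = bellXX ε (g t x) (h t x) * pd k (g t) x + bellXY ε (g t x) (h t x) * pd k (h t) x := by
    intro k x
    have := hasDerivAt_bellX hε ((hg.slice t).hasDerivAt_zero k x) ((hh.slice t).hasDerivAt_zero k x)
    rw [single_zero_add] at this
    exact this.deriv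
  have eY : ∀ k x, pd k (fun x => bellY ε (g t x) (h t x)) x
      = bellXY ε (g t x) (h t x) * pd k (g t) x + bellYY ε (g t x) (h t x) * pd k (h t) x := by
    intro k x
    have := hasDerivAt_bellY hε ((hg.slice t).hasDerivAt_zero k x) ((hh.slice t).hasDerivAt_zero k x)
    rw [single_zero_add] at this
    exact this.deriv
  have sgk := fun k => (hg.slice t).pd k
  have shk := fun k => (hh.slice t).pd k
  have iX : ∀ k, Integrable (fun x => bellX ε (g t x) (h t x) * pd k (pd k (g t)) x) volume :=
    fun k => (sX.mul ((sgk k).pd k)).continuous.integrable_torus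
  have iY : ∀ k, Integrable (fun x => bellY ε (g t x) (h t x) * pd k (pd k (h t)) x) volume :=
    fun k => (sY.mul ((shk k).pd k)).continuous.integrable_torus
  have iX' : ∀ k, Integrable (fun x => pd k (fun x => bellX ε (g t x) (h t x)) x * pd k (g t) x)
      volume := fun k => ((sX.pd k).mul (sgk k)).continuous.integrable_torus
  have iY' : ∀ k, Integrable (fun x => pd k (fun x => bellY ε (g t x) (h t x)) x * pd k (h t) x)
      volume := fun k => ((sY.pd k).mul (shk k)).continuous.integrable_torus
  simp_rw [e1]
  rw [integral_add (integrable_finsetSum _ fun k _ => iX k) (integrable_finsetSum _ fun k _ => iY k),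
    integral_finsetSum _ fun k _ => iX k, integral_finsetSum _ fun k _ => iY k]
  -- after an integration by parts the dissipation is the Hessian of the Bellman function applied to
  -- the gradients of `g` and `h`
  simp_rw [fun k => integral_mul_pd sX (sgk k) k, fun k => integral_mul_pd sY (shk k) k]
  rw [Finset.sum_neg_distrib, Finset.sum_neg_distrib, ← neg_add, neg_le_neg_iff,
    ← integral_finsetSum _ fun k _ => iX' k, ← integral_finsetSum _ fun k _ => iY' k,
    ← integral_add (integrable_finsetSum _ fun k _ => iX' k)
      (integrable_finsetSum _ fun k _ => iY' k), ← integral_const_mul]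
  refine integral_mono
    (((sgk j).mul (shk i)).continuous.abs.integrable_torus.const_mul _)
    ((integrable_finsetSum _ fun k _ => iX' k).add (integrable_finsetSum _ fun k _ => iY' k))
    fun x => ?_
  simp only [eX, eY, ← Finset.sum_add_distrib]
  have hq := fun k => bell_hessian hε (g t x) (h t x) (pd k (g t) x) (pd k (h t) x)
  have hr := Real.sqrt_pos.2 (bellBase_pos hε (g t x) (h t x))
  set r := √(bellBase ε (g t x) (h t x))
  -- the two weights multiply to `9/4`, so the arithmetic-geometric mean inequality removes `r`
  calc 3 / 4 * |pd j (g t) x * pd i (h t) x|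
      ≤ (3 * r * pd j (g t) x ^ 2 + 3 / 4 / r * pd i (h t) x ^ 2) / 4 := by
        rw [abs_mul, ← sq_abs (pd j (g t) x), ← sq_abs (pd i (h t) x)]
        set α := |pd j (g t) x|
        set β := |pd i (h t) x|
        have h0 : 0 ≤ 3 / r * (r * α - β / 2) ^ 2 := by positivity
        have h1 : 3 / r * (r * α - β / 2) ^ 2
            = 3 * r * α ^ 2 + 3 / 4 / r * β ^ 2 - 3 * (α * β) := by
          field_simp; ring
        linarith
    _ ≤ ∑ k, (3 * r * pd k (g t) x ^ 2 + 3 / 4 / r * pd k (h t) x ^ 2) / 4 := by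
        rw [← Finset.sum_div, Finset.sum_add_distrib]
        gcongr
        · exact Finset.single_le_sum (f := fun k => 3 * r * pd k (g t) x ^ 2)
            (fun k _ => by positivity) (Finset.mem_univ j)
        · exact Finset.single_le_sum (f := fun k => 3 / 4 / r * pd k (h t) x ^ 2)
            (fun k _ => by positivity) (Finset.mem_univ i)
    _ ≤ _ := Finset.sum_le_sum fun k _ => (hq k).trans (le_of_eq (by ring))

end Bellman

/-! ### Second derivatives are controlled by the Laplacian in `L³` -/

theorem integral_mul_lap {q r : Torus d → ℝ} (hq : SmoothT q) (hr : SmoothT r) :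
    ∫ x, q x * lap r x = ∫ x, lap q x * r x := by
  have h : ∀ k, ∫ x, q x * pd k (pd k r) x = ∫ x, pd k (pd k q) x * r x := by
    intro k
    have h2 := integral_mul_pd (hq.pd k) hr k
    rw [integral_mul_pd hq (hr.pd k) k]
    linarith
  simp only [lap, Finset.mul_sum, Finset.sum_mul]
  rw [integral_finsetSum _ fun k _ => (hq.mul ((hr.pd k).pd k)).continuous.integrable_torus,
    integral_finsetSum _ fun k _ => (((hq.pd k).pd k).mul hr).continuous.integrable_torus]
  exact Finset.sum_congr rfl fun k _ => h k

/-- Under the heat flow the Fourier coefficients of `∂_i ∂_j w` decay, since the one at frequency zero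
vanishes. -/
theorem tendsto_heat_coeff (s : Finset (Fin d → ℤ)) (i j : Fin d) (c : (Fin d → ℤ) → ℂ) :
    Tendsto (fun t : ℝ => ∑ k ∈ s, ‖(Real.exp (-(eig k) * t) : ℂ) * (sym i k * (sym j k * c k))‖)
      atTop (𝓝 0) := by
  rw [← Finset.sum_const_zero (s := s)]
  refine tendsto_finsetSum _ fun k _ => ?_
  by_cases hk : k = 0
  · subst hk; simp [sym]
  · have h1 : Tendsto (fun t : ℝ => Real.exp (-(eig k) * t)) atTop (𝓝 0) := by
      refine Real.tendsto_exp_atBot.comp ?_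
      exact tendsto_id.const_mul_atTop_of_neg (neg_lt_zero.2 (eig_pos hk))
    have h2 := h1.mul_const ‖sym i k * (sym j k * c k)‖
    rw [zero_mul] at h2
    refine h2.congr fun t => ?_
    rw [norm_mul ((Real.exp (-(eig k) * t) : ℝ) : ℂ), Complex.norm_real,
      Real.norm_of_nonneg (Real.exp_pos _).le]

/-- With `G`, `H`, `V` the heat flows of `Δw`, `h` and `∂_i ∂_j w`, the functional
`8/3 ∫ bell(G, H) - ∫ V H` does not increase, and its limit at infinity is nonnegative. -/
theorem integral_hessian_le_bell {ε : ℝ} (hε : 0 < ε) (s s' : Finset (Fin d → ℤ))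
    (c e : (Fin d → ℤ) → ℂ) (i j : Fin d) :
    ∫ x, pd i (pd j (trig s c)) x * trig s' e x
      ≤ 8 / 3 * ∫ x, bell ε (lap (trig s c) x) (trig s' e x) := by
  -- the heat flows of `Δw`, of `∂_i ∂_j w` and of `h`
  set G := heat s (fun k => -(eig k : ℂ) * c k) with hG
  set V := heat s (fun k => sym i k * (sym j k * c k)) with hV
  set H := heat s' e with hH
  have sG : IsSmooth G := isSmooth_heat _ _
  have sV : IsSmooth V := isSmooth_heat _ _
  have sH : IsSmooth H := isSmooth_heat _ _
  have hGV : ∀ t, lap (V t) = pd i (pd j (G t)) := by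
    intro t
    simp only [hG, hV, heat, lap_trig, pd_trig]
    congr 1; ext k; ring
  set F : ℝ → ℝ := fun t => 8 / 3 * (∫ x, bell ε (G t x) (H t x)) - ∫ x, V t x * H t x with hF
  have hFd : ∀ t, ∃ D, HasDerivAt F D t ∧ D ≤ 0 := by
    intro t
    obtain ⟨D, hD, hD2⟩ := bell_dissipation hε sG sH (fun t => dt_heat _ _ t)
      (fun t => dt_heat _ _ t) i j t
    have hJ := (sV.mul sH).hasDerivAt_integral t
    refine ⟨_, (hD.const_mul (8 / 3)).sub hJ, ?_⟩
    -- both factors solve the heat equation, and `ΔV = ∂_i ∂_j G`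
    have e1 : ∫ x, dt (fun t x => V t x * H t x) t x
        = - 2 * ∫ x, pd j (G t) x * pd i (H t) x := by
      have e2 : ∀ x, dt (fun t x => V t x * H t x) t x
          = lap (V t) x * H t x + V t x * lap (H t) x := by
        intro x
        have := ((sV.hasDerivAt_time t x).mul (sH.hasDerivAt_time t x)).deriv
        rw [hV, hH, dt_heat, dt_heat] at this
        exact this
      have lV : Continuous (lap (V t)) :=
        continuous_finsetSum _ fun k _ => (((sV.slice t).pd k).pd k).continuous
      have lH : Continuous (lap (H t)) :=
        continuous_finsetSum _ fun k _ => (((sH.slice t).pd k).pd k).continuous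
      have h3 := integral_mul_pd (sH.slice t) ((sG.slice t).pd j) i
      simp_rw [e2]
      have i2 : Integrable (fun x => lap (V t) x * H t x) volume :=
        (lV.mul (sH.slice t).continuous).integrable_torus
      have i3 : Integrable (fun x => V t x * lap (H t) x) volume :=
        ((sV.slice t).continuous.mul lH).integrable_torus
      rw [integral_add i2 i3,
        integral_mul_lap (sV.slice t) (sH.slice t), hGV]
      have h4 : ∫ x, pd i (pd j (G t)) x * H t x = - ∫ x, pd j (G t) x * pd i (H t) x := by
        rw [← integral_neg]
        simp_rw [mul_comm _ (H t _)]
        rw [h3, ← integral_neg]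
        congr 1; ext x; ring
      rw [h4]; ring
    have i1 := (((sG.slice t).pd j).mul ((sH.slice t).pd i)).continuous
    have h2 : ∫ x, pd j (G t) x * pd i (H t) x ≤ ∫ x, |pd j (G t) x * pd i (H t) x| :=
      integral_mono i1.integrable_torus i1.abs.integrable_torus fun x => le_abs_self _
    rw [e1]; linarith
  have hanti : Antitone F := by
    refine antitone_of_deriv_nonpos (fun t => ?_) fun t => ?_
    · obtain ⟨D, hD, -⟩ := hFd t; exact hD.differentiableAt
    · obtain ⟨D, hD, hD2⟩ := hFd t; rw [hD.deriv]; exact hD2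
  have hF0 : F 0 = 8 / 3 * (∫ x, bell ε (lap (trig s c) x) (trig s' e x))
      - ∫ x, pd i (pd j (trig s c)) x * trig s' e x := by
    simp only [hF, hG, hV, hH, heat_zero, lap_trig, pd_trig]
  have hlim : Tendsto (fun t => ∫ x, V t x * H t x) atTop (𝓝 0) := by
    have hb := (tendsto_heat_coeff s i j c).mul_const (∑ k ∈ s', ‖e k‖)
    rw [zero_mul] at hb
    refine squeeze_zero_norm' ?_ hb
    filter_upwards [eventually_ge_atTop 0] with t ht
    refine (norm_integral_le_of_norm_le_const (μ := volume)
      (C := (∑ k ∈ s, ‖(Real.exp (-(eig k) * t) : ℂ) * (sym i k * (sym j k * c k))‖)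
        * ∑ k ∈ s', ‖e k‖) (Eventually.of_forall fun x => ?_)).trans
      (le_of_eq (by rw [probReal_univ, mul_one]))
    rw [norm_mul]
    refine mul_le_mul (abs_trig_le _ _ x) ((abs_trig_le _ _ x).trans
      (Finset.sum_le_sum fun k _ => ?_)) (norm_nonneg _)
      (Finset.sum_nonneg fun k _ => norm_nonneg _)
    rw [norm_mul, Complex.norm_real, Real.norm_of_nonneg (Real.exp_pos _).le]
    refine mul_le_of_le_one_left (norm_nonneg _) (Real.exp_le_one_iff.2 ?_)
    have : 0 ≤ eig k := Finset.sum_nonneg fun j _ => sq_nonneg _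
    nlinarith
  have hge : ∀ᶠ t in atTop, -(∫ x, V t x * H t x) ≤ F 0 := by
    filter_upwards [eventually_ge_atTop 0] with t ht
    refine le_trans ?_ (hanti ht)
    have : 0 ≤ ∫ x, bell ε (G t x) (H t x) := integral_nonneg fun x =>
      mul_nonneg (bellBase_pos hε _ _).le (Real.sqrt_nonneg _)
    simp only [hF]; linarith
  have h0 := le_of_tendsto hlim.neg hge
  rw [neg_zero, hF0] at h0
  linarith

theorem bell_le {ε : ℝ} (hε : 0 < ε) (ξ η : ℝ) :
    bell ε ξ η ≤ 6 * (|ξ| ^ 3 + |η| * √|η| + ε * √ε) := by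
  have h1 : bellBase ε ξ η ≤ ξ ^ 2 + |η| + ε := by
    have : softAbs ε η ≤ |η| + ε := by
      refine Real.sqrt_le_iff.2 ⟨by positivity, ?_⟩
      rw [← sq_abs η]; nlinarith [abs_nonneg η]
    unfold bellBase; linarith
  have h0 := (bellBase_pos hε ξ η).le
  have hmono : ∀ {x y : ℝ}, 0 ≤ x → x ≤ y → x * √x ≤ y * √y := fun hx hxy =>
    mul_le_mul hxy (Real.sqrt_le_sqrt hxy) (Real.sqrt_nonneg _) (hx.trans hxy)
  -- `(3m)^{3/2} ≤ 6 m^{3/2}`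
  have h3 : ∀ m : ℝ, 0 ≤ m → 3 * m * √(3 * m) ≤ 6 * (m * √m) := by
    intro m hm
    have : √(3 * m) ≤ 2 * √m := by
      rw [Real.sqrt_le_iff]
      refine ⟨by positivity, ?_⟩
      rw [mul_pow, Real.sq_sqrt hm]; linarith
    calc 3 * m * √(3 * m) ≤ 3 * m * (2 * √m) := by gcongr
      _ = _ := by ring
  have hξ : ξ ^ 2 * √(ξ ^ 2) = |ξ| ^ 3 := by
    rw [Real.sqrt_sq_eq_abs, ← sq_abs ξ]; ring
  have p1 : 0 ≤ ξ ^ 2 * √(ξ ^ 2) := by positivity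
  have p2 : 0 ≤ |η| * √|η| := by positivity
  have p3 : 0 ≤ ε * √ε := by positivity
  unfold bell
  rw [← hξ]
  have hmax : ∃ m, 0 ≤ m ∧ ξ ^ 2 + |η| + ε ≤ 3 * m
      ∧ m * √m ≤ ξ ^ 2 * √(ξ ^ 2) + |η| * √|η| + ε * √ε := by
    have hx := sq_nonneg ξ
    have hy := abs_nonneg η
    rcases le_total (ξ ^ 2) |η| with h | h <;> rcases le_total |η| ε with h' | h' <;>
      rcases le_total (ξ ^ 2) ε with h'' | h''
    all_goals first
      | exact ⟨ε, hε.le, by linarith, by linarith⟩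
      | exact ⟨|η|, hy, by linarith, by linarith⟩
      | exact ⟨ξ ^ 2, hx, by linarith, by linarith⟩
  obtain ⟨m, hm, h4, h5⟩ := hmax
  calc bellBase ε ξ η * √(bellBase ε ξ η) ≤ 3 * m * √(3 * m) := hmono h0 (h1.trans h4)
    _ ≤ 6 * (m * √m) := h3 m hm
    _ ≤ _ := by linarith

/-- The additive form of the bound of `∂_i ∂_j w` in the dual of `L^{3/2}`, by `Δw` in `L³`. -/
theorem integral_hessian_le (s : Finset (Fin d → ℤ)) (c : (Fin d → ℤ) → ℂ) (i j : Fin d)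
    {h : Torus d → ℝ} (hh : Continuous h) :
    ∫ x, pd i (pd j (trig s c)) x * h x
      ≤ 16 * ∫ x, (|lap (trig s c) x| ^ 3 + |h x| * √|h x|) := by
  have sw := smoothT_trig s c
  have cg : Continuous (lap (trig s c)) := by rw [lap_trig]; exact (smoothT_trig _ _).continuous
  -- for trigonometric polynomials `h` let `ε → 0`
  have h1 : ∀ s' e, ∫ x, pd i (pd j (trig s c)) x * trig s' e x
      ≤ 16 * ∫ x, (|lap (trig s c) x| ^ 3 + |trig s' e x| * √|trig s' e x|) := by
    intro s' e
    have ch := (smoothT_trig s' e).continuous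
    have cc : Continuous fun x => |lap (trig s c) x| ^ 3 + |trig s' e x| * √|trig s' e x| := by
      fun_prop
    have h2 : ∀ ε : ℝ, 0 < ε → ∫ x, pd i (pd j (trig s c)) x * trig s' e x
        ≤ 16 * ((∫ x, (|lap (trig s c) x| ^ 3 + |trig s' e x| * √|trig s' e x|)) + ε * √ε) := by
      intro ε hε
      have cb : Continuous fun x => bell ε (lap (trig s c) x) (trig s' e x) :=
        (contDiff_bell hε).continuous.comp (cg.prodMk ch)
      calc _ ≤ 8 / 3 * ∫ x, bell ε (lap (trig s c) x) (trig s' e x) :=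
            integral_hessian_le_bell hε s s' c e i j
        _ ≤ 8 / 3 * ∫ x, 6 * ((|lap (trig s c) x| ^ 3 + |trig s' e x| * √|trig s' e x|)
              + ε * √ε) := by
            refine mul_le_mul_of_nonneg_left (integral_mono cb.integrable_torus
              ((cc.add continuous_const).integrable_torus.const_mul 6) fun x => ?_) (by norm_num)
            exact bell_le hε _ _
        _ = _ := by
            rw [integral_const_mul, integral_add cc.integrable_torus (integrable_const _)]
            simp; ring
    have h3 : Tendsto (fun ε : ℝ => 16 * ((∫ x, (|lap (trig s c) x| ^ 3
        + |trig s' e x| * √|trig s' e x|)) + ε * √ε)) (𝓝[>] 0)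
        (𝓝 (16 * ((∫ x, (|lap (trig s c) x| ^ 3 + |trig s' e x| * √|trig s' e x|)) + 0 * √0))) := by
      have : Continuous (fun ε : ℝ => 16 * ((∫ x, (|lap (trig s c) x| ^ 3
        + |trig s' e x| * √|trig s' e x|)) + ε * √ε)) := by fun_prop
      exact (this.tendsto 0).mono_left nhdsWithin_le_nhds
    rw [zero_mul, add_zero] at h3
    exact ge_of_tendsto h3 (by filter_upwards [self_mem_nhdsWithin] with ε hε using h2 ε hε)
  -- general `h` by uniform approximation
  choose S E hSE using fun n : ℕ => exists_trig_near hh (show (0 : ℝ) < 1 / (n + 1) by positivity)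
  have hlim : ∀ x, Tendsto (fun n => trig (S n) (E n) x) atTop (𝓝 (h x)) := by
    intro x
    rw [tendsto_iff_norm_sub_tendsto_zero]
    refine squeeze_zero (fun _ => norm_nonneg _) (fun n => ?_)
      (tendsto_one_div_add_atTop_nhds_zero_nat (𝕜 := ℝ))
    rw [Real.norm_eq_abs, abs_sub_comm]; exact hSE n x
  obtain ⟨M, hM⟩ := (isCompact_univ (X := Torus d)).exists_bound_of_continuousOn hh.continuousOn
  have hbd : ∀ n x, |trig (S n) (E n) x| ≤ M + 1 := by
    intro n x
    have h2 := hSE n x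
    have h3 : |h x| ≤ M := hM x (mem_univ _)
    have h4 : (1 : ℝ) / (n + 1) ≤ 1 := by
      rw [div_le_one (by positivity)]; linarith [Nat.cast_nonneg (α := ℝ) n]
    calc |trig (S n) (E n) x| = |h x - (h x - trig (S n) (E n) x)| := by rw [sub_sub_cancel]
      _ ≤ |h x| + |h x - trig (S n) (E n) x| := abs_sub _ _
      _ ≤ _ := by linarith
  have cv := ((sw.pd j).pd i).continuous
  obtain ⟨N, hN⟩ := ((sw.pd j).pd i).bounded
  obtain ⟨L, hL⟩ := (isCompact_univ (X := Torus d)).exists_bound_of_continuousOn cg.continuousOn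
  refine le_of_tendsto_of_tendsto (f := fun n =>
    ∫ x, pd i (pd j (trig s c)) x * trig (S n) (E n) x) (g := fun n => 16 * ∫ x,
    (|lap (trig s c) x| ^ 3 + |trig (S n) (E n) x| * √|trig (S n) (E n) x|)) (b := atTop) ?_ ?_
    (Eventually.of_forall fun n => h1 _ _)
  · refine tendsto_integral_of_dominated_convergence (fun _ => N * (M + 1))
      (fun n => (cv.mul (smoothT_trig _ _).continuous).aestronglyMeasurable)
      (integrable_const _) (fun n => Eventually.of_forall fun x => ?_)
      (Eventually.of_forall fun x => (hlim x).const_mul _)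
    rw [norm_mul]
    exact mul_le_mul (hN x) (hbd n x) (norm_nonneg _) ((abs_nonneg _).trans (hN x))
  · refine (tendsto_integral_of_dominated_convergence
      (fun _ => L ^ 3 + (M + 1) * √(M + 1))
      (fun n => ?_) (integrable_const _) (fun n => Eventually.of_forall fun x => ?_)
      (Eventually.of_forall fun x => ?_)).const_mul 16
    · have := (smoothT_trig (S n) (E n)).continuous
      exact Continuous.aestronglyMeasurable (by fun_prop)
    · rw [Real.norm_of_nonneg (by positivity)]
      have h5 : |lap (trig s c) x| ≤ L := hL x (mem_univ _)
      have h6 := hbd n x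
      gcongr
      exact (abs_nonneg _).trans h6
    · exact tendsto_const_nhds.add ((hlim x).abs.mul (hlim x).abs.sqrt)

/-- The Calderón–Zygmund estimate `‖∂_i ∂_j w‖_{L³} ≲ ‖Δ w‖_{L³}`. -/
theorem integral_hessian_cube_le (s : Finset (Fin d → ℤ)) (c : (Fin d → ℤ) → ℂ) (i j : Fin d) :
    ∫ x, |pd i (pd j (trig s c)) x| ^ 3 ≤ 2 ^ 15 * ∫ x, |lap (trig s c) x| ^ 3 := by
  have cv := (((smoothT_trig s c).pd j).pd i).continuous
  have cg : Continuous (lap (trig s c)) := by rw [lap_trig]; exact (smoothT_trig _ _).continuous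
  set v := pd i (pd j (trig s c))
  -- the small factor makes the term `|h|^{3/2}` absorbable
  have h := integral_hessian_le s c i j (h := fun x => 1 / 1024 * (v x * |v x|)) (by fun_prop)
  have e1 : ∀ x, v x * (1 / 1024 * (v x * |v x|)) = 1 / 1024 * |v x| ^ 3 := by
    intro x
    have : |v x| ^ 3 = |v x| ^ 2 * |v x| := by ring
    rw [this, sq_abs]; ring
  have e2 : ∀ x, |1 / 1024 * (v x * |v x|)| * √|1 / 1024 * (v x * |v x|)|
      = 1 / 32768 * |v x| ^ 3 := by
    intro x
    have e3 : |1 / 1024 * (v x * |v x|)| = (1 / 32 * |v x|) ^ 2 := by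
      rw [abs_mul, abs_mul, abs_abs, abs_of_pos (by norm_num : (0 : ℝ) < 1 / 1024)]; ring
    rw [e3, Real.sqrt_sq (by positivity)]; ring
  have h : ∫ x, v x * (1 / 1024 * (v x * |v x|)) ≤ 16 * ∫ x, (|lap (trig s c) x| ^ 3
      + |1 / 1024 * (v x * |v x|)| * √|1 / 1024 * (v x * |v x|)|) := h
  simp only [e1, e2] at h
  have i1 : Integrable (fun x => |lap (trig s c) x| ^ 3) volume :=
    (cg.abs.pow 3).integrable_torus
  have i2 : Integrable (fun x => |v x| ^ 3) volume := (cv.abs.pow 3).integrable_torus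
  rw [integral_const_mul, integral_add i1 (i2.const_mul _), integral_const_mul] at h
  linarith

/-- The `L²` bound of second derivatives, by integrating by parts twice. -/
theorem integral_hessian_sq (s : Finset (Fin d → ℤ)) (c : (Fin d → ℤ) → ℂ) (i : Fin d) :
    ∑ k, ∫ x, pd k (pd i (trig s c)) x ^ 2
      ≤ ∫ x, lap (trig s c) x ^ 2 := by
  have sw := smoothT_trig s c
  have pc : ∀ i k, pd i (pd k (trig s c)) = pd k (pd i (trig s c)) := by
    intro i k; simp only [pd_trig]; congr 1; ext m; ring
  have e : ∀ i k, ∫ x, pd k (pd i (trig s c)) x ^ 2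
      = ∫ x, pd i (pd i (trig s c)) x * pd k (pd k (trig s c)) x := by
    intro i k
    have h1 := integral_mul_pd ((sw.pd i).pd k) (sw.pd i) k
    have h2 := integral_mul_pd (((sw.pd k).pd k)) (sw.pd i) i
    have h3 : pd k (pd k (pd i (trig s c))) = pd i (pd k (pd k (trig s c))) := by
      simp only [pd_trig]; congr 1; ext m; ring
    rw [h3] at h1
    calc ∫ x, pd k (pd i (trig s c)) x ^ 2
        = ∫ x, pd k (pd i (trig s c)) x * pd k (pd i (trig s c)) x := by
          congr 1; ext x; ring
      _ = ∫ x, pd k (pd k (trig s c)) x * pd i (pd i (trig s c)) x := by rw [h1, h2]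
      _ = _ := by congr 1; ext x; ring
  have ic : ∀ i k, Integrable (fun x => pd i (pd i (trig s c)) x * pd k (pd k (trig s c)) x)
      volume := fun i k => (((sw.pd i).pd i).mul ((sw.pd k).pd k)).continuous.integrable_torus
  have h4 : ∫ x, lap (trig s c) x ^ 2 = ∑ i, ∑ k, ∫ x, pd k (pd i (trig s c)) x ^ 2 := by
    simp_rw [e]
    simp only [lap, sq, Finset.sum_mul_sum]
    rw [integral_finsetSum _ fun i _ => integrable_finsetSum _ fun k _ => ic i k]
    exact Finset.sum_congr rfl fun i _ => integral_finsetSum _ fun k _ => ic i k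
  rw [h4]
  exact Finset.single_le_sum (f := fun i => ∑ k, ∫ x, pd k (pd i (trig s c)) x ^ 2)
    (fun i _ => Finset.sum_nonneg fun k _ => integral_nonneg fun x => sq_nonneg _)
    (Finset.mem_univ i)

/-! ### The pressure at a fixed time -/

theorem abs_integral_pow_le {X : Type*} [MeasurableSpace X] {μ : Measure X}
    [IsProbabilityMeasure μ] {g : X → ℝ} (hg : Integrable g μ) {n : ℕ}
    (hgn : Integrable (fun x => |g x| ^ n) μ) : |∫ x, g x ∂μ| ^ n ≤ ∫ x, |g x| ^ n ∂μ := by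
  calc |∫ x, g x ∂μ| ^ n ≤ (∫ x, |g x| ∂μ) ^ n :=
        pow_le_pow_left₀ (abs_nonneg _) (abs_integral_le_integral_abs) _
    _ ≤ _ := ConvexOn.map_integral_le (convexOn_pow n) (continuous_pow n).continuousOn isClosed_Ici
        (Eventually.of_forall fun x => abs_nonneg (g x)) hg.abs hgn

/-- A one-dimensional Poincaré inequality along the direction `k`: by Rolle's theorem `∂_k w`
vanishes somewhere on each circle. -/
theorem integral_pd_pow_le {w : Torus d → ℝ} (hw : SmoothT w) (k : Fin d) (n : ℕ) :
    ∫ x, |pd k w x| ^ n ≤ ∫ x, |pd k (pd k w) x| ^ n := by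
  set l : ℝ → Torus d := fun s => proj (EuclideanSpace.single k s) with hl
  have cl : Continuous l := by
    have : l = fun s : ℝ => proj (s • (EuclideanSpace.single k 1 : E d)) := by
      ext1 s; simp only [hl]; rw [single_eq_smul]
    rw [this]; fun_prop
  have c2 := ((hw.pd k).pd k).continuous
  have hper : ∀ x, w (x + l 1) = w (x + l 0) := by
    intro x
    congr 2
    ext i
    simp only [hl, proj, PiLp.single_apply]
    split <;> simp
  have key : ∀ x, |pd k w x| ^ n ≤ ∫ s in (0 : ℝ)..1, |pd k (pd k w) (x + l s)| ^ n := by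
    intro x
    -- the point on the circle at which the derivative vanishes
    obtain ⟨c, ⟨hc0, hc1⟩, hc⟩ := exists_hasDerivAt_eq_zero (f := fun s => w (x + l s))
      (f' := fun s => pd k w (x + l s)) zero_lt_one
      (hw.continuous.comp (continuous_const.add cl)).continuousOn (hper x).symm
      fun s _ => hw.hasDerivAt k x s
    have cont : Continuous fun s => pd k (pd k w) (x + l s) := c2.comp (continuous_const.add cl)
    have h1 : ∫ s in (0 : ℝ)..c, pd k (pd k w) (x + l s) = - pd k w x := by
      rw [intervalIntegral.integral_eq_sub_of_hasDerivAt (f := fun s => pd k w (x + l s))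
        (fun s _ => (hw.pd k).hasDerivAt k x s) (cont.intervalIntegrable _ _), hc]
      simp only [hl, single_zero_add]; ring
    have h2 : |pd k w x| ≤ ∫ s in (0 : ℝ)..1, |pd k (pd k w) (x + l s)| := by
      rw [← abs_neg, ← h1]
      refine (intervalIntegral.abs_integral_le_integral_abs hc0.le).trans ?_
      exact intervalIntegral.integral_mono_interval le_rfl hc0.le hc1.le
        (Eventually.of_forall fun s => abs_nonneg _) (cont.abs.intervalIntegrable _ _)
    refine (pow_le_pow_left₀ (abs_nonneg _) h2 n).trans ?_
    rw [intervalIntegral.integral_of_le zero_le_one, intervalIntegral.integral_of_le zero_le_one]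
    have : IsProbabilityMeasure (volume.restrict (Ioc (0 : ℝ) 1)) := ⟨by simp⟩
    have i1 := (cont.abs.intervalIntegrable (μ := volume) 0 1).1
    have i2 : Integrable (fun s => |pd k (pd k w) (x + l s)| ^ n) (volume.restrict (Ioc 0 1)) :=
      ((cont.abs.pow n).intervalIntegrable (μ := volume) 0 1).1
    have h3 := abs_integral_pow_le (μ := volume.restrict (Ioc (0 : ℝ) 1)) (n := n) i1
      (by simpa only [abs_abs] using i2)
    rw [abs_of_nonneg (integral_nonneg fun s => abs_nonneg _)] at h3
    simpa only [abs_abs] using h3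
  have cF : Continuous (Function.uncurry fun (x : Torus d) (s : ℝ) =>
      |pd k (pd k w) (x + l s)| ^ n) := by
    have : Continuous fun z : Torus d × ℝ => pd k (pd k w) (z.1 + l z.2) :=
      c2.comp (continuous_fst.add (cl.comp continuous_snd))
    exact this.abs.pow n
  have cI : Continuous fun x => ∫ s in (0 : ℝ)..1, |pd k (pd k w) (x + l s)| ^ n :=
    intervalIntegral.continuous_parametric_intervalIntegral_of_continuous' cF 0 1
  calc ∫ x, |pd k w x| ^ n ≤ ∫ x, ∫ s in (0 : ℝ)..1, |pd k (pd k w) (x + l s)| ^ n :=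
        integral_mono ((hw.pd k).continuous.abs.pow n).integrable_torus cI.integrable_torus key
    _ = ∫ s in (0 : ℝ)..1, ∫ x, |pd k (pd k w) (x + l s)| ^ n := by
        simp_rw [intervalIntegral.integral_of_le zero_le_one]
        refine integral_integral_swap ?_
        obtain ⟨C, hC⟩ := ((hw.pd k).pd k).bounded
        refine Integrable.of_bound cF.aestronglyMeasurable (C ^ n) (Eventually.of_forall fun z => ?_)
        simp only [Function.uncurry, norm_pow, Real.norm_eq_abs, abs_abs]
        exact pow_le_pow_left₀ (abs_nonneg _) (hC _) n
    _ = _ := by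
        simp_rw [integral_add_right_eq_self (fun x => |pd k (pd k w) x| ^ n)]
        simp

/-- Bounded measurable functions are almost everywhere limits of uniformly bounded sequences of
trigonometric polynomials. -/
theorem exists_trig_tendsto_ae {g : Torus d → ℝ} (hg : AEStronglyMeasurable g volume) {M : ℝ}
    (hM : ∀ x, |g x| ≤ M) : ∃ (S : ℕ → Finset (Fin d → ℤ)) (e : ℕ → (Fin d → ℤ) → ℂ),
      (∀ n x, |trig (S n) (e n) x| ≤ M + 1) ∧
      ∀ᵐ x, Tendsto (fun n => trig (S n) (e n) x) atTop (𝓝 (g x)) := by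
  have hM0 : 0 ≤ M := (abs_nonneg _).trans (hM 0)
  have hL : MemLp g 1 volume := MemLp.of_bound hg M (Eventually.of_forall hM)
  choose q hq1 hq2 using fun n : ℕ => hL.exists_boundedContinuous_eLpNorm_sub_le
    ENNReal.one_ne_top (ε := ((n : ℝ≥0∞) + 1)⁻¹) (by simp)
  have h1 : Tendsto (fun n => eLpNorm (⇑(q n) - g) 1 volume) atTop (𝓝 0) := by
    refine tendsto_of_tendsto_of_tendsto_of_le_of_le tendsto_const_nhds
      (?_ : Tendsto (fun n : ℕ => ((n : ℝ≥0∞) + 1)⁻¹) atTop (𝓝 0)) (fun _ => zero_le) fun n => ?_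
    · have := (tendsto_add_atTop_iff_nat 1).2 ENNReal.tendsto_inv_nat_nhds_zero
      simpa using this
    · rw [← eLpNorm_neg, neg_sub]; exact hq1 n
  obtain ⟨ns, -, hns⟩ := (tendstoInMeasure_of_tendsto_eLpNorm one_ne_zero
    (fun n => (q n).continuous.aestronglyMeasurable) hg h1).exists_seq_tendsto_ae
  -- truncation keeps the approximations bounded by `M`
  choose S e hSe using fun n : ℕ => exists_trig_near
    (f := fun x => max (-M) (min M (q (ns n) x)))
    (continuous_const.max (continuous_const.min (q (ns n)).continuous))
    (show (0 : ℝ) < 1 / (n + 1) by positivity)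
  refine ⟨S, e, fun n x => ?_, ?_⟩
  · have h2 := hSe n x
    have h3 : |max (-M) (min M (q (ns n) x))| ≤ M :=
      abs_le.2 ⟨le_max_left _ _, max_le (by linarith) (min_le_left _ _)⟩
    have h4 : (1 : ℝ) / (n + 1) ≤ 1 := by
      rw [div_le_one (by positivity)]; linarith [Nat.cast_nonneg (α := ℝ) n]
    rw [abs_le] at *
    constructor <;> linarith [h2.1, h2.2, h3.1, h3.2]
  · filter_upwards [hns] with x hx
    have h2 : Tendsto (fun n => max (-M) (min M (q (ns n) x))) atTop (𝓝 (g x)) := by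
      have := (tendsto_const_nhds (x := -M)).max ((tendsto_const_nhds (x := M)).min hx)
      have hx' := abs_le.1 (hM x)
      rwa [min_eq_right hx'.2, max_eq_right hx'.1] at this
    have h3 : Tendsto (fun n => max (-M) (min M (q (ns n) x)) - trig (S n) (e n) x) atTop (𝓝 0) :=
      squeeze_zero_norm (fun n => hSe n x) tendsto_one_div_add_atTop_nhds_zero_nat
    simpa using h2.sub h3

/-- The cubic-growth bound `∫ p g ≤ a + C ∫ |g|³ + b ∫ g² + ‖p‖₁ ∫ |g|` extends from
trigonometric polynomials to all `g ∈ L³`, with `|p|` in place of `p`. -/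
theorem lintegral_mul_le_of_trig {p : Torus d → ℝ} (hp : Integrable p) {a C b m : ℝ}
    (hC : 0 ≤ C) (hb : 0 ≤ b) (hm : 0 ≤ m)
    (H : ∀ s c, ∫ x, p x * trig s c x ≤ a + C * (∫ x, |trig s c x| ^ 3)
      + b * (∫ x, |trig s c x| ^ 2) + m * ∫ x, |trig s c x|)
    {h : Torus d → ℝ} (hh : MemLp h 3 volume) :
    ∫⁻ x, ‖p x * h x‖ₑ ≤ ENNReal.ofReal (a + C * (∫ x, |h x| ^ 3) + b * (∫ x, |h x| ^ 2)
      + m * ∫ x, |h x|) := by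
  have i3 : Integrable (fun x => |h x| ^ 3) volume := by
    simpa using hh.integrable_norm_pow (p := 3) (by norm_num)
  have i2 : Integrable (fun x => |h x| ^ 2) volume := by
    simpa using (hh.mono_exponent (p := 2) (by norm_num)).integrable_norm_pow (p := 2) (by norm_num)
  have i1 : Integrable (fun x => |h x|) volume := (hh.integrable (by norm_num)).abs
  -- the hypothesis for bounded measurable `g`, by approximation
  have H2 : ∀ {g : Torus d → ℝ} {M : ℝ}, AEStronglyMeasurable g volume → (∀ x, |g x| ≤ M) →
      ∫ x, p x * g x ≤ a + C * (∫ x, |g x| ^ 3) + b * (∫ x, |g x| ^ 2) + m * ∫ x, |g x| := by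
    intro g M hg hM
    obtain ⟨S, e, hb1, hlim⟩ := exists_trig_tendsto_ae hg hM
    have hpow : ∀ n : ℕ, Tendsto (fun j => ∫ x, |trig (S j) (e j) x| ^ n) atTop
        (𝓝 (∫ x, |g x| ^ n)) := by
      intro n
      refine tendsto_integral_of_dominated_convergence (fun _ => (M + 1) ^ n)
        (fun j => ((smoothT_trig _ _).continuous.abs.pow n).aestronglyMeasurable)
        (integrable_const _) (fun j => Eventually.of_forall fun x => ?_) ?_
      · rw [norm_pow, Real.norm_eq_abs, abs_abs]
        exact pow_le_pow_left₀ (abs_nonneg _) (hb1 j x) n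
      · filter_upwards [hlim] with x hx using hx.abs.pow n
    have h1 := hpow 1
    simp only [pow_one] at h1
    refine le_of_tendsto_of_tendsto ?_ (((tendsto_const_nhds.add ((hpow 3).const_mul C)).add
      ((hpow 2).const_mul b)).add (h1.const_mul m)) (Eventually.of_forall fun j => H (S j) (e j))
    refine tendsto_integral_of_dominated_convergence (fun x => ‖p x‖ * (M + 1))
      (fun j => hp.aestronglyMeasurable.mul (smoothT_trig _ _).continuous.aestronglyMeasurable)
      (hp.norm.mul_const _) (fun j => Eventually.of_forall fun x => ?_) ?_
    · rw [norm_mul]; exact mul_le_mul_of_nonneg_left (hb1 j x) (norm_nonneg _)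
    · filter_upwards [hlim] with x hx using hx.const_mul _
  -- test with `sign p · min (|h|, N)`
  have H3 : ∀ N : ℕ, ∫⁻ x, ‖p x‖ₑ * ENNReal.ofReal (min |h x| N)
      ≤ ENNReal.ofReal (a + C * (∫ x, |h x| ^ 3) + b * (∫ x, |h x| ^ 2) + m * ∫ x, |h x|) := by
    intro N
    have hmin0 : ∀ x, 0 ≤ min |h x| (N : ℝ) := fun x => le_min (abs_nonneg _) N.cast_nonneg
    have mmin : AEStronglyMeasurable (fun x => min |h x| (N : ℝ)) volume :=
      hh.aestronglyMeasurable.norm.inf aestronglyMeasurable_const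
    set σ : ℝ → ℝ := fun y => if 0 ≤ y then 1 else -1 with hσ
    have mσ : Measurable σ := Measurable.ite measurableSet_Ici measurable_const measurable_const
    have hσ1 : ∀ y, |σ y| = 1 := by intro y; simp only [hσ]; split <;> simp
    have hσ2 : ∀ y, y * σ y = |y| := by
      intro y; simp only [hσ]; split
      · rw [abs_of_nonneg ‹_›, mul_one]
      · rw [abs_of_neg (not_le.1 ‹_›), mul_neg_one]
    have mg : AEStronglyMeasurable (fun x => σ (p x) * min |h x| (N : ℝ)) volume :=
      (mσ.comp_aemeasurable hp.aemeasurable).aestronglyMeasurable.mul mmin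
    have habs : ∀ x, |σ (p x) * min |h x| (N : ℝ)| = min |h x| N := by
      intro x; rw [abs_mul, hσ1, one_mul, abs_of_nonneg (hmin0 x)]
    have h1 := H2 mg (M := N) fun x => by rw [habs]; exact min_le_right _ _
    simp only [habs, ← mul_assoc, hσ2] at h1
    have hle : ∀ x, min |h x| (N : ℝ) ≤ |h x| := fun x => min_le_left _ _
    have hmono : ∀ n : ℕ, Integrable (fun x => |h x| ^ n) volume →
        ∫ x, (min |h x| (N : ℝ)) ^ n ≤ ∫ x, |h x| ^ n := fun n hn =>
      integral_mono_of_nonneg (Eventually.of_forall fun x => pow_nonneg (hmin0 x) n) hn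
        (Eventually.of_forall fun x => pow_le_pow_left₀ (hmin0 x) (hle x) n)
    have e1 : ∫⁻ x, ‖p x‖ₑ * ENNReal.ofReal (min |h x| N)
        = ENNReal.ofReal (∫ x, |p x| * min |h x| N) := by
      rw [ofReal_integral_eq_lintegral_ofReal]
      · refine lintegral_congr fun x => ?_
        rw [ENNReal.ofReal_mul (abs_nonneg _), Real.enorm_eq_ofReal_abs]
      · refine (hp.abs.mul_const (N : ℝ)).mono' (hp.abs.aestronglyMeasurable.mul mmin)
          (Eventually.of_forall fun x => ?_)
        rw [norm_mul, Real.norm_of_nonneg (hmin0 x), Real.norm_eq_abs, abs_abs]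
        exact mul_le_mul_of_nonneg_left (min_le_right _ _) (abs_nonneg _)
      · exact Eventually.of_forall fun x => mul_nonneg (abs_nonneg _) (hmin0 x)
    rw [e1]
    refine ENNReal.ofReal_le_ofReal (h1.trans ?_)
    have h4 : ∫ x, min |h x| (N : ℝ) ≤ ∫ x, |h x| := by
      simpa using hmono 1 (by simpa using i1)
    have h2 := hmono 2 i2
    have h3 := hmono 3 i3
    gcongr
  -- monotone convergence as `N → ∞`
  have hlim : Tendsto (fun N : ℕ => ∫⁻ x, ‖p x‖ₑ * ENNReal.ofReal (min |h x| N)) atTop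
      (𝓝 (∫⁻ x, ‖p x * h x‖ₑ)) := by
    refine lintegral_tendsto_of_tendsto_of_monotone (fun N => ?_) ?_ ?_
    · exact hp.aestronglyMeasurable.enorm.mul ((hh.aestronglyMeasurable.norm.inf
        aestronglyMeasurable_const).aemeasurable.ennreal_ofReal)
    · refine Eventually.of_forall fun x N N' hN => ?_
      dsimp only
      gcongr
    · refine Eventually.of_forall fun x => ?_
      refine tendsto_const_nhds.congr' ?_
      obtain ⟨N₀, hN₀⟩ := exists_nat_ge |h x|
      filter_upwards [eventually_ge_atTop N₀] with N hN
      have : |h x| ≤ N := hN₀.trans (by exact_mod_cast hN)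
      rw [min_eq_left this, enorm_mul, Real.enorm_eq_ofReal_abs (h x)]
  exact le_of_tendsto' hlim H3

/-- Every trigonometric polynomial is, up to its mean, the Laplacian of another. -/
theorem exists_lap_eq (s : Finset (Fin d → ℤ)) (c : (Fin d → ℤ) → ℂ) :
    ∃ e, ∀ x, lap (trig s e) x = trig s c x - ∫ y, trig s c y := by
  refine ⟨fun k => -(c k) / eig k, ?_⟩
  have h1 : ∀ x, lap (trig s fun k => -(c k) / eig k) x
      = trig s c x - (if (0 : Fin d → ℤ) ∈ s then (c 0).re else 0) := by
    intro x
    rw [lap_trig]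
    have : ∀ k, -(eig k : ℂ) * (-(c k) / eig k) = c k - if k = 0 then c 0 else 0 := by
      intro k
      split_ifs with hk
      · subst hk; simp [eig_zero]
      · have : (eig k : ℂ) ≠ 0 := by exact_mod_cast (eig_pos hk).ne'
        field_simp; ring
    simp only [trig, this, sub_mul, Finset.sum_sub_distrib, Complex.sub_re, ite_mul, zero_mul,
      Finset.sum_ite_eq']
    split_ifs <;> simp [UnitAddTorus.mFourier_zero]
  have sw := smoothT_trig s fun k => -(c k) / eig k
  have h2 : ∫ x, lap (trig s fun k => -(c k) / eig k) x = 0 := by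
    unfold lap
    rw [integral_finsetSum _ fun k _ => ((sw.pd k).pd k).continuous.integrable_torus]
    exact Finset.sum_eq_zero fun k _ => integral_pd (sw.pd k) k
  simp_rw [h1] at h2
  rw [integral_sub (smoothT_trig s c).continuous.integrable_torus (integrable_const _)] at h2
  intro x
  rw [h1]
  simp only [integral_const, probReal_univ, one_smul] at h2
  linarith

/-! ### Continuity of space correlations under translation -/

theorem integral_abs_pow_eq {X : Type*} [MeasurableSpace X] {μ : Measure X} {f : X → ℝ} {q : ℕ}
    (hq : q ≠ 0) (hf : MemLp f q μ) : ∫ x, |f x| ^ q ∂μ = (eLpNorm f q μ).toReal ^ q := by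
  have hq' : (q : ℝ) ≠ 0 := by exact_mod_cast hq
  rw [hf.eLpNorm_eq_integral_rpow_norm (by exact_mod_cast hq) (by simp)]
  simp only [ENNReal.toReal_natCast, Real.rpow_natCast, Real.norm_eq_abs]
  have h0 : 0 ≤ ∫ x, |f x| ^ q ∂μ := integral_nonneg fun x => by positivity
  rw [ENNReal.toReal_ofReal (Real.rpow_nonneg h0 _), ← Real.rpow_natCast, ← Real.rpow_mul h0,
    inv_mul_cancel₀ hq', Real.rpow_one]

theorem measurePreserving_shift (c : Torus d) :
    MeasurePreserving (fun x : Torus d => x + c) volume volume :=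
  measurePreserving_add_right volume c

/-- Translations are continuous in `L^q`. -/
theorem tendsto_integral_shift_sub_pow {h : Torus d → ℝ} {q : ℕ} (hq : q ≠ 0)
    (hh : MemLp h q volume) (c₀ : Torus d) :
    Tendsto (fun c => ∫ x, |h (x + c) - h (x + c₀)| ^ q) (𝓝 c₀) (𝓝 0) := by
  have : Fact ((1 : ℝ≥0∞) ≤ q) := ⟨by exact_mod_cast Nat.one_le_iff_ne_zero.2 hq⟩
  let τ : C(Torus d, C(Torus d, Torus d)) :=
    ContinuousMap.curry ⟨fun z : Torus d × Torus d => z.2 + z.1, by fun_prop⟩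
  have hτ : ∀ c, MeasurePreserving (τ c) volume volume := fun c => measurePreserving_shift c
  have hc := Continuous.compMeasurePreservingLp (f := fun _ => hh.toLp h) (g := τ)
    continuous_const τ.continuous hτ (by simp)
  have h1 := (tendsto_iff_norm_sub_tendsto_zero.1 (hc.tendsto c₀)).pow q
  rw [zero_pow hq] at h1
  refine h1.congr fun c => ?_
  simp only [Lp.toLp_compMeasurePreserving]
  rw [← MemLp.toLp_sub, Lp.norm_toLp, ← integral_abs_pow_eq hq
    ((hh.comp_measurePreserving (hτ c)).sub (hh.comp_measurePreserving (hτ c₀)))]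
  rfl

theorem _root_.MeasureTheory.MemLp.shift {h : Torus d → ℝ} {p : ℝ≥0∞} (hh : MemLp h p volume) (c : Torus d) :
    MemLp (fun x => h (x + c)) p volume := hh.comp_measurePreserving (measurePreserving_shift c)

/-- If `g` is in duality with `L^q`, in the weak form that `∫ |g k| ≤ a + b ∫ |k|^q`, then
its correlation with `h ∈ L^q` is continuous: apply the bound to `k = λ (h(·+c) - h(·+c₀))` with
`λ` large. -/
theorem continuous_integral_mul_shift {g h : Torus d → ℝ} {q : ℕ} (hq : q ≠ 0)
    (hg : AEStronglyMeasurable g volume) (hh : MemLp h q volume) {a b : ℝ}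
    (H : ∀ k : Torus d → ℝ, MemLp k q volume →
      ∫⁻ x, ‖g x * k x‖ₑ ≤ ENNReal.ofReal (a + b * ∫ x, |k x| ^ q)) :
    Continuous fun c => ∫ x, g x * h (x + c) := by
  have hi : ∀ k : Torus d → ℝ, MemLp k q volume → Integrable (fun x => g x * k x) volume :=
    fun k hk => ⟨hg.mul hk.aestronglyMeasurable, (H k hk).trans_lt ENNReal.ofReal_lt_top⟩
  have hbd : ∀ k : Torus d → ℝ, MemLp k q volume → |∫ x, g x * k x| ≤
      max 0 (a + b * ∫ x, |k x| ^ q) := by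
    intro k hk
    refine (norm_integral_le_lintegral_norm (fun x => g x * k x)).trans ?_
    refine ENNReal.toReal_le_of_le_ofReal (le_max_left _ _) ?_
    simp only [ofReal_norm]
    exact (H k hk).trans (ENNReal.ofReal_le_ofReal (le_max_right _ _))
  rw [continuous_iff_continuousAt]
  intro c₀
  rw [ContinuousAt, Metric.tendsto_nhds]
  intro ε hε
  -- the factor `λ`, so large that `(|a| + 1) / λ < ε`
  obtain ⟨r, hr⟩ := exists_gt ((|a| + 1) / ε)
  have hr0 : 0 < r := lt_of_le_of_lt (by positivity) hr
  have ht := (tendsto_integral_shift_sub_pow hq hh c₀).const_mul (b * r ^ q)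
  rw [mul_zero] at ht
  filter_upwards [ht.eventually (gt_mem_nhds zero_lt_one)] with c hc
  have hk : MemLp (fun x => h (x + c) - h (x + c₀)) q volume := (hh.shift c).sub (hh.shift c₀)
  have h1 := hbd _ (hk.const_mul r)
  have e1 : ∫ x, |r * (h (x + c) - h (x + c₀))| ^ q
      = r ^ q * ∫ x, |h (x + c) - h (x + c₀)| ^ q := by
    rw [← integral_const_mul]
    congr 1; ext x
    rw [abs_mul, mul_pow, abs_of_pos hr0]
  have e2 : ∫ x, g x * (r * (h (x + c) - h (x + c₀)))
      = r * ((∫ x, g x * h (x + c)) - ∫ x, g x * h (x + c₀)) := by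
    rw [← integral_sub (hi _ (hh.shift c)) (hi _ (hh.shift c₀)), ← integral_const_mul]
    congr 1; ext x; ring
  rw [e1, e2, abs_mul, abs_of_pos hr0] at h1
  have h2 : max 0 (a + b * (r ^ q * ∫ x, |h (x + c) - h (x + c₀)| ^ q)) ≤ |a| + 1 := by
    refine max_le (by positivity) ?_
    have := le_abs_self a
    linarith
  have h3 : |a| + 1 < r * ε := by rwa [div_lt_iff₀ hε] at hr
  rw [Real.dist_eq]
  by_contra! hcon
  nlinarith [mul_le_mul_of_nonneg_left hcon hr0.le]

/-- The measure preserving shift of space-time. -/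
theorem measurePreserving_shift_spaceTime (T : ℝ) (c : Torus d) :
    MeasurePreserving (fun z : ℝ × Torus d => (z.1, z.2 + c)) (spaceTime d T) (spaceTime d T) :=
  (MeasurePreserving.id _).prod (measurePreserving_shift c)

/-- The change of variables `(t, x, c) ↦ (t, x, x + c)`, which turns a separation into a second
point. -/
theorem measurePreserving_skew (T : ℝ) :
    MeasurePreserving (fun w : (ℝ × Torus d) × Torus d => (w.1, w.1.2 + w.2))
      ((spaceTime d T).prod volume) ((spaceTime d T).prod volume) :=
  (MeasurePreserving.id (spaceTime d T)).skew_product (g := fun z y => z.2 + y)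
    (by fun_prop) (Eventually.of_forall fun z => (measurePreserving_add_left volume z.2).map_eq)

/-- The correlation `∫∫ g(t, x) h(t, x + c) dt dx` at the separation `c`. -/
noncomputable def shiftCorr (T : ℝ) (g h : ℝ × Torus d → ℝ) (c : Torus d) : ℝ :=
  ∫ z, g z * h (z.1, z.2 + c) ∂(spaceTime d T)

/-- The correlation of `g` and `h` is defined at every separation and depends continuously
on it. -/
structure ContCorr (T : ℝ) (g h : ℝ × Torus d → ℝ) : Prop where
  pair : Pair T g h
  integrable : ∀ c : Torus d, Integrable (fun z => g z * h (z.1, z.2 + c)) (spaceTime d T)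
  continuous : Continuous (shiftCorr T g h)

theorem ContCorr.symm {T : ℝ} {g h : ℝ × Torus d → ℝ} (H : ContCorr T g h) :
    ContCorr T h g ∧ ∀ c, shiftCorr T h g c = shiftCorr T g h (-c) := by
  have e : ∀ c : Torus d, (fun z : ℝ × Torus d => h z * g (z.1, z.2 + c))
      = (fun z : ℝ × Torus d => g z * h (z.1, z.2 + -c)) ∘ fun z => (z.1, z.2 + c) := by
    intro c; ext z; simp [mul_comm]
  -- translate both points by `-c`
  have e2 : ∀ c, shiftCorr T h g c = shiftCorr T g h (-c) := by
    intro c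
    unfold shiftCorr
    have hm := measurePreserving_shift_spaceTime (d := d) T c
    have h1 := integral_map (μ := spaceTime d T) hm.measurable.aemeasurable
      (hm.map_eq.symm ▸ (H.integrable (-c)).aestronglyMeasurable)
    rw [hm.map_eq] at h1
    rw [e c, h1]
    rfl
  refine ⟨⟨H.pair.symm, fun c => ?_, ?_⟩, e2⟩
  · rw [e c]
    exact (measurePreserving_shift_spaceTime T c).integrable_comp_of_integrable (H.integrable _)
  · rw [funext e2]; exact H.continuous.comp continuous_neg

/-- A smeared correlation is the average of the correlations at fixed separation. -/
theorem corr_eq_integral_shiftCorr {T : ℝ} {g h : ℝ × Torus d → ℝ} (H : Pair T g h)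
    {Q : Torus d → ℝ} (hQ : Continuous Q) : corr T Q g h = ∫ c, Q c * shiftCorr T g h c := by
  have hm := measurePreserving_skew (d := d) T
  have hi := H.integrable_corr hQ
  have e1 : corr T Q g h = ∫ w : (ℝ × Torus d) × Torus d,
      Q w.2 * (g w.1 * h (w.1.1, w.1.2 + w.2)) ∂((spaceTime d T).prod volume) := by
    have h1 := integral_map (μ := (spaceTime d T).prod volume) hm.measurable.aemeasurable
      (hm.map_eq.symm ▸ hi.aestronglyMeasurable)
    rw [hm.map_eq] at h1
    unfold corr
    rw [h1]
    simp
  have hi2 : Integrable (fun w : (ℝ × Torus d) × Torus d =>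
      Q w.2 * (g w.1 * h (w.1.1, w.1.2 + w.2))) ((spaceTime d T).prod volume) := by
    have := hm.integrable_comp_of_integrable hi
    refine this.congr (Eventually.of_forall fun w => ?_)
    simp
  rw [e1, integral_prod_symm _ hi2]
  simp_rw [integral_const_mul]
  rfl

/-- A sufficient condition for `ContCorr`: at almost every time `g` is in duality with `L^q ∋ h`,
and the correlations are dominated by an integrable function of time. -/
structure ShiftPair (T : ℝ) (q : ℕ) (g h : ℝ × Torus d → ℝ) : Prop where
  measurable_left : AEStronglyMeasurable g (spaceTime d T)
  measurable_right : AEStronglyMeasurable h (spaceTime d T)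
  memLp : ∀ᵐ t ∂(volume.restrict (Icc 0 T)), MemLp (fun x => h (t, x)) q volume
  dual : ∀ᵐ t ∂(volume.restrict (Icc 0 T)), ∃ a b : ℝ, 0 ≤ b ∧ ∀ k : Torus d → ℝ, MemLp k q volume →
      ∫⁻ x, ‖g (t, x) * k x‖ₑ ≤ ENNReal.ofReal (a + b * ∫ x, |k x| ^ q)
  bound : ∃ B : ℝ → ℝ, Integrable B (volume.restrict (Icc 0 T)) ∧
    ∀ᵐ t ∂(volume.restrict (Icc 0 T)), ∀ c : Torus d,
      ∫⁻ x, ‖g (t, x) * h (t, x + c)‖ₑ ≤ ENNReal.ofReal (B t)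

/-- Continuity at almost every time, and dominated convergence in time. -/
theorem ShiftPair.contCorr {T : ℝ} {q : ℕ} (hq : q ≠ 0) {g h : ℝ × Torus d → ℝ}
    (H : ShiftPair T q g h) : ContCorr T g h := by
  obtain ⟨B, hB, hBd⟩ := H.bound
  have hm1 : ∀ c : Torus d, AEStronglyMeasurable (fun z : ℝ × Torus d => g z * h (z.1, z.2 + c))
      (spaceTime d T) := fun c => H.measurable_left.mul
    (H.measurable_right.comp_measurePreserving (measurePreserving_shift_spaceTime T c))
  have hle : ∀ c : Torus d, ∫⁻ z, ‖g z * h (z.1, z.2 + c)‖ₑ ∂(spaceTime d T)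
      ≤ ∫⁻ t in Icc 0 T, ENNReal.ofReal (B t) := by
    intro c
    unfold spaceTime
    rw [lintegral_prod _ (hm1 c).enorm]
    exact lintegral_mono_ae (by filter_upwards [hBd] with t ht using ht c)
  have hfin : ∫⁻ t in Icc 0 T, ENNReal.ofReal (B t) < ⊤ := hB.lintegral_lt_top
  have hint : ∀ c : Torus d, Integrable (fun z => g z * h (z.1, z.2 + c)) (spaceTime d T) :=
    fun c => ⟨hm1 c, (hle c).trans_lt hfin⟩
  refine ⟨?_, hint, ?_⟩
  · have hm := measurePreserving_skew (d := d) T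
    have mW : AEStronglyMeasurable (fun w : (ℝ × Torus d) × Torus d => g w.1 * h (w.1.1, w.2))
        ((spaceTime d T).prod volume) := H.measurable_left.comp_fst.mul
      (H.measurable_right.comp_measurePreserving (measurePreserving_forget T))
    have h1 := integrable_map_measure (μ := (spaceTime d T).prod volume)
      (hm.map_eq.symm ▸ mW) hm.measurable.aemeasurable
    rw [hm.map_eq] at h1
    refine h1.2 ⟨mW.comp_measurePreserving hm, ?_⟩
    have mW' := (mW.comp_measurePreserving hm).enorm
    unfold HasFiniteIntegral
    rw [lintegral_prod_symm _ mW']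
    refine lt_of_le_of_lt (lintegral_mono fun c => hle c) ?_
    simpa using hfin
  · have e : ∀ c, shiftCorr T g h c = ∫ t in Icc 0 T, ∫ x, g (t, x) * h (t, x + c) :=
      fun c => integral_prod _ (hint c)
    rw [funext e]
    refine continuous_of_dominated (bound := fun t => |B t|)
      (fun c => (hint c).integral_prod_left.aestronglyMeasurable) (fun c => ?_) hB.abs ?_
    · filter_upwards [hBd] with t ht
      refine (norm_integral_le_lintegral_norm _).trans ?_
      refine ENNReal.toReal_le_of_le_ofReal (abs_nonneg _) ?_
      simp only [ofReal_norm]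
      exact (ht c).trans (ENNReal.ofReal_le_ofReal (le_abs_self _))
    · filter_upwards [H.memLp, H.dual, H.measurable_left.prodMk_left] with t h1 ⟨a, b, hb, h2⟩ h3
      exact continuous_integral_mul_shift hq h3 h1 h2

theorem lintegral_enorm_mul_le {φ w : Torus d → ℝ} {C : ℝ} (hC : ∀ x, |φ x| ≤ C) {A : ℝ}
    (h : ∫⁻ x, ‖w x‖ₑ ≤ ENNReal.ofReal A) :
    ∫⁻ x, ‖φ x * w x‖ₑ ≤ ENNReal.ofReal (C * A) := by
  have hC0 : 0 ≤ C := (abs_nonneg _).trans (hC 0)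
  calc ∫⁻ x, ‖φ x * w x‖ₑ ≤ ∫⁻ x, ENNReal.ofReal C * ‖w x‖ₑ := by
        refine lintegral_mono fun x => ?_
        dsimp only
        rw [enorm_mul, Real.enorm_eq_ofReal_abs (φ x)]
        gcongr; exact hC x
    _ = ENNReal.ofReal C * ∫⁻ x, ‖w x‖ₑ := lintegral_const_mul' _ _ ENNReal.ofReal_ne_top
    _ ≤ ENNReal.ofReal C * ENNReal.ofReal A := by gcongr
    _ = _ := (ENNReal.ofReal_mul hC0).symm

theorem ShiftPair.smooth_mul_left {T : ℝ} {q : ℕ} {g h : ℝ × Torus d → ℝ}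
    (H : ShiftPair T q g h) {φ : ℝ → Torus d → ℝ} (hφ : IsSmooth φ) :
    ShiftPair T q (fun z => φ z.1 z.2 * g z) h := by
  obtain ⟨C, hC⟩ := hφ.bounded T
  obtain ⟨B, hB, hBd⟩ := H.bound
  refine ⟨hφ.continuous.aestronglyMeasurable.mul H.measurable_left, H.measurable_right, H.memLp,
    ?_, fun t => C * B t, hB.const_mul C, ?_⟩
  · filter_upwards [H.dual, ae_restrict_mem measurableSet_Icc] with t ⟨a, b, hb, h1⟩ ht
    have hC0 : 0 ≤ C := (abs_nonneg _).trans (hC t ht 0)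
    refine ⟨C * a, C * b, mul_nonneg hC0 hb, fun k hk => ?_⟩
    have := lintegral_enorm_mul_le (hC t ht) (h1 k hk)
    simp only [mul_assoc]
    rwa [← mul_add]
  · filter_upwards [hBd, ae_restrict_mem measurableSet_Icc] with t h1 ht c
    have := lintegral_enorm_mul_le (hC t ht) (h1 c)
    simpa only [mul_assoc] using this

theorem ShiftPair.smooth_mul_right {T : ℝ} {q : ℕ} {g h : ℝ × Torus d → ℝ}
    (H : ShiftPair T q g h) {φ : ℝ → Torus d → ℝ} (hφ : IsSmooth φ) :
    ShiftPair T q g (fun z => φ z.1 z.2 * h z) := by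
  obtain ⟨C, hC⟩ := hφ.bounded T
  obtain ⟨B, hB, hBd⟩ := H.bound
  refine ⟨H.measurable_left, hφ.continuous.aestronglyMeasurable.mul H.measurable_right,
    ?_, H.dual, fun t => C * B t, hB.const_mul C, ?_⟩
  · filter_upwards [H.memLp, ae_restrict_mem measurableSet_Icc] with t h1 ht
    exact h1.of_le_mul (c := C) ((hφ.slice t).continuous.aestronglyMeasurable.mul
      h1.aestronglyMeasurable) (Eventually.of_forall fun x => by
        rw [norm_mul]; exact mul_le_mul_of_nonneg_right (hC t ht x) (norm_nonneg _))
  · filter_upwards [hBd, ae_restrict_mem measurableSet_Icc] with t h1 ht c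
    have := lintegral_enorm_mul_le (φ := fun x => φ t (x + c)) (fun x => hC t ht _) (h1 c)
    simpa only [mul_left_comm (g _)] using this

/-! ### Functions in duality with the velocity -/

/-- At almost every time `∫ |g h| ≤ a + C ∫ |h|³ + b ∫ |h|²` for all `h ∈ L³(𝕋^d)`, with `a, b`
integrable in time. This covers `L^{3/2}_{t,x}` as well as `L¹_t L²_x`. -/
structure Tame (T : ℝ) (g : ℝ × Torus d → ℝ) (a b : ℝ → ℝ) (C : ℝ) : Prop where
  measurable : AEStronglyMeasurable g (spaceTime d T)
  integrable_left : Integrable a (volume.restrict (Icc 0 T))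
  integrable_right : Integrable b (volume.restrict (Icc 0 T))
  nonneg_left : ∀ t, 0 ≤ a t
  nonneg_right : ∀ t, 0 ≤ b t
  nonneg : 0 ≤ C
  bound : ∀ᵐ t ∂(volume.restrict (Icc 0 T)), ∀ h : Torus d → ℝ, MemLp h 3 volume →
    ∫⁻ x, ‖g (t, x) * h x‖ₑ ≤ ENNReal.ofReal (a t + C * (∫ x, |h x| ^ 3) + b t * ∫ x, |h x| ^ 2)

theorem integrable_abs_pow {X : Type*} [MeasurableSpace X] {μ : Measure X} {f : X → ℝ} {q : ℕ}
    (hf : MemLp f q μ) (hq : q ≠ 0) : Integrable (fun x => |f x| ^ q) μ := by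
  simpa using hf.integrable_norm_pow hq

theorem memLp_slice {T : ℝ} {q : ℕ} (hq : q ≠ 0) {h : ℝ × Torus d → ℝ}
    (hh : MemLp h q (spaceTime d T)) :
    ∀ᵐ t ∂(volume.restrict (Icc 0 T)), MemLp (fun x => h (t, x)) q volume := by
  have h1 := (integrable_abs_pow hh hq)
  unfold spaceTime at h1
  filter_upwards [h1.prod_right_ae, hh.aestronglyMeasurable.prodMk_left] with t h2 h3
  refine (integrable_norm_rpow_iff h3 (by exact_mod_cast hq) (by simp)).1 ?_
  simpa using h2

theorem integrable_slice {T : ℝ} {h : ℝ × Torus d → ℝ} (hh : Integrable h (spaceTime d T)) :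
    ∀ᵐ t ∂(volume.restrict (Icc 0 T)), Integrable (fun x => h (t, x)) volume := by
  unfold spaceTime at hh; exact hh.prod_right_ae

theorem integrable_time_integral {T : ℝ} {h : ℝ × Torus d → ℝ}
    (hh : Integrable h (spaceTime d T)) :
    Integrable (fun t => ∫ x, h (t, x)) (volume.restrict (Icc 0 T)) := by
  unfold spaceTime at hh; exact hh.integral_prod_left

theorem lintegral_enorm_le_of_abs_le {f F : Torus d → ℝ} (hF : Integrable F)
    (h : ∀ x, |f x| ≤ F x) : ∫⁻ x, ‖f x‖ₑ ≤ ENNReal.ofReal (∫ x, F x) := by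
  rw [ofReal_integral_eq_lintegral_ofReal hF
    (Eventually.of_forall fun x => (abs_nonneg _).trans (h x))]
  refine lintegral_mono fun x => ?_
  rw [Real.enorm_eq_ofReal_abs]
  exact ENNReal.ofReal_le_ofReal (h x)

/-- A pointwise Young inequality gives tameness. -/
theorem tame_of_young {T : ℝ} {g m : ℝ × Torus d → ℝ} {b C : ℝ}
    (hg : AEStronglyMeasurable g (spaceTime d T)) (hm : Integrable m (spaceTime d T))
    (hm0 : ∀ z, 0 ≤ m z) (hb : 0 ≤ b) (hC : 0 ≤ C)
    (hy : ∀ z y, |g z| * |y| ≤ m z + C * |y| ^ 3 + b * |y| ^ 2) :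
    Tame T g (fun t => ∫ x, m (t, x)) (fun _ => b) C where
  measurable := hg
  integrable_left := integrable_time_integral hm
  integrable_right := integrable_const _
  nonneg_left _ := integral_nonneg fun _ => hm0 _
  nonneg_right _ := hb
  nonneg := hC
  bound := by
    filter_upwards [integrable_slice hm] with t ht h hh
    have i3 : Integrable (fun x => |h x| ^ 3) := integrable_abs_pow hh (by norm_num)
    have i2 : Integrable (fun x => |h x| ^ 2) :=
      integrable_abs_pow (hh.mono_exponent (by norm_num)) (by norm_num)
    have i4 : Integrable (fun x => m (t, x) + C * |h x| ^ 3) := ht.add (i3.const_mul C)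
    rw [← integral_const_mul, ← integral_const_mul, ← integral_add ht (i3.const_mul C),
      ← integral_add i4 (i2.const_mul b)]
    refine lintegral_enorm_le_of_abs_le (i4.add (i2.const_mul b)) fun x => ?_
    rw [abs_mul]; exact hy _ _

/-- A pointwise Young inequality, with `h ∈ L^q_{t,x}`, gives continuous correlations. -/
theorem shiftPair_of_young {T : ℝ} {q : ℕ} (hq : q ≠ 0) {g h m : ℝ × Torus d → ℝ}
    (hg : AEStronglyMeasurable g (spaceTime d T)) (hm : Integrable m (spaceTime d T))
    (hh : MemLp h q (spaceTime d T)) (hy : ∀ z y, |g z| * |y| ≤ m z + |y| ^ q) :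
    ShiftPair T q g h where
  measurable_left := hg
  measurable_right := hh.aestronglyMeasurable
  memLp := memLp_slice hq hh
  dual := by
    filter_upwards [integrable_slice hm] with t ht
    refine ⟨∫ x, m (t, x), 1, zero_le_one, fun k hk => ?_⟩
    have ik := integrable_abs_pow hk hq
    rw [one_mul, ← integral_add ht ik]
    exact lintegral_enorm_le_of_abs_le (ht.add ik) fun x => by rw [abs_mul]; exact hy _ _
  bound := by
    refine ⟨fun t => (∫ x, m (t, x)) + ∫ x, |h (t, x)| ^ q, (integrable_time_integral hm).add
      (integrable_time_integral (integrable_abs_pow hh hq)), ?_⟩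
    filter_upwards [integrable_slice hm, memLp_slice hq hh] with t ht h1 c
    have ik := integrable_abs_pow (h1.shift c) hq
    rw [← integral_add_right_eq_self (fun x => |h (t, x)| ^ q) c, ← integral_add ht ik]
    exact lintegral_enorm_le_of_abs_le (ht.add ik) fun x => by rw [abs_mul]; exact hy _ _

/-- Tame functions have continuous correlations with the components of the velocity, which lie in
`L³_{t,x} ∩ L^∞_t L²_x`. -/
theorem Tame.shiftPair {T : ℝ} {g h : ℝ × Torus d → ℝ} {a b : ℝ → ℝ} {C : ℝ} (H : Tame T g a b C)
    (hh : MemLp h 3 (spaceTime d T)) {U : ℝ}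
    (hU : ∀ t ∈ Icc 0 T, ∫ x, |h (t, x)| ^ 2 ≤ U) : ShiftPair T 3 g h where
  measurable_left := H.measurable
  measurable_right := hh.aestronglyMeasurable
  memLp := memLp_slice (q := 3) (by norm_num) hh
  dual := by
    filter_upwards [H.bound] with t ht
    refine ⟨a t + b t, C + b t, add_nonneg H.nonneg (H.nonneg_right t), fun k hk => ?_⟩
    refine (ht k hk).trans (ENNReal.ofReal_le_ofReal ?_)
    have i3 : Integrable (fun x => |k x| ^ 3) := integrable_abs_pow hk (by norm_num)
    have i2 : Integrable (fun x => |k x| ^ 2) :=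
      integrable_abs_pow (hk.mono_exponent (by norm_num)) (by norm_num)
    -- the quadratic term is absorbed into the cubic one, as the torus has measure one
    have h1 : ∫ x, |k x| ^ 2 ≤ 1 + ∫ x, |k x| ^ 3 := by
      have : ∫ x, (1 + |k x| ^ 3) = 1 + ∫ x, |k x| ^ 3 := by
        rw [integral_add (integrable_const _) i3]; simp
      rw [← this]
      refine integral_mono i2 ((integrable_const _).add i3) fun x => ?_
      have := abs_nonneg (k x)
      dsimp only
      rcases le_total |k x| 1 with h | h
      · nlinarith [pow_nonneg this 3]
      · nlinarith [mul_nonneg (sq_nonneg |k x|) (sub_nonneg.2 h)]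
    nlinarith [mul_le_mul_of_nonneg_left h1 (H.nonneg_right t)]
  bound := by
    refine ⟨fun t => a t + C * (∫ x, |h (t, x)| ^ 3) + b t * U, ?_, ?_⟩
    · exact (H.integrable_left.add ((integrable_time_integral
        (integrable_abs_pow (q := 3) hh (by norm_num))).const_mul C)).add
        (H.integrable_right.mul_const U)
    · filter_upwards [H.bound, memLp_slice (q := 3) (by norm_num) hh,
        ae_restrict_mem measurableSet_Icc] with t ht h1 hT c
      refine (ht _ (h1.shift c)).trans (ENNReal.ofReal_le_ofReal ?_)
      rw [integral_add_right_eq_self (fun x => |h (t, x)| ^ 3) c,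
        integral_add_right_eq_self (fun x => |h (t, x)| ^ 2) c]
      have := mul_le_mul_of_nonneg_left (hU t hT) (H.nonneg_right t)
      linarith

/-! ### The pressure is tame -/

theorem abs_integral_le_of_lintegral {f : Torus d → ℝ} {A : ℝ} (hA : 0 ≤ A)
    (h : ∫⁻ x, ‖f x‖ₑ ≤ ENNReal.ofReal A) : |∫ x, f x| ≤ A := by
  refine (norm_integral_le_lintegral_norm f).trans (ENNReal.toReal_le_of_le_ofReal hA ?_)
  simpa only [ofReal_norm] using h

theorem integral_abs_sub_mean_pow_le {g : Torus d → ℝ} (hg : Continuous g) (n : ℕ) :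
    ∫ x, |g x - ∫ y, g y| ^ (n + 1) ≤ 2 ^ (n + 1) * ∫ x, |g x| ^ (n + 1) := by
  have i1 : Integrable (fun x => |g x| ^ (n + 1)) volume := (hg.abs.pow _).integrable_torus
  have hJ := abs_integral_pow_le hg.integrable_torus i1
  set m := ∫ y, g y
  calc ∫ x, |g x - m| ^ (n + 1)
      ≤ ∫ x, 2 ^ n * (|g x| ^ (n + 1) + |m| ^ (n + 1)) := by
        refine integral_mono ((hg.sub continuous_const).abs.pow _).integrable_torus
          ((i1.add (integrable_const _)).const_mul _) fun x => ?_
        exact (pow_le_pow_left₀ (abs_nonneg _) (abs_sub _ _) _).trans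
          (add_pow_le (abs_nonneg _) (abs_nonneg _) (n + 1))
    _ = 2 ^ n * ((∫ x, |g x| ^ (n + 1)) + |m| ^ (n + 1)) := by
        rw [integral_const_mul, integral_add i1 (integrable_const _)]; simp
    _ ≤ 2 ^ n * ((∫ x, |g x| ^ (n + 1)) + ∫ x, |g x| ^ (n + 1)) := by gcongr
    _ = _ := by ring

/-- The elliptic estimate for the pressure `p = -Δ⁻¹ (∂_i ∂_j (U^i U^j) - ∂_i F^i)`, tested with
trigonometric polynomials. -/
theorem pressure_trig_bound {p : Torus d → ℝ} (hp : Integrable p) {U : Torus d → E d}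
    (hU : MemLp U 3 volume) {F : Fin d → Torus d → ℝ} {a b C : Fin d → ℝ} (ha : ∀ i, 0 ≤ a i)
    (hb : ∀ i, 0 ≤ b i) (hC : ∀ i, 0 ≤ C i)
    (hF : ∀ i, ∀ k : Torus d → ℝ, MemLp k 3 volume → ∫⁻ x, ‖F i x * k x‖ₑ
      ≤ ENNReal.ofReal (a i + C i * (∫ x, |k x| ^ 3) + b i * ∫ x, |k x| ^ 2))
    (hE : ∀ s c, (∫ x, p x * lap (trig s c) x)
      + (∑ i, ∑ j, ∫ x, U x i * U x j * pd j (pd i (trig s c)) x)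
      + ∑ i, ∫ x, F i x * pd i (trig s c) x = 0)
    (s : Finset (Fin d → ℤ)) (c : (Fin d → ℤ) → ℂ) :
    ∫ x, p x * trig s c x ≤ (d ^ 2 * (∫ x, ‖U x‖ ^ 3) + ∑ i, a i)
      + (2 ^ 18 * (d ^ 2 + ∑ i, C i)) * (∫ x, |trig s c x| ^ 3)
      + (4 * ∑ i, b i) * (∫ x, |trig s c x| ^ 2) + (∫ x, |p x|) * ∫ x, |trig s c x| := by
  -- solve `Δw = g - ∫ g` for the trigonometric polynomial `g`
  obtain ⟨e, he⟩ := exists_lap_eq s c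
  set w := trig s e with hw
  have sw : SmoothT w := smoothT_trig s e
  have ct := (smoothT_trig s c).continuous
  set G3 := ∫ x, |lap w x| ^ 3 with hG3
  set G2 := ∫ x, |lap w x| ^ 2 with hG2
  have hG3' : G3 ≤ 2 ^ 3 * ∫ x, |trig s c x| ^ 3 := by
    rw [hG3]; simp only [he]; exact integral_abs_sub_mean_pow_le ct 2
  have hG2' : G2 ≤ 2 ^ 2 * ∫ x, |trig s c x| ^ 2 := by
    rw [hG2]; simp only [he]; exact integral_abs_sub_mean_pow_le ct 1
  have iU : Integrable (fun x => ‖U x‖ ^ 3) volume := hU.integrable_norm_pow (by norm_num)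
  -- the quadratic term, by Young's inequality and the `L³` bound of second derivatives
  have h1 : ∀ i j, -(∫ x, U x i * U x j * pd j (pd i w) x)
      ≤ (∫ x, ‖U x‖ ^ 3) + 2 ^ 15 * G3 := by
    intro i j
    have ci := ((sw.pd i).pd j).continuous
    have i3 : Integrable (fun x => |pd j (pd i w) x| ^ 3) volume := (ci.abs.pow 3).integrable_torus
    have h2 := integral_hessian_cube_le s e j i
    have h3 : |∫ x, U x i * U x j * pd j (pd i w) x|
        ≤ ∫ x, (‖U x‖ ^ 3 + |pd j (pd i w) x| ^ 3) := by
      refine abs_integral_le_of_lintegral (integral_nonneg fun x => by positivity)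
        (lintegral_enorm_le_of_abs_le (iU.add i3) fun x => ?_)
      rw [abs_mul, abs_mul]
      have h4 : |U x i| ≤ ‖U x‖ := PiLp.norm_apply_le (U x) i
      have h5 : |U x j| ≤ ‖U x‖ := PiLp.norm_apply_le (U x) j
      have h6 := norm_nonneg (U x)
      have h7 := abs_nonneg (pd j (pd i w) x)
      calc |U x i| * |U x j| * |pd j (pd i w) x| ≤ ‖U x‖ * ‖U x‖ * |pd j (pd i w) x| := by gcongr
        _ ≤ _ := by
          rcases le_total ‖U x‖ |pd j (pd i w) x| with h | h
          · nlinarith [pow_nonneg h6 3, mul_nonneg (mul_nonneg h7 (sub_nonneg.2 h)) h6,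
              mul_nonneg (mul_nonneg h7 (sub_nonneg.2 h)) h7]
          · nlinarith [pow_nonneg h7 3, mul_nonneg (mul_nonneg h6 (sub_nonneg.2 h)) h6]
    rw [integral_add iU i3] at h3
    have := neg_abs_le (∫ x, U x i * U x j * pd j (pd i w) x)
    linarith
  -- the force term, by the duality bound applied to `∂_i w`
  have h2 : ∀ i, -(∫ x, F i x * pd i w x) ≤ a i + C i * (2 ^ 15 * G3) + b i * G2 := by
    intro i
    have ci := (sw.pd i).continuous
    have hm : MemLp (pd i w) 3 volume := by
      obtain ⟨M, hM⟩ := (sw.pd i).bounded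
      exact MemLp.of_bound ci.aestronglyMeasurable M (Eventually.of_forall hM)
    have n3 : 0 ≤ ∫ x, |pd i w x| ^ 3 := integral_nonneg fun x => by positivity
    have n2 : 0 ≤ ∫ x, |pd i w x| ^ 2 := integral_nonneg fun x => by positivity
    have h3 := abs_integral_le_of_lintegral (add_nonneg (add_nonneg (ha i)
      (mul_nonneg (hC i) n3)) (mul_nonneg (hb i) n2)) (hF i _ hm)
    have h4 := (integral_pd_pow_le sw i 3).trans (integral_hessian_cube_le s e i i)
    have h5 : ∫ x, |pd i w x| ^ 2 ≤ G2 := by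
      refine (integral_pd_pow_le sw i 2).trans ?_
      have h6 := integral_hessian_sq s e i
      simp only [hG2, sq_abs]
      refine le_trans ?_ h6
      exact Finset.single_le_sum (f := fun k => ∫ x, pd k (pd i (trig s e)) x ^ 2)
        (fun k _ => integral_nonneg fun x => sq_nonneg _) (Finset.mem_univ i)
    have := neg_abs_le (∫ x, F i x * pd i w x)
    have := mul_le_mul_of_nonneg_left h4 (hC i)
    have := mul_le_mul_of_nonneg_left h5 (hb i)
    linarith
  have h3 : ∫ x, p x * lap w x ≤ d ^ 2 * ((∫ x, ‖U x‖ ^ 3) + 2 ^ 15 * G3)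
      + ((∑ i, a i) + (∑ i, C i) * (2 ^ 15 * G3) + (∑ i, b i) * G2) := by
    have h4 := Finset.sum_le_sum fun i (_ : i ∈ Finset.univ) =>
      Finset.sum_le_sum fun j (_ : j ∈ Finset.univ) => h1 i j
    have h5 := Finset.sum_le_sum fun i (_ : i ∈ Finset.univ) => h2 i
    simp only [Finset.sum_neg_distrib, Finset.sum_const, Finset.card_univ, Fintype.card_fin,
      nsmul_eq_mul, Finset.sum_add_distrib, ← Finset.sum_mul] at h4 h5
    have := hE s e
    rw [sq, mul_assoc]
    linarith
  obtain ⟨M, hM⟩ := (smoothT_trig s c).bounded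
  have ip : Integrable (fun x => p x * lap w x) volume := by
    have cl : Continuous (lap w) := by rw [hw, lap_trig]; exact (smoothT_trig _ _).continuous
    obtain ⟨N, hN⟩ := (isCompact_univ (X := Torus d)).exists_bound_of_continuousOn cl.continuousOn
    exact hp.mul_bdd (c := N) cl.aestronglyMeasurable (Eventually.of_forall fun x => hN x (mem_univ _))
  -- only the mean of `g` is not seen by `Δw`
  have h4 : ∫ x, p x * trig s c x = (∫ x, p x * lap w x) + (∫ x, p x) * ∫ x, trig s c x := by
    rw [← integral_mul_const, ← integral_add ip (hp.mul_const _)]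
    congr 1; ext x; rw [he]; ring
  have h5 : (∫ x, p x) * ∫ x, trig s c x ≤ (∫ x, |p x|) * ∫ x, |trig s c x| := by
    refine (le_abs_self _).trans ?_
    rw [abs_mul]
    gcongr <;> exact abs_integral_le_integral_abs
  have hC' : 0 ≤ ∑ i, C i := Finset.sum_nonneg fun i _ => hC i
  have hb' : 0 ≤ ∑ i, b i := Finset.sum_nonneg fun i _ => hb i
  have h6 := mul_le_mul_of_nonneg_left hG3'
    (show (0 : ℝ) ≤ 2 ^ 15 * (d ^ 2 + ∑ i, C i) by positivity)
  have h7 := mul_le_mul_of_nonneg_left hG2' hb'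
  rw [h4]
  linarith

/-! ### Integrability of the components -/

theorem aestronglyMeasurable_apply {X : Type*} [MeasurableSpace X] {μ : Measure X} {g : X → E d}
    (hg : AEStronglyMeasurable g μ) (i : Fin d) : AEStronglyMeasurable (fun x => g x i) μ :=
  (EuclideanSpace.proj (𝕜 := ℝ) i).continuous.comp_aestronglyMeasurable hg

theorem memLp_apply {X : Type*} [MeasurableSpace X] {μ : Measure X} {g : X → E d} {p : ℝ≥0∞}
    (hg : MemLp g p μ) (i : Fin d) : MemLp (fun x => g x i) p μ :=
  hg.of_le (aestronglyMeasurable_apply hg.aestronglyMeasurable i)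
    (Eventually.of_forall fun x => PiLp.norm_apply_le (g x) i)

/-- A function in `C⁰([0, T]; L²)` is bounded in `L²`, by compactness of `[0, T]`. -/
theorem exists_integral_sq_le {T : ℝ} {u : ℝ → Torus d → E d} (hu : MemC0L2 T u) :
    ∃ U : ℝ, ∀ t ∈ Icc 0 T, ∀ i, ∫ x, |u t x i| ^ 2 ≤ U := by
  have h1 : ∃ M : ℝ≥0∞, M ≠ ⊤ ∧ ∀ t ∈ Icc 0 T, eLpNorm (u t) 2 volume ≤ M := by
    -- local boundedness around each time, extended by compactness
    refine isCompact_Icc.induction_on (p := fun s => ∃ M : ℝ≥0∞, M ≠ ⊤ ∧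
      ∀ t ∈ s, t ∈ Icc 0 T → eLpNorm (u t) 2 volume ≤ M) ⟨0, by simp⟩ ?_ ?_ ?_ |>.imp
        fun M hM => ⟨hM.1, fun t ht => hM.2 t ht ht⟩
    · rintro s t hst ⟨M, hM, h⟩
      exact ⟨M, hM, fun r hr => h r (hst hr)⟩
    · rintro s t ⟨M, hM, h⟩ ⟨M', hM', h'⟩
      refine ⟨max M M', by simp [hM, hM'], ?_⟩
      rintro r (hr | hr) hrT
      · exact (h r hr hrT).trans (le_max_left _ _)
      · exact (h' r hr hrT).trans (le_max_right _ _)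
    · intro t₀ ht₀
      refine ⟨_, (hu.2 t₀ ht₀).eventually (gt_mem_nhds zero_lt_one),
        1 + eLpNorm (u t₀) 2 volume, by simpa using (hu.1 t₀ ht₀).2.ne, fun t ht htT => ?_⟩
      calc eLpNorm (u t) 2 volume = eLpNorm (u t - u t₀ + u t₀) 2 volume := by rw [sub_add_cancel]
        _ ≤ eLpNorm (u t - u t₀) 2 volume + eLpNorm (u t₀) 2 volume :=
            eLpNorm_add_le ((hu.1 t htT).sub (hu.1 t₀ ht₀)).aestronglyMeasurable
              (hu.1 t₀ ht₀).aestronglyMeasurable (by norm_num)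
        _ ≤ _ := by gcongr; exact le_of_lt ht
  obtain ⟨M, hM, h⟩ := h1
  refine ⟨M.toReal ^ 2, fun t ht i => ?_⟩
  have h2 := integral_abs_pow_eq (q := 2) (by norm_num) (memLp_apply (hu.1 t ht) i)
  rw [h2]
  refine pow_le_pow_left₀ ENNReal.toReal_nonneg (ENNReal.toReal_mono hM ?_) 2
  exact (eLpNorm_mono fun x => PiLp.norm_apply_le (u t x) i).trans (h t ht)

theorem young_sqrt (x y : ℝ) : |x| * |y| ≤ |x| * √|x| + |y| ^ 3 := by
  have hx := abs_nonneg x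
  have hy := abs_nonneg y
  rcases le_total (|y| ^ 2) |x| with h | h
  · have : |y| ≤ √|x| := Real.le_sqrt_of_sq_le h
    nlinarith [mul_le_mul_of_nonneg_left this hx, pow_nonneg hy 3]
  · nlinarith [mul_nonneg hx (Real.sqrt_nonneg |x|), mul_nonneg hy (sub_nonneg.2 h)]

/-- Forces of either class are tame. For `f ∈ L¹_t L²_x` use Young's inequality with the weight
`1 + ‖f(t)‖_{L²}`. -/
theorem force_tame {T : ℝ} {f : ℝ → Torus d → E d} (hf : MemLpTX T (3 / 2) f ∨ MemL1L2 T f)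
    (i : Fin d) : Integrable (fun z : ℝ × Torus d => f z.1 z.2 i) (spaceTime d T) ∧
      ∃ a b C, Tame T (fun z : ℝ × Torus d => f z.1 z.2 i) a b C := by
  rcases hf with hf | ⟨hfm, hf⟩
  · have h1 := memLp_apply hf i
    have h32 : (1 : ℝ≥0∞) ≤ 3 / 2 := by
      rw [ENNReal.le_div_iff_mul_le (by simp) (by simp)]; norm_num
    refine ⟨h1.integrable h32, _, _, _, tame_of_young
      (m := fun z : ℝ × Torus d => |f z.1 z.2 i| * √|f z.1 z.2 i|) (b := 0) (C := 1)
      h1.aestronglyMeasurable ?_ (fun z => by positivity) le_rfl zero_le_one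
      fun z y => by linarith [young_sqrt (f z.1 z.2 i) y]⟩
    refine (h1.integrable_norm_rpow (by simp) (by finiteness)).congr
      (Eventually.of_forall fun z => ?_)
    have e : (3 / 2 : ℝ≥0∞).toReal = 1 + 1 / 2 := by simp; norm_num
    simp only [e]
    rw [Real.rpow_add_of_nonneg (norm_nonneg _) zero_le_one (by norm_num), Real.rpow_one,
      ← Real.sqrt_eq_rpow, Real.norm_eq_abs]
  · set N : ℝ → ℝ≥0∞ := fun t => eLpNorm (f t) 2 volume with hN
    have mN : AEMeasurable N (volume.restrict (Icc 0 T)) := by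
      have h1 : ∀ t, N t = (∫⁻ x, ‖f t x‖ₑ ^ (2 : ℝ)) ^ (1 / (2 : ℝ)) := by
        intro t
        simp [hN, eLpNorm_eq_lintegral_rpow_enorm_toReal]
      rw [funext h1]
      unfold spaceTime at hfm
      exact ((hfm.enorm.pow_const 2).lintegral_prod_right').pow_const _
    have hfin := ae_lt_top' mN hf.ne
    have iN : Integrable (fun t => (N t).toReal) (volume.restrict (Icc 0 T)) :=
      integrable_toReal_of_lintegral_ne_top mN hf.ne
    have m1 := aestronglyMeasurable_apply hfm i
    have hslice : ∀ᵐ t ∂(volume.restrict (Icc 0 T)), MemLp (f t) 2 volume := by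
      have := hfm
      unfold spaceTime at this
      filter_upwards [hfin, this.prodMk_left] with t h1 h2 using ⟨h2, h1⟩
    refine ⟨⟨m1, ?_⟩, fun t => 1 + (N t).toReal, fun t => 1 + (N t).toReal, 0, m1,
      (integrable_const _).add iN, (integrable_const _).add iN, fun t => by positivity,
      fun t => by positivity, le_rfl, ?_⟩
    · unfold HasFiniteIntegral spaceTime
      have m2 := m1.enorm
      unfold spaceTime at m2
      rw [lintegral_prod _ m2]
      refine lt_of_le_of_lt (lintegral_mono_ae ?_) hf
      filter_upwards [hslice] with t ht
      have h2 := memLp_apply ht i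
      calc ∫⁻ x, ‖f t x i‖ₑ = eLpNorm (fun x => f t x i) 1 volume := eLpNorm_one_eq_lintegral_enorm.symm
        _ ≤ eLpNorm (fun x => f t x i) 2 volume :=
            eLpNorm_le_eLpNorm_of_exponent_le (by norm_num) h2.aestronglyMeasurable
        _ ≤ _ := eLpNorm_mono fun x => PiLp.norm_apply_le (f t x) i
    · filter_upwards [hslice] with t ht h hh
      have h1 := memLp_apply ht i
      have if2 : Integrable (fun x => |f t x i| ^ 2) := integrable_abs_pow h1 (by norm_num)
      have ih2 : Integrable (fun x => |h x| ^ 2) :=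
        integrable_abs_pow (hh.mono_exponent (by norm_num)) (by norm_num)
      -- the weight; the summand `1` avoids a division by zero
      set n := 1 + (N t).toReal with hn
      have hn0 : 0 < n := by positivity
      have h2 : ∫ x, |f t x i| ^ 2 ≤ n ^ 2 := by
        rw [integral_abs_pow_eq (q := 2) (by norm_num) h1]
        refine pow_le_pow_left₀ ENNReal.toReal_nonneg ?_ 2
        have : (eLpNorm (fun x => f t x i) (2 : ℕ) volume).toReal ≤ (N t).toReal :=
          ENNReal.toReal_mono ht.2.ne (eLpNorm_mono fun x => PiLp.norm_apply_le (f t x) i)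
        linarith
      refine (lintegral_enorm_le_of_abs_le (F := fun x => n⁻¹ * |f t x i| ^ 2 + n * |h x| ^ 2)
        ((if2.const_mul _).add (ih2.const_mul _)) fun x => ?_).trans
        (ENNReal.ofReal_le_ofReal ?_)
      · rw [abs_mul]
        set α := |f t x i|
        set β := |h x|
        have h3 : n⁻¹ * α ^ 2 + n * β ^ 2 - 2 * (α * β) = n⁻¹ * (α - n * β) ^ 2 := by
          field_simp; ring
        have h4 : 0 ≤ n⁻¹ * (α - n * β) ^ 2 := by positivity
        have h5 : 0 ≤ α * β := mul_nonneg (abs_nonneg _) (abs_nonneg _)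
        linarith
      · rw [integral_add (if2.const_mul _) (ih2.const_mul _), integral_const_mul,
          integral_const_mul]
        have : n⁻¹ * ∫ x, |f t x i| ^ 2 ≤ n := by
          rw [inv_mul_le_iff₀ hn0]; linarith
        linarith

/-! ### The pressure equation at almost every time -/

/-- The weak form of `-Δp = ∂_i ∂_j (u^i u^j) - ∂_i f^i`, at almost every time and for all
trigonometric polynomials simultaneously. It is the momentum equation tested with `χ(t) ∇w(x)`. -/
theorem ae_pressure_equation {T ν : ℝ} {u : ℝ → Torus d → E d} {p : ℝ → Torus d → ℝ}
    {f : ℝ → Torus d → E d} {u₀ : Torus d → E d} {G : Fin d → ℝ → Torus d → E d}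
    (hu : IsWeakSolution T ν u p f u₀ G) (huH : ν ≠ 0 → MemL2H1 T u G)
    (hui : ∀ i, Integrable (fun z : ℝ × Torus d => u z.1 z.2 i) (spaceTime d T))
    (huu : ∀ i j, Integrable (fun z : ℝ × Torus d => u z.1 z.2 i * u z.1 z.2 j) (spaceTime d T))
    (hf : ∀ i, Integrable (fun z : ℝ × Torus d => f z.1 z.2 i) (spaceTime d T)) :
    ∀ᵐ t ∂(volume.restrict (Icc 0 T)), ∀ s c, (∫ x, p t x * lap (trig s c) x)
      + (∑ i, ∑ j, ∫ x, u t x i * u t x j * pd j (pd i (trig s c)) x)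
      + ∑ i, ∫ x, f t x i * pd i (trig s c) x = 0 := by
  have hp := hu.pressure_integrable
  -- the integrand for the test function `w`
  let Z : (Torus d → ℝ) → ℝ × Torus d → ℝ := fun w z => p z.1 z.2 * lap w z.2
    + (∑ i, ∑ j, u z.1 z.2 i * u z.1 z.2 j * pd j (pd i w) z.2) + ∑ i, f z.1 z.2 i * pd i w z.2
  have slap : ∀ {w : Torus d → ℝ}, SmoothT w → SmoothT (lap w) := fun {w} hw => by
    have : SmoothT (fun x => ∑ k, pd k (pd k w) x) := ContDiff.sum fun k _ => (hw.pd k).pd k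
    exact this
  have mul_int : ∀ {g : ℝ × Torus d → ℝ} {w : Torus d → ℝ}, Integrable g (spaceTime d T) →
      SmoothT w → Integrable (fun z => g z * w z.2) (spaceTime d T) := fun {g w} hg hw => by
    have := integrable_moment hg hw
    simpa only [mul_comm] using this
  have iZ : ∀ {w}, SmoothT w → Integrable (Z w) (spaceTime d T) := fun {w} hw =>
    ((mul_int hp (slap hw)).add (integrable_finsetSum _ fun i _ => integrable_finsetSum _ fun j _ =>
      mul_int (huu i j) ((hw.pd i).pd j))).add
      (integrable_finsetSum _ fun i _ => mul_int (hf i) (hw.pd i))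
  -- the equation for a single trigonometric polynomial
  have h1 : ∀ s c, ∀ᵐ t ∂(volume.restrict (Icc 0 T)), ∫ x, Z (trig s c) (t, x) = 0 := by
    intro s c
    set w := trig s c with hw
    have sw : SmoothT w := smoothT_trig s c
    refine ae_eq_zero_of_tests (integrable_time_integral (iZ sw)) fun χ hχ _ hs => ?_
    have hχ0 : χ 0 = 0 := by
      by_contra h; exact lt_irrefl _ (hs (subset_tsupport _ h)).1
    have hχT : χ T = 0 := by
      by_contra h; exact lt_irrefl _ (hs (subset_tsupport _ h)).2
    have hφ : ∀ {q : Torus d → ℝ}, SmoothT q → IsSmooth (fun t x => χ t * q x) := fun hq =>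
      (isSmooth_time hχ).mul hq.isSmooth
    have hmom := hu.momentum (fun i t x => χ t * pd i w x) fun i => hφ (sw.pd i)
    have pdχ : ∀ {q : Torus d → ℝ}, SmoothT q → ∀ k t x,
        pd k (fun x => χ t * q x) x = χ t * pd k q x := fun hq k t x => pd_const_mul hq _ k x
    have dtχ : ∀ (q : Torus d → ℝ) t x, dt (fun t x => χ t * q x) t x = deriv χ t * q x := by
      intro q t x
      exact (((hχ.differentiable (by simp)) t).hasDerivAt.mul_const (q x)).deriv
    simp only [hχ0, hχT, zero_mul, sub_zero, Finset.sum_const_zero, integral_zero, zero_add, dtχ,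
      pdχ (sw.pd _)] at hmom
    have smooth' : ContDiff ℝ ∞ (deriv χ) := (contDiff_infty_iff_deriv.1 hχ).2
    have i1 : Integrable (fun z : ℝ × Torus d => ∑ i, deriv χ z.1 * pd i w z.2 * u z.1 z.2 i)
        (spaceTime d T) := integrable_finsetSum _ fun i _ =>
      integrable_smooth_mul (hui i) ((isSmooth_time smooth').mul (sw.pd i).isSmooth)
    -- a gradient is orthogonal to the velocity, so the time derivative contributes nothing
    have z1 : ∫ z, (∑ i, deriv χ z.1 * pd i w z.2 * u z.1 z.2 i) ∂(spaceTime d T) = 0 := by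
      have := hu.div_free (fun t x => deriv χ t * w x) ((isSmooth_time smooth').mul sw.isSmooth)
      refine Eq.trans ?_ this
      congr 1; ext z
      refine Finset.sum_congr rfl fun i _ => ?_
      rw [pd_const_mul sw]; ring
    -- likewise for the viscous term, after moving `∂_j` from `∂_j u` back to the test function
    have z2 : ν * ∫ z, (∑ i, ∑ j, χ z.1 * pd j (pd i w) z.2 * G j z.1 z.2 i) ∂(spaceTime d T) = 0
        ∧ (Integrable (fun z => ν * ∑ i, ∑ j, χ z.1 * pd j (pd i w) z.2 * G j z.1 z.2 i)
          (spaceTime d T)) := by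
      by_cases hν : ν = 0
      · simp [hν]
      have hG := huH hν
      have iG : ∀ i j, Integrable (fun z => χ z.1 * pd j (pd i w) z.2 * G j z.1 z.2 i)
          (spaceTime d T) := fun i j =>
        integrable_smooth_mul ((memLp_apply (hG j).1 i).integrable (by norm_num))
          (hφ ((sw.pd i).pd j))
      refine ⟨?_, (integrable_finsetSum _ fun i _ => integrable_finsetSum _ fun j _ =>
        iG i j).const_mul ν⟩
      rw [integral_finsetSum _ fun i _ => integrable_finsetSum _ fun j _ => iG i j]
      simp_rw [fun i => integral_finsetSum Finset.univ fun j _ => iG i j]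
      have e1 : ∀ i j, ∫ z, χ z.1 * pd j (pd i w) z.2 * G j z.1 z.2 i ∂(spaceTime d T)
          = - ∫ z, u z.1 z.2 i * pd i (fun x => χ z.1 * pd j (pd j w) x) z.2 ∂(spaceTime d T) := by
        intro i j
        have h2 := (hG j).2 _ (hφ ((sw.pd i).pd j)) i
        have e2 : pd j (pd j (pd i w)) = pd i (pd j (pd j w)) := by
          simp only [hw, pd_trig]; congr 1; ext m; ring
        simp only [pdχ ((sw.pd _).pd _), e2] at h2 ⊢
        rw [h2, neg_neg]
        congr 1; ext z; ring
      simp_rw [e1]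
      rw [Finset.sum_comm]
      refine mul_eq_zero_of_right _ (Finset.sum_eq_zero fun j _ => ?_)
      have h3 := hu.div_free _ (hφ ((sw.pd j).pd j))
      rw [integral_finsetSum _ fun i _ => ?_] at h3
      · rw [Finset.sum_neg_distrib, h3, neg_zero]
      · simp only [pdχ ((sw.pd _).pd _)]
        have := integrable_smooth_mul (hui i) (hφ (((sw.pd j).pd j).pd i))
        simpa only [mul_comm] using this
    have e3 : ∫ t in Icc 0 T, χ t * ∫ x, Z w (t, x)
        = ∫ z, χ z.1 * Z w z ∂(spaceTime d T) := by
      have := integrable_smooth_mul (iZ sw) (isSmooth_time hχ)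
      unfold spaceTime at this ⊢
      rw [integral_prod _ this]
      simp_rw [integral_const_mul]
    rw [e3]
    have i4 : Integrable (fun z : ℝ × Torus d => ∑ i, χ z.1 * pd i w z.2 * f z.1 z.2 i)
        (spaceTime d T) := integrable_finsetSum _ fun i _ =>
      integrable_smooth_mul (hf i) (hφ (sw.pd i))
    have i5 : Integrable (fun z : ℝ × Torus d => ∑ i, ∑ j, χ z.1 * pd j (pd i w) z.2 * u z.1 z.2 i
        * u z.1 z.2 j) (spaceTime d T) := integrable_finsetSum _ fun i _ =>
      integrable_finsetSum _ fun j _ => by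
        have := integrable_smooth_mul (huu i j) (hφ ((sw.pd i).pd j))
        simpa only [mul_assoc] using this
    have i6 : Integrable (fun z : ℝ × Torus d => ∑ i, χ z.1 * pd i (pd i w) z.2 * p z.1 z.2)
        (spaceTime d T) := integrable_finsetSum _ fun i _ =>
      integrable_smooth_mul hp (hφ ((sw.pd i).pd i))
    rw [integral_sub ((i1.fun_add i5).fun_add i6) z2.2, integral_const_mul, z2.1, sub_zero,
      integral_add (i1.fun_add i5) i6, integral_add i1 i5, z1, zero_add] at hmom
    have e4 : ∫ z, χ z.1 * Z w z ∂(spaceTime d T)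
        = (∫ z, ∑ i, χ z.1 * pd i w z.2 * f z.1 z.2 i ∂(spaceTime d T))
          + ((∫ z, ∑ i, ∑ j, χ z.1 * pd j (pd i w) z.2 * u z.1 z.2 i * u z.1 z.2 j
            ∂(spaceTime d T)) + ∫ z, ∑ i, χ z.1 * pd i (pd i w) z.2 * p z.1 z.2
            ∂(spaceTime d T)) := by
      rw [← integral_add i5 i6, ← integral_add i4 (i5.fun_add i6)]
      congr 1; ext z
      simp only [Z, lap, mul_add, Finset.mul_sum]
      rw [add_comm, add_comm (∑ i, χ z.1 * (p z.1 z.2 * pd i (pd i w) z.2))]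
      congr 1
      · exact Finset.sum_congr rfl fun i _ => by ring
      congr 1
      · exact Finset.sum_congr rfl fun i _ => Finset.sum_congr rfl fun j _ => by ring
      · exact Finset.sum_congr rfl fun i _ => by ring
    rw [e4, hmom]; ring
  -- countably many frequencies suffice, by linearity
  have h2 : ∀ᵐ t ∂(volume.restrict (Icc 0 T)), ∀ k : Fin d → ℤ,
      (∫ x, Z (trig {k} fun _ => 1) (t, x) = 0 ∧ Integrable fun x => Z (trig {k} fun _ => 1) (t, x))
      ∧ ∫ x, Z (trig {k} fun _ => Complex.I) (t, x) = 0
        ∧ Integrable fun x => Z (trig {k} fun _ => Complex.I) (t, x) := by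
    rw [ae_all_iff]
    intro k
    filter_upwards [h1 {k} fun _ => 1, h1 {k} fun _ => Complex.I,
      integrable_slice (iZ (smoothT_trig {k} fun _ => 1)),
      integrable_slice (iZ (smoothT_trig {k} fun _ => Complex.I))] with t a b c e
    exact ⟨⟨a, c⟩, b, e⟩
  filter_upwards [h2, integrable_slice hp, ae_all_iff.2 fun i => ae_all_iff.2 fun j =>
    integrable_slice (huu i j), ae_all_iff.2 fun i => integrable_slice (hf i)]
    with t h3 h4 h5 h6 s c
  have lin : ∀ (s : Finset (Fin d → ℤ)) (c : (Fin d → ℤ) → ℂ) x, trig s c x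
      = ∑ k ∈ s, ((c k).re * trig {k} (fun _ => 1) x + (c k).im * trig {k} (fun _ => Complex.I) x) := by
    intro s c x
    simp only [trig, Finset.sum_singleton, Complex.re_sum]
    refine Finset.sum_congr rfl fun k _ => ?_
    simp
    ring
  have lin1 : ∀ i x, pd i (trig s c) x = ∑ k ∈ s, ((c k).re * pd i (trig {k} fun _ => 1) x
      + (c k).im * pd i (trig {k} fun _ => Complex.I) x) := by
    intro i x
    simp only [pd_trig, trig, Finset.sum_singleton, Complex.re_sum]
    refine Finset.sum_congr rfl fun k _ => ?_
    simp
    ring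
  have lin2 : ∀ i j x, pd j (pd i (trig s c)) x
      = ∑ k ∈ s, ((c k).re * pd j (pd i (trig {k} fun _ => 1)) x
      + (c k).im * pd j (pd i (trig {k} fun _ => Complex.I)) x) := by
    intro i j x
    simp only [pd_trig, trig, Finset.sum_singleton, Complex.re_sum]
    refine Finset.sum_congr rfl fun k _ => ?_
    simp
    ring
  have hZ : ∀ x, Z (trig s c) (t, x) = ∑ k ∈ s, ((c k).re * Z (trig {k} fun _ => 1) (t, x)
      + (c k).im * Z (trig {k} fun _ => Complex.I) (t, x)) := by
    intro x
    simp only [Z, lap, lin1, lin2, Finset.mul_sum, mul_add, Finset.sum_add_distrib]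
    have comm1 : ∀ F : Fin d → (Fin d → ℤ) → ℝ, ∑ i, ∑ k ∈ s, F i k = ∑ k ∈ s, ∑ i, F i k :=
      fun F => Finset.sum_comm
    simp only [comm1, mul_left_comm (p t x), mul_left_comm (f t x _),
      mul_left_comm (u t x _ * u t x _)]
    ring
  have h7 : ∫ x, Z (trig s c) (t, x) = 0 := by
    simp_rw [hZ]
    rw [integral_finsetSum _ fun k _ => ((h3 k).1.2.const_mul _).fun_add ((h3 k).2.2.const_mul _)]
    refine Finset.sum_eq_zero fun k _ => ?_
    rw [integral_add ((h3 k).1.2.const_mul _) ((h3 k).2.2.const_mul _), integral_const_mul,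
      integral_const_mul, (h3 k).1.1, (h3 k).2.1]
    simp
  have sw := smoothT_trig s c
  have mul_int' : ∀ {g w : Torus d → ℝ}, Integrable g → SmoothT w →
      Integrable (fun x => g x * w x) := fun {g w} hg hw => by
    obtain ⟨N, hN⟩ := hw.bounded
    exact hg.mul_bdd (c := N) hw.continuous.aestronglyMeasurable (Eventually.of_forall hN)
  have j1 := mul_int' h4 (slap sw)
  have j2 := fun i j => mul_int' (h5 i j) ((sw.pd i).pd j)
  have j3 := fun i => mul_int' (h6 i) (sw.pd i)
  simp only [Z] at h7
  rw [integral_add (j1.fun_add (integrable_finsetSum _ fun i _ => integrable_finsetSum _ fun j _ =>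
    j2 i j)) (integrable_finsetSum _ fun i _ => j3 i), integral_add j1 (integrable_finsetSum _
    fun i _ => integrable_finsetSum _ fun j _ => j2 i j), integral_finsetSum _ fun i _ =>
    integrable_finsetSum _ fun j _ => j2 i j, integral_finsetSum _ fun i _ => j3 i] at h7
  simp_rw [fun i => integral_finsetSum Finset.univ fun j _ => j2 i j] at h7
  exact h7

theorem integrable_mul_apply {T : ℝ} {u : ℝ → Torus d → E d} (hu3 : MemLpTX T 3 u) (i j : Fin d) :
    Integrable (fun z : ℝ × Torus d => u z.1 z.2 i * u z.1 z.2 j) (spaceTime d T) := by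
  have h : ∀ i, MemLp (fun z : ℝ × Torus d => u z.1 z.2 i) 2 (spaceTime d T) := fun i =>
    (memLp_apply hu3 i).mono_exponent (by norm_num)
  exact (h i).integrable_mul (h j)

theorem integrable_norm_cube {T : ℝ} {u : ℝ → Torus d → E d} (hu3 : MemLpTX T 3 u) :
    Integrable (fun z : ℝ × Torus d => ‖u z.1 z.2‖ ^ 3) (spaceTime d T) :=
  MemLp.integrable_norm_pow (p := 3) hu3 (by norm_num)

theorem young_cube {x y : ℝ} (hx : 0 ≤ x) (hy : 0 ≤ y) : x ^ 2 * y ≤ x ^ 3 + y ^ 3 := by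
  rcases le_total x y with h | h
  · nlinarith [pow_nonneg hx 3, mul_nonneg (mul_nonneg hy (sub_nonneg.2 h)) hx,
      mul_nonneg (mul_nonneg hy (sub_nonneg.2 h)) hy]
  · nlinarith [pow_nonneg hy 3, mul_nonneg (mul_nonneg hx (sub_nonneg.2 h)) hx]

theorem abs_mul_apply_le (v : E d) (i j : Fin d) : |v i * v j| ≤ ‖v‖ ^ 2 := by
  rw [abs_mul, sq]
  exact mul_le_mul (PiLp.norm_apply_le v i) (PiLp.norm_apply_le v j) (abs_nonneg _) (norm_nonneg _)

/-- The pressure is tame: the elliptic estimate for trigonometric polynomials extends to `L³` by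
duality, and `∫ |h| ≤ 1 + ∫ |h|²` removes the term with the mean. -/
theorem pressure_tame {T ν : ℝ} {u : ℝ → Torus d → E d} {p : ℝ → Torus d → ℝ}
    {f : ℝ → Torus d → E d} {u₀ : Torus d → E d} {G : Fin d → ℝ → Torus d → E d}
    (hu : IsWeakSolution T ν u p f u₀ G) (hu3 : MemLpTX T 3 u)
    (huH : ν ≠ 0 → MemL2H1 T u G) (hf : MemLpTX T (3 / 2) f ∨ MemL1L2 T f) :
    ∃ a b C, Tame T (fun z : ℝ × Torus d => p z.1 z.2) a b C := by
  have hp := hu.pressure_integrable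
  choose a b C hT using fun i => (force_tame hf i).2
  have huu := integrable_mul_apply hu3
  have h3 := integrable_norm_cube hu3
  have hE := ae_pressure_equation hu huH
    (fun i => (memLp_apply hu3 i).integrable (by norm_num)) huu fun i => (force_tame hf i).1
  refine ⟨fun t => (d ^ 2 * (∫ x, ‖u t x‖ ^ 3) + ∑ i, a i t) + ∫ x, |p t x|,
    fun t => 4 * (∑ i, b i t) + ∫ x, |p t x|, 2 ^ 18 * (d ^ 2 + ∑ i, C i),
    hp.aestronglyMeasurable, ?_, ?_, fun t => ?_, fun t => ?_, ?_, ?_⟩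
  · exact (((integrable_time_integral h3).const_mul _).add
      (integrable_finsetSum _ fun i _ => (hT i).integrable_left)).add
      (integrable_time_integral hp.abs)
  · exact ((integrable_finsetSum _ fun i _ => (hT i).integrable_right).const_mul 4).add
      (integrable_time_integral hp.abs)
  · have h1 : 0 ≤ ∑ i, a i t := Finset.sum_nonneg fun i _ => (hT i).nonneg_left t
    positivity
  · have h1 : 0 ≤ ∑ i, b i t := Finset.sum_nonneg fun i _ => (hT i).nonneg_right t
    positivity
  · have h1 : 0 ≤ ∑ i, C i := Finset.sum_nonneg fun i _ => (hT i).nonneg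
    positivity
  · have hslice : ∀ᵐ t ∂(volume.restrict (Icc 0 T)), MemLp (u t) 3 volume := by
      have hm := hu3.aestronglyMeasurable
      unfold spaceTime at hm
      filter_upwards [integrable_slice h3, hm.prodMk_left] with t h1 h2
      refine (integrable_norm_rpow_iff h2 (by norm_num) (by norm_num)).1 ?_
      simpa using h1
    filter_upwards [hE, hslice, integrable_slice hp, ae_all_iff.2 fun i => (hT i).bound]
      with t hEt hut hpt hTt h hh
    have h1 := pressure_trig_bound hpt hut (F := fun i x => f t x i) (fun i => (hT i).nonneg_left t)
      (fun i => (hT i).nonneg_right t) (fun i => (hT i).nonneg) hTt hEt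
    have hb : 0 ≤ ∑ i, b i t := Finset.sum_nonneg fun i _ => (hT i).nonneg_right t
    have hC : 0 ≤ ∑ i, C i := Finset.sum_nonneg fun i _ => (hT i).nonneg
    have hm : 0 ≤ ∫ x, |p t x| := integral_nonneg fun x => abs_nonneg _
    refine (lintegral_mul_le_of_trig hpt (by positivity) (by positivity) hm h1 hh).trans
      (ENNReal.ofReal_le_ofReal ?_)
    have i2 : Integrable (fun x => |h x| ^ 2) :=
      integrable_abs_pow (hh.mono_exponent (by norm_num)) (by norm_num)
    have i1 : Integrable (fun x => |h x|) := (hh.integrable (by norm_num)).abs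
    -- the mean of `h` is absorbed into the quadratic term
    have h2 : ∫ x, |h x| ≤ 1 + ∫ x, |h x| ^ 2 := by
      have : ∫ x, (1 + |h x| ^ 2) = 1 + ∫ x, |h x| ^ 2 := by
        rw [integral_add (integrable_const _) i2]; simp
      rw [← this]
      exact integral_mono i1 ((integrable_const _).add i2) fun x => by
        dsimp only; nlinarith [sq_nonneg (|h x| - 1)]
    nlinarith [mul_le_mul_of_nonneg_left h2 hm]

/-! ### Balance laws and correlations of a weak solution -/

/-- The balance laws of a weak solution, in components, together with the continuity of all
two-point correlations that enter the balance of the two-point energy. `G k i` is `∂_k u^i`. -/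
structure Flow (T ν : ℝ) (u : Fin d → ℝ × Torus d → ℝ) (p : ℝ × Torus d → ℝ)
    (f : Fin d → ℝ × Torus d → ℝ) (G : Fin d → Fin d → ℝ × Torus d → ℝ) : Prop where
  evolution : ∀ i, EvolutionLaw T (u i)
    (fun k z => u i z * u k z + (if k = i then p z else 0) - ν * G k i z) (f i)
  incompressible : StationaryLaw T u (fun _ => 0)
  gradient : ν ≠ 0 → ∀ k i, StationaryLaw T (fun l z => if l = k then u i z else 0) (G k i)
  velocity : ∀ i j, ShiftPair T 3 (u i) (u j)
  transport : ∀ i k j, ShiftPair T 3 (fun z => u i z * u k z) (u j)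
  pressure : ∀ j, ShiftPair T 3 p (u j)
  force : ∀ i j, ShiftPair T 3 (f i) (u j)
  cubic : ∀ i j k, ShiftPair T 1 (fun _ => 1) (fun z => u i z * u j z * u k z)
  gradient_velocity : ν ≠ 0 → ∀ k i j, ShiftPair T 3 (G k i) (u j)
  gradient_gradient : ν ≠ 0 → ∀ k i j, ShiftPair T 2 (G k i) (G k j)

/-- The momentum equation for a single component. -/
theorem IsWeakSolution.evolutionLaw {T ν : ℝ} {u : ℝ → Torus d → E d} {p : ℝ → Torus d → ℝ}
    {f : ℝ → Torus d → E d} {u₀ : Torus d → E d} {G : Fin d → ℝ → Torus d → E d}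
    (hu : IsWeakSolution T ν u p f u₀ G)
    (hui : ∀ i, Integrable (fun z : ℝ × Torus d => u z.1 z.2 i) (spaceTime d T))
    (huu : ∀ i j, Integrable (fun z : ℝ × Torus d => u z.1 z.2 i * u z.1 z.2 j) (spaceTime d T))
    (hf : ∀ i, Integrable (fun z : ℝ × Torus d => f z.1 z.2 i) (spaceTime d T))
    (hG : ∀ k i, Integrable (fun z : ℝ × Torus d => ν * G k z.1 z.2 i) (spaceTime d T))
    (i : Fin d) :
    EvolutionLaw T (fun z : ℝ × Torus d => u z.1 z.2 i) (fun k z => u z.1 z.2 i * u z.1 z.2 k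
      + (if k = i then p z.1 z.2 else 0) - ν * G k z.1 z.2 i) (fun z => f z.1 z.2 i) := by
  have hp := hu.pressure_integrable
  have hpk : ∀ k, Integrable (fun z : ℝ × Torus d => if k = i then p z.1 z.2 else 0)
      (spaceTime d T) := fun k => by
    by_cases h : k = i
    · simpa [h] using hp
    · simp [h]
  refine ⟨hui i, fun k => ((huu i k).add (hpk k)).sub (hG k i), hf i,
    fun x => u T x i, fun x => u₀ x i, fun φ hφ => ?_⟩
  -- test the momentum equation with the vector field `φ e_i`
  have hmom := hu.momentum (fun j => if j = i then φ else fun _ _ => 0) fun j => by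
    split
    · exact hφ
    · exact isSmooth_zero
  have e1 : ∀ j t x, (if j = i then φ else fun _ _ => 0) t x = if j = i then φ t x else 0 := by
    intro j t x; split <;> rfl
  have e2 : ∀ j t x, dt (if j = i then φ else fun _ _ => 0) t x
      = if j = i then dt φ t x else 0 := by
    intro j t x; split
    · rfl
    · simp [dt]
  have e3 : ∀ j k t x, pd k ((if j = i then φ else fun _ _ => 0) t) x
      = if j = i then pd k (φ t) x else 0 := by
    intro j k t x; split
    · rfl
    · simp [pd]
  simp only [e1, e2, e3, ite_mul, zero_mul, Finset.sum_sub_distrib, Finset.sum_ite_eq',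
    Finset.sum_ite_irrel, Finset.sum_const_zero, Finset.mem_univ, if_true] at hmom
  have j1 := integrable_smooth_mul (hui i) hφ.dt
  have j2 := integrable_smooth_mul (hf i) hφ
  have j3 : Integrable (fun z : ℝ × Torus d => ∑ k, pd k (φ z.1) z.2 * (u z.1 z.2 i * u z.1 z.2 k
      + (if k = i then p z.1 z.2 else 0) - ν * G k z.1 z.2 i)) (spaceTime d T) :=
    integrable_finsetSum _ fun k _ =>
      integrable_smooth_mul (((huu i k).add (hpk k)).sub (hG k i)) (hφ.pd k)
  rw [integral_add (j1.fun_add j3) j2]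
  have e4 : ∀ z : ℝ × Torus d, dt φ z.1 z.2 * u z.1 z.2 i
      + ∑ k, pd k (φ z.1) z.2 * (u z.1 z.2 i * u z.1 z.2 k
        + (if k = i then p z.1 z.2 else 0) - ν * G k z.1 z.2 i)
      = dt φ z.1 z.2 * u z.1 z.2 i
        + (∑ k, pd k (φ z.1) z.2 * u z.1 z.2 i * u z.1 z.2 k) + pd i (φ z.1) z.2 * p z.1 z.2
        - ν * ∑ k, pd k (φ z.1) z.2 * G k z.1 z.2 i := by
    intro z
    simp only [mul_sub, mul_add, mul_ite, mul_zero, Finset.sum_sub_distrib, Finset.sum_add_distrib,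
      Finset.sum_ite_eq', Finset.mem_univ, if_true, Finset.mul_sum, mul_assoc, mul_left_comm ν]
    ring
  simp_rw [e4]
  have e5 : ∫ x, (φ T x * u T x i - φ 0 x * u₀ x i) = - ∫ x, (φ 0 x * u₀ x i - φ T x * u T x i) := by
    rw [← integral_neg]; congr 1; ext x; ring
  rw [e5]
  linarith

/-- The weak gradient, as the divergence of the field with the single component `u^i` in direction
`k`. -/
theorem MemL2H1.stationaryLaw {T : ℝ} {u : ℝ → Torus d → E d} {G : Fin d → ℝ → Torus d → E d}
    (hG : MemL2H1 T u G)
    (hui : ∀ i, Integrable (fun z : ℝ × Torus d => u z.1 z.2 i) (spaceTime d T)) (k i : Fin d) :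
    StationaryLaw T (fun l (z : ℝ × Torus d) => if l = k then u z.1 z.2 i else 0)
      (fun z => G k z.1 z.2 i) := by
  have iG := (memLp_apply (hG k).1 i).integrable (by norm_num)
  refine ⟨fun l => ?_, iG, fun φ hφ => ?_⟩
  · by_cases h : l = k
    · simpa [h] using hui i
    · simp [h]
  · simp only [mul_ite, mul_zero, Finset.sum_ite_eq', Finset.mem_univ, if_true]
    have h := (hG k).2 φ hφ i
    rw [integral_add (integrable_smooth_mul (hui i) (hφ.pd k)) (integrable_smooth_mul iG hφ)]
    simp_rw [mul_comm (pd k _ _), mul_comm (φ _ _)]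
    rw [h]; ring

/-- The weak solutions of the statement have all balance laws and all continuous correlations. -/
theorem IsWeakSolution.flow {T ν : ℝ} {u : ℝ → Torus d → E d} {p : ℝ → Torus d → ℝ}
    {f : ℝ → Torus d → E d} {u₀ : Torus d → E d} {G : Fin d → ℝ → Torus d → E d}
    (hu : IsWeakSolution T ν u p f u₀ G) (hu3 : MemLpTX T 3 u) (huC : MemC0L2 T u)
    (huH : ν ≠ 0 → MemL2H1 T u G) (hf : MemLpTX T (3 / 2) f ∨ MemL1L2 T f) :
    Flow T ν (fun i z => u z.1 z.2 i) (fun z => p z.1 z.2) (fun i z => f z.1 z.2 i)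
      (fun k i z => G k z.1 z.2 i) := by
  have hui3 := fun i => memLp_apply hu3 i
  have hui := fun i => (hui3 i).integrable (by norm_num)
  have huu := integrable_mul_apply hu3
  have hfi := fun i => (force_tame hf i).1
  have h3 := integrable_norm_cube hu3
  obtain ⟨U, hU⟩ := exists_integral_sq_le huC
  have hGm : ν ≠ 0 → ∀ k i, MemLp (fun z : ℝ × Torus d => G k z.1 z.2 i) 2 (spaceTime d T) :=
    fun h k i => memLp_apply ((huH h) k).1 i
  have young2 : ∀ x y : ℝ, |x| * |y| ≤ |x| ^ 2 + |y| ^ 2 := fun x y => by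
    nlinarith [sq_nonneg (|x| - |y|), sq_nonneg |x|, sq_nonneg |y|]
  have tame2 : ∀ g : ℝ × Torus d → ℝ, MemLp g 2 (spaceTime d T) →
      Tame T g (fun t => ∫ x, |g (t, x)| ^ 2) (fun _ => 1) 0 := fun g hg =>
    tame_of_young hg.aestronglyMeasurable (integrable_abs_pow (q := 2) hg (by norm_num))
      (fun z => by positivity) zero_le_one le_rfl fun z y => by linarith [young2 (g z) y]
  refine ⟨hu.evolutionLaw hui huu hfi fun k i => ?_, ⟨hui, integrable_zero _ _ _, fun φ hφ => ?_⟩,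
    fun h k i => (huH h).stationaryLaw hui k i, fun i j => ?_, fun i k j => ?_, fun j => ?_,
    fun i j => ?_, fun i j k => ?_, fun h k i j => ?_, fun h k i j => ?_⟩
  · by_cases h : ν = 0
    · simp [h]
    · exact ((hGm h k i).integrable (by norm_num)).const_mul ν
  · simp only [mul_zero, add_zero]
    refine Eq.trans ?_ (hu.div_free φ hφ)
    simp_rw [mul_comm]
  · exact (tame2 _ ((hui3 i).mono_exponent (by norm_num))).shiftPair (hui3 j)
      fun t ht => hU t ht j
  · refine (tame_of_young (m := fun z : ℝ × Torus d => ‖u z.1 z.2‖ ^ 3) (b := 0) (C := 1)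
      (huu i k).aestronglyMeasurable h3 (fun z => by positivity) le_rfl zero_le_one
      fun z y => ?_).shiftPair (hui3 j) fun t ht => hU t ht j
    have := mul_le_mul_of_nonneg_right (abs_mul_apply_le (u z.1 z.2) i k) (abs_nonneg y)
    linarith [young_cube (norm_nonneg (u z.1 z.2)) (abs_nonneg y)]
  · obtain ⟨a, b, C, h⟩ := pressure_tame hu hu3 huH hf
    exact h.shiftPair (hui3 j) fun t ht => hU t ht j
  · obtain ⟨-, a, b, C, h⟩ := force_tame hf i
    exact h.shiftPair (hui3 j) fun t ht => hU t ht j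
  · refine shiftPair_of_young one_ne_zero (m := fun _ => 0) aestronglyMeasurable_const
      (integrable_zero _ _ _) ?_ fun z y => by simp
    rw [Nat.cast_one, memLp_one_iff_integrable]
    refine h3.mono' ((hui3 i).aestronglyMeasurable.mul (hui3 j).aestronglyMeasurable |>.mul
      (hui3 k).aestronglyMeasurable) (Eventually.of_forall fun z => ?_)
    rw [norm_mul, pow_succ]
    exact mul_le_mul (abs_mul_apply_le (u z.1 z.2) i j) (PiLp.norm_apply_le (u z.1 z.2) k)
      (norm_nonneg _) (by positivity)
  · exact (tame2 _ (hGm h k i)).shiftPair (hui3 j) fun t ht => hU t ht j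
  · exact shiftPair_of_young (q := 2) two_ne_zero (hGm h k i).aestronglyMeasurable
      (integrable_abs_pow (q := 2) (hGm h k i) two_ne_zero) (hGm h k j)
      fun z y => young2 _ _

/-! ### The balance of the two-point energy -/

theorem corr_const_mul_left (T : ℝ) (Q : Torus d → ℝ) (r : ℝ) (g h : ℝ × Torus d → ℝ) :
    corr T Q (fun z => r * g z) h = r * corr T Q g h := by
  unfold corr
  rw [← integral_const_mul]
  congr 1; ext w; ring

theorem corr_const_mul_right (T : ℝ) (Q : Torus d → ℝ) (r : ℝ) (g h : ℝ × Torus d → ℝ) :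
    corr T Q g (fun z => r * h z) = r * corr T Q g h := by
  unfold corr
  rw [← integral_const_mul]
  congr 1; ext w; ring

theorem corr_zero_right (T : ℝ) (Q : Torus d → ℝ) (g : ℝ × Torus d → ℝ) :
    corr T Q g (fun _ => 0) = 0 := by
  simp [corr]

theorem corr_zero_left (T : ℝ) (Q : Torus d → ℝ) (h : ℝ × Torus d → ℝ) :
    corr T Q (fun _ => 0) h = 0 := by
  simp [corr]

theorem Pair.zero_right (T : ℝ) (g : ℝ × Torus d → ℝ) : Pair T g (fun _ => 0) := by
  simp [Pair]

theorem Pair.zero_left (T : ℝ) (g : ℝ × Torus d → ℝ) : Pair T (fun _ => 0) g := by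
  simp [Pair]

theorem Pair.const_mul_left {T : ℝ} {g h : ℝ × Torus d → ℝ} (hp : Pair T g h) (r : ℝ) :
    Pair T (fun z => r * g z) h := by
  have := Integrable.const_mul hp r
  simpa only [Pair, mul_assoc] using this

theorem corr_sum_left {T : ℝ} {Q : Torus d → ℝ} (hQ : Continuous Q) {ι : Type*} {s : Finset ι}
    {g : ι → ℝ × Torus d → ℝ} {h : ℝ × Torus d → ℝ} (hp : ∀ k ∈ s, Pair T (g k) h) :
    corr T Q (fun z => ∑ k ∈ s, g k z) h = ∑ k ∈ s, corr T Q (g k) h := by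
  unfold corr
  rw [← integral_finsetSum _ fun k hk => (hp k hk).integrable_corr hQ]
  simp only [Finset.sum_mul, Finset.mul_sum]

theorem corr_sum_kernel {T : ℝ} {ι : Type*} {s : Finset ι} {Q : ι → Torus d → ℝ}
    (hQ : ∀ k ∈ s, Continuous (Q k)) {g h : ℝ × Torus d → ℝ} (hp : Pair T g h) :
    corr T (fun x => ∑ k ∈ s, Q k x) g h = ∑ k ∈ s, corr T (Q k) g h := by
  unfold corr
  rw [← integral_finsetSum _ fun k hk => hp.integrable_corr (hQ k hk)]
  simp only [Finset.sum_mul]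

theorem corr_add_right {T : ℝ} {Q : Torus d → ℝ} (hQ : Continuous Q) {g h h' : ℝ × Torus d → ℝ}
    (hp : Pair T g h) (hp' : Pair T g h') :
    corr T Q g (fun z => h z + h' z) = corr T Q g h + corr T Q g h' := by
  have hQ' : Continuous fun x => Q (-x) := hQ.comp continuous_neg
  rw [corr_symm, corr_add_left hQ' hp.symm hp'.symm, ← corr_symm T Q g h, ← corr_symm T Q g h']

/-- If the second factor is constant, the derivative of the kernel integrates to zero. -/
theorem corr_pd_one_right {T : ℝ} {g : ℝ × Torus d → ℝ} (hg : Pair T g fun _ => 1)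
    {Q : Torus d → ℝ} (hQ : SmoothT Q) (k : Fin d) : corr T (pd k Q) g (fun _ => 1) = 0 := by
  have h := (stationaryLaw_const T k).corr_right (g := g) (fun l => ?_) (Pair.zero_right T g) hQ
  · rw [Finset.sum_eq_single k (fun l _ hl => by simp [hl, corr_zero_right]) (by simp)] at h
    simpa [corr_zero_right] using h
  · by_cases hl : l = k
    · simpa [hl] using hg
    · simpa [hl] using Pair.zero_right T g

/-- If the first factor is a test function, the derivative of the kernel moves onto it. -/
theorem corr_pd_one_left {T : ℝ} {h : ℝ × Torus d → ℝ} (hh : Pair T (fun _ => 1) h)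
    {Q : Torus d → ℝ} (hQ : SmoothT Q) {φ : ℝ → Torus d → ℝ} (hφ : IsSmooth φ) (k : Fin d) :
    corr T (pd k Q) (fun z => φ z.1 z.2 * 1) h
      = corr T Q (fun z => pd k (φ z.1) z.2 * 1) h := by
  have h := (stationaryLaw_const T k).corr_left (h := h) (fun l => ?_) (Pair.zero_left T h) hQ hφ
  · rw [Finset.sum_eq_single k (fun l _ hl => by simp [hl, corr_zero_left]) (by simp),
      Finset.sum_eq_single k (fun l _ hl => by simp [hl, corr_zero_left]) (by simp)] at h
    simpa [corr_zero_left] using h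
  · by_cases hl : l = k
    · simpa [hl] using hh
    · simpa [hl] using Pair.zero_left T h

/-- A law for a field with a single nonzero component, as a statement about that component. -/
theorem StationaryLaw.corr_single {T : ℝ} {k : Fin d} {a c : ℝ × Torus d → ℝ}
    (H : StationaryLaw T (fun l z => if l = k then a z else 0) c) {Q : Torus d → ℝ}
    (hQ : SmoothT Q) :
    (∀ g, Pair T g a → Pair T g c → corr T (pd k Q) g a = - corr T Q g c) ∧
    ∀ (h : ℝ × Torus d → ℝ) (φ : ℝ → Torus d → ℝ), IsSmooth φ → Pair T a h → Pair T c h →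
      corr T (pd k Q) (fun z => φ z.1 z.2 * a z) h
        = corr T Q (fun z => pd k (φ z.1) z.2 * a z) h
          + corr T Q (fun z => φ z.1 z.2 * c z) h := by
  constructor
  · intro g hga hgc
    have h := H.corr_right (g := g) (fun l => ?_) hgc hQ
    · rw [Finset.sum_eq_single k (fun l _ hl => by simp [hl, corr_zero_right]) (by simp)] at h
      simpa using h
    · by_cases hl : l = k
      · simpa [hl] using hga
      · simpa [hl] using Pair.zero_right T g
  · intro h φ hφ hah hch
    have h := H.corr_left (h := h) (fun l => ?_) hch hQ hφ
    · rw [Finset.sum_eq_single k (fun l _ hl => by simp [hl, corr_zero_left]) (by simp),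
        Finset.sum_eq_single k (fun l _ hl => by simp [hl, corr_zero_left]) (by simp)] at h
      simpa using h
    · by_cases hl : l = k
      · simpa [hl] using hah
      · simpa [hl] using Pair.zero_left T h

section Flow

variable {T ν : ℝ} {u : Fin d → ℝ × Torus d → ℝ} {p : ℝ × Torus d → ℝ}
  {f : Fin d → ℝ × Torus d → ℝ} {G : Fin d → Fin d → ℝ × Torus d → ℝ}

theorem ShiftPair.pair {T : ℝ} {q : ℕ} {g h : ℝ × Torus d → ℝ} (H : ShiftPair T (q + 1) g h) :
    Pair T g h := (H.contCorr (Nat.succ_ne_zero q)).pair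

/-- The viscous terms of the two-point balance. -/
theorem Flow.viscous_terms (H : Flow T ν u p f G) {φ : ℝ → Torus d → ℝ} (hφ : IsSmooth φ)
    {Q : Torus d → ℝ} (hQ : SmoothT Q) (i j : Fin d) :
    - (∑ k, corr T Q (fun z => pd k (φ z.1) z.2 * (ν * G k i z)) (u j))
      + ∑ k, corr T (pd k Q) (fun z => φ z.1 z.2 * (ν * G k i z)) (u j)
      - ∑ k, corr T (pd k Q) (fun z => φ z.1 z.2 * u i z) (fun z => ν * G k j z)
      = ν * ∑ k, (corr T Q (fun z => pd k (pd k (φ z.1)) z.2 * u i z) (u j)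
        - 2 * corr T Q (fun z => φ z.1 z.2 * G k i z) (G k j)) := by
  rcases eq_or_ne ν 0 with rfl | hν
  · simp [corr_zero_left, corr_zero_right]
  simp only [mul_left_comm _ ν, corr_const_mul_left, corr_const_mul_right, ← Finset.mul_sum]
  rw [← mul_neg, ← mul_add, ← mul_sub, ← Finset.sum_neg_distrib, ← Finset.sum_add_distrib,
    ← Finset.sum_sub_distrib]
  congr 1
  refine Finset.sum_congr rfl fun k _ => ?_
  have puu := (H.velocity i j).pair
  have pgu := (H.gradient_velocity hν k i j).pair
  have pug := (H.gradient_velocity hν k j i).pair.symm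
  have pgg := (H.gradient_gradient hν k i j).pair
  obtain ⟨S1, -⟩ := (H.gradient hν k j).corr_single hQ
  obtain ⟨-, S2⟩ := (H.gradient hν k i).corr_single hQ
  -- every derivative of a kernel moves onto `u`, or onto `φ`, where it meets the weak gradient
  have e1 := S1 _ (pgu.smooth_mul hφ) (pgg.smooth_mul hφ)
  have e2 := S2 _ φ hφ pug pgg
  have e3 := S1 _ (puu.smooth_mul (hφ.pd k)) (pug.smooth_mul (hφ.pd k))
  have e4 := S2 _ _ (hφ.pd k) puu pgu
  linarith

/-- The evolution of `u^i(t, x) u^j(t, z)` tested with `φ(t, x) Q(z - x)`. -/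
theorem Flow.two_point (H : Flow T ν u p f G) (hT : 0 < T) {φ : ℝ → Torus d → ℝ}
    (hφ : IsSmooth φ) (h0 : ∀ x, φ 0 x = 0) (h1 : ∀ x, φ T x = 0) {Q : Torus d → ℝ}
    (hQ : SmoothT Q) (i j : Fin d) :
    corr T Q (fun z => dt φ z.1 z.2 * u i z) (u j)
      + (∑ k, corr T Q (fun z => pd k (φ z.1) z.2 * (u i z * u k z)) (u j))
      + corr T Q (fun z => pd i (φ z.1) z.2 * p z) (u j)
      + corr T Q (fun z => φ z.1 z.2 * f i z) (u j)
      + corr T Q (fun z => φ z.1 z.2 * u i z) (f j)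
      - (∑ k, corr T (pd k Q) (fun z => φ z.1 z.2 * (u i z * u k z)) (u j))
      + (∑ k, corr T (pd k Q) (fun z => φ z.1 z.2 * u i z) (fun z => u j z * u k z))
      - corr T (pd i Q) (fun z => φ z.1 z.2 * p z) (u j)
      + corr T (pd j Q) (fun z => φ z.1 z.2 * u i z) p
      + ν * ∑ k, (corr T Q (fun z => pd k (pd k (φ z.1)) z.2 * u i z) (u j)
        - 2 * corr T Q (fun z => φ z.1 z.2 * G k i z) (G k j)) = 0 := by
  have cQ := hQ.continuous
  have cQ' : ∀ k, Continuous (pd k Q) := fun k => (hQ.pd k).continuous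
  have puu := (H.velocity i j).pair
  have ptu := fun k => (H.transport i k j).pair
  have put := fun k => (H.transport j k i).pair.symm
  have ppu := (H.pressure j).pair
  have pup := (H.pressure i).pair.symm
  have pfu := (H.force i j).pair
  have puf := (H.force j i).pair.symm
  have pgu : ∀ k, Pair T (fun z => ν * G k i z) (u j) := fun k => by
    rcases eq_or_ne ν 0 with rfl | hν
    · simpa using Pair.zero_left T (u j)
    · exact (H.gradient_velocity hν k i j).pair.const_mul_left ν
  have pug : ∀ k, Pair T (u i) (fun z => ν * G k j z) := fun k => by
    rcases eq_or_ne ν 0 with rfl | hν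
    · simpa using Pair.zero_right T (u i)
    · exact ((H.gradient_velocity hν k j i).pair.const_mul_left ν).symm
  have pδu : ∀ k, Pair T (fun z => if k = i then p z else 0) (u j) := fun k => by
    by_cases h : k = i
    · simpa [h] using ppu
    · simpa [h] using Pair.zero_left T (u j)
  have puδ : ∀ k, Pair T (u i) (fun z => if k = j then p z else 0) := fun k => by
    by_cases h : k = j
    · simpa [h] using pup
    · simpa [h] using Pair.zero_right T (u i)
  have pA : ∀ k, Pair T (fun z => u i z * u k z + (if k = i then p z else 0) - ν * G k i z)
      (u j) := fun k => by
    have := ((ptu k).add_left (pδu k)).add_left ((pgu k).const_mul_left (-1))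
    simpa only [neg_mul, one_mul, ← sub_eq_add_neg] using this
  have pB : ∀ k, Pair T (u i) (fun z => u j z * u k z + (if k = j then p z else 0) - ν * G k j z) :=
    fun k => by
    have := (((put k).symm.add_left (puδ k).symm).add_left ((pug k).symm.const_mul_left (-1))).symm
    simpa only [neg_mul, one_mul, ← sub_eq_add_neg] using this
  have main := (H.evolution i).two_point hT (H.evolution j) puu pA pB pfu puf hφ h0 h1 hQ
  -- expand the fluxes
  have eA : ∀ {R : Torus d → ℝ} {ψ : ℝ → Torus d → ℝ}, Continuous R → IsSmooth ψ → ∀ k,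
      corr T R (fun z => ψ z.1 z.2 * (u i z * u k z + (if k = i then p z else 0) - ν * G k i z)) (u j)
      = corr T R (fun z => ψ z.1 z.2 * (u i z * u k z)) (u j)
        + (if k = i then corr T R (fun z => ψ z.1 z.2 * p z) (u j) else 0)
        - corr T R (fun z => ψ z.1 z.2 * (ν * G k i z)) (u j) := by
    intro R ψ hR hψ k
    have e : (fun z : ℝ × Torus d => ψ z.1 z.2 * (u i z * u k z + (if k = i then p z else 0)
        - ν * G k i z)) = fun z => (ψ z.1 z.2 * (u i z * u k z)
          + ψ z.1 z.2 * (if k = i then p z else 0)) + (-1) * (ψ z.1 z.2 * (ν * G k i z)) := by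
      ext z; ring
    rw [e, corr_add_left hR (((ptu k).smooth_mul hψ).add_left ((pδu k).smooth_mul hψ))
      (((pgu k).smooth_mul hψ).const_mul_left (-1)),
      corr_add_left hR ((ptu k).smooth_mul hψ) ((pδu k).smooth_mul hψ), corr_const_mul_left]
    by_cases h : k = i
    · simp [h]; ring
    · simp [h, corr_zero_left]; ring
  have eB : ∀ k, corr T (pd k Q) (fun z => φ z.1 z.2 * u i z)
      (fun z => u j z * u k z + (if k = j then p z else 0) - ν * G k j z)
      = corr T (pd k Q) (fun z => φ z.1 z.2 * u i z) (fun z => u j z * u k z)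
        + (if k = j then corr T (pd k Q) (fun z => φ z.1 z.2 * u i z) p else 0)
        - corr T (pd k Q) (fun z => φ z.1 z.2 * u i z) (fun z => ν * G k j z) := by
    intro k
    have e : (fun z : ℝ × Torus d => u j z * u k z + (if k = j then p z else 0)
        - ν * G k j z) = fun z => (u j z * u k z
          + (if k = j then p z else 0)) + (-1) * (ν * G k j z) := by
      ext z; ring
    have q1 := (put k).smooth_mul hφ
    have q2 := (puδ k).smooth_mul hφ
    have q3 := (pug k).smooth_mul hφ
    rw [e, corr_add_right (cQ' k) (q1.symm.add_left q2.symm).symm (q3.symm.const_mul_left (-1)).symm,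
      corr_add_right (cQ' k) q1 q2, corr_const_mul_right]
    by_cases h : k = j
    · simp [h]; ring
    · simp [h, corr_zero_right]; ring
  have eS := fun k => (pA k).smooth_mul (hφ.pd k)
  rw [corr_add_left cQ ((puu.smooth_mul hφ.dt).add_left (Pair.sum_left fun k _ => eS k))
    (pfu.smooth_mul hφ), corr_add_left cQ (puu.smooth_mul hφ.dt) (Pair.sum_left fun k _ => eS k),
    corr_sum_left cQ fun k _ => eS k] at main
  simp only [fun k => eA cQ (hφ.pd k) k, fun k => eA (cQ' k) hφ k, eB, Finset.sum_add_distrib,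
    Finset.sum_sub_distrib, Finset.sum_ite_eq', Finset.mem_univ, if_true] at main
  have hv := H.viscous_terms hφ hQ i j
  linarith

end Flow

/-! ### Third order structure functions -/

theorem integrable_fun_sub {X : Type*} [MeasurableSpace X] {μ : Measure X} {f g : X → ℝ}
    (hf : Integrable f μ) (hg : Integrable g μ) : Integrable (fun x => f x - g x) μ := hf.sub hg

/-- The correlation of three increments over the separation `c`, weighted with `φ`. -/
noncomputable def incr (T : ℝ) (φ : ℝ → Torus d → ℝ) (a b e : ℝ × Torus d → ℝ) (c : Torus d) : ℝ :=
  ∫ z, φ z.1 z.2 * ((a (z.1, z.2 + c) - a z) * (b (z.1, z.2 + c) - b z)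
    * (e (z.1, z.2 + c) - e z)) ∂(spaceTime d T)

/-- The part of the two-point balance that multiplies the kernel `Q^{ij}`. -/
noncomputable def kernelTerm (T ν : ℝ) (φ : ℝ → Torus d → ℝ) (u : Fin d → ℝ × Torus d → ℝ)
    (p : ℝ × Torus d → ℝ) (f : Fin d → ℝ × Torus d → ℝ) (G : Fin d → Fin d → ℝ × Torus d → ℝ)
    (i j : Fin d) (c : Torus d) : ℝ :=
  shiftCorr T (fun z => dt φ z.1 z.2 * u i z) (u j) c
    + (∑ k, shiftCorr T (fun z => pd k (φ z.1) z.2 * (u i z * u k z)) (u j) c)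
    + shiftCorr T (fun z => pd i (φ z.1) z.2 * p z) (u j) c
    + shiftCorr T (fun z => φ z.1 z.2 * f i z) (u j) c
    + shiftCorr T (fun z => φ z.1 z.2 * u i z) (f j) c
    + 1 / 2 * (∑ k, (shiftCorr T (fun z => pd k (φ z.1) z.2 * 1) (fun z => u i z * u j z * u k z) c
      - shiftCorr T (fun z => pd k (φ z.1) z.2 * u k z) (fun z => u i z * u j z) c))
    + ν * ∑ k, (shiftCorr T (fun z => pd k (pd k (φ z.1)) z.2 * u i z) (u j) c
      - 2 * shiftCorr T (fun z => φ z.1 z.2 * G k i z) (G k j) c)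

/-- The part of the two-point balance that multiplies the potential `κ`. -/
noncomputable def potentialTerm (T : ℝ) (φ : ℝ → Torus d → ℝ) (u : Fin d → ℝ × Torus d → ℝ)
    (p : ℝ × Torus d → ℝ) (c : Torus d) : ℝ :=
  ∑ i, shiftCorr T (fun z => pd i (φ z.1) z.2 * u i z) p c

section Flow

variable {T ν : ℝ} {u : Fin d → ℝ × Torus d → ℝ} {p : ℝ × Torus d → ℝ}
  {f : Fin d → ℝ × Torus d → ℝ} {G : Fin d → Fin d → ℝ × Torus d → ℝ}

theorem ShiftPair.contCorr_left {q : ℕ} {g h : ℝ × Torus d → ℝ} (H : ShiftPair T (q + 1) g h)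
    {φ : ℝ → Torus d → ℝ} (hφ : IsSmooth φ) : ContCorr T (fun z => φ z.1 z.2 * g z) h :=
  (H.smooth_mul_left hφ).contCorr q.succ_ne_zero

theorem ShiftPair.contCorr_right {q : ℕ} {g h : ℝ × Torus d → ℝ} (H : ShiftPair T (q + 1) g h)
    {φ : ℝ → Torus d → ℝ} (hφ : IsSmooth φ) : ContCorr T (fun z => φ z.1 z.2 * h z) g :=
  ((H.smooth_mul_right hφ).contCorr q.succ_ne_zero).symm.1

theorem Flow.continuous_kernelTerm (H : Flow T ν u p f G) {φ : ℝ → Torus d → ℝ}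
    (hφ : IsSmooth φ) (i j : Fin d) : Continuous (kernelTerm T ν φ u p f G i j) := by
  have h1 := ((H.velocity i j).contCorr_left hφ.dt).continuous
  have h2 := fun k => ((H.transport i k j).contCorr_left (hφ.pd k)).continuous
  have h3 := ((H.pressure j).contCorr_left (hφ.pd i)).continuous
  have h4 := ((H.force i j).contCorr_left hφ).continuous
  have h5 := ((H.force j i).contCorr_right hφ).continuous
  have h6 := fun k => ((H.cubic i j k).contCorr_left (hφ.pd k)).continuous
  have h7 := fun k => ((H.transport i j k).contCorr_right (hφ.pd k)).continuous
  have h8 := fun k => ((H.velocity i j).contCorr_left ((hφ.pd k).pd k)).continuous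
  have h9 : Continuous fun c => ν * ∑ k, (shiftCorr T (fun z => pd k (pd k (φ z.1)) z.2 * u i z)
      (u j) c - 2 * shiftCorr T (fun z => φ z.1 z.2 * G k i z) (G k j) c) := by
    rcases eq_or_ne ν 0 with rfl | hν
    · simpa using continuous_const
    · have h10 := fun k => ((H.gradient_gradient hν k i j).contCorr_left hφ).continuous
      fun_prop
  unfold kernelTerm
  fun_prop

theorem Flow.continuous_potentialTerm (H : Flow T ν u p f G) {φ : ℝ → Torus d → ℝ}
    (hφ : IsSmooth φ) : Continuous (potentialTerm T φ u p) := by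
  have h1 := fun i => ((H.pressure i).contCorr_right (hφ.pd i)).continuous
  unfold potentialTerm
  fun_prop

/-- The product of three increments, expanded into correlations. -/
theorem Flow.incr_eq (H : Flow T ν u p f G) {φ : ℝ → Torus d → ℝ} (hφ : IsSmooth φ)
    (i j k : Fin d) (c : Torus d) : incr T φ (u i) (u j) (u k) c
      = shiftCorr T (fun z => φ z.1 z.2 * 1) (fun z => u i z * u j z * u k z) c
        - shiftCorr T (fun z => φ z.1 z.2 * u k z) (fun z => u i z * u j z) c
        - shiftCorr T (fun z => φ z.1 z.2 * u j z) (fun z => u i z * u k z) c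
        - shiftCorr T (fun z => φ z.1 z.2 * u i z) (fun z => u j z * u k z) c
        + shiftCorr T (fun z => φ z.1 z.2 * (u i z * u j z)) (u k) c
        + shiftCorr T (fun z => φ z.1 z.2 * (u i z * u k z)) (u j) c
        + shiftCorr T (fun z => φ z.1 z.2 * (u j z * u k z)) (u i) c
        - shiftCorr T (fun z => φ z.1 z.2 * (u i z * u j z * u k z)) (fun _ => 1) c := by
  have h1 := ((H.cubic i j k).contCorr_left hφ).integrable c
  have h2 := ((H.transport i j k).contCorr_right hφ).integrable c
  have h3 := ((H.transport i k j).contCorr_right hφ).integrable c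
  have h4 := ((H.transport j k i).contCorr_right hφ).integrable c
  have h5 := ((H.transport i j k).contCorr_left hφ).integrable c
  have h6 := ((H.transport i k j).contCorr_left hφ).integrable c
  have h7 := ((H.transport j k i).contCorr_left hφ).integrable c
  have h8 := ((H.cubic i j k).contCorr_right hφ).integrable c
  simp only [incr, shiftCorr]
  rw [← integral_sub h1 h2]
  have i12 := integrable_fun_sub h1 h2
  rw [← integral_sub i12 h3]
  have i13 := integrable_fun_sub i12 h3
  rw [← integral_sub i13 h4]
  have i14 := integrable_fun_sub i13 h4
  rw [← integral_add i14 h5]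
  have i15 := i14.fun_add h5
  rw [← integral_add i15 h6]
  have i16 := i15.fun_add h6
  rw [← integral_add i16 h7]
  have i17 := i16.fun_add h7
  rw [← integral_sub i17 h8]
  congr 1; ext z
  ring

theorem Flow.continuous_incr (H : Flow T ν u p f G) {φ : ℝ → Torus d → ℝ} (hφ : IsSmooth φ)
    (i j k : Fin d) : Continuous (incr T φ (u i) (u j) (u k)) := by
  rw [funext (H.incr_eq hφ i j k)]
  have h1 := ((H.cubic i j k).contCorr_left hφ).continuous
  have h2 := ((H.transport i j k).contCorr_right hφ).continuous
  have h3 := ((H.transport i k j).contCorr_right hφ).continuous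
  have h4 := ((H.transport j k i).contCorr_right hφ).continuous
  have h5 := ((H.transport i j k).contCorr_left hφ).continuous
  have h6 := ((H.transport i k j).contCorr_left hφ).continuous
  have h7 := ((H.transport j k i).contCorr_left hφ).continuous
  have h8 := ((H.cubic i j k).contCorr_right hφ).continuous
  fun_prop

theorem Flow.integral_mul_incr (H : Flow T ν u p f G) {φ : ℝ → Torus d → ℝ} (hφ : IsSmooth φ)
    {R : Torus d → ℝ} (hR : Continuous R) (i j k : Fin d) :
    ∫ c, R c * incr T φ (u i) (u j) (u k) c
      = corr T R (fun z => φ z.1 z.2 * 1) (fun z => u i z * u j z * u k z)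
        - corr T R (fun z => φ z.1 z.2 * u k z) (fun z => u i z * u j z)
        - corr T R (fun z => φ z.1 z.2 * u j z) (fun z => u i z * u k z)
        - corr T R (fun z => φ z.1 z.2 * u i z) (fun z => u j z * u k z)
        + corr T R (fun z => φ z.1 z.2 * (u i z * u j z)) (u k)
        + corr T R (fun z => φ z.1 z.2 * (u i z * u k z)) (u j)
        + corr T R (fun z => φ z.1 z.2 * (u j z * u k z)) (u i)
        - corr T R (fun z => φ z.1 z.2 * (u i z * u j z * u k z)) (fun _ => 1) := by
  have h1 := (H.cubic i j k).contCorr_left hφ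
  have h2 := (H.transport i j k).contCorr_right hφ
  have h3 := (H.transport i k j).contCorr_right hφ
  have h4 := (H.transport j k i).contCorr_right hφ
  have h5 := (H.transport i j k).contCorr_left hφ
  have h6 := (H.transport i k j).contCorr_left hφ
  have h7 := (H.transport j k i).contCorr_left hφ
  have h8 := (H.cubic i j k).contCorr_right hφ
  have hi : ∀ {g h : ℝ × Torus d → ℝ}, ContCorr T g h →
      Integrable (fun c => R c * shiftCorr T g h c) := fun hc =>
    (hR.mul hc.continuous).integrable_torus
  rw [corr_eq_integral_shiftCorr h1.pair hR, corr_eq_integral_shiftCorr h2.pair hR,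
    corr_eq_integral_shiftCorr h3.pair hR, corr_eq_integral_shiftCorr h4.pair hR,
    corr_eq_integral_shiftCorr h5.pair hR, corr_eq_integral_shiftCorr h6.pair hR,
    corr_eq_integral_shiftCorr h7.pair hR, corr_eq_integral_shiftCorr h8.pair hR,
    ← integral_sub (hi h1) (hi h2)]
  have i12 := integrable_fun_sub (hi h1) (hi h2)
  rw [← integral_sub i12 (hi h3)]
  have i13 := integrable_fun_sub i12 (hi h3)
  rw [← integral_sub i13 (hi h4)]
  have i14 := integrable_fun_sub i13 (hi h4)
  rw [← integral_add i14 (hi h5)]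
  have i15 := i14.fun_add (hi h5)
  rw [← integral_add i15 (hi h6)]
  have i16 := i15.fun_add (hi h6)
  rw [← integral_add i16 (hi h7)]
  have i17 := i16.fun_add (hi h7)
  rw [← integral_sub i17 (hi h8)]
  congr 1; ext c
  simp only [H.incr_eq hφ]
  ring

theorem Flow.integral_mul_kernelTerm (H : Flow T ν u p f G) {φ : ℝ → Torus d → ℝ}
    (hφ : IsSmooth φ) {R : Torus d → ℝ} (hR : Continuous R) (i j : Fin d) :
    ∫ c, R c * kernelTerm T ν φ u p f G i j c
      = corr T R (fun z => dt φ z.1 z.2 * u i z) (u j)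
        + (∑ k, corr T R (fun z => pd k (φ z.1) z.2 * (u i z * u k z)) (u j))
        + corr T R (fun z => pd i (φ z.1) z.2 * p z) (u j)
        + corr T R (fun z => φ z.1 z.2 * f i z) (u j)
        + corr T R (fun z => φ z.1 z.2 * u i z) (f j)
        + 1 / 2 * (∑ k, (corr T R (fun z => pd k (φ z.1) z.2 * 1) (fun z => u i z * u j z * u k z)
          - corr T R (fun z => pd k (φ z.1) z.2 * u k z) (fun z => u i z * u j z)))
        + ν * ∑ k, (corr T R (fun z => pd k (pd k (φ z.1)) z.2 * u i z) (u j)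
          - 2 * corr T R (fun z => φ z.1 z.2 * G k i z) (G k j)) := by
  have h1 := (H.velocity i j).contCorr_left hφ.dt
  have h2 := fun k => (H.transport i k j).contCorr_left (hφ.pd k)
  have h3 := (H.pressure j).contCorr_left (hφ.pd i)
  have h4 := (H.force i j).contCorr_left hφ
  have h5 := (H.force j i).contCorr_right hφ
  have h6 := fun k => (H.cubic i j k).contCorr_left (hφ.pd k)
  have h7 := fun k => (H.transport i j k).contCorr_right (hφ.pd k)
  have h8 := fun k => (H.velocity i j).contCorr_left ((hφ.pd k).pd k)
  have hi : ∀ {g h : ℝ × Torus d → ℝ}, ContCorr T g h →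
      Integrable (fun c => R c * shiftCorr T g h c) := fun hc =>
    (hR.mul hc.continuous).integrable_torus
  have hv : Integrable (fun c => R c * (ν * ∑ k, (shiftCorr T (fun z => pd k (pd k (φ z.1)) z.2
      * u i z) (u j) c - 2 * shiftCorr T (fun z => φ z.1 z.2 * G k i z) (G k j) c))) ∧
      ∫ c, R c * (ν * ∑ k, (shiftCorr T (fun z => pd k (pd k (φ z.1)) z.2
      * u i z) (u j) c - 2 * shiftCorr T (fun z => φ z.1 z.2 * G k i z) (G k j) c))
      = ν * ∑ k, (corr T R (fun z => pd k (pd k (φ z.1)) z.2 * u i z) (u j)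
          - 2 * corr T R (fun z => φ z.1 z.2 * G k i z) (G k j)) := by
    rcases eq_or_ne ν 0 with rfl | hν
    · simp
    have h9 := fun k => (H.gradient_gradient hν k i j).contCorr_left hφ
    have c8 := fun k => (h8 k).continuous
    have c9 := fun k => (h9 k).continuous
    refine ⟨Continuous.integrable_torus (by fun_prop), ?_⟩
    have e : ∀ c, R c * (ν * ∑ k, (shiftCorr T (fun z => pd k (pd k (φ z.1)) z.2
        * u i z) (u j) c - 2 * shiftCorr T (fun z => φ z.1 z.2 * G k i z) (G k j) c))
        = ν * ∑ k, (R c * shiftCorr T (fun z => pd k (pd k (φ z.1)) z.2 * u i z) (u j) c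
          - 2 * (R c * shiftCorr T (fun z => φ z.1 z.2 * G k i z) (G k j) c)) := by
      intro c
      rw [mul_left_comm, Finset.mul_sum]
      congr 1
      exact Finset.sum_congr rfl fun k _ => by ring
    simp_rw [e]
    have j1 := fun k => (hi (h9 k)).const_mul 2
    rw [integral_const_mul, integral_finsetSum _ fun k _ => integrable_fun_sub (hi (h8 k)) (j1 k)]
    congr 1
    refine Finset.sum_congr rfl fun k _ => ?_
    rw [integral_sub (hi (h8 k)) (j1 k), integral_const_mul,
      corr_eq_integral_shiftCorr (h8 k).pair hR, corr_eq_integral_shiftCorr (h9 k).pair hR]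
  have j2 : Integrable (fun c => ∑ k, R c * shiftCorr T (fun z => pd k (φ z.1) z.2
      * (u i z * u k z)) (u j) c) := integrable_finsetSum _ fun k _ => hi (h2 k)
  have j6 : Integrable (fun c => 1 / 2 * ∑ k, (R c * shiftCorr T (fun z => pd k (φ z.1) z.2 * 1)
      (fun z => u i z * u j z * u k z) c - R c * shiftCorr T (fun z => pd k (φ z.1) z.2 * u k z)
      (fun z => u i z * u j z) c)) :=
    (integrable_finsetSum _ fun k _ => integrable_fun_sub (hi (h6 k)) (hi (h7 k))).const_mul _
  have e6 : ∫ c, 1 / 2 * ∑ k, (R c * shiftCorr T (fun z => pd k (φ z.1) z.2 * 1)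
      (fun z => u i z * u j z * u k z) c - R c * shiftCorr T (fun z => pd k (φ z.1) z.2 * u k z)
      (fun z => u i z * u j z) c)
      = 1 / 2 * (∑ k, (corr T R (fun z => pd k (φ z.1) z.2 * 1) (fun z => u i z * u j z * u k z)
          - corr T R (fun z => pd k (φ z.1) z.2 * u k z) (fun z => u i z * u j z))) := by
    rw [integral_const_mul, integral_finsetSum _ fun k _ => integrable_fun_sub (hi (h6 k)) (hi (h7 k))]
    congr 1
    refine Finset.sum_congr rfl fun k _ => ?_
    rw [integral_sub (hi (h6 k)) (hi (h7 k)), corr_eq_integral_shiftCorr (h6 k).pair hR,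
      corr_eq_integral_shiftCorr (h7 k).pair hR]
  rw [← hv.2, ← e6, corr_eq_integral_shiftCorr h1.pair hR, corr_eq_integral_shiftCorr h3.pair hR,
    corr_eq_integral_shiftCorr h4.pair hR, corr_eq_integral_shiftCorr h5.pair hR,
    Finset.sum_congr rfl fun k _ => corr_eq_integral_shiftCorr (h2 k).pair hR,
    ← integral_finsetSum _ fun k _ => hi (h2 k), ← integral_add (hi h1) j2]
  have i2 := (hi h1).fun_add j2
  rw [← integral_add i2 (hi h3)]
  have i3 := i2.fun_add (hi h3)
  rw [← integral_add i3 (hi h4)]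
  have i4 := i3.fun_add (hi h4)
  rw [← integral_add i4 (hi h5)]
  have i5 := i4.fun_add (hi h5)
  rw [← integral_add i5 j6, ← integral_add (i5.fun_add j6) hv.1]
  congr 1; ext c
  simp only [kernelTerm, ← mul_sub, ← Finset.mul_sum]
  ring

theorem Flow.integral_mul_potentialTerm (H : Flow T ν u p f G) {φ : ℝ → Torus d → ℝ}
    (hφ : IsSmooth φ) {R : Torus d → ℝ} (hR : Continuous R) :
    ∫ c, R c * potentialTerm T φ u p c
      = ∑ i, corr T R (fun z => pd i (φ z.1) z.2 * u i z) p := by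
  have h := fun i => (H.pressure i).contCorr_right (hφ.pd i)
  have hi : ∀ i, Integrable (fun c => R c * shiftCorr T (fun z => pd i (φ z.1) z.2 * u i z) p c) :=
    fun i => (hR.mul (h i).continuous).integrable_torus
  rw [Finset.sum_congr rfl fun i _ => corr_eq_integral_shiftCorr (h i).pair hR,
    ← integral_finsetSum _ fun i _ => hi i]
  simp only [potentialTerm, Finset.mul_sum]

/-- The third order increments, tested with the gradient of a symmetric matrix of kernels. Terms
in which the derivative falls on an incompressible field vanish. -/
theorem Flow.sum_integral_mul_incr (H : Flow T ν u p f G) {φ : ℝ → Torus d → ℝ}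
    (hφ : IsSmooth φ) {Q : Fin d → Fin d → Torus d → ℝ} (hQ : ∀ i j, SmoothT (Q i j))
    (hs : ∀ i j, Q i j = Q j i) :
    ∑ i, ∑ j, ∑ k, ∫ c, pd k (Q i j) c * incr T φ (u i) (u j) (u k) c
      = ∑ i, ∑ j, ((∑ k, (corr T (Q i j) (fun z => pd k (φ z.1) z.2 * 1)
            (fun z => u i z * u j z * u k z)
          - corr T (Q i j) (fun z => pd k (φ z.1) z.2 * u k z) (fun z => u i z * u j z)))
        - 2 * (∑ k, corr T (pd k (Q i j)) (fun z => φ z.1 z.2 * u i z) (fun z => u j z * u k z))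
        + 2 * ∑ k, corr T (pd k (Q i j)) (fun z => φ z.1 z.2 * (u i z * u k z)) (u j)) := by
  have cQ := fun i j k => ((hQ i j).pd k).continuous
  -- the terms of `u^i u^j u^k` at a single point, and those differentiated along `u^k`
  have a1 : ∀ i j k, corr T (pd k (Q i j)) (fun z => φ z.1 z.2 * 1)
      (fun z => u i z * u j z * u k z) = corr T (Q i j) (fun z => pd k (φ z.1) z.2 * 1)
      (fun z => u i z * u j z * u k z) := fun i j k =>
    corr_pd_one_left (H.cubic i j k).pair (hQ i j) hφ k
  have a2 : ∀ i j, ∑ k, corr T (pd k (Q i j)) (fun z => φ z.1 z.2 * u k z) (fun z => u i z * u j z)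
      = ∑ k, corr T (Q i j) (fun z => pd k (φ z.1) z.2 * u k z) (fun z => u i z * u j z) := by
    intro i j
    have := H.incompressible.corr_left (fun k => (H.transport i j k).pair.symm)
      (Pair.zero_left T _) (hQ i j) hφ
    simpa [corr_zero_left] using this
  have a3 : ∀ i j, ∑ k, corr T (pd k (Q i j)) (fun z => φ z.1 z.2 * (u i z * u j z)) (u k) = 0 := by
    intro i j
    have := H.incompressible.corr_right (fun k => (H.transport i j k).pair.smooth_mul hφ)
      (Pair.zero_right T _) (hQ i j)
    simpa [corr_zero_right] using this
  have a4 : ∀ i j k, corr T (pd k (Q i j)) (fun z => φ z.1 z.2 * (u i z * u j z * u k z))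
      (fun _ => 1) = 0 := fun i j k =>
    corr_pd_one_right ((H.cubic i j k).pair.symm.smooth_mul hφ) (hQ i j) k
  -- by symmetry of `Q` the remaining terms agree in pairs
  have sw1 : ∑ i, ∑ j, ∑ k, corr T (pd k (Q i j)) (fun z => φ z.1 z.2 * u j z)
      (fun z => u i z * u k z) = ∑ i, ∑ j, ∑ k, corr T (pd k (Q i j)) (fun z => φ z.1 z.2 * u i z)
      (fun z => u j z * u k z) := by
    rw [Finset.sum_comm]
    exact Finset.sum_congr rfl fun i _ => Finset.sum_congr rfl fun j _ => by rw [hs i j]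
  have sw2 : ∑ i, ∑ j, ∑ k, corr T (pd k (Q i j)) (fun z => φ z.1 z.2 * (u j z * u k z)) (u i)
      = ∑ i, ∑ j, ∑ k, corr T (pd k (Q i j)) (fun z => φ z.1 z.2 * (u i z * u k z)) (u j) := by
    rw [Finset.sum_comm]
    exact Finset.sum_congr rfl fun i _ => Finset.sum_congr rfl fun j _ => by rw [hs i j]
  simp only [fun i j k => H.integral_mul_incr hφ (cQ i j k) i j k, Finset.sum_add_distrib,
    Finset.sum_sub_distrib, a1, a2, a3, a4, sw1, sw2, Finset.sum_const_zero, ← Finset.mul_sum]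
  ring

/-- The two-point energy balance for a symmetric matrix of kernels whose divergence is a
gradient. -/
theorem Flow.two_point_balance (H : Flow T ν u p f G) (hT : 0 < T) {φ : ℝ → Torus d → ℝ}
    (hφ : IsSmooth φ) (h0 : ∀ x, φ 0 x = 0) (h1 : ∀ x, φ T x = 0)
    {Q : Fin d → Fin d → Torus d → ℝ} (hQ : ∀ i j, SmoothT (Q i j))
    (hs : ∀ i j, Q i j = Q j i) {κ : Torus d → ℝ} (hκ : SmoothT κ)
    (hdiv : ∀ i x, ∑ j, pd j (Q i j) x = pd i κ x) :
    1 / 2 * ∑ i, ∑ j, ∑ k, ∫ c, pd k (Q i j) c * incr T φ (u i) (u j) (u k) c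
      = (∑ i, ∑ j, ∫ c, Q i j c * kernelTerm T ν φ u p f G i j c)
        + ∫ c, κ c * potentialTerm T φ u p c := by
  rw [H.sum_integral_mul_incr hφ hQ hs, H.integral_mul_potentialTerm hφ hκ.continuous]
  simp only [fun i j => H.integral_mul_kernelTerm hφ (hQ i j).continuous i j]
  have cQ := fun i j k => ((hQ i j).pd k).continuous
  have tp := fun i j => H.two_point hT hφ h0 h1 (hQ i j) i j
  have hdiv' : ∀ i, pd i κ = fun x => ∑ j, pd j (Q i j) x := fun i => by
    ext x; rw [hdiv]
  -- the pressure meets `∂_i Q^{ij} = ∂_j κ`, a gradient, which is orthogonal to the velocity at the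
  -- second point
  have b1 : ∑ i, ∑ j, corr T (pd i (Q i j)) (fun z => φ z.1 z.2 * p z) (u j) = 0 := by
    have := H.incompressible.corr_right (fun j => (H.pressure j).pair.smooth_mul hφ)
      (Pair.zero_right T _) hκ
    rw [corr_zero_right, neg_zero] at this
    rw [Finset.sum_comm]
    refine Eq.trans (Finset.sum_congr rfl fun j _ => ?_) this
    rw [hdiv' j, corr_sum_kernel (fun i _ => cQ j i i) ((H.pressure j).pair.smooth_mul hφ)]
    exact Finset.sum_congr rfl fun i _ => by rw [hs i j]
  -- at the first point the gradient of `κ` moves onto the localization `φ`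
  have b2 : ∑ i, ∑ j, corr T (pd j (Q i j)) (fun z => φ z.1 z.2 * u i z) p
      = ∑ i, corr T κ (fun z => pd i (φ z.1) z.2 * u i z) p := by
    have := H.incompressible.corr_left (fun j => (H.pressure j).pair.symm)
      (Pair.zero_left T _) hκ hφ
    simp only [mul_zero, corr_zero_left, add_zero] at this
    refine Eq.trans (Finset.sum_congr rfl fun i _ => ?_) this
    rw [hdiv' i, corr_sum_kernel (fun j _ => cQ i j j) ((H.pressure i).pair.symm.smooth_mul hφ)]
  have tps := Finset.sum_eq_zero fun i (_ : i ∈ Finset.univ) =>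
    Finset.sum_eq_zero fun j (_ : j ∈ Finset.univ) => tp i j
  simp only [Finset.sum_add_distrib, Finset.sum_sub_distrib, ← Finset.mul_sum, b1, b2] at tps ⊢
  linarith

end Flow

/-! ### Polar coordinates and radial test functions -/

instance : IsFiniteMeasure (sphereMeasure d) :=
  inferInstanceAs (IsFiniteMeasure (volume : Measure (E d)).toSphere)

theorem sphereMeasure_real_univ_pos (hd : 0 < d) : 0 < (sphereMeasure d).real univ := by
  rw [sphereMeasure, Measure.toSphere_real_apply_univ, finrank_euclideanSpace_fin]
  exact mul_pos (Nat.cast_pos.2 hd) (ENNReal.toReal_pos (measure_ball_pos _ _ one_pos).ne'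
    measure_ball_lt_top.ne)

/-- Integration in polar coordinates. -/
theorem integral_polar (hd : 0 < d) {F : E d → ℝ} (hF : Integrable F) :
    ∫ v, F v = ∫ r in Ioi (0 : ℝ), r ^ (d - 1) *
      ∫ θ : sphere (0 : E d) 1, F (r • (θ : E d)) ∂(sphereMeasure d) := by
  have : Nonempty (Fin d) := ⟨⟨0, hd⟩⟩
  have hmp := (volume : Measure (E d)).measurePreserving_homeomorphUnitSphereProd
  rw [finrank_euclideanSpace_fin] at hmp
  have hme := (homeomorphUnitSphereProd (E d)).measurableEmbedding
  let K : sphere (0 : E d) 1 × Ioi (0 : ℝ) → ℝ := fun w => F ((w.2 : ℝ) • (w.1 : E d))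
  have hK : ∀ x, K (homeomorphUnitSphereProd (E d) x) = F x := by
    intro x
    have := congrArg (Subtype.val) ((homeomorphUnitSphereProd (E d)).symm_apply_apply x)
    simp only [homeomorphUnitSphereProd_symm_apply_coe] at this
    simp only [K, this]
  -- polar coordinates parametrize the complement of the origin, which has full measure
  have h1 : ∫ v, F v = ∫ x : ({(0)}ᶜ : Set (E d)), F x ∂(volume.comap Subtype.val) := by
    rw [integral_subtype_comap (measurableSet_singleton _).compl fun x ↦ F x,
      restrict_compl_singleton]
  have hKi : Integrable K ((sphereMeasure d).prod (.volumeIoiPow (d - 1))) := by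
    rw [sphereMeasure, ← hmp.integrable_comp_emb hme]
    have : K ∘ homeomorphUnitSphereProd (E d) = F ∘ Subtype.val := funext hK
    rw [this]
    have hms := (measurableSet_singleton (0 : E d)).compl
    have he : MeasurableEmbedding (Subtype.val : ({0}ᶜ : Set (E d)) → E d) :=
      MeasurableEmbedding.subtype_coe hms
    have := he.integrable_map_iff (μ := (volume : Measure (E d)).comap Subtype.val) (g := F)
    rw [map_comap_subtype_coe hms,
      restrict_compl_singleton] at this
    exact this.1 hF
  rw [h1]
  simp_rw [← hK]
  rw [hmp.integral_comp hme K, ← sphereMeasure, integral_prod_symm _ hKi]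
  simp only [Measure.volumeIoiPow, ENNReal.ofReal]
  rw [integral_withDensity_eq_integral_smul (measurable_subtype_coe.pow_const _).real_toNNReal,
    integral_subtype_comap measurableSet_Ioi fun r ↦ Real.toNNReal (r ^ (d - 1)) •
      ∫ θ : sphere (0 : E d) 1, F (r • (θ : E d)) ∂(sphereMeasure d)]
  refine setIntegral_congr_fun measurableSet_Ioi fun r hr => ?_
  simp only [NNReal.smul_def, Real.coe_toNNReal _ (pow_nonneg (le_of_lt hr) _), smul_eq_mul]

/-- Spherical integrals of continuous functions depend continuously on parameters. -/
theorem continuous_sphereIntegral {F : ℝ → E d → ℝ}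
    (hF : Continuous fun z : ℝ × E d => F z.1 z.2) :
    Continuous fun r => ∫ θ : sphere (0 : E d) 1, F r θ ∂(sphereMeasure d) := by
  have := continuous_parametric_integral_of_continuous (μ := sphereMeasure d)
    (f := fun (r : ℝ) (θ : sphere (0 : E d) 1) => F r θ)
    (hF.comp (continuous_fst.prodMk (continuous_subtype_val.comp continuous_snd)))
    (isCompact_univ : IsCompact (univ : Set (sphere (0 : E d) 1)))
  simpa using this

theorem integrable_sphere {F : E d → ℝ} (hF : Continuous F) :
    Integrable (fun θ : sphere (0 : E d) 1 => F θ) (sphereMeasure d) := by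
  have hc : Continuous fun θ : sphere (0 : E d) 1 => F θ := hF.comp continuous_subtype_val
  exact hc.integrable_of_hasCompactSupport (HasCompactSupport.of_compactSpace _)

/-- Integration of a function of small support over the torus in polar coordinates. -/
theorem integral_polar_of_support (hd : 0 < d) {F : E d → ℝ} (hF : Continuous F)
    (h0 : ∀ v, 1 / 4 ≤ ‖v‖ → F v = 0) :
    ∫ v, F v = ∫ r in (0 : ℝ)..(1 / 4), r ^ (d - 1) *
      ∫ θ : sphere (0 : E d) 1, F (r • (θ : E d)) ∂(sphereMeasure d) := by
  have hcs : HasCompactSupport F := HasCompactSupport.intro (isCompact_closedBall (0 : E d) (1 / 4))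
    fun v hv => h0 v (by simpa using (not_le.1 (by simpa using hv)).le)
  rw [integral_polar hd (hF.integrable_of_hasCompactSupport hcs),
    intervalIntegral.integral_of_le (by norm_num)]
  refine setIntegral_eq_of_subset_of_forall_sdiff_eq_zero measurableSet_Ioi Ioc_subset_Ioi_self ?_
  rintro r ⟨hr, hr'⟩
  have hr4 : 1 / 4 ≤ r := by
    by_contra h
    exact hr' ⟨hr, (not_le.1 h).le⟩
  have : ∀ θ : sphere (0 : E d) 1, F (r • (θ : E d)) = 0 := fun θ => by
    apply h0
    rw [norm_smul, norm_eq_of_mem_sphere θ, mul_one, Real.norm_eq_abs]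
    exact hr4.trans (le_abs_self r)
  simp [this]

/-- The smooth functions on the line that vanish on `[1/16, ∞)`; composed with `‖v‖²` they give
smooth radial functions on the ball of radius `1/4`. -/
def RadialTest (M : ℝ → ℝ) : Prop := ContDiff ℝ ∞ M ∧ ∀ s, 1 / 16 ≤ s → M s = 0

theorem RadialTest.continuous {M : ℝ → ℝ} (hM : RadialTest M) : Continuous M := hM.1.continuous

theorem RadialTest.mul {M : ℝ → ℝ} (hM : RadialTest M) {a : ℝ → ℝ} (ha : ContDiff ℝ ∞ a) :
    RadialTest (fun s => a s * M s) :=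
  ⟨ha.mul hM.1, fun s hs => by simp [hM.2 s hs]⟩

theorem RadialTest.hasDerivAt {M : ℝ → ℝ} (hM : RadialTest M) (s : ℝ) :
    HasDerivAt M (deriv M s) s :=
  ((hM.1.differentiable (by simp)) s).hasDerivAt

theorem RadialTest.continuous_deriv {M : ℝ → ℝ} (hM : RadialTest M) : Continuous (deriv M) :=
  hM.1.continuous_deriv (by simp)

/-- The primitive that vanishes at `1/16` is again a radial test. -/
theorem RadialTest.exists_primitive {m : ℝ → ℝ} (hm : RadialTest m) :
    ∃ M, RadialTest M ∧ deriv M = m := by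
  refine ⟨fun s => ∫ x in (1 / 16 : ℝ)..s, m x, ?_, ?_⟩
  · have hd : ∀ s, HasDerivAt (fun s => ∫ x in (1 / 16 : ℝ)..s, m x) (m s) s := fun s =>
      (hm.continuous.integral_hasStrictDerivAt _ s).hasDerivAt
    refine ⟨contDiff_infty_iff_deriv.2 ⟨fun s => (hd s).differentiableAt, ?_⟩, fun s hs => ?_⟩
    · rw [funext fun s => (hd s).deriv]
      exact hm.1
    · change ∫ x in (1 / 16 : ℝ)..s, m x = 0
      rw [intervalIntegral.integral_congr (g := fun _ => (0 : ℝ)), intervalIntegral.integral_zero]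
      intro x hx
      rw [uIcc_of_le hs] at hx
      exact hm.2 x hx.1
  · exact funext fun s => (hm.continuous.integral_hasStrictDerivAt _ s).hasDerivAt.deriv

/-- Integration by parts against `M(r²)`. There are no boundary terms: `M(1/16) = 0`, and the
primitive vanishes at zero. -/
theorem RadialTest.integral_eq_neg_deriv {M : ℝ → ℝ} (hM : RadialTest M) {h : ℝ → ℝ}
    (hh : Continuous h) :
    ∫ r in (0 : ℝ)..(1 / 4), M (r ^ 2) * h r
      = - ∫ r in (0 : ℝ)..(1 / 4), deriv M (r ^ 2) * (2 * r * ∫ ρ in (0 : ℝ)..r, h ρ) := by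
  have h1 : ∀ r : ℝ, HasDerivAt (fun r => M (r ^ 2)) (deriv M (r ^ 2) * (2 * r)) r := fun r => by
    have h3 : HasDerivAt (fun r : ℝ => r ^ 2) (2 * r) r := by simpa using hasDerivAt_pow 2 r
    exact HasDerivAt.comp r (hM.hasDerivAt (r ^ 2)) h3
  have h2 : ∀ r : ℝ, HasDerivAt (fun r => ∫ ρ in (0 : ℝ)..r, h ρ) (h r) r := fun r =>
    (hh.integral_hasStrictDerivAt _ r).hasDerivAt
  have c1 : Continuous fun r : ℝ => deriv M (r ^ 2) * (2 * r) := by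
    have := hM.continuous_deriv
    fun_prop
  rw [intervalIntegral.integral_mul_deriv_eq_deriv_mul (fun r _ => h1 r) (fun r _ => h2 r)
    (c1.intervalIntegrable _ _) (hh.intervalIntegrable _ _), hM.2 ((1 / 4) ^ 2) (by norm_num)]
  simp [mul_assoc]

/-- If `∫ M'(r²) g(r) dr = ∫ M(r²) h(r) dr` for all radial tests `M`, then `g` is `-2r` times the
primitive of `h`: integrate by parts on the right, and use that `M'` is arbitrary. -/
theorem eq_primitive_of_radialTest {g h : ℝ → ℝ} (hg : Continuous g) (hh : Continuous h)
    (H : ∀ M, RadialTest M → ∫ r in (0 : ℝ)..(1 / 4), deriv M (r ^ 2) * g r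
      = ∫ r in (0 : ℝ)..(1 / 4), M (r ^ 2) * h r) {r : ℝ} (hr : r ∈ Ioo (0 : ℝ) (1 / 4)) :
    g r = - (2 * r * ∫ ρ in (0 : ℝ)..r, h ρ) := by
  have cH : Continuous fun r => ∫ ρ in (0 : ℝ)..r, h ρ :=
    intervalIntegral.continuous_primitive (fun a b => hh.intervalIntegrable a b) 0
  let k : ℝ → ℝ := fun r => g r + 2 * r * ∫ ρ in (0 : ℝ)..r, h ρ
  have hk : Continuous k := by fun_prop
  have key : ∀ χ : ℝ → ℝ, ContDiff ℝ ∞ χ → HasCompactSupport χ → tsupport χ ⊆ Ioo 0 (1 / 4) →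
      ∫ t in Icc 0 (1 / 4), χ t * k t = 0 := by
    intro χ hχ _ hχs
    have hz : ∀ t, t ∉ Ioo (0 : ℝ) (1 / 4) → χ t = 0 := fun t ht =>
      image_eq_zero_of_notMem_tsupport fun h => ht (hχs h)
    -- `s ↦ χ(√s)` is smooth because `χ` vanishes near zero
    have hm : RadialTest fun s => χ (√s) := by
      refine ⟨contDiff_iff_contDiffAt.2 fun s => ?_, fun s hs => hz _ fun h => ?_⟩
      · rcases eq_or_ne s 0 with rfl | hs
        · have : ∀ᶠ s in 𝓝 (0 : ℝ), χ (√s) = 0 := by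
            have h0 : (0 : ℝ) ∉ tsupport χ := fun h => (hχs h).1.false
            have h1 : ∀ᶠ t in 𝓝 (√(0 : ℝ)), χ t = 0 := by
              rw [Real.sqrt_zero]
              exact (notMem_tsupport_iff_eventuallyEq.1 h0)
            exact Real.continuous_sqrt.continuousAt.eventually h1
          exact (contDiffAt_const (c := (0 : ℝ))).congr_of_eventuallyEq this
        · exact hχ.contDiffAt.comp s (Real.contDiffAt_sqrt hs)
      · have : √(1 / 16 : ℝ) ≤ √s := Real.sqrt_le_sqrt hs
        rw [show (1 / 16 : ℝ) = (1 / 4) ^ 2 by norm_num, Real.sqrt_sq (by norm_num)] at this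
        exact absurd h.2 (not_lt.2 this)
    obtain ⟨M, hM, hMd⟩ := hm.exists_primitive
    have e := H M hM
    rw [hM.integral_eq_neg_deriv hh, eq_neg_iff_add_eq_zero] at e
    have cM : Continuous fun r : ℝ => deriv M (r ^ 2) := hM.continuous_deriv.comp (by fun_prop)
    have c1 : Continuous fun r => deriv M (r ^ 2) * g r := cM.mul hg
    have c2 : Continuous fun r => deriv M (r ^ 2) * (2 * r * ∫ ρ in (0 : ℝ)..r, h ρ) := by fun_prop
    rw [← intervalIntegral.integral_add (c1.intervalIntegrable _ _)
      (c2.intervalIntegrable _ _)] at e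
    rw [integral_Icc_eq_integral_Ioc, ← intervalIntegral.integral_of_le (by norm_num)]
    refine Eq.trans ?_ e
    have e2 : EqOn (fun r => χ r * k r) (fun r => deriv M (r ^ 2) * g r
        + deriv M (r ^ 2) * (2 * r * ∫ ρ in (0 : ℝ)..r, h ρ)) (uIcc 0 (1 / 4)) := by
      intro r hr
      rw [uIcc_of_le (by norm_num)] at hr
      simp only [hMd, Real.sqrt_sq hr.1, k]
      ring
    exact intervalIntegral.integral_congr e2
  have hae := ae_eq_zero_of_tests (T := 1 / 4) (h := k) hk.integrableOn_Icc key
  have hae' : k =ᵐ[volume.restrict (Icc 0 (1 / 4))] fun _ => 0 := hae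
  -- both sides are continuous
  have := Measure.eqOn_Icc_of_ae_eq volume (by norm_num : (0 : ℝ) ≠ 1 / 4) hae'
    hk.continuousOn continuousOn_const
  have := this (Ioo_subset_Icc_self hr)
  simp only [k] at this
  linarith

/-- L'Hôpital's rule for primitives. -/
theorem tendsto_primitive_div_pow {h : ℝ → ℝ} (hh : Continuous h) {n : ℕ} {β : ℝ}
    (hβ : Tendsto (fun r => h r / r ^ n) (𝓝[>] 0) (𝓝 β)) :
    Tendsto (fun r => (∫ ρ in (0 : ℝ)..r, h ρ) / r ^ (n + 1)) (𝓝[>] 0) (𝓝 (β / (n + 1))) := by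
  have cH : Continuous fun r => ∫ ρ in (0 : ℝ)..r, h ρ :=
    intervalIntegral.continuous_primitive (fun a b => hh.intervalIntegrable a b) 0
  refine HasDerivAt.lhopital_zero_nhdsGT (f' := h) (g' := fun r => (n + 1) * r ^ n)
    (Eventually.of_forall fun r => (hh.integral_hasStrictDerivAt _ r).hasDerivAt)
    (Eventually.of_forall fun r => by simpa using hasDerivAt_pow (n + 1) r)
    (eventually_mem_nhdsWithin.mono fun r hr => ?_) ?_ ?_ ?_
  · have : (0 : ℝ) < r := hr
    positivity
  · have := cH.tendsto 0
    rw [intervalIntegral.integral_same] at this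
    exact this.mono_left nhdsWithin_le_nhds
  · have : Continuous fun r : ℝ => r ^ (n + 1) := by fun_prop
    have := this.tendsto 0
    rw [zero_pow n.succ_ne_zero] at this
    exact this.mono_left nhdsWithin_le_nhds
  · refine (hβ.div_const ((n : ℝ) + 1)).congr fun r => ?_
    rw [div_div, mul_comm]

/-! ### Isotropic kernels -/

theorem integrable_of_support {F : E d → ℝ} (hF : Continuous F)
    (h0 : ∀ v, 1 / 4 ≤ ‖v‖ → F v = 0) : Integrable F :=
  hF.integrable_of_hasCompactSupport (HasCompactSupport.intro (isCompact_closedBall (0 : E d) (1 / 4))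
    fun v hv => h0 v (by simpa using (not_le.1 (by simpa using hv)).le))

theorem RadialTest.deriv {M : ℝ → ℝ} (hM : RadialTest M) : RadialTest (deriv M) := by
  refine ⟨(contDiff_infty_iff_deriv.1 hM.1).2, fun s hs => ?_⟩
  have h1 : EqOn (_root_.deriv M) (fun _ => 0) (closure (Ioi (1 / 16))) := by
    refine EqOn.closure (fun x hx => ?_) hM.continuous_deriv continuous_const
    have : M =ᶠ[𝓝 x] fun _ => 0 := by
      filter_upwards [Ioi_mem_nhds hx] with y hy using hM.2 y (le_of_lt hy)
    rw [this.deriv_eq, deriv_const]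
  rw [closure_Ioi] at h1
  exact h1 hs

theorem RadialTest.zero : RadialTest fun _ => 0 := ⟨contDiff_const, fun _ _ => rfl⟩

theorem RadialTest.comp_norm_sq {M : ℝ → ℝ} (hM : RadialTest M) {v : E d} (hv : 1 / 4 ≤ ‖v‖) :
    M (‖v‖ ^ 2) = 0 :=
  hM.2 _ (by nlinarith)

theorem RadialTest.hasFDerivAt {M : ℝ → ℝ} (hM : RadialTest M) (v : E d) :
    HasFDerivAt (fun v : E d => M (‖v‖ ^ 2)) (_root_.deriv M (‖v‖ ^ 2) • (2 • innerSL ℝ v)) v :=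
  (hM.hasDerivAt _).comp_hasFDerivAt v (hasStrictFDerivAt_norm_sq v).hasFDerivAt

theorem hasFDerivAt_coord (i : Fin d) (v : E d) :
    HasFDerivAt (fun v : E d => v i) (EuclideanSpace.proj i : E d →L[ℝ] ℝ) v :=
  (EuclideanSpace.proj i : E d →L[ℝ] ℝ).hasFDerivAt

/-- The kernels `a(|v|²) δ_{ij} + b(|v|²) v_i v_j`. -/
noncomputable def isoKernel (a b : ℝ → ℝ) (i j : Fin d) (v : E d) : ℝ :=
  (if i = j then a (‖v‖ ^ 2) else 0) + b (‖v‖ ^ 2) * (v i * v j)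

theorem contDiff_isoKernel {a b : ℝ → ℝ} (ha : RadialTest a) (hb : RadialTest b) (i j : Fin d) :
    ContDiff ℝ ∞ (isoKernel a b i j) := by
  have h1 : ContDiff ℝ ∞ fun v : E d => a (‖v‖ ^ 2) := ha.1.comp (contDiff_norm_sq ℝ)
  have h2 : ContDiff ℝ ∞ fun v : E d => b (‖v‖ ^ 2) := hb.1.comp (contDiff_norm_sq ℝ)
  have h3 : ∀ i, ContDiff ℝ ∞ fun v : E d => v i := fun i => by fun_prop
  unfold isoKernel
  refine ContDiff.add ?_ (h2.mul ((h3 i).mul (h3 j)))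
  split_ifs
  · exact h1
  · exact contDiff_const

theorem isoKernel_eq_zero {a b : ℝ → ℝ} (ha : RadialTest a) (hb : RadialTest b) (i j : Fin d)
    {v : E d} (hv : 1 / 4 ≤ ‖v‖) : isoKernel a b i j v = 0 := by
  simp [isoKernel, ha.comp_norm_sq hv, hb.comp_norm_sq hv]

theorem fderiv_isoKernel {a b : ℝ → ℝ} (ha : RadialTest a) (hb : RadialTest b) (i j k : Fin d)
    (v : E d) : fderiv ℝ (isoKernel a b i j) v (EuclideanSpace.single k 1)
      = (if i = j then 2 * deriv a (‖v‖ ^ 2) * v k else 0)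
        + 2 * deriv b (‖v‖ ^ 2) * (v i * v j * v k)
        + b (‖v‖ ^ 2) * ((if i = k then v j else 0) + (if j = k then v i else 0)) := by
  have h1 : HasFDerivAt (fun v : E d => if i = j then a (‖v‖ ^ 2) else 0)
      (if i = j then deriv a (‖v‖ ^ 2) • (2 • innerSL ℝ v) else 0) v := by
    split_ifs
    · exact ha.hasFDerivAt v
    · exact hasFDerivAt_const 0 v
  have h := h1.fun_add ((hb.hasFDerivAt v).fun_mul ((hasFDerivAt_coord i v).fun_mul
    (hasFDerivAt_coord j v)))
  have h' : HasFDerivAt (isoKernel a b i j) _ v := h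
  rw [h'.fderiv]
  have hin : inner ℝ v (EuclideanSpace.single k (1 : ℝ)) = v k := by
    rw [EuclideanSpace.inner_single_right]; simp
  have hite : (if i = j then deriv a (‖v‖ ^ 2) • (2 • innerSL ℝ v) else 0 : E d →L[ℝ] ℝ)
      (EuclideanSpace.single k 1) = if i = j then 2 * deriv a (‖v‖ ^ 2) * v k else 0 := by
    split_ifs
    · simp [hin]; ring
    · rfl
  rw [add_apply, hite]
  by_cases hik : i = k <;> by_cases hjk : j = k <;> simp [hik, hjk, hin] <;> ring

theorem fderiv_radial {κ : ℝ → ℝ} (hκ : RadialTest κ) (k : Fin d) (v : E d) :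
    fderiv ℝ (fun v : E d => κ (‖v‖ ^ 2)) v (EuclideanSpace.single k 1)
      = 2 * deriv κ (‖v‖ ^ 2) * v k := by
  rw [(hκ.hasFDerivAt v).fderiv]
  have hin : inner ℝ v (EuclideanSpace.single k (1 : ℝ)) = v k := by
    rw [EuclideanSpace.inner_single_right]; simp
  simp [hin]
  ring

/-- Contraction of the gradient of an isotropic kernel with a symmetric tensor. -/
theorem sum_fderiv_isoKernel {a b : ℝ → ℝ} (ha : RadialTest a) (hb : RadialTest b)
    {γ : Fin d → Fin d → Fin d → ℝ} (h1 : ∀ i j k, γ i j k = γ j i k)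
    (h2 : ∀ i j k, γ i j k = γ i k j) (v : E d) :
    ∑ i, ∑ j, ∑ k, fderiv ℝ (isoKernel a b i j) v (EuclideanSpace.single k 1) * γ i j k
      = 2 * (deriv a (‖v‖ ^ 2) + b (‖v‖ ^ 2)) * (∑ i, ∑ k, v k * γ i i k)
        + 2 * deriv b (‖v‖ ^ 2) * ∑ i, ∑ j, ∑ k, v i * v j * v k * γ i j k := by
  simp only [fderiv_isoKernel ha hb, add_mul, mul_add, Finset.sum_add_distrib, ite_mul, zero_mul,
    mul_ite, mul_zero, Finset.sum_ite_eq, Finset.mem_univ, if_true]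
  have e1 : ∑ i, ∑ j, ∑ k, (if i = j then 2 * deriv a (‖v‖ ^ 2) * v k * γ i j k else 0)
      = 2 * deriv a (‖v‖ ^ 2) * ∑ i, ∑ k, v k * γ i i k := by
    rw [Finset.mul_sum]
    refine Finset.sum_congr rfl fun i _ => ?_
    rw [Finset.sum_comm, Finset.mul_sum]
    refine Finset.sum_congr rfl fun k _ => ?_
    rw [Finset.sum_ite_eq]
    simp [mul_assoc]
  have e2 : ∑ i, ∑ j, b (‖v‖ ^ 2) * v j * γ i j i = b (‖v‖ ^ 2) * ∑ i, ∑ k, v k * γ i i k := by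
    simp only [Finset.mul_sum]
    refine Finset.sum_congr rfl fun i _ => Finset.sum_congr rfl fun k _ => ?_
    rw [h2 i k i]; ring
  have e3 : ∑ i, ∑ j, b (‖v‖ ^ 2) * v i * γ i j j = b (‖v‖ ^ 2) * ∑ i, ∑ k, v k * γ i i k := by
    rw [Finset.sum_comm]
    simp only [Finset.mul_sum]
    refine Finset.sum_congr rfl fun i _ => Finset.sum_congr rfl fun k _ => ?_
    rw [h1 k i i, h2 i k i]; ring
  have e4 : ∑ i, ∑ j, ∑ k, 2 * deriv b (‖v‖ ^ 2) * (v i * v j * v k) * γ i j k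
      = 2 * deriv b (‖v‖ ^ 2) * ∑ i, ∑ j, ∑ k, v i * v j * v k * γ i j k := by
    simp only [Finset.mul_sum, mul_assoc]
  rw [e1, e2, e3, e4]
  ring

/-! ### The balance on spheres -/

/-- Third order structure functions `γ` and second order quantities `W`, `V` on the torus, related
by the two-point balance for all matrices of kernels whose divergence is a gradient. -/
structure TwoPointBalance (γ : Fin d → Fin d → Fin d → Torus d → ℝ)
    (W : Fin d → Fin d → Torus d → ℝ) (V : Torus d → ℝ) : Prop where
  symm_left : ∀ i j k, γ i j k = γ j i k
  symm_right : ∀ i j k, γ i j k = γ i k j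
  continuous_cubic : ∀ i j k, Continuous (γ i j k)
  continuous_kernel : ∀ i j, Continuous (W i j)
  continuous_potential : Continuous V
  balance : ∀ (Q : Fin d → Fin d → Torus d → ℝ) (κ : Torus d → ℝ), (∀ i j, SmoothT (Q i j)) →
    (∀ i j, Q i j = Q j i) → SmoothT κ → (∀ i x, ∑ j, pd j (Q i j) x = pd i κ x) →
    1 / 2 * ∑ i, ∑ j, ∑ k, ∫ c, pd k (Q i j) c * γ i j k c
      = (∑ i, ∑ j, ∫ c, Q i j c * W i j c) + ∫ c, κ c * V c

/-- The integral of `F(θ, rθ)` over the unit sphere, the second argument being read modulo the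
lattice. -/
noncomputable def sphereInt (F : E d → Torus d → ℝ) (r : ℝ) : ℝ :=
  ∫ θ : sphere (0 : E d) 1, F θ (proj (r • (θ : E d))) ∂(sphereMeasure d)

theorem continuous_sphereInt {F : E d → Torus d → ℝ}
    (hF : Continuous fun z : E d × Torus d => F z.1 z.2) : Continuous (sphereInt F) := by
  refine continuous_sphereIntegral (F := fun r θ => F θ (proj (r • θ))) ?_
  exact hF.comp (continuous_snd.prodMk (continuous_proj.comp (continuous_fst.smul continuous_snd)))

theorem integrable_sphereInt {F : E d → Torus d → ℝ}
    (hF : Continuous fun z : E d × Torus d => F z.1 z.2) (r : ℝ) :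
    Integrable (fun θ : sphere (0 : E d) 1 => F θ (proj (r • (θ : E d)))) (sphereMeasure d) :=
  integrable_sphere (F := fun θ => F θ (proj (r • θ)))
    (hF.comp (continuous_id.prodMk (continuous_proj.comp (continuous_const_smul r))))

section

variable {γ : Fin d → Fin d → Fin d → Torus d → ℝ} {W : Fin d → Fin d → Torus d → ℝ}
  {V : Torus d → ℝ}

/-- The balance for isotropic kernels, in polar coordinates. The hypothesis `hκ'` says that the
divergence of the kernels is the gradient of `κ`. -/
theorem TwoPointBalance.radial (H : TwoPointBalance γ W V) (hd : 0 < d) {a b κ : ℝ → ℝ}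
    (ha : RadialTest a) (hb : RadialTest b) (hκ : RadialTest κ)
    (hκ' : ∀ s, 2 * deriv κ s = 2 * deriv a s + 2 * s * deriv b s + (d + 1) * b s) :
    ∫ r in (0 : ℝ)..(1 / 4), r ^ (d - 1) * ((deriv a (r ^ 2) + b (r ^ 2)) * r
          * sphereInt (fun θ c => ∑ i, ∑ k, θ k * γ i i k c) r
        + deriv b (r ^ 2) * r ^ 3
          * sphereInt (fun θ c => ∑ i, ∑ j, ∑ k, θ i * θ j * θ k * γ i j k c) r)
      = ∫ r in (0 : ℝ)..(1 / 4), r ^ (d - 1) * (a (r ^ 2) * sphereInt (fun _ c => ∑ i, W i i c) r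
        + b (r ^ 2) * r ^ 2 * sphereInt (fun θ c => ∑ i, ∑ j, θ i * θ j * W i j c) r
        + κ (r ^ 2) * sphereInt (fun _ c => V c) r) := by
  have hK := contDiff_isoKernel (d := d) ha hb
  have hK0 : ∀ i j (v : E d), 1 / 4 ≤ ‖v‖ → isoKernel a b i j v = 0 := fun i j v hv =>
    isoKernel_eq_zero ha hb i j hv
  have hκs : ContDiff ℝ ∞ fun v : E d => κ (‖v‖ ^ 2) := hκ.1.comp (contDiff_norm_sq ℝ)
  have hκ0 : ∀ v : E d, 1 / 4 ≤ ‖v‖ → κ (‖v‖ ^ 2) = 0 := fun v hv => hκ.comp_norm_sq hv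
  have hQ := fun i j => smoothT_per (hK i j) (hK0 i j)
  have cγ := H.continuous_cubic
  have cW := H.continuous_kernel
  have cV := H.continuous_potential
  have hdK : ∀ i j k (v : E d), 1 / 4 ≤ ‖v‖ →
      fderiv ℝ (isoKernel a b i j) v (EuclideanSpace.single k 1) = 0 := by
    intro i j k v hv
    rw [fderiv_isoKernel ha hb]
    simp [ha.deriv.comp_norm_sq hv, hb.deriv.comp_norm_sq hv, hb.comp_norm_sq hv]
  have cdK : ∀ i j k, Continuous fun v : E d =>
      fderiv ℝ (isoKernel a b i j) v (EuclideanSpace.single k 1) := fun i j k =>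
    ((hK i j).continuous_fderiv (by simp)).clm_apply continuous_const
  -- the balance for the periodized kernels
  have B := H.balance (fun i j => per (isoKernel a b i j)) (per fun v => κ (‖v‖ ^ 2)) hQ
    (fun i j => by
      congr 1; ext v
      simp only [isoKernel, eq_comm (a := i), mul_comm (v i)])
    (smoothT_per hκs hκ0) (fun i x => by
      simp only [pd_per (hK i _) (hK0 i _), pd_per hκs hκ0, per, fderiv_isoKernel ha hb,
        fderiv_radial hκ, hκ']
      set v : E d := rep x
      have hn : ∑ j, v j * v j = ‖v‖ ^ 2 := by
        rw [EuclideanSpace.real_norm_sq_eq]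
        exact Finset.sum_congr rfl fun j _ => (sq _).symm
      have e1 : ∑ j, v i * v j * v j = ‖v‖ ^ 2 * v i := by
        rw [← hn, Finset.sum_mul]
        exact Finset.sum_congr rfl fun j _ => by ring
      simp only [Finset.sum_add_distrib, ← Finset.mul_sum, Finset.sum_ite_eq, Finset.mem_univ,
        if_true, e1, Finset.sum_const, Finset.card_univ, Fintype.card_fin, nsmul_eq_mul]
      ring)
  simp only [pd_per (hK _ _) (hK0 _ _)] at B
  have m1 : ∀ i j k, ∫ c, per (fun v => fderiv ℝ (isoKernel a b i j) v
      (EuclideanSpace.single k 1)) c * γ i j k c = ∫ v, fderiv ℝ (isoKernel a b i j) v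
      (EuclideanSpace.single k 1) * γ i j k (proj v) := fun i j k => by
    refine integral_per_mul (hdK i j k) ?_
    rw [← pd_per (hK i j) (hK0 i j)]
    exact (((hQ i j).pd k).continuous.mul (cγ i j k)).aestronglyMeasurable
  have m2 : ∀ i j, ∫ c, per (isoKernel a b i j) c * W i j c
      = ∫ v, isoKernel a b i j v * W i j (proj v) := fun i j =>
    integral_per_mul (hK0 i j) ((hQ i j).continuous.mul (cW i j)).aestronglyMeasurable
  have m3 : ∫ c, per (fun v => κ (‖v‖ ^ 2)) c * V c = ∫ v : E d, κ (‖v‖ ^ 2) * V (proj v) :=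
    integral_per_mul hκ0 ((smoothT_per hκs hκ0).continuous.mul cV).aestronglyMeasurable
  simp only [m1, m2, m3] at B
  have c1 : ∀ i j k, Continuous fun v : E d => fderiv ℝ (isoKernel a b i j) v
      (EuclideanSpace.single k 1) * γ i j k (proj v) := fun i j k =>
    (cdK i j k).mul ((cγ i j k).comp continuous_proj)
  have c2 : ∀ i j, Continuous fun v : E d => isoKernel a b i j v * W i j (proj v) := fun i j =>
    (hK i j).continuous.mul ((cW i j).comp continuous_proj)
  have c3 : Continuous fun v : E d => κ (‖v‖ ^ 2) * V (proj v) :=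
    hκs.continuous.mul (cV.comp continuous_proj)
  have i1 : ∀ i j k, Integrable fun v : E d => fderiv ℝ (isoKernel a b i j) v
      (EuclideanSpace.single k 1) * γ i j k (proj v) := fun i j k =>
    integrable_of_support (c1 i j k) fun v hv => by simp [hdK i j k v hv]
  have i2 : ∀ i j, Integrable fun v : E d => isoKernel a b i j v * W i j (proj v) := fun i j =>
    integrable_of_support (c2 i j) fun v hv => by simp [hK0 i j v hv]
  have i3 : Integrable fun v : E d => κ (‖v‖ ^ 2) * V (proj v) :=
    integrable_of_support c3 fun v hv => by simp [hκ0 v hv]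
  have s1 : ∑ i, ∑ j, ∑ k, ∫ v, fderiv ℝ (isoKernel a b i j) v
      (EuclideanSpace.single k 1) * γ i j k (proj v)
      = ∫ v, ∑ i, ∑ j, ∑ k, fderiv ℝ (isoKernel a b i j) v
        (EuclideanSpace.single k 1) * γ i j k (proj v) := by
    rw [integral_finsetSum _ fun i _ => integrable_finsetSum _ fun j _ =>
      integrable_finsetSum _ fun k _ => i1 i j k]
    refine Finset.sum_congr rfl fun i _ => ?_
    rw [integral_finsetSum _ fun j _ => integrable_finsetSum _ fun k _ => i1 i j k]
    refine Finset.sum_congr rfl fun j _ => ?_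
    rw [integral_finsetSum _ fun k _ => i1 i j k]
  have s2 : ∑ i, ∑ j, ∫ v, isoKernel a b i j v * W i j (proj v)
      = ∫ v, ∑ i, ∑ j, isoKernel a b i j v * W i j (proj v) := by
    rw [integral_finsetSum _ fun i _ => integrable_finsetSum _ fun j _ => i2 i j]
    refine Finset.sum_congr rfl fun i _ => ?_
    rw [integral_finsetSum _ fun j _ => i2 i j]
  have i2' : Integrable fun v : E d => ∑ i, ∑ j, isoKernel a b i j v * W i j (proj v) :=
    integrable_finsetSum _ fun i _ => integrable_finsetSum _ fun j _ => i2 i j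
  rw [s1, s2, ← integral_add i2' i3, integral_polar_of_support hd (by fun_prop)
    (fun v hv => by simp [hdK _ _ _ v hv]), integral_polar_of_support hd (by fun_prop)
    (fun v hv => by simp [hK0 _ _ v hv, hκ0 v hv]), ← intervalIntegral.integral_const_mul] at B
  have nθ : ∀ (r : ℝ) (θ : sphere (0 : E d) 1), ‖r • (θ : E d)‖ ^ 2 = r ^ 2 := fun r θ => by
    rw [norm_smul, norm_eq_of_mem_sphere θ, mul_one, Real.norm_eq_abs, sq_abs]
  refine Eq.trans ?_ (B.trans ?_)
  · congr 1; ext r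
    simp only [sum_fderiv_isoKernel ha hb (fun i j k => congrFun (H.symm_left i j k) _)
      (fun i j k => congrFun (H.symm_right i j k) _), nθ]
    have j1 := integrable_sphereInt (F := fun θ c => ∑ i, ∑ k, θ k * γ i i k c) (by fun_prop) r
    have j2 := integrable_sphereInt
      (F := fun θ c => ∑ i, ∑ j, ∑ k, θ i * θ j * θ k * γ i j k c) (by fun_prop) r
    have e : ∀ θ : sphere (0 : E d) 1,
        2 * (deriv a (r ^ 2) + b (r ^ 2)) * (∑ i, ∑ k, (r • (θ : E d)) k * γ i i k (proj (r • θ)))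
        + 2 * deriv b (r ^ 2) * ∑ i, ∑ j, ∑ k, (r • (θ : E d)) i * (r • (θ : E d)) j
          * (r • (θ : E d)) k * γ i j k (proj (r • θ))
        = 2 * ((deriv a (r ^ 2) + b (r ^ 2)) * r)
            * (∑ i, ∑ k, (θ : E d) k * γ i i k (proj (r • θ)))
          + 2 * (deriv b (r ^ 2) * r ^ 3) * ∑ i, ∑ j, ∑ k, (θ : E d) i * (θ : E d) j
            * (θ : E d) k * γ i j k (proj (r • θ)) := by
      intro θ
      simp only [PiLp.smul_apply, smul_eq_mul, Finset.mul_sum]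
      congr 1
      · exact Finset.sum_congr rfl fun i _ => Finset.sum_congr rfl fun j _ => by ring
      · exact Finset.sum_congr rfl fun i _ => Finset.sum_congr rfl fun j _ =>
          Finset.sum_congr rfl fun k _ => by ring
    simp only [e]
    rw [integral_add (j1.const_mul _) (j2.const_mul _), integral_const_mul, integral_const_mul]
    simp only [sphereInt]
    ring
  · congr 1; ext r
    have j1 := integrable_sphereInt (F := fun _ c => ∑ i, W i i c) (by fun_prop) r
    have j2 := integrable_sphereInt
      (F := fun θ c => ∑ i, ∑ j, θ i * θ j * W i j c) (by fun_prop) r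
    have j3 := integrable_sphereInt (F := fun _ c => V c) (by fun_prop) r
    have e : ∀ θ : sphere (0 : E d) 1,
        (∑ i, ∑ j, isoKernel a b i j (r • (θ : E d)) * W i j (proj (r • θ)))
          = a (r ^ 2) * (∑ i, W i i (proj (r • θ)))
            + b (r ^ 2) * r ^ 2 * ∑ i, ∑ j, (θ : E d) i * (θ : E d) j * W i j (proj (r • θ)) := by
      intro θ
      simp only [isoKernel, nθ, add_mul, Finset.sum_add_distrib, ite_mul, zero_mul,
        Finset.sum_ite_eq, Finset.mem_univ, if_true, PiLp.smul_apply, smul_eq_mul, Finset.mul_sum]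
      congr 1
      exact Finset.sum_congr rfl fun i _ => Finset.sum_congr rfl fun j _ => by ring
    simp only [e, nθ]
    have j12 := (j1.const_mul (a (r ^ 2))).fun_add (j2.const_mul (b (r ^ 2) * r ^ 2))
    rw [integral_add j12 (j3.const_mul _),
      integral_add (j1.const_mul _) (j2.const_mul _), integral_const_mul, integral_const_mul,
      integral_const_mul]
    rfl

end

/-! ### Small separations -/

/-- The second moments of the sphere. The two sides agree when integrated against radial tests,
because the divergence of `M(|v|²) v_i e_j` has integral zero. -/
theorem integral_sphere_coord_mul (hd : 0 < d) (i j : Fin d) :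
    ∫ θ : sphere (0 : E d) 1, (θ : E d) i * (θ : E d) j ∂(sphereMeasure d)
      = if i = j then (sphereMeasure d).real univ / d else 0 := by
  set m := ∫ θ : sphere (0 : E d) 1, (θ : E d) i * (θ : E d) j ∂(sphereMeasure d) with hm
  set σ := (sphereMeasure d).real univ with hσ
  set δ : ℝ := if i = j then 1 else 0 with hδ
  -- the resulting relation is evaluated at the radius `1/8`; any radius below `1/4` would do
  have key := eq_primitive_of_radialTest (g := fun r => 2 * r ^ (d + 1) * m)
    (h := fun r => -(δ * σ * r ^ (d - 1))) (by fun_prop) (by fun_prop) (fun M hM => by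
    have hK : ContDiff ℝ ∞ fun v : E d => M (‖v‖ ^ 2) * v i := by
      have h1 : ContDiff ℝ ∞ fun v : E d => M (‖v‖ ^ 2) := hM.1.comp (contDiff_norm_sq ℝ)
      exact h1.mul (by fun_prop)
    have hK0 : ∀ v : E d, 1 / 4 ≤ ‖v‖ → M (‖v‖ ^ 2) * v i = 0 := fun v hv => by
      simp [hM.comp_norm_sq hv]
    have hdK : ∀ v : E d, fderiv ℝ (fun v : E d => M (‖v‖ ^ 2) * v i) v
        (EuclideanSpace.single j 1)
        = 2 * deriv M (‖v‖ ^ 2) * (v i * v j) + M (‖v‖ ^ 2) * δ := by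
      intro v
      have hin : inner ℝ v (EuclideanSpace.single j (1 : ℝ)) = v j := by
        rw [EuclideanSpace.inner_single_right]; simp
      rw [((hM.hasFDerivAt v).fun_mul (hasFDerivAt_coord i v)).fderiv]
      by_cases hij : i = j <;> simp [hδ, hij, hin] <;> ring
    -- the derivative `∂_j` of a smooth function has integral zero
    have e0 := integral_pd (smoothT_per hK hK0) j
    rw [pd_per hK hK0] at e0
    simp only [hdK] at e0
    have cM := hM.continuous
    have cM' := hM.continuous_deriv
    have cD : Continuous fun v : E d => 2 * deriv M (‖v‖ ^ 2) * (v i * v j) + M (‖v‖ ^ 2) * δ := by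
      fun_prop
    have hD0 : ∀ v : E d, 1 / 4 ≤ ‖v‖ →
        2 * deriv M (‖v‖ ^ 2) * (v i * v j) + M (‖v‖ ^ 2) * δ = 0 := fun v hv => by
      simp [hM.comp_norm_sq hv, hM.deriv.comp_norm_sq hv]
    have e1 := integral_per_mul (h := fun _ => 1) hD0 (by
      have := ((smoothT_per hK hK0).pd j).continuous
      rw [pd_per hK hK0] at this
      simp only [hdK] at this
      simpa using this.aestronglyMeasurable)
    simp only [mul_one] at e1
    rw [e0, integral_polar_of_support hd cD hD0] at e1
    have nθ : ∀ (r : ℝ) (θ : sphere (0 : E d) 1), ‖r • (θ : E d)‖ ^ 2 = r ^ 2 := fun r θ => by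
      rw [norm_smul, norm_eq_of_mem_sphere θ, mul_one, Real.norm_eq_abs, sq_abs]
    have e2 : ∀ r : ℝ, r ^ (d - 1) * ∫ θ : sphere (0 : E d) 1,
        (2 * deriv M (‖r • (θ : E d)‖ ^ 2) * ((r • (θ : E d)) i * (r • (θ : E d)) j)
          + M (‖r • (θ : E d)‖ ^ 2) * δ) ∂(sphereMeasure d)
        = deriv M (r ^ 2) * (2 * r ^ (d + 1) * m) - M (r ^ 2) * -(δ * σ * r ^ (d - 1)) := by
      intro r
      have e3 : ∀ θ : sphere (0 : E d) 1,
          2 * deriv M (‖r • (θ : E d)‖ ^ 2) * ((r • (θ : E d)) i * (r • (θ : E d)) j)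
            + M (‖r • (θ : E d)‖ ^ 2) * δ
          = 2 * deriv M (r ^ 2) * r ^ 2 * ((θ : E d) i * (θ : E d) j) + M (r ^ 2) * δ := by
        intro θ
        rw [nθ]
        simp only [PiLp.smul_apply, smul_eq_mul]
        ring
      simp only [e3]
      rw [integral_add ((integrable_sphere (F := fun θ => θ i * θ j) (by fun_prop)).const_mul _)
        (integrable_const _), integral_const_mul, integral_const, ← hm, ← hσ,
        show d + 1 = (d - 1) + 2 by omega, pow_add]
      simp only [smul_eq_mul]
      ring
    simp only [e2] at e1
    rw [intervalIntegral.integral_sub (Continuous.intervalIntegrable (by fun_prop) _ _)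
      (Continuous.intervalIntegrable (by fun_prop) _ _)] at e1
    linarith) (r := 1 / 8) (by norm_num)
  rw [intervalIntegral.integral_neg, intervalIntegral.integral_const_mul, integral_pow] at key
  have hd' : (d : ℝ) ≠ 0 := by positivity
  have hc : ((d - 1 : ℕ) : ℝ) + 1 = d := by
    rw [← Nat.cast_add_one, Nat.sub_add_cancel hd]
  rw [hc, Nat.sub_add_cancel hd, zero_pow hd.ne', pow_succ] at key
  have hp : ((1 : ℝ) / 8) ^ d ≠ 0 := by positivity
  have hmul : m * d = δ * σ := by
    field_simp at key
    refine mul_right_cancel₀ hp ?_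
    linarith
  have : m = δ * σ / d := eq_div_of_mul_eq hd' hmul
  rw [this, hδ]
  split_ifs <;> simp

theorem sphereInt_const_zero (h : Torus d → ℝ) :
    sphereInt (fun _ c => h c) 0 = (sphereMeasure d).real univ * h 0 := by
  simp [sphereInt, proj_zero]

/-- At zero separation the directional average of `W` is its normalized trace. -/
theorem sphereInt_coord_mul_zero (hd : 0 < d) (W : Fin d → Fin d → Torus d → ℝ) :
    sphereInt (fun θ c => ∑ i, ∑ j, θ i * θ j * W i j c) 0
      = (sphereMeasure d).real univ / d * ∑ i, W i i 0 := by
  simp only [sphereInt, zero_smul, proj_zero]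
  have hi : ∀ i j, Integrable (fun θ : sphere (0 : E d) 1 => (θ : E d) i * (θ : E d) j * W i j 0)
      (sphereMeasure d) := fun i j =>
    (integrable_sphere (F := fun θ => θ i * θ j) (by fun_prop)).mul_const _
  rw [integral_finsetSum _ fun i _ => integrable_finsetSum _ fun j _ => hi i j, Finset.mul_sum]
  refine Finset.sum_congr rfl fun i _ => ?_
  rw [integral_finsetSum _ fun j _ => hi i j]
  simp only [integral_mul_const, integral_sphere_coord_mul hd, ite_mul, zero_mul,
    Finset.sum_ite_eq, Finset.mem_univ, if_true]

section

variable {γ : Fin d → Fin d → Fin d → Torus d → ℝ} {W : Fin d → Fin d → Torus d → ℝ}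
  {V : Torus d → ℝ}

theorem tendsto_right_of_continuous {F : ℝ → ℝ} (hF : Continuous F) :
    Tendsto F (𝓝[>] 0) (𝓝 (F 0)) := (hF.tendsto 0).mono_left nhdsWithin_le_nhds

/-- The limit of the third order structure function for the full increment. -/
theorem TwoPointBalance.tendsto_full (H : TwoPointBalance γ W V) (hd : 0 < d) :
    Tendsto (fun r => sphereInt (fun θ c => ∑ i, ∑ k, θ k * γ i i k c) r / r) (𝓝[>] 0)
      (𝓝 (-(2 / d) * ((sphereMeasure d).real univ * (∑ i, W i i 0 + V 0)))) := by
  have cγ := H.continuous_cubic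
  have cW := H.continuous_kernel
  have cV := H.continuous_potential
  have cA : Continuous (sphereInt (fun θ c => ∑ i, ∑ k, θ k * γ i i k c)) :=
    continuous_sphereInt (by fun_prop)
  have cC : Continuous (sphereInt (d := d) (fun _ c => ∑ i, W i i c)) :=
    continuous_sphereInt (by fun_prop)
  have cVb : Continuous (sphereInt (d := d) (fun _ c => V c)) := continuous_sphereInt (by fun_prop)
  set A := sphereInt (fun θ c => ∑ i, ∑ k, θ k * γ i i k c)
  have hC0 := sphereInt_const_zero (fun c => ∑ i, W i i c)
  have hV0 := sphereInt_const_zero V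
  set C := sphereInt (d := d) (fun _ c => ∑ i, W i i c)
  set Vb := sphereInt (d := d) (fun _ c => V c)
  have ch : Continuous fun r => r ^ (d - 1) * (C r + Vb r) := by fun_prop
  -- the kernels are `M(|v|²) δ_{ij}`, whose divergence is the gradient of `M(|v|²)`
  have key := fun r hr => eq_primitive_of_radialTest (g := fun r => r ^ d * A r)
    (h := fun r => r ^ (d - 1) * (C r + Vb r)) (by fun_prop) ch (fun M hM => by
      have := H.radial hd hM RadialTest.zero hM (by simp)
      simp only [deriv_const', add_zero, zero_mul] at this
      refine Eq.trans ?_ (this.trans ?_)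
      · congr 1; ext r
        obtain ⟨n, rfl⟩ : ∃ n, d = n + 1 := ⟨d - 1, by omega⟩
        simp only [Nat.add_sub_cancel]
        ring
      · congr 1; ext r; ring) (r := r) hr
  have hlim := tendsto_primitive_div_pow (n := d - 1) (β := C 0 + Vb 0) ch
    ((tendsto_right_of_continuous (cC.add cVb)).congr' (by
      filter_upwards [self_mem_nhdsWithin] with r hr
      have : r ^ (d - 1) ≠ 0 := pow_ne_zero _ (ne_of_gt hr)
      field_simp
      rfl))
  have hc : ((d - 1 : ℕ) : ℝ) + 1 = d := by
    rw [← Nat.cast_add_one, Nat.sub_add_cancel hd]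
  rw [hc, Nat.sub_add_cancel hd, hC0, hV0] at hlim
  have := hlim.const_mul (-2)
  rw [show -2 * (((sphereMeasure d).real univ * ∑ i, W i i 0
    + (sphereMeasure d).real univ * V 0) / d)
    = -(2 / d) * ((sphereMeasure d).real univ * (∑ i, W i i 0 + V 0)) by ring] at this
  refine this.congr' ?_
  filter_upwards [Ioo_mem_nhdsGT (by norm_num : (0 : ℝ) < 1 / 4)] with r hr
  have k := key r hr
  have hr0 : r ≠ 0 := hr.1.ne'
  field_simp
  linarith

/-- The limit of the third order structure function for the transverse increment. -/
theorem TwoPointBalance.tendsto_transverse (H : TwoPointBalance γ W V) (hd : 0 < d) :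
    Tendsto (fun r => (sphereInt (fun θ c => ∑ i, ∑ k, θ k * γ i i k c) r
        - sphereInt (fun θ c => ∑ i, ∑ j, ∑ k, θ i * θ j * θ k * γ i j k c) r) / r) (𝓝[>] 0)
      (𝓝 (-(2 * (d - 1) / (d * (d + 2)))
        * ((sphereMeasure d).real univ * (∑ i, W i i 0 + V 0)))) := by
  have cγ := H.continuous_cubic
  have cW := H.continuous_kernel
  have cV := H.continuous_potential
  have cA : Continuous (sphereInt (fun θ c => ∑ i, ∑ k, θ k * γ i i k c)) :=
    continuous_sphereInt (by fun_prop)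
  have cA3 : Continuous (sphereInt (fun θ c => ∑ i, ∑ j, ∑ k, θ i * θ j * θ k * γ i j k c)) :=
    continuous_sphereInt (by fun_prop)
  have cC : Continuous (sphereInt (d := d) (fun _ c => ∑ i, W i i c)) :=
    continuous_sphereInt (by fun_prop)
  have cC3 : Continuous (sphereInt (d := d) (fun θ c => ∑ i, ∑ j, θ i * θ j * W i j c)) :=
    continuous_sphereInt (by fun_prop)
  have cVb : Continuous (sphereInt (d := d) (fun _ c => V c)) := continuous_sphereInt (by fun_prop)
  set A := sphereInt (fun θ c => ∑ i, ∑ k, θ k * γ i i k c)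
  set A3 := sphereInt (fun θ c => ∑ i, ∑ j, ∑ k, θ i * θ j * θ k * γ i j k c)
  have hC0 := sphereInt_const_zero (fun c => ∑ i, W i i c)
  have hC30 := sphereInt_coord_mul_zero hd W
  have hV0 := sphereInt_const_zero V
  set C := sphereInt (d := d) (fun _ c => ∑ i, W i i c)
  set C3 := sphereInt (d := d) (fun θ c => ∑ i, ∑ j, θ i * θ j * W i j c)
  set Vb := sphereInt (d := d) (fun _ c => V c)
  have cw : Continuous fun r => r ^ (d - 1) * Vb r := by fun_prop
  have cK : Continuous fun r => ∫ ρ in (0 : ℝ)..r, ρ ^ (d - 1) * Vb ρ :=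
    intervalIntegral.continuous_primitive (fun a b => cw.intervalIntegrable a b) 0
  set K := fun r => ∫ ρ in (0 : ℝ)..r, ρ ^ (d - 1) * Vb ρ with hK
  have ch : Continuous fun r => r ^ (d + 1) * (C r - C3 r) + (d - 1) * (r * K r) := by fun_prop
  have key := fun r hr => eq_primitive_of_radialTest (g := fun r => r ^ (d + 2) * (A r - A3 r))
    (h := fun r => r ^ (d + 1) * (C r - C3 r) + (d - 1) * (r * K r)) (by fun_prop) ch
    (fun M hM => by
      -- The kernels are `M(s) (s δ_{ij} - v_i v_j)` with `s = |v|²`.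
      obtain ⟨N, hN, hN'⟩ := hM.exists_primitive
      have ha : RadialTest fun s => s * M s := hM.mul contDiff_id
      have hb : RadialTest fun s => (-1) * M s := hM.mul contDiff_const
      have hκ : RadialTest fun s => (-(((d : ℝ) - 1) / 2)) * N s := hN.mul contDiff_const
      have da : ∀ s, deriv (fun s => s * M s) s = M s + s * deriv M s := fun s => by
        rw [((hasDerivAt_id' s).fun_mul (hM.hasDerivAt s)).deriv, one_mul]
      have db : ∀ s, deriv (fun s => (-1) * M s) s = - deriv M s := fun s => by
        rw [((hM.hasDerivAt s).const_mul _).deriv]; ring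
      have dκ : ∀ s, deriv (fun s => (-(((d : ℝ) - 1) / 2)) * N s) s
          = -(((d : ℝ) - 1) / 2) * M s := fun s => by
        rw [((hN.hasDerivAt s).const_mul _).deriv, hN']
      have := H.radial hd ha hb hκ (fun s => by rw [da, db, dκ]; ring)
      simp only [da, db] at this
      have cM := hM.continuous
      have cM' := hM.continuous_deriv
      have cN := hN.continuous
      refine Eq.trans ?_ (this.trans ?_)
      · congr 1; ext r
        obtain ⟨n, rfl⟩ : ∃ n, d = n + 1 := ⟨d - 1, by omega⟩
        simp only [Nat.add_sub_cancel]
        ring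
      · have e := hN.integral_eq_neg_deriv cw
        rw [hN'] at e
        have e1 : ∀ r, r ^ (d - 1) * (r ^ 2 * M (r ^ 2) * C r + -1 * M (r ^ 2) * r ^ 2 * C3 r
            + -(((d : ℝ) - 1) / 2) * N (r ^ 2) * Vb r)
            = M (r ^ 2) * (r ^ (d + 1) * (C r - C3 r))
              + (-(((d : ℝ) - 1) / 2)) * (N (r ^ 2) * (r ^ (d - 1) * Vb r)) := fun r => by
          obtain ⟨n, rfl⟩ : ∃ n, d = n + 1 := ⟨d - 1, by omega⟩
          simp only [Nat.add_sub_cancel]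
          ring
        have e2 : ∀ r, M (r ^ 2) * (r ^ (d + 1) * (C r - C3 r) + (d - 1) * (r * K r))
            = M (r ^ 2) * (r ^ (d + 1) * (C r - C3 r))
              + (((d : ℝ) - 1) / 2) * (M (r ^ 2) * (2 * r * K r)) := fun r => by ring
        refine Eq.trans (intervalIntegral.integral_congr fun r _ => e1 r) ?_
        simp only [e2]
        rw [intervalIntegral.integral_add (Continuous.intervalIntegrable (by fun_prop) _ _)
          (Continuous.intervalIntegrable (by fun_prop) _ _),
          intervalIntegral.integral_add (Continuous.intervalIntegrable (by fun_prop) _ _)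
          (Continuous.intervalIntegrable (by fun_prop) _ _),
          intervalIntegral.integral_const_mul, intervalIntegral.integral_const_mul, e]
        ring) (r := r) hr
  have hc : ((d - 1 : ℕ) : ℝ) + 1 = d := by
    rw [← Nat.cast_add_one, Nat.sub_add_cancel hd]
  have hKlim := tendsto_primitive_div_pow (n := d - 1) (β := Vb 0) cw
    ((tendsto_right_of_continuous cVb).congr' (by
      filter_upwards [self_mem_nhdsWithin] with r hr
      have : r ^ (d - 1) ≠ 0 := pow_ne_zero _ (ne_of_gt hr)
      field_simp))
  rw [hc, Nat.sub_add_cancel hd] at hKlim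
  replace hKlim : Tendsto (fun r => K r / r ^ d) (𝓝[>] 0) (𝓝 (Vb 0 / d)) := hKlim
  have hlim := tendsto_primitive_div_pow (n := d + 1)
    (β := (C 0 - C3 0) + (d - 1) * (Vb 0 / d)) ch
    (((tendsto_right_of_continuous (cC.sub cC3)).add (hKlim.const_mul ((d : ℝ) - 1))).congr' (by
      filter_upwards [self_mem_nhdsWithin] with r hr
      have : r ≠ 0 := ne_of_gt hr
      simp only [Pi.sub_apply, pow_succ]
      field_simp))
  rw [hC0, hV0, hC30] at hlim
  have := hlim.const_mul (-2)
  have hd' : (d : ℝ) ≠ 0 := by positivity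
  have hd2 : (d : ℝ) + 2 ≠ 0 := by positivity
  convert this.congr' ?_ using 2
  · push_cast
    rw [show (d : ℝ) + 1 + 1 = d + 2 by ring]
    field_simp
  · filter_upwards [Ioo_mem_nhdsGT (by norm_num : (0 : ℝ) < 1 / 4)] with r hr
    have k := key r hr
    have hr0 : r ≠ 0 := hr.1.ne'
    generalize (∫ ρ in (0 : ℝ)..r, (ρ ^ (d + 1) * (C ρ - C3 ρ) + (d - 1) * (ρ * K ρ))) = I at k ⊢
    field_simp at k ⊢
    simp only [pow_succ] at k ⊢
    linarith

end

/-! ### The flux through small spheres -/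

/-- The coefficients of the cubic form `(y · δ) |T_•(y) δ|²` in `δ`, for a unit vector `y`. -/
noncomputable def fluxWeight : Label → E d → Fin d → Fin d → Fin d → ℝ
  | .I, y, i, j, k => if i = j then y k else 0
  | .L, y, i, j, k => y i * y j * y k
  | .T, y, i, j, k => (if i = j then y k else 0) - y i * y j * y k

theorem continuous_fluxWeight (l : Label) (i j k : Fin d) :
    Continuous fun y : E d => fluxWeight l y i j k := by
  have h1 : Continuous fun y : E d => if i = j then y k else 0 := by
    split_ifs <;> fun_prop
  cases l
  · exact h1
  · simp only [fluxWeight]; fun_prop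
  · simp only [fluxWeight]; fun_prop

theorem sum_ite_mul (γ : Fin d → Fin d → Fin d → ℝ) (y : E d) :
    ∑ i, ∑ j, ∑ k, (if i = j then y k else 0) * γ i j k = ∑ i, ∑ k, y k * γ i i k := by
  refine Finset.sum_congr rfl fun i _ => ?_
  rw [Finset.sum_comm]
  refine Finset.sum_congr rfl fun k _ => ?_
  simp

theorem sum_fluxWeight_T (γ : Fin d → Fin d → Fin d → ℝ) (y : E d) :
    ∑ i, ∑ j, ∑ k, fluxWeight .T y i j k * γ i j k
      = (∑ i, ∑ k, y k * γ i i k) - ∑ i, ∑ j, ∑ k, y i * y j * y k * γ i j k := by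
  simp only [fluxWeight, sub_mul, Finset.sum_sub_distrib, sum_ite_mul]

/-- On the unit sphere the flux integrand is a cubic form in the increment. -/
theorem fluxIntegrand_eq (l : Label) (v : Torus d → E d) (r : ℝ) (x : Torus d) {y : E d}
    (hy : ‖y‖ = 1) : fluxIntegrand l v r x y = ∑ i, ∑ j, ∑ k, fluxWeight l y i j k
      * (increment v r x y i * increment v r x y j * increment v r x y k) := by
  set δ := increment v r x y
  have hδ : fluxIntegrand l v r x y
      = (∑ j, y j * δ j) * ∑ i, (∑ j, tensor l y i j * δ j) ^ 2 := rfl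
  rw [hδ]
  set s := ∑ j, y j * δ j with hs
  have hn : ∑ i, y i ^ 2 = 1 := by rw [← EuclideanSpace.real_norm_sq_eq, hy, one_pow]
  have e1 : ∑ i, ∑ k, y k * (δ i * δ i * δ k) = s * ∑ i, δ i ^ 2 := by
    rw [hs, Finset.sum_mul_sum, Finset.sum_comm]
    exact Finset.sum_congr rfl fun i _ => Finset.sum_congr rfl fun k _ => by ring
  have e2 : ∑ i, ∑ j, ∑ k, y i * y j * y k * (δ i * δ j * δ k) = s ^ 3 := by
    have : s ^ 3 = s * (s * s) := by ring
    rw [this, hs, Finset.sum_mul_sum, Finset.sum_mul_sum]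
    refine Finset.sum_congr rfl fun i _ => ?_
    simp only [Finset.mul_sum]
    exact Finset.sum_congr rfl fun i _ => Finset.sum_congr rfl fun k _ => by ring
  have tL : ∀ i, ∑ j, y i * y j / ‖y‖ ^ 2 * δ j = y i * s := fun i => by
    rw [hy, hs, Finset.mul_sum]
    exact Finset.sum_congr rfl fun j _ => by ring
  have tI : ∀ i, ∑ j, (1 : Matrix (Fin d) (Fin d) ℝ) i j * δ j = δ i := fun i => by
    simp [Matrix.one_apply]
  cases l
  · simp only [fluxWeight, tensor, tI, sum_ite_mul, e1]
  · simp only [fluxWeight, tensor, Matrix.of_apply, tL, e2, mul_pow, ← Finset.sum_mul, hn]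
    ring
  · simp only [sum_fluxWeight_T, tensor, Matrix.sub_apply, Matrix.of_apply, sub_mul,
      Finset.sum_sub_distrib, tI, tL, e1, e2]
    have e3 : ∑ i, (δ i - y i * s) ^ 2 = ∑ i, δ i ^ 2 - s ^ 2 := by
      have : ∀ i, (δ i - y i * s) ^ 2 = δ i ^ 2 - 2 * s * (y i * δ i) + y i ^ 2 * s ^ 2 :=
        fun i => by ring
      simp only [this, Finset.sum_add_distrib, Finset.sum_sub_distrib, ← Finset.mul_sum,
        ← Finset.sum_mul, hn, ← hs]
      ring
    rw [e3]; ring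

/-- The limit for each of the three tensors. The longitudinal cubic form is the full one minus the
transverse one. -/
theorem TwoPointBalance.tendsto_flux {γ : Fin d → Fin d → Fin d → Torus d → ℝ}
    {W : Fin d → Fin d → Torus d → ℝ} {V : Torus d → ℝ} (H : TwoPointBalance γ W V) (hd : 0 < d)
    (l : Label) :
    Tendsto (fun r => sphereInt (fun θ c => ∑ i, ∑ j, ∑ k, fluxWeight l θ i j k * γ i j k c) r / r)
      (𝓝[>] 0) (𝓝 (-(coeff d l / 2) * ((sphereMeasure d).real univ * (∑ i, W i i 0 + V 0)))) := by
  have cγ := H.continuous_cubic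
  have hT := H.tendsto_transverse hd
  have hI := H.tendsto_full hd
  have hd' : (d : ℝ) ≠ 0 := by positivity
  have hd2 : (d : ℝ) + 2 ≠ 0 := by positivity
  cases l
  · simp only [fluxWeight, fun (θ : E d) c => sum_ite_mul (fun i j k => γ i j k c) θ]
    convert hI using 3
    simp only [coeff]; field_simp; norm_num
  · simp only [fluxWeight]
    convert hI.sub hT using 2
    · ring
    · simp only [coeff]; field_simp; ring
  · simp only [fun (θ : E d) c => sum_fluxWeight_T (fun i j k => γ i j k c) θ]
    convert hT using 2
    · congr 1
      exact integral_sub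
        (integrable_sphereInt (F := fun θ c => ∑ i, ∑ k, θ k * γ i i k c) (by fun_prop) _)
        (integrable_sphereInt
          (F := fun θ c => ∑ i, ∑ j, ∑ k, θ i * θ j * θ k * γ i j k c) (by fun_prop) _)
    · simp only [coeff]; field_simp; ring

section

variable {T : ℝ} {u : ℝ → Torus d → E d}

theorem abs_increment_mul_le (v w : E d) (i j k : Fin d) :
    |(v - w) i * (v - w) j * (v - w) k| ≤ 4 * (‖v‖ ^ 3 + ‖w‖ ^ 3) := by
  have h1 := fun i => PiLp.norm_apply_le (v - w) i
  have h2 : ‖v - w‖ ≤ ‖v‖ + ‖w‖ := norm_sub_le v w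
  calc |(v - w) i * (v - w) j * (v - w) k| = ‖(v - w) i‖ * ‖(v - w) j‖ * ‖(v - w) k‖ := by
        rw [abs_mul, abs_mul]; rfl
    _ ≤ ‖v - w‖ * ‖v - w‖ * ‖v - w‖ := by
        gcongr <;> exact h1 _
    _ ≤ (‖v‖ + ‖w‖) ^ 3 := by
        rw [← pow_two, ← pow_succ]; gcongr
    _ ≤ 4 * (‖v‖ ^ 3 + ‖w‖ ^ 3) := by
        nlinarith [mul_nonneg (add_nonneg (norm_nonneg v) (norm_nonneg w))
          (sq_nonneg (‖v‖ - ‖w‖))]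

/-- Products of three increments over a random separation are integrable. -/
theorem integrable_increment {Y : Type*} [MeasurableSpace Y] {σ : Measure Y} [IsFiniteMeasure σ]
    (hu3 : MemLpTX T 3 u) {s : Y → Torus d} (hs : Measurable s) (i j k : Fin d) :
    Integrable (fun w : Y × (ℝ × Torus d) =>
      (u w.2.1 (w.2.2 + s w.1) - u w.2.1 w.2.2) i * (u w.2.1 (w.2.2 + s w.1) - u w.2.1 w.2.2) j
        * (u w.2.1 (w.2.2 + s w.1) - u w.2.1 w.2.2) k) (σ.prod (spaceTime d T)) := by
  have hmp : MeasurePreserving (fun w : Y × (ℝ × Torus d) => (w.1, (w.2.1, w.2.2 + s w.1)))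
      (σ.prod (spaceTime d T)) (σ.prod (spaceTime d T)) :=
    (MeasurePreserving.id σ).skew_product (g := fun y (z : ℝ × Torus d) => (z.1, z.2 + s y))
      (by unfold Function.uncurry; fun_prop)
      (Eventually.of_forall fun y => (measurePreserving_shift_spaceTime T (s y)).map_eq)
  have i1 : Integrable (fun w : Y × (ℝ × Torus d) => ‖u w.2.1 w.2.2‖ ^ 3)
      (σ.prod (spaceTime d T)) := (integrable_norm_cube hu3).comp_snd σ
  have i2 : Integrable (fun w : Y × (ℝ × Torus d) => ‖u w.2.1 (w.2.2 + s w.1)‖ ^ 3)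
      (σ.prod (spaceTime d T)) := hmp.integrable_comp_of_integrable i1
  have m1 : AEStronglyMeasurable (fun w : Y × (ℝ × Torus d) => u w.2.1 w.2.2)
      (σ.prod (spaceTime d T)) := hu3.aestronglyMeasurable.comp_snd
  have m2 : AEStronglyMeasurable (fun w : Y × (ℝ × Torus d) => u w.2.1 (w.2.2 + s w.1))
      (σ.prod (spaceTime d T)) := m1.comp_measurePreserving hmp
  have m3 := fun i => aestronglyMeasurable_apply (m2.sub m1) i
  exact ((i2.add i1).const_mul 4).mono' (((m3 i).mul (m3 j)).mul (m3 k))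
    (Eventually.of_forall fun w => abs_increment_mul_le _ _ i j k)

theorem integrable_increment_at (hu3 : MemLpTX T 3 u) (c : Torus d) (i j k : Fin d) :
    Integrable (fun z : ℝ × Torus d =>
      (u z.1 (z.2 + c) - u z.1 z.2) i * (u z.1 (z.2 + c) - u z.1 z.2) j
        * (u z.1 (z.2 + c) - u z.1 z.2) k) (spaceTime d T) := by
  have i1 := integrable_norm_cube hu3
  have hmp := measurePreserving_shift_spaceTime (d := d) T c
  have i2 : Integrable (fun z : ℝ × Torus d => ‖u z.1 (z.2 + c)‖ ^ 3) (spaceTime d T) :=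
    hmp.integrable_comp_of_integrable i1
  have m1 : AEStronglyMeasurable (fun z : ℝ × Torus d => u z.1 z.2) (spaceTime d T) :=
    hu3.aestronglyMeasurable
  have m2 : AEStronglyMeasurable (fun z : ℝ × Torus d => u z.1 (z.2 + c)) (spaceTime d T) :=
    m1.comp_measurePreserving hmp
  have m3 := fun i => aestronglyMeasurable_apply (m2.sub m1) i
  exact ((i2.add i1).const_mul 4).mono' (((m3 i).mul (m3 j)).mul (m3 k))
    (Eventually.of_forall fun w => abs_increment_mul_le _ _ i j k)

theorem measurable_sphere_shift (r : ℝ) :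
    Measurable fun θ : sphere (0 : E d) 1 => proj (r • (θ : E d)) :=
  (continuous_proj.comp (continuous_subtype_val.const_smul r)).measurable

theorem integrable_weighted_increment (hu3 : MemLpTX T 3 u) (l : Label) (r : ℝ) (i j k : Fin d) :
    Integrable (fun w : sphere (0 : E d) 1 × (ℝ × Torus d) => fluxWeight l (w.1 : E d) i j k
      * (increment (u w.2.1) r w.2.2 w.1 i * increment (u w.2.1) r w.2.2 w.1 j
        * increment (u w.2.1) r w.2.2 w.1 k)) ((sphereMeasure d).prod (spaceTime d T)) := by
  have hi := integrable_increment (σ := sphereMeasure d) hu3 (measurable_sphere_shift r) i j k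
  have hc : Continuous fun θ : sphere (0 : E d) 1 => fluxWeight l (θ : E d) i j k :=
    (continuous_fluxWeight l i j k).comp continuous_subtype_val
  obtain ⟨C, hC⟩ := isCompact_univ.exists_bound_of_continuousOn hc.continuousOn
  exact hi.bdd_mul (c := C) (hc.comp continuous_fst).aestronglyMeasurable
    (Eventually.of_forall fun w => hC w.1 (mem_univ _))

theorem integrable_fluxIntegrand (hu3 : MemLpTX T 3 u) (l : Label) (r : ℝ) :
    Integrable (fun w : sphere (0 : E d) 1 × (ℝ × Torus d) =>
      fluxIntegrand l (u w.2.1) r w.2.2 (w.1 : E d)) ((sphereMeasure d).prod (spaceTime d T)) := by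
  simp only [fun w : sphere (0 : E d) 1 × (ℝ × Torus d) =>
    fluxIntegrand_eq l (u w.2.1) r w.2.2 (norm_eq_of_mem_sphere w.1)]
  exact integrable_finsetSum _ fun i _ => integrable_finsetSum _ fun j _ =>
    integrable_finsetSum _ fun k _ => integrable_weighted_increment hu3 l r i j k

theorem ae_integrable_fluxIntegrand (hu3 : MemLpTX T 3 u) (l : Label) (r : ℝ) :
    ∀ᵐ z ∂(spaceTime d T), Integrable
      (fun y : sphere (0 : E d) 1 => fluxIntegrand l (u z.1) r z.2 (y : E d)) (sphereMeasure d) :=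
  (integrable_fluxIntegrand hu3 l r).prod_left_ae

theorem sphereFlux_eq (l : Label) (r t : ℝ) (x : Torus d) :
    sphereFlux l u r t x = 1 / r * ((sphereMeasure d).real univ)⁻¹
      * ∫ y : sphere (0 : E d) 1, fluxIntegrand l (u t) r x (y : E d) ∂(sphereMeasure d) := by
  rw [sphereFlux, average_eq, smul_eq_mul, mul_assoc]

theorem integrable_sphereFlux (hu3 : MemLpTX T 3 u) (l : Label) (r : ℝ) :
    Integrable (fun z : ℝ × Torus d => sphereFlux l u r z.1 z.2) (spaceTime d T) := by
  simp only [sphereFlux_eq]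
  exact ((integrable_fluxIntegrand hu3 l r).integral_prod_right).const_mul _

/-- Testing the spherical flux with `φ` gives the spherical mean of the third order
correlations. -/
theorem integral_sphereFlux_mul (hu3 : MemLpTX T 3 u) (l : Label) (r : ℝ) {φ : ℝ → Torus d → ℝ}
    (hφ : IsSmooth φ) : ∫ z, sphereFlux l u r z.1 z.2 * φ z.1 z.2 ∂(spaceTime d T)
      = ((sphereMeasure d).real univ)⁻¹ * (sphereInt (fun θ c => ∑ i, ∑ j, ∑ k,
          fluxWeight l θ i j k * incr T φ (fun z => u z.1 z.2 i) (fun z => u z.1 z.2 j)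
            (fun z => u z.1 z.2 k) c) r / r) := by
  obtain ⟨C, hC⟩ := hφ.bounded T
  have hmem : ∀ᵐ z ∂(spaceTime d T), z.1 ∈ Icc 0 T :=
    Measure.quasiMeasurePreserving_fst.ae (ae_restrict_mem measurableSet_Icc)
  have hφm : AEStronglyMeasurable (fun z : ℝ × Torus d => φ z.1 z.2) (spaceTime d T) :=
    hφ.continuous.aestronglyMeasurable
  have hφb : ∀ᵐ z ∂(spaceTime d T), ‖φ z.1 z.2‖ ≤ C := hmem.mono fun z hz => hC z.1 hz z.2
  have hi : Integrable (fun w : sphere (0 : E d) 1 × (ℝ × Torus d) =>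
      φ w.2.1 w.2.2 * fluxIntegrand l (u w.2.1) r w.2.2 (w.1 : E d))
      ((sphereMeasure d).prod (spaceTime d T)) :=
    (integrable_fluxIntegrand hu3 l r).bdd_mul (c := C) hφm.comp_snd
      (Measure.quasiMeasurePreserving_snd.ae hφb)
  have e1 : ∀ z : ℝ × Torus d, sphereFlux l u r z.1 z.2 * φ z.1 z.2
      = 1 / r * ((sphereMeasure d).real univ)⁻¹ * ∫ y : sphere (0 : E d) 1,
        φ z.1 z.2 * fluxIntegrand l (u z.1) r z.2 (y : E d) ∂(sphereMeasure d) := fun z => by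
    rw [sphereFlux_eq, integral_const_mul]; ring
  have e2 : ∀ y : sphere (0 : E d) 1, ∫ z, φ z.1 z.2 * fluxIntegrand l (u z.1) r z.2 (y : E d)
        ∂(spaceTime d T)
      = ∑ i, ∑ j, ∑ k, fluxWeight l (y : E d) i j k * incr T φ (fun z => u z.1 z.2 i)
        (fun z => u z.1 z.2 j) (fun z => u z.1 z.2 k) (proj (r • (y : E d))) := fun y => by
    have j1 : ∀ i j k, Integrable (fun z : ℝ × Torus d => fluxWeight l (y : E d) i j k
        * (φ z.1 z.2 * (increment (u z.1) r z.2 y i * increment (u z.1) r z.2 y j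
          * increment (u z.1) r z.2 y k))) (spaceTime d T) := fun i j k =>
      (((integrable_increment_at hu3 (proj (r • (y : E d))) i j k).bdd_mul (c := C) hφm
        hφb).const_mul _)
    have e3 : ∀ z : ℝ × Torus d, φ z.1 z.2 * fluxIntegrand l (u z.1) r z.2 (y : E d)
        = ∑ i, ∑ j, ∑ k, fluxWeight l (y : E d) i j k
        * (φ z.1 z.2 * (increment (u z.1) r z.2 y i * increment (u z.1) r z.2 y j
          * increment (u z.1) r z.2 y k)) := fun z => by
      rw [fluxIntegrand_eq l _ r _ (norm_eq_of_mem_sphere y)]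
      simp only [Finset.mul_sum]
      exact Finset.sum_congr rfl fun i _ => Finset.sum_congr rfl fun j _ =>
        Finset.sum_congr rfl fun k _ => by ring
    simp only [e3]
    rw [integral_finsetSum _ fun i _ => integrable_finsetSum _ fun j _ =>
      integrable_finsetSum _ fun k _ => j1 i j k]
    refine Finset.sum_congr rfl fun i _ => ?_
    rw [integral_finsetSum _ fun j _ => integrable_finsetSum _ fun k _ => j1 i j k]
    refine Finset.sum_congr rfl fun j _ => ?_
    rw [integral_finsetSum _ fun k _ => j1 i j k]
    refine Finset.sum_congr rfl fun k _ => ?_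
    rw [integral_const_mul]
    rfl
  simp only [e1]
  rw [integral_const_mul, ← integral_integral_swap hi]
  simp only [e2, sphereInt]
  ring

end

/-! ### Distributions given by integrable functions and their derivatives -/

/-- Linear operators on smooth functions that are controlled by two derivatives. -/
structure IsTestOp (op : (ℝ → Torus d → ℝ) → ℝ → Torus d → ℝ) : Prop where
  smooth : ∀ φ, IsSmooth φ → IsSmooth (op φ)
  map_add : ∀ φ ψ, IsSmooth φ → IsSmooth ψ → ∀ t x, op (φ + ψ) t x = op φ t x + op ψ t x
  map_smul : ∀ (c : ℝ) φ, IsSmooth φ → ∀ t x, op (c • φ) t x = c * op φ t x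
  bound : ∀ φ, IsSmooth φ → ∀ M, (∀ n ≤ 2, ∀ z, ‖iteratedFDeriv ℝ n (lift φ) z‖ ≤ M) →
    ∀ t x, |op φ t x| ≤ M

theorem isTestOp_id : IsTestOp (fun φ : ℝ → Torus d → ℝ => φ) where
  smooth _ h := h
  map_add _ _ _ _ _ _ := rfl
  map_smul _ _ _ _ _ := rfl
  bound φ _ M hM t x := by
    obtain ⟨v, rfl⟩ := proj_surjective x
    have := hM 0 (by norm_num) (t, v)
    rwa [norm_iteratedFDeriv_zero] at this

theorem norm_single_one (k : Fin d) : ‖((0 : ℝ), EuclideanSpace.single k (1 : ℝ))‖ = 1 := by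
  simp [Prod.norm_def]

theorem isTestOp_pd (k : Fin d) : IsTestOp (fun φ : ℝ → Torus d → ℝ => fun t => pd k (φ t)) where
  smooth _ h := h.pd k
  map_add _ _ h h' t x := pd_add (h.slice t) (h'.slice t) k x
  map_smul c _ h t x := pd_const_mul (h.slice t) c k x
  bound φ h M hM t x := by
    obtain ⟨v, rfl⟩ := proj_surjective x
    have := hM 1 (by norm_num) (t, v)
    rw [norm_iteratedFDeriv_one] at this
    rw [pd_lift h]
    refine ((fderiv ℝ (lift φ) (t, v)).le_opNorm _).trans ?_
    rwa [norm_single_one, mul_one]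

theorem isTestOp_dt : IsTestOp (fun φ : ℝ → Torus d → ℝ => dt φ) where
  smooth _ h := h.dt
  map_add _ _ h h' t x := ((h.hasDerivAt_time t x).add (h'.hasDerivAt_time t x)).deriv
  map_smul c _ h t x := ((h.hasDerivAt_time t x).const_mul c).deriv
  bound φ h M hM t x := by
    obtain ⟨v, rfl⟩ := proj_surjective x
    have := hM 1 (by norm_num) (t, v)
    rw [norm_iteratedFDeriv_one] at this
    rw [dt_lift h]
    refine ((fderiv ℝ (lift φ) (t, v)).le_opNorm _).trans ?_
    have e : ‖((1 : ℝ), (0 : E d))‖ = 1 := by simp [Prod.norm_def]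
    rwa [e, mul_one]

theorem isTestOp_pd_pd (k : Fin d) :
    IsTestOp (fun φ : ℝ → Torus d → ℝ => fun t => pd k (pd k (φ t))) where
  smooth _ h := (h.pd k).pd k
  map_add φ ψ h h' t x := by
    have e : pd k ((φ + ψ) t) = fun x => pd k (φ t) x + pd k (ψ t) x :=
      funext fun x => pd_add (h.slice t) (h'.slice t) k x
    rw [e]
    exact pd_add ((h.pd k).slice t) ((h'.pd k).slice t) k x
  map_smul c φ h t x := by
    have e : pd k ((c • φ) t) = fun x => c * pd k (φ t) x :=
      funext fun x => pd_const_mul (h.slice t) c k x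
    rw [e]
    exact pd_const_mul ((h.pd k).slice t) c k x
  bound φ h M hM t x := by
    obtain ⟨v, rfl⟩ := proj_surjective x
    have h2 := hM 2 le_rfl (t, v)
    rw [← norm_iteratedFDeriv_fderiv, norm_iteratedFDeriv_one] at h2
    have e : lift (fun t => pd k (φ t))
        = fun z : ℝ × E d => fderiv ℝ (lift φ) z (0, EuclideanSpace.single k 1) := by
      ext z; exact pd_lift h k z.1 z.2
    have hdiff : DifferentiableAt ℝ (fderiv ℝ (lift φ)) (t, v) :=
      ((ContDiff.fderiv_right (m := 1) h (by norm_cast)).differentiable (by simp)) _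
    have e2 := pd_lift (h.pd k) k t v
    rw [e, fderiv_clm_apply hdiff (differentiableAt_const _)] at e2
    simp only [fderiv_fun_const, Pi.zero_apply, ContinuousLinearMap.comp_zero, zero_add,
      ContinuousLinearMap.flip_apply] at e2
    rw [e2]
    set w : ℝ × E d := (0, EuclideanSpace.single k 1)
    have hw : ‖w‖ = 1 := norm_single_one k
    have l1 := (fderiv ℝ (fderiv ℝ (lift φ)) (t, v) w).le_opNorm w
    have l2 := (fderiv ℝ (fderiv ℝ (lift φ)) (t, v)).le_opNorm w
    rw [hw, mul_one] at l1 l2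
    exact l1.trans (l2.trans h2)

section

variable {T : ℝ}

theorem IsTestOp.integrable_mul {op : (ℝ → Torus d → ℝ) → ℝ → Torus d → ℝ} (hop : IsTestOp op)
    {g : ℝ × Torus d → ℝ} (hg : Integrable g (spaceTime d T)) {φ : ℝ → Torus d → ℝ}
    (hφ : IsSmooth φ) : Integrable (fun z => g z * op φ z.1 z.2) (spaceTime d T) := by
  -- outside `[0, T]`, which carries all the measure, `op φ` may be unbounded
  obtain ⟨C, hC⟩ := (hop.smooth φ hφ).bounded T
  have hmem : ∀ᵐ z ∂(spaceTime d T), z.1 ∈ Icc 0 T :=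
    Measure.quasiMeasurePreserving_fst.ae (ae_restrict_mem measurableSet_Icc)
  exact hg.mul_bdd (c := C) (hop.smooth φ hφ).continuous.aestronglyMeasurable
    (hmem.mono fun z hz => hC z.1 hz z.2)

/-- The distribution `φ ↦ ∫ g op(φ)`. -/
noncomputable def weakPairing {op : (ℝ → Torus d → ℝ) → ℝ → Torus d → ℝ} (hop : IsTestOp op)
    {g : ℝ × Torus d → ℝ} (hg : Integrable g (spaceTime d T)) : TestFunctions d T →ₗ[ℝ] ℝ where
  toFun φ := ∫ z, g z * op φ.1 z.1 z.2 ∂(spaceTime d T)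
  map_add' φ ψ := by
    rw [← integral_add (hop.integrable_mul hg φ.2.1) (hop.integrable_mul hg ψ.2.1)]
    congr 1; ext z
    rw [← mul_add, ← hop.map_add _ _ φ.2.1 ψ.2.1]
    rfl
  map_smul' c φ := by
    rw [RingHom.id_apply, smul_eq_mul, ← integral_const_mul]
    congr 1; ext z
    rw [mul_left_comm, ← hop.map_smul _ _ φ.2.1]
    rfl

theorem weakPairing_apply {op : (ℝ → Torus d → ℝ) → ℝ → Torus d → ℝ} (hop : IsTestOp op)
    {g : ℝ × Torus d → ℝ} (hg : Integrable g (spaceTime d T)) (φ : TestFunctions d T) :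
    weakPairing hop hg φ = ∫ z, g z * op φ.1 z.1 z.2 ∂(spaceTime d T) := rfl

theorem isDistribution_weakPairing {op : (ℝ → Torus d → ℝ) → ℝ → Torus d → ℝ} (hop : IsTestOp op)
    {g : ℝ × Torus d → ℝ} (hg : Integrable g (spaceTime d T)) :
    IsDistribution (weakPairing hop hg) := by
  intro a b _ _
  refine ⟨2, ∫ z, |g z| ∂(spaceTime d T), fun φ M _ hM => ?_⟩
  rw [weakPairing_apply, ← integral_mul_const]
  refine (norm_integral_le_integral_norm _).trans
    (integral_mono (hop.integrable_mul hg φ.2.1).norm (hg.abs.mul_const M) fun z => ?_)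
  simp only [norm_mul, Real.norm_eq_abs]
  exact mul_le_mul_of_nonneg_left (hop.bound _ φ.2.1 M hM _ _) (abs_nonneg _)

theorem IsDistribution.add {D D' : TestFunctions d T →ₗ[ℝ] ℝ} (h : IsDistribution D)
    (h' : IsDistribution D') : IsDistribution (D + D') := by
  intro a b ha hb
  obtain ⟨N, C, H⟩ := h a b ha hb
  obtain ⟨N', C', H'⟩ := h' a b ha hb
  refine ⟨max N N', C + C', fun φ M hs hM => ?_⟩
  have h1 := H φ M hs fun n hn => hM n (hn.trans (le_max_left _ _))
  have h2 := H' φ M hs fun n hn => hM n (hn.trans (le_max_right _ _))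
  rw [LinearMap.add_apply, add_mul]
  exact (abs_add_le _ _).trans (add_le_add h1 h2)

theorem IsDistribution.smul {D : TestFunctions d T →ₗ[ℝ] ℝ} (h : IsDistribution D) (c : ℝ) :
    IsDistribution (c • D) := by
  intro a b ha hb
  obtain ⟨N, C, H⟩ := h a b ha hb
  refine ⟨N, |c| * C, fun φ M hs hM => ?_⟩
  rw [LinearMap.smul_apply, smul_eq_mul, abs_mul, mul_assoc]
  exact mul_le_mul_of_nonneg_left (H φ M hs hM) (abs_nonneg _)

theorem IsDistribution.zero : IsDistribution (0 : TestFunctions d T →ₗ[ℝ] ℝ) :=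
  fun _ _ _ _ => ⟨0, 0, fun _ _ _ _ => by simp⟩

theorem IsDistribution.sum {ι : Type*} {s : Finset ι} {D : ι → TestFunctions d T →ₗ[ℝ] ℝ}
    (h : ∀ i ∈ s, IsDistribution (D i)) : IsDistribution (∑ i ∈ s, D i) :=
  Finset.sum_induction _ _ (fun _ _ => IsDistribution.add) IsDistribution.zero h

end

/-! ### The local energy balance -/

section

variable {T ν : ℝ} {u : ℝ → Torus d → E d} {p : ℝ → Torus d → ℝ} {f : ℝ → Torus d → E d}
  {G : Fin d → ℝ → Torus d → E d}

theorem incr_comm_left (φ : ℝ → Torus d → ℝ) (a b e : ℝ × Torus d → ℝ) :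
    incr T φ a b e = incr T φ b a e := by
  ext c; simp only [incr]; congr 1; ext z; ring

theorem incr_comm_right (φ : ℝ → Torus d → ℝ) (a b e : ℝ × Torus d → ℝ) :
    incr T φ a b e = incr T φ a e b := by
  ext c; simp only [incr]; congr 1; ext z; ring

/-- The correlations of a flow, localized with `φ`, satisfy the two-point balance. -/
theorem Flow.twoPointBalance {u : Fin d → ℝ × Torus d → ℝ} {p : ℝ × Torus d → ℝ}
    {f : Fin d → ℝ × Torus d → ℝ} {G : Fin d → Fin d → ℝ × Torus d → ℝ}
    (H : Flow T ν u p f G) (hT : 0 < T) {φ : ℝ → Torus d → ℝ}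
    (hφ : IsSmooth φ) (h0 : ∀ x, φ 0 x = 0) (h1 : ∀ x, φ T x = 0) :
    TwoPointBalance (fun i j k => incr T φ (u i) (u j) (u k))
      (fun i j => kernelTerm T ν φ u p f G i j) (potentialTerm T φ u p) where
  symm_left _ _ _ := incr_comm_left φ _ _ _
  symm_right _ _ _ := incr_comm_right φ _ _ _
  continuous_cubic := H.continuous_incr hφ
  continuous_kernel := H.continuous_kernelTerm hφ
  continuous_potential := H.continuous_potentialTerm hφ
  balance _ _ hQ hs hκ hdiv := H.two_point_balance hT hφ h0 h1 hQ hs hκ hdiv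

theorem ShiftPair.integrable_mul {q : ℕ} {g h : ℝ × Torus d → ℝ} (H : ShiftPair T (q + 1) g h) :
    Integrable (fun z => g z * h z) (spaceTime d T) := by
  simpa using (H.contCorr q.succ_ne_zero).integrable 0

theorem ContCorr.integrable_zero {g h : ℝ × Torus d → ℝ} (H : ContCorr T g h) :
    Integrable (fun z => g z * h z) (spaceTime d T) := by
  simpa using H.integrable 0

theorem shiftCorr_at_zero (g h : ℝ × Torus d → ℝ) :
    shiftCorr T g h 0 = ∫ z, g z * h z ∂(spaceTime d T) := by
  simp [shiftCorr]

end

section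

variable {T ν : ℝ} {u : ℝ → Torus d → E d} {p : ℝ → Torus d → ℝ} {f : ℝ → Torus d → E d}
  {G : Fin d → ℝ → Torus d → E d}

theorem integrable_energy (hu3 : MemLpTX T 3 u) :
    Integrable (fun z : ℝ × Torus d => ‖u z.1 z.2‖ ^ 2) (spaceTime d T) := by
  simp only [EuclideanSpace.real_norm_sq_eq]
  simp only [sq]
  exact integrable_finsetSum _ fun i _ => integrable_mul_apply hu3 i i

theorem Flow.integrable_energyFlux (H : Flow T ν (fun i z => u z.1 z.2 i) (fun z => p z.1 z.2)
    (fun i z => f z.1 z.2 i) (fun k i z => G k z.1 z.2 i)) (j : Fin d) :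
    Integrable (fun z : ℝ × Torus d => u z.1 z.2 j * ‖u z.1 z.2‖ ^ 2
      + 2 * p z.1 z.2 * u z.1 z.2 j) (spaceTime d T) := by
  have h1 : Integrable (fun z : ℝ × Torus d => ∑ i, 1 * (u z.1 z.2 i * u z.1 z.2 i * u z.1 z.2 j))
      (spaceTime d T) := integrable_finsetSum _ fun i _ => (H.cubic i i j).integrable_mul
  refine (h1.add ((H.pressure j).integrable_mul.const_mul 2)).congr (Eventually.of_forall fun z => ?_)
  simp only [Pi.add_apply, EuclideanSpace.real_norm_sq_eq, one_mul, ← Finset.sum_mul, ← sq]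
  ring

theorem Flow.integrable_work (H : Flow T ν (fun i z => u z.1 z.2 i) (fun z => p z.1 z.2)
    (fun i z => f z.1 z.2 i) (fun k i z => G k z.1 z.2 i)) :
    Integrable (fun z : ℝ × Torus d => ∑ i, u z.1 z.2 i * f z.1 z.2 i) (spaceTime d T) := by
  refine integrable_finsetSum _ fun i _ => ?_
  simp only [mul_comm (u _ _ i)]
  exact (H.force i i).integrable_mul

theorem Flow.integrable_dissipation (H : Flow T ν (fun i z => u z.1 z.2 i) (fun z => p z.1 z.2)
    (fun i z => f z.1 z.2 i) (fun k i z => G k z.1 z.2 i)) :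
    Integrable (fun z : ℝ × Torus d => ν * ∑ k, ‖G k z.1 z.2‖ ^ 2) (spaceTime d T) := by
  rcases eq_or_ne ν 0 with rfl | hν
  · simp
  · simp only [EuclideanSpace.real_norm_sq_eq]
    simp only [sq]
    exact (integrable_finsetSum _ fun k _ => integrable_finsetSum _ fun i _ =>
      (H.gradient_gradient hν k i i).integrable_mul).const_mul ν

/-- The pairing with a test function, term by term. -/
theorem Flow.balancePairing_eq (H : Flow T ν (fun i z => u z.1 z.2 i) (fun z => p z.1 z.2)
    (fun i z => f z.1 z.2 i) (fun k i z => G k z.1 z.2 i)) (hu3 : MemLpTX T 3 u)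
    {φ : ℝ → Torus d → ℝ} (hφ : IsSmooth φ) :
    balancePairing T ν u p f G φ
      = -(∫ z, ‖u z.1 z.2‖ ^ 2 * dt φ z.1 z.2 ∂(spaceTime d T))
        - (∑ j, ∫ z, (u z.1 z.2 j * ‖u z.1 z.2‖ ^ 2 + 2 * p z.1 z.2 * u z.1 z.2 j)
          * pd j (φ z.1) z.2 ∂(spaceTime d T))
        - 2 * (∫ z, (∑ i, u z.1 z.2 i * f z.1 z.2 i) * φ z.1 z.2 ∂(spaceTime d T))
        - ν * (∑ k, ∫ z, ‖u z.1 z.2‖ ^ 2 * pd k (pd k (φ z.1)) z.2 ∂(spaceTime d T))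
        + 2 * ∫ z, (ν * ∑ k, ‖G k z.1 z.2‖ ^ 2) * φ z.1 z.2 ∂(spaceTime d T) := by
  have a1 := (isTestOp_dt.integrable_mul (integrable_energy hu3) hφ).fun_neg
  have a2 := fun j => (isTestOp_pd j).integrable_mul (H.integrable_energyFlux j) hφ
  have a3 := isTestOp_id.integrable_mul H.integrable_work hφ
  have a4 := fun k => (isTestOp_pd_pd k).integrable_mul (integrable_energy hu3) hφ
  have a5 := isTestOp_id.integrable_mul H.integrable_dissipation hφ
  have b2 := integrable_finsetSum Finset.univ fun j _ => a2 j
  have b4 := integrable_finsetSum Finset.univ fun k _ => a4 k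
  rw [← integral_neg, ← integral_finsetSum _ fun j _ => a2 j,
    ← integral_finsetSum _ fun k _ => a4 k, ← integral_const_mul, ← integral_const_mul,
    ← integral_const_mul, ← integral_sub a1 b2]
  have c2 := integrable_fun_sub a1 b2
  rw [← integral_sub c2 (a3.const_mul 2)]
  have c3 := integrable_fun_sub c2 (a3.const_mul 2)
  rw [← integral_sub c3 (b4.const_mul ν)]
  have c4 := integrable_fun_sub c3 (b4.const_mul ν)
  rw [← integral_add c4 (a5.const_mul 2), balancePairing]
  congr 1; ext z
  simp only [lap, ← Finset.mul_sum]
  ring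

/-- At zero separation the two-point balance turns into the local energy balance. -/
theorem Flow.trace_eq (H : Flow T ν (fun i z => u z.1 z.2 i) (fun z => p z.1 z.2)
    (fun i z => f z.1 z.2 i) (fun k i z => G k z.1 z.2 i)) (hu3 : MemLpTX T 3 u)
    {φ : ℝ → Torus d → ℝ} (hφ : IsSmooth φ) :
    ∑ i, kernelTerm T ν φ (fun i z => u z.1 z.2 i) (fun z => p z.1 z.2)
      (fun i z => f z.1 z.2 i) (fun k i z => G k z.1 z.2 i) i i 0
      + potentialTerm T φ (fun i z => u z.1 z.2 i) (fun z => p z.1 z.2) 0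
      = -balancePairing T ν u p f G φ := by
  have h1 := fun i => ((H.velocity i i).contCorr_left hφ.dt).integrable_zero
  have h2 := fun i k => ((H.transport i k i).contCorr_left (hφ.pd k)).integrable_zero
  have h3 := fun i => ((H.pressure i).contCorr_left (hφ.pd i)).integrable_zero
  have h4 := fun i => ((H.force i i).contCorr_left hφ).integrable_zero
  have h8 := fun i k => ((H.velocity i i).contCorr_left ((hφ.pd k).pd k)).integrable_zero
  have e1 : ∫ z, ‖u z.1 z.2‖ ^ 2 * dt φ z.1 z.2 ∂(spaceTime d T)
      = ∑ i, ∫ z, dt φ z.1 z.2 * u z.1 z.2 i * u z.1 z.2 i ∂(spaceTime d T) := by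
    rw [← integral_finsetSum _ fun i _ => h1 i]
    congr 1; ext z
    rw [EuclideanSpace.real_norm_sq_eq, Finset.sum_mul]
    exact Finset.sum_congr rfl fun i _ => by ring
  have e2 : ∀ j, ∫ z, (u z.1 z.2 j * ‖u z.1 z.2‖ ^ 2 + 2 * p z.1 z.2 * u z.1 z.2 j)
        * pd j (φ z.1) z.2 ∂(spaceTime d T)
      = (∑ i, ∫ z, pd j (φ z.1) z.2 * (u z.1 z.2 i * u z.1 z.2 j) * u z.1 z.2 i ∂(spaceTime d T))
        + 2 * ∫ z, pd j (φ z.1) z.2 * p z.1 z.2 * u z.1 z.2 j ∂(spaceTime d T) := fun j => by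
    rw [← integral_finsetSum _ fun i _ => h2 i j, ← integral_const_mul,
      ← integral_add (integrable_finsetSum _ fun i _ => h2 i j) ((h3 j).const_mul 2)]
    congr 1; ext z
    rw [EuclideanSpace.real_norm_sq_eq, add_mul, Finset.mul_sum, Finset.sum_mul]
    congr 1
    · exact Finset.sum_congr rfl fun i _ => by ring
    · ring
  have e3 : ∫ z, (∑ i, u z.1 z.2 i * f z.1 z.2 i) * φ z.1 z.2 ∂(spaceTime d T)
      = ∑ i, ∫ z, φ z.1 z.2 * f z.1 z.2 i * u z.1 z.2 i ∂(spaceTime d T) := by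
    rw [← integral_finsetSum _ fun i _ => h4 i]
    congr 1; ext z
    rw [Finset.sum_mul]
    exact Finset.sum_congr rfl fun i _ => by ring
  have e4 : ∀ k, ∫ z, ‖u z.1 z.2‖ ^ 2 * pd k (pd k (φ z.1)) z.2 ∂(spaceTime d T)
      = ∑ i, ∫ z, pd k (pd k (φ z.1)) z.2 * u z.1 z.2 i * u z.1 z.2 i ∂(spaceTime d T) := by
    intro k
    rw [← integral_finsetSum _ fun i _ => h8 i k]
    congr 1; ext z
    rw [EuclideanSpace.real_norm_sq_eq, Finset.sum_mul]
    exact Finset.sum_congr rfl fun i _ => by ring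
  have e5 : ∫ z, (ν * ∑ k, ‖G k z.1 z.2‖ ^ 2) * φ z.1 z.2 ∂(spaceTime d T)
      = ν * ∑ k, ∑ i, ∫ z, φ z.1 z.2 * G k z.1 z.2 i * G k z.1 z.2 i ∂(spaceTime d T) := by
    rcases eq_or_ne ν 0 with rfl | hν
    · simp
    have h9 := fun i k => ((H.gradient_gradient hν k i i).contCorr_left hφ).integrable_zero
    simp only [← fun k => integral_finsetSum Finset.univ fun i _ => h9 i k]
    rw [← integral_finsetSum _ fun k _ => integrable_finsetSum _ fun i _ => h9 i k,
      ← integral_const_mul]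
    congr 1; ext z
    rw [mul_assoc, Finset.sum_mul]
    congr 1
    refine Finset.sum_congr rfl fun k _ => ?_
    rw [EuclideanSpace.real_norm_sq_eq, Finset.sum_mul]
    exact Finset.sum_congr rfl fun i _ => by ring
  have s1 : ∀ i, ∫ z, φ z.1 z.2 * u z.1 z.2 i * f z.1 z.2 i ∂(spaceTime d T)
      = ∫ z, φ z.1 z.2 * f z.1 z.2 i * u z.1 z.2 i ∂(spaceTime d T) := fun i => by
    congr 1; ext z; ring
  have s2 : ∀ i, ∫ z, pd i (φ z.1) z.2 * u z.1 z.2 i * p z.1 z.2 ∂(spaceTime d T)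
      = ∫ z, pd i (φ z.1) z.2 * p z.1 z.2 * u z.1 z.2 i ∂(spaceTime d T) := fun i => by
    congr 1; ext z; ring
  have s3 : ∀ i k, ∫ z, pd k (φ z.1) z.2 * u z.1 z.2 k * (u z.1 z.2 i * u z.1 z.2 i)
        ∂(spaceTime d T)
      = ∫ z, pd k (φ z.1) z.2 * 1 * (u z.1 z.2 i * u z.1 z.2 i * u z.1 z.2 k)
        ∂(spaceTime d T) := fun i k => by
    congr 1; ext z; ring
  have w1 := Finset.sum_comm (s := Finset.univ) (t := Finset.univ) (f := fun i k =>
    ∫ z, pd k (φ z.1) z.2 * (u z.1 z.2 i * u z.1 z.2 k) * u z.1 z.2 i ∂(spaceTime d T))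
  have w2 := Finset.sum_comm (s := Finset.univ) (t := Finset.univ) (f := fun i k =>
    ∫ z, pd k (pd k (φ z.1)) z.2 * u z.1 z.2 i * u z.1 z.2 i ∂(spaceTime d T))
  have w3 := Finset.sum_comm (s := Finset.univ) (t := Finset.univ) (f := fun i k =>
    ∫ z, φ z.1 z.2 * G k z.1 z.2 i * G k z.1 z.2 i ∂(spaceTime d T))
  rw [H.balancePairing_eq hu3 hφ]
  simp only [kernelTerm, potentialTerm, shiftCorr_at_zero, e1, e2, e3, e4, e5, s1, s2, s3, sub_self,
    Finset.sum_const_zero, mul_zero, add_zero, Finset.sum_add_distrib, Finset.sum_sub_distrib,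
    ← Finset.mul_sum, w1, w2, w3]
  ring

/-- The dissipation `D` with `∂_t |u|² + ⋯ = -2 D`, as a linear functional. -/
noncomputable def Flow.dissipation (H : Flow T ν (fun i z => u z.1 z.2 i) (fun z => p z.1 z.2)
    (fun i z => f z.1 z.2 i) (fun k i z => G k z.1 z.2 i)) (hu3 : MemLpTX T 3 u) :
    TestFunctions d T →ₗ[ℝ] ℝ :=
  (1 / 2 : ℝ) • weakPairing isTestOp_dt (integrable_energy hu3)
    + (1 / 2 : ℝ) • ∑ j, weakPairing (isTestOp_pd j) (H.integrable_energyFlux j)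
    + weakPairing isTestOp_id H.integrable_work
    + (ν / 2) • ∑ k, weakPairing (isTestOp_pd_pd k) (integrable_energy hu3)
    + (-1 : ℝ) • weakPairing isTestOp_id H.integrable_dissipation

theorem Flow.isDistribution_dissipation (H : Flow T ν (fun i z => u z.1 z.2 i)
    (fun z => p z.1 z.2) (fun i z => f z.1 z.2 i) (fun k i z => G k z.1 z.2 i))
    (hu3 : MemLpTX T 3 u) : IsDistribution (H.dissipation hu3) :=
  (((((isDistribution_weakPairing _ _).smul _).add
    ((IsDistribution.sum fun _ _ => isDistribution_weakPairing _ _).smul _)).add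
    (isDistribution_weakPairing _ _)).add
    ((IsDistribution.sum fun _ _ => isDistribution_weakPairing _ _).smul _)).add
    ((isDistribution_weakPairing _ _).smul _)

theorem Flow.balancePairing_eq_dissipation (H : Flow T ν (fun i z => u z.1 z.2 i)
    (fun z => p z.1 z.2) (fun i z => f z.1 z.2 i) (fun k i z => G k z.1 z.2 i))
    (hu3 : MemLpTX T 3 u) (φ : TestFunctions d T) :
    balancePairing T ν u p f G φ.1 = -2 * H.dissipation hu3 φ := by
  rw [H.balancePairing_eq hu3 φ.2.1]
  simp only [dissipation, LinearMap.add_apply, LinearMap.smul_apply, LinearMap.sum_apply,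
    weakPairing_apply, smul_eq_mul]
  ring

/-- The spherical fluxes converge to the dissipation in the sense of distributions. -/
theorem Flow.tendsto_sphereFlux (H : Flow T ν (fun i z => u z.1 z.2 i) (fun z => p z.1 z.2)
    (fun i z => f z.1 z.2 i) (fun k i z => G k z.1 z.2 i)) (hd : 0 < d) (hT : 0 < T)
    (hu3 : MemLpTX T 3 u) (l : Label) (φ : TestFunctions d T) :
    Tendsto (fun r : ℝ => ∫ z, sphereFlux l u r z.1 z.2 * φ.1 z.1 z.2 ∂(spaceTime d T))
      (𝓝[>] 0) (𝓝 (-coeff d l * H.dissipation hu3 φ)) := by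
  obtain ⟨hφ, a, b, ha, hb, hs⟩ := φ.2
  have hB := H.twoPointBalance hT hφ (hs 0 fun h => by linarith [h.1])
    (hs T fun h => by linarith [h.2])
  have hlim := (hB.tendsto_flux hd l).const_mul ((sphereMeasure d).real univ)⁻¹
  have hS := (sphereMeasure_real_univ_pos hd).ne'
  simp only [integral_sphereFlux_mul hu3 l _ hφ]
  convert hlim using 2
  rw [H.trace_eq hu3 hφ, H.balancePairing_eq_dissipation hu3 φ]
  field_simp

end

end EnergyBalance

theorem theorem1p1 {d : ℕ} (hd : 2 ≤ d) {T : ℝ} (hT : 0 < T) {ν : ℝ} (hν : 0 ≤ ν)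
    (u : ℝ → Torus d → E d) (p : ℝ → Torus d → ℝ) (f : ℝ → Torus d → E d)
    (u₀ : Torus d → E d) (G : Fin d → ℝ → Torus d → E d)
    (hu : IsWeakSolution T ν u p f u₀ G)
    (hu3 : MemLpTX T 3 u) (huC : MemC0L2 T u)
    (huH : ν ≠ 0 → MemL2H1 T u G)
    (hf : MemLpTX T (3 / 2) f ∨ MemL1L2 T f)
    (hu₀ : MemLp u₀ 2 volume) :
    -- each term of the balance is a locally integrable function or a derivative of one
    (∀ j, Integrable (fun z : ℝ × Torus d =>
        u z.1 z.2 j * ‖u z.1 z.2‖ ^ 2 + 2 * p z.1 z.2 * u z.1 z.2 j) (spaceTime d T)) ∧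
    Integrable (fun z : ℝ × Torus d => ∑ i, u z.1 z.2 i * f z.1 z.2 i) (spaceTime d T) ∧
    -- the sphere averages are well defined as integrable functions of `(t, x)`
    (∀ (k : Label) (ℓ : ℝ), 0 < ℓ →
      (∀ᵐ z ∂(spaceTime d T), Integrable
        (fun y : sphere (0 : E d) 1 => fluxIntegrand k (u z.1) ℓ z.2 (y : E d))
        (sphereMeasure d)) ∧
      Integrable (fun z : ℝ × Torus d => sphereFlux k u ℓ z.1 z.2) (spaceTime d T)) ∧
    -- the limits exist, and the balance laws hold in the sense of distributions
    ∀ k : Label, ∃ D : TestFunctions d T →ₗ[ℝ] ℝ, IsDistribution D ∧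
      (∀ φ : TestFunctions d T,
        Tendsto (fun ℓ : ℝ => ∫ z, sphereFlux k u ℓ z.1 z.2 * φ.1 z.1 z.2 ∂(spaceTime d T))
          (𝓝[>] 0) (𝓝 (- coeff d k * D φ))) ∧
      ∀ φ : TestFunctions d T, balancePairing T ν u p f G φ.1 = - 2 * D φ := by
  have H := hu.flow hu3 huC huH hf
  have hd' : 0 < d := by omega
  exact ⟨H.integrable_energyFlux, H.integrable_work,
    fun k ℓ _ => ⟨ae_integrable_fluxIntegrand hu3 k ℓ, integrable_sphereFlux hu3 k ℓ⟩,
    fun k => ⟨H.dissipation hu3, H.isDistribution_dissipation hu3,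
      H.tendsto_sphereFlux hd' hT hu3 k, H.balancePairing_eq_dissipation hu3⟩⟩
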